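/- Let $\mu,\chi>0$ and $\gamma,\kappa\ge 0$. Consider on $\mathbb R^3$ the micropolar system $$\text{(MP)}\quad \partial_t u+u\cdot\nabla u+\nabla p=(\mu+\chi)\Delta u+2\chi\,\mathrm{curl}\,w,\quad \partial_t w+u\cdot\nabla w=\gamma\Delta w+\kappa\nabla\mathrm{div}\,w+2\chi\,\mathrm{curl}\,u-4\chi w,\quad \mathrm{div}\,u=0,$$ where the nonlinear terms are understood as $u\cdot\nabla v=\mathrm{div}(u\otimes v)=\sum_j\partial_j(u_jv)$. Let $L^2_\sigma$ be the space of vector fields in $L^2(\mathbb R^3)$ that are divergence-free in the sense of distributions, $\mathbb P$ the $L^2$-orthogonal projector onto $L^2_\sigma$, and let $C^0_w([0,\infty);L^2)$ denote the weakly continuous $L^2$-valued functions. Fix a non-negative even $\theta\in C_c^\infty(\mathbb R^3)$ with $\int\theta=1$ and put $\theta_\varepsilon(x)=\varepsilon^{-3}\theta(x/\varepsilon)$, $J_\varepsilon f=\theta_\varepsilon*f$. Let $(u_0,w_0)\in L^2_\sigma\times L^2$. Say that $(u,w)$ has *finite energy regularity* if - $u\in L^\infty(\mathbb R_+;L^2)\cap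 C^0_w([0,\infty);L^2)\cap L^2(\mathbb R_+;\dot H^1)$; - $w\in L^\infty(\mathbb R_+;L^2)\cap C^0_w([0,\infty);L^2)$, and moreover $w\in L^2(\mathbb R_+;\dot H^1)$ if $\gamma>0$, and $\mathrm{div}\,w\in L^2(\mathbb R_+\times\mathbb R^3)$ if $\gamma=0$ and $\kappa>0$. For $0\le s\le t$ put $$D_s^t(u,w)=2\mu\int_s^t\|\nabla u\|_{L^2}^2+2\gamma\int_s^t\|\nabla w\|_{L^2}^2+2\kappa\int_s^t\|\mathrm{div}\,w\|_{L^2}^2+2\chi\int_s^t\|\mathrm{curl}\,u-2w\|_{L^2}^2,$$ where a term with coefficient zero is absent. For $\varepsilon>0$, a *mollified solution* is a pair $(u_\varepsilon,w_\varepsilon)$ with finite energy regularity that solves, in the sense of distributions on $(0,\infty)\times\mathbb R^3$, $$\partial_t u_\varepsilon+\mathbb P((J_\varepsilon u_\varepsilon)\cdot\nabla u_\varepsilon)=(\mu+\chi)\Delta u_\varepsilon+2\chi\,\mathrm{curl}\,w_\varepsilon,$$ $$\partial_t w_\varepsilon+(J_\varepsilon u_\varepsilon)\cdot\nabla w_\varepsilon=\gamma\Delta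 w_\varepsilon+\kappa\nabla\mathrm{div}\,w_\varepsilon+2\chi\,\mathrm{curl}\,u_\varepsilon-4\chi w_\varepsilon,\qquad \mathrm{div}\,u_\varepsilon=0,$$ with $(u_\varepsilon,w_\varepsilon)|_{t=0}=(u_0,w_0)$, and satisfies the energy equality $\|u_\varepsilon(t)\|_{L^2}^2+\|w_\varepsilon(t)\|_{L^2}^2+D_s^t(u_\varepsilon,w_\varepsilon)=\|u_\varepsilon(s)\|_{L^2}^2+\|w_\varepsilon(s)\|_{L^2}^2$ for all $t\ge s\ge0$. A *restricted Leray solution* with data $(u_0,w_0)$ is a pair of distributions $(u,w)$ on $(0,\infty)\times\mathbb R^3$ for which there are $\varepsilon_n>0$, $\varepsilon_n\to0$, and mollified solutions $(u_{\varepsilon_n},w_{\varepsilon_n})$ with data $(u_0,w_0)$ that converge to $(u,w)$ in $\mathscr D'((0,\infty)\times\mathbb R^3)$. **Proposition.** A restricted Leray solution with data $(u_0,w_0)$ exists. Moreover, every restricted Leray solution $(u,w)$ is given by a pair of $L^2$-valued functions of $t\in[0,\infty)$, still denoted $(u,w)$, such that: a) $(u,w)$ solves (MP) in the sense of distributions on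 $(0,\infty)\times\mathbb R^3$, for some distribution $p$, and $u|_{t=0}=u_0$, $w|_{t=0}=w_0$. b), c) $(u,w)$ has finite energy regularity. d) $\|u(t)\|_{L^2}^2+\|w(t)\|_{L^2}^2+D_0^t(u,w)\le\|u_0\|_{L^2}^2+\|w_0\|_{L^2}^2$ for all $t\ge0$. Furthermore, for every sequence $\varepsilon_n\to0$, $\varepsilon_n>0$, and every sequence of mollified solutions $(u_{\varepsilon_n},w_{\varepsilon_n})$ with data $(u_0,w_0)$ that converges to $(u,w)$ in $\mathscr D'((0,\infty)\times\mathbb R^3)$: e) if $f:[0,\infty)\to[0,\infty)$ satisfies $\|u_{\varepsilon_n}(t)\|_{L^2}\le f(t)$ for all $n$ and all $t\ge0$, then $\|u(t)\|_{L^2}\le f(t)$ for all $t\ge0$; likewise, if $g:[0,\infty)\to[0,\infty)$ satisfies $\|w_{\varepsilon_n}(t)\|_{L^2}\le g(t)$ for all $n$ and all $t\ge0$, then $\|w(t)\|_{L^2}\le g(t)$ for all $t\ge0$. f) let $z_L=(u_L,w_L)$ be the solution in $C^0_w([0,\infty);L^2)$ of the linear system $\partial_t u_L=(\mu+\chi)\Delta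 u_L+2\chi\,\mathrm{curl}\,w_L$, $\partial_t w_L=\gamma\Delta w_L+\kappa\nabla\mathrm{div}\,w_L+2\chi\,\mathrm{curl}\,u_L-4\chi w_L$, $\mathrm{div}\,u_L=0$, with data $(u_0,w_0)$, and write $z_{\varepsilon_n}=(u_{\varepsilon_n},w_{\varepsilon_n})$, $z=(u,w)$. If $h:[0,\infty)\to[0,\infty)$ satisfies $\|z_{\varepsilon_n}(t)-z_L(t)\|_{L^2}\le h(t)$ for all $n$ and all $t\ge0$, then $\|z(t)-z_L(t)\|_{L^2}\le h(t)$ for all $t\ge0$. -/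

import Mathlib

open MeasureTheory Set Filter TopologicalSpace
open scoped ENNReal Topology ContDiff Distributions LineDeriv

noncomputable section

namespace Micropolar

/-! ### Spaces -/

/-- Physical space `ℝ³`. -/
abbrev E3 := EuclideanSpace ℝ (Fin 3)

/-- The Hilbert space `L²(ℝ³)` of square integrable vector fields. -/
abbrev L2Field := Lp E3 2 (volume : Measure E3)

/-- The `j`-th vector of the canonical basis of `ℝ³`. -/
abbrev e (j : Fin 3) : E3 := EuclideanSpace.single j (1 : ℝ)

/-- The open set `(0,∞) × ℝ³` of space-time. -/
def spaceTime : Opens (ℝ × E3) := ⟨Ioi 0 ×ˢ univ, isOpen_Ioi.prod isOpen_univ⟩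

/-! ### Divergence-free fields and the Leray projector -/

/-- The distributional divergence of the field `v`, tested against `φ`. -/
def divPairing (v : L2Field) (φ : 𝓓((⊤ : Opens E3), ℝ)) : ℝ :=
  -∑ j, ∫ x, (∂_{e j} φ) x * v x j

/-- The smooth compactly supported field `φ e_j`, as an element of `L²`. -/
def testField (j : Fin 3) (φ : 𝓓((⊤ : Opens E3), ℝ)) : L2Field :=
  ((show Continuous (fun x => φ x • e j) by fun_prop).memLp_of_hasCompactSupport
    (p := 2) (μ := volume) φ.hasCompactSupport.smul_right).toLp _

theorem inner_testField (j : Fin 3) (φ : 𝓓((⊤ : Opens E3), ℝ)) (v : L2Field) :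
    inner ℝ (testField j φ) v = ∫ x, φ x * v x j := by
  rw [L2.inner_def]
  refine integral_congr_ae ?_
  filter_upwards [MemLp.coeFn_toLp
    ((show Continuous (fun x => φ x • e j) by fun_prop).memLp_of_hasCompactSupport
    (p := 2) (μ := volume) φ.hasCompactSupport.smul_right)] with x hx
  simp only [testField]
  rw [hx, inner_smul_left, EuclideanSpace.inner_single_left]
  simp

theorem divPairing_eq (v : L2Field) (φ : 𝓓((⊤ : Opens E3), ℝ)) :
    divPairing v φ = -∑ j, inner ℝ (testField j (∂_{e j} φ)) v := by
  simp only [divPairing, inner_testField]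

/-- `L²_σ(ℝ³)`: the fields in `L²(ℝ³)` that are divergence-free in the sense of distributions. -/
def L2sigma : Submodule ℝ L2Field where
  carrier := {v | ∀ φ : 𝓓((⊤ : Opens E3), ℝ), divPairing v φ = 0}
  add_mem' := by
    intro a b ha hb φ
    have ha := ha φ
    have hb := hb φ
    rw [divPairing_eq] at *
    simp only [inner_add_right, Finset.sum_add_distrib]
    linarith
  zero_mem' := by
    intro φ
    simp [divPairing_eq]
  smul_mem' := by
    intro c a ha φ
    have ha := ha φ
    rw [divPairing_eq] at *
    simp only [inner_smul_right, ← Finset.mul_sum, ← mul_neg, ha, mul_zero]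

theorem isClosed_L2sigma : IsClosed (L2sigma : Set L2Field) := by
  have : (L2sigma : Set L2Field) =
      ⋂ φ : 𝓓((⊤ : Opens E3), ℝ), {v | divPairing v φ = 0} := by
    ext v
    simp [L2sigma]
  rw [this]
  refine isClosed_iInter fun φ => ?_
  simp only [divPairing_eq]
  exact isClosed_eq (by fun_prop) continuous_const

instance : CompleteSpace L2sigma := isClosed_L2sigma.completeSpace_coe

/-- The Leray projector `ℙ`: the orthogonal projector of `L²` onto `L²_σ`. -/
def leray : L2Field →L[ℝ] L2Field := L2sigma.starProjection

/-! ### Weak derivatives of `L²` fields, and their norms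

The squared norms take values in `[0,∞]`. Weak derivatives are unique, so each infimum below is
over at most one object; it is `∞` exactly when the weak derivative does not exist in `L²`. -/

/-- `G j ∈ L²` is the weak derivative `∂_j v` for every `j`. -/
def HasWeakGrad (v : L2Field) (G : Fin 3 → L2Field) : Prop :=
  ∀ j, ∀ φ : 𝓓((⊤ : Opens E3), ℝ), ∫ x, φ x • G j x = -∫ x, (∂_{e j} φ) x • v x

/-- `d ∈ L²` is the weak divergence of `v`. -/
def HasWeakDiv (v : L2Field) (d : Lp ℝ 2 (volume : Measure E3)) : Prop :=
  ∀ φ : 𝓓((⊤ : Opens E3), ℝ), ∫ x, φ x * d x = divPairing v φ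

/-- `c ∈ L²` is the weak curl of `v`: `c_i = ∂_{i+1} v_{i+2} - ∂_{i+2} v_{i+1}`, with indices
modulo 3. -/
def HasWeakCurl (v c : L2Field) : Prop :=
  ∀ i : Fin 3, ∀ φ : 𝓓((⊤ : Opens E3), ℝ),
    ∫ x, φ x * c x i =
      (-∫ x, (∂_{e (i + 1)} φ) x * v x (i + 2)) - (-∫ x, (∂_{e (i + 2)} φ) x * v x (i + 1))

/-- `‖∇v‖²_{L²}`. -/
def gradSq (v : L2Field) : ℝ≥0∞ :=
  ⨅ (G : Fin 3 → L2Field) (_ : HasWeakGrad v G), ∑ j, ‖G j‖ₑ ^ 2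

/-- `‖div v‖²_{L²}`. -/
def divSq (v : L2Field) : ℝ≥0∞ :=
  ⨅ (d : Lp ℝ 2 (volume : Measure E3)) (_ : HasWeakDiv v d), ‖d‖ₑ ^ 2

/-- `‖curl v - 2 w‖²_{L²}`. -/
def curlSubSq (v w : L2Field) : ℝ≥0∞ :=
  ⨅ (c : L2Field) (_ : HasWeakCurl v c), ‖c - (2 : ℝ) • w‖ₑ ^ 2

/-! ### Mollification -/

/-- The kernels `θ ∈ C_c^∞(ℝ³)`, non-negative, even and of integral one. -/
structure MollifierKernel where
  toFun : E3 → ℝ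
  smooth : ContDiff ℝ ∞ toFun
  compactSupport : HasCompactSupport toFun
  nonneg : ∀ x, 0 ≤ toFun x
  even : ∀ x, toFun (-x) = toFun x
  integral_eq_one : ∫ x, toFun x = 1

/-- `θ_ε(x) = ε⁻³ θ(x/ε)`. -/
def MollifierKernel.scaled (θ : MollifierKernel) (ε : ℝ) (x : E3) : ℝ :=
  (ε ^ 3)⁻¹ * θ.toFun (ε⁻¹ • x)

/-- `J_ε v = θ_ε * v`. -/
def mollify (θ : MollifierKernel) (ε : ℝ) (v : L2Field) : E3 → E3 :=
  convolution (θ.scaled ε) v (ContinuousLinearMap.lsmul ℝ ℝ) volume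

open Classical in
/-- The class in `L²` of a square integrable field (and `0` for other fields; below it is applied to
products of a bounded continuous function and an `L²` field only). -/
def toL2 (f : E3 → E3) : L2Field := if h : MemLp f 2 volume then h.toLp f else 0

/-! ### Distributions on `(0,∞) × ℝ³`

Time-dependent `L²` fields are curves `u : ℝ → L²`, of which only the times `t ≥ 0` matter. Such a
curve, and more generally a family `f(t,·)` of locally integrable functions, is seen as a functional
on the scalar test functions. -/

/-- The functional `φ ↦ ∫_0^∞ ∫_{ℝ³} f(t,x) φ(t,x) dx dt`. -/
def regular (f : ℝ → E3 → ℝ) (φ : 𝓓(spaceTime, ℝ)) : ℝ :=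
  ∫ t in Ioi (0 : ℝ), ∫ x, f t x * φ (t, x)

/-- The distributional time derivative. -/
def Dt (T : 𝓓(spaceTime, ℝ) → ℝ) (φ : 𝓓(spaceTime, ℝ)) : ℝ :=
  -T (∂_{((1 : ℝ), (0 : E3))} φ)

/-- The distributional space derivative `∂_j`. -/
def Dx (j : Fin 3) (T : 𝓓(spaceTime, ℝ) → ℝ) (φ : 𝓓(spaceTime, ℝ)) : ℝ :=
  -T (∂_{((0 : ℝ), e j)} φ)

/-- The `i`-th component of a time-dependent field, as a distribution. -/
def comp (u : ℝ → L2Field) (i : Fin 3) : 𝓓(spaceTime, ℝ) → ℝ :=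
  regular fun t x => u t x i

/-- The `i`-th component of `Δ u`. -/
def lapD (u : ℝ → L2Field) (i : Fin 3) : 𝓓(spaceTime, ℝ) → ℝ :=
  ∑ j, Dx j (Dx j (comp u i))

/-- The `i`-th component of `∇ div u`. -/
def gradDivD (u : ℝ → L2Field) (i : Fin 3) : 𝓓(spaceTime, ℝ) → ℝ :=
  Dx i (∑ j, Dx j (comp u j))

/-- The `i`-th component of `curl u`, with indices modulo 3. -/
def curlD (u : ℝ → L2Field) (i : Fin 3) : 𝓓(spaceTime, ℝ) → ℝ :=
  Dx (i + 1) (comp u (i + 2)) - Dx (i + 2) (comp u (i + 1))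

/-- The `i`-th component of `b·∇v = div (b ⊗ v) = ∑_j ∂_j (b_j v)`, for a divergence-free `b`. -/
def transportD (b : ℝ → E3 → E3) (v : ℝ → L2Field) (i : Fin 3) : 𝓓(spaceTime, ℝ) → ℝ :=
  ∑ j, Dx j (regular fun t x => b t x j * v t x i)

/-- The `i`-th component of `ℙ(b·∇v) = ∑_j ∂_j ℙ(b_j v)`, for a divergence-free bounded `b`. -/
def lerayTransportD (b : ℝ → E3 → E3) (v : ℝ → L2Field) (i : Fin 3) : 𝓓(spaceTime, ℝ) → ℝ :=
  ∑ j, Dx j (regular fun t x => leray (toL2 fun y => b t y j • v t y) x i)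

/-- The linear part `(μ+χ) Δu + 2χ curl w` of the velocity equation. -/
def linU (μ χ : ℝ) (u w : ℝ → L2Field) (i : Fin 3) : 𝓓(spaceTime, ℝ) → ℝ :=
  (μ + χ) • lapD u i + (2 * χ) • curlD w i

/-- The linear part `γ Δw + κ ∇ div w + 2χ curl u - 4χ w` of the microrotation equation. -/
def linW (χ γ κ : ℝ) (u w : ℝ → L2Field) (i : Fin 3) : 𝓓(spaceTime, ℝ) → ℝ :=
  γ • lapD w i + κ • gradDivD w i + (2 * χ) • curlD u i - (4 * χ) • comp w i

/-! ### Energy spaces and energy balance -/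

/-- Weak continuity on `[0,∞)` with values in `L²`. -/
def WeaklyContinuous (u : ℝ → L2Field) : Prop :=
  ∀ v : L2Field, ContinuousOn (fun t => inner ℝ v (u t)) (Ici 0)

/-- `u ∈ L^∞(ℝ₊; L²) ∩ C_w([0,∞); L²)`. -/
structure BoundedWeaklyContinuous (u : ℝ → L2Field) : Prop where
  bounded : ∃ M : ℝ, ∀ t, 0 ≤ t → ‖u t‖ ≤ M
  weaklyContinuous : WeaklyContinuous u

/-- The regularity of finite energy solutions, according to the values of `γ` and `κ`. -/
structure EnergyClass (γ κ : ℝ) (u w : ℝ → L2Field) : Prop where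
  u_mem : BoundedWeaklyContinuous u
  u_grad : ∫⁻ t in Ioi (0 : ℝ), gradSq (u t) < ⊤
  w_mem : BoundedWeaklyContinuous w
  w_grad : 0 < γ → ∫⁻ t in Ioi (0 : ℝ), gradSq (w t) < ⊤
  w_div : γ = 0 → 0 < κ → ∫⁻ t in Ioi (0 : ℝ), divSq (w t) < ⊤

/-- `‖u(t)‖² + ‖w(t)‖²`. -/
def energy (u w : ℝ → L2Field) (t : ℝ) : ℝ≥0∞ := ‖u t‖ₑ ^ 2 + ‖w t‖ₑ ^ 2

/-- `2μ∫‖∇u‖² + 2γ∫‖∇w‖² + 2κ∫‖div w‖² + 2χ∫‖curl u - 2w‖²` over the time interval from `s`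
to `t`. An integral with coefficient zero does not contribute, since `0 * ∞ = 0`. -/
def dissipation (μ χ γ κ : ℝ) (u w : ℝ → L2Field) (s t : ℝ) : ℝ≥0∞ :=
  ENNReal.ofReal (2 * μ) * (∫⁻ τ in Ioc s t, gradSq (u τ)) +
  ENNReal.ofReal (2 * γ) * (∫⁻ τ in Ioc s t, gradSq (w τ)) +
  ENNReal.ofReal (2 * κ) * (∫⁻ τ in Ioc s t, divSq (w τ)) +
  ENNReal.ofReal (2 * χ) * (∫⁻ τ in Ioc s t, curlSubSq (u τ) (w τ))

/-! ### Solutions -/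

/-- `(u,w)` solves, in the sense of distributions on `(0,∞) × ℝ³` and for some pressure `p`, the
micropolar system
`∂_t u + u·∇u + ∇p = (μ+χ)Δu + 2χ curl w`,
`∂_t w + u·∇w = γΔw + κ∇div w + 2χ curl u - 4χ w`, `div u = 0`. -/
structure SolvesMicropolar (μ χ γ κ : ℝ) (u w : ℝ → L2Field) : Prop where
  velocity : ∃ p : 𝓓'(spaceTime, ℝ), ∀ i,
    Dt (comp u i) + transportD (fun t => u t) u i + Dx i p = linU μ χ u w i
  microrotation : ∀ i,
    Dt (comp w i) + transportD (fun t => u t) w i = linW χ γ κ u w i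
  divFree : ∀ t, 0 ≤ t → u t ∈ L2sigma

/-- `(u,w)` is the weakly continuous solution of the linear micropolar system
`∂_t u = (μ+χ)Δu + 2χ curl w`, `∂_t w = γΔw + κ∇div w + 2χ curl u - 4χ w`, `div u = 0`,
with initial data `(u₀,w₀)`. -/
structure IsLinearSolution (μ χ γ κ : ℝ) (u₀ w₀ : L2Field) (u w : ℝ → L2Field) : Prop where
  u_weaklyContinuous : WeaklyContinuous u
  w_weaklyContinuous : WeaklyContinuous w
  velocity : ∀ i, Dt (comp u i) = linU μ χ u w i
  microrotation : ∀ i, Dt (comp w i) = linW χ γ κ u w i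
  divFree : ∀ t, 0 ≤ t → u t ∈ L2sigma
  initial : u 0 = u₀ ∧ w 0 = w₀

/-- `(u,w)` is a mollified solution: a finite energy weak solution of
`∂_t u + ℙ((J_ε u)·∇u) = (μ+χ)Δu + 2χ curl w`,
`∂_t w + (J_ε u)·∇w = γΔw + κ∇div w + 2χ curl u - 4χ w`, `div u = 0`,
with initial data `(u₀,w₀)`, that satisfies the energy equality between any two times. -/
structure IsMollifiedSolution (θ : MollifierKernel) (μ χ γ κ : ℝ) (u₀ w₀ : L2Field) (ε : ℝ)
    (u w : ℝ → L2Field) : Prop where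
  regularity : EnergyClass γ κ u w
  velocity : ∀ i,
    Dt (comp u i) + lerayTransportD (fun t => mollify θ ε (u t)) u i = linU μ χ u w i
  microrotation : ∀ i,
    Dt (comp w i) + transportD (fun t => mollify θ ε (u t)) w i = linW χ γ κ u w i
  divFree : ∀ t, 0 ≤ t → u t ∈ L2sigma
  initial : u 0 = u₀ ∧ w 0 = w₀
  energy_eq : ∀ s t, 0 ≤ s → s ≤ t →
    energy u w t + dissipation μ χ γ κ u w s t = energy u w s

/-- The distribution `U` on `(0,∞) × ℝ³` is given by the time-dependent field `u`. -/
def Represents (u : ℝ → L2Field) (U : 𝓓'(spaceTime, E3)) : Prop :=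
  ∀ (φ : 𝓓(spaceTime, ℝ)) (i : Fin 3), U φ i = comp u i φ

/-- `(uₙ,wₙ)` is a sequence of mollified solutions, with parameters `εₙ → 0`, converging to `(U,W)`
in the sense of distributions on `(0,∞) × ℝ³`. -/
structure MollifiedApproximation (θ : MollifierKernel) (μ χ γ κ : ℝ) (u₀ w₀ : L2Field)
    (ε : ℕ → ℝ) (un wn : ℕ → ℝ → L2Field) (U W : 𝓓'(spaceTime, E3)) : Prop where
  pos : ∀ n, 0 < ε n
  tendsto_zero : Tendsto ε atTop (𝓝 0)
  mollified : ∀ n, IsMollifiedSolution θ μ χ γ κ u₀ w₀ (ε n) (un n) (wn n)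
  tendsto_u : ∀ (φ : 𝓓(spaceTime, ℝ)) (i : Fin 3),
    Tendsto (fun n => comp (un n) i φ) atTop (𝓝 (U φ i))
  tendsto_w : ∀ (φ : 𝓓(spaceTime, ℝ)) (i : Fin 3),
    Tendsto (fun n => comp (wn n) i φ) atTop (𝓝 (W φ i))

/-- `(U,W)` is a restricted Leray solution with initial data `(u₀,w₀)`. -/
def IsRestrictedLeray (θ : MollifierKernel) (μ χ γ κ : ℝ) (u₀ w₀ : L2Field)
    (U W : 𝓓'(spaceTime, E3)) : Prop :=
  ∃ (ε : ℕ → ℝ) (un wn : ℕ → ℝ → L2Field),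
    MollifiedApproximation θ μ χ γ κ u₀ w₀ ε un wn U W

end Micropolar

end

open Micropolar

noncomputable section

namespace Micropolar

/-! A restricted Leray solution is a weak limit of mollified solutions. The energy equality bounds
the approximations uniformly in `L²`, and the equations bound their time derivatives uniformly when
tested. A subsequence therefore converges weakly in `L²` at every time `t ≥ 0`, not only for almost
every `t` (`exists_weak_subseq`). Norms and dissipation integrals are weakly lower semicontinuous,
which gives d), e) and f); the regularity in b), c) follows from d). What remains is to construct
mollified solutions and to pass to the limit in the quadratic terms.

Construction for fixed `ε`. Derivatives are replaced by bounded operators `D j δ`, convolutions with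
`δ⁻¹ (∂_j θ)_δ`. The system becomes a locally Lipschitz ordinary differential equation in `L² × L²`.
Since `D j δ` is skew-adjoint and the mollified velocity is divergence-free, transport does no work
(`sum_inner_skew`). The identity `∑ ‖D_j v‖² = ‖curl v‖² + ‖div v‖²` completes the square in the
coupling terms, so the field is dissipative and its flow is global (`exists_ode_of_dissipative`).
Letting `δ → 0` yields a finite energy solution (`exists_finiteEnergy`): with `ε` fixed, the
mollified velocity converges pointwise and boundedly, so weak convergence suffices in the products.

Energy equality. The mollified equation is mollified again at scale `δ` and tested with the
mollified solution. The work of the transport reduces to a Friedrichs commutator, which is bounded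
uniformly in `δ` and tends to zero (`tendsto_sum_commutator`); dominated convergence in time gives
the equality (`energy_equality`).

Limit `ε → 0`. The product of `J_ε u_ε` with `v_ε` is bounded only in `L¹`, so the test fields, and
their images under `ℙ`, must be bounded functions; this is a Sobolev-type bound valid for all
translation invariant operators (`abs_inner_testField_le`). Strong compactness is not used. Because
`μ > 0`, `∇u_ε` is bounded in `L²` of space-time, so `J_ε u_ε` may be replaced by `J_δ u_ε` with an
error `O(ε + δ)` uniform in the solution; for fixed `δ` the limit is taken by weak convergence, and
then `δ → 0` (`Equivariant.tendsto_integral_tri`). Only the velocity needs a gradient bound, so `γ =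
0` is allowed. The pressure is the part of the quadratic term seen by `1 - ℙ` (`exists_pressure`).

Weak gradients, divergences and curls are handled uniformly: the squared norm of a first order
derivative is the supremum over `n` of the squared norms of its mollifications at scale `dn n`
(`FirstOrder.nSq_eq`), a supremum of weakly lower semicontinuous functions. Measurability in time
and lower semicontinuity follow at once.

Finally, a weakly continuous curve is determined at every time by the distribution it defines
(`eq_of_comp_eq`). Hence any other approximating sequence has a subsequence with the same pointwise
weak limits, and e), f) hold for all sequences. -/

/-- Scalar test functions on physical space. -/
abbrev TF := 𝓓((⊤ : Opens E3), ℝ)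

instance fact_two_ne_top : Fact ((2 : ℝ≥0∞) ≠ ⊤) := ⟨by norm_num⟩

/-! ### Test fields -/

theorem memLp_smul_single (j : Fin 3) (φ : TF) :
    MemLp (fun x => φ x • e j) 2 (volume : Measure E3) :=
  (show Continuous (fun x => φ x • e j) by fun_prop).memLp_of_hasCompactSupport
    (p := 2) (μ := volume) φ.hasCompactSupport.smul_right

theorem coeFn_testField (j : Fin 3) (φ : TF) : testField j φ =ᵐ[volume] fun x => φ x • e j :=
  MemLp.coeFn_toLp (memLp_smul_single j φ)

theorem testField_add (j : Fin 3) (φ ψ : TF) :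
    testField j (φ + ψ) = testField j φ + testField j ψ := by
  ext1
  filter_upwards [coeFn_testField j (φ + ψ), coeFn_testField j φ, coeFn_testField j ψ,
    Lp.coeFn_add (testField j φ) (testField j ψ)] with x h1 h2 h3 h4
  rw [h1, h4, Pi.add_apply, h2, h3, FunLike.coe_add, Pi.add_apply, add_smul]

theorem testField_smul (j : Fin 3) (c : ℝ) (φ : TF) :
    testField j (c • φ) = c • testField j φ := by
  ext1
  filter_upwards [coeFn_testField j (c • φ), coeFn_testField j φ,
    Lp.coeFn_smul c (testField j φ)] with x h1 h2 h4
  rw [h1, h4, Pi.smul_apply, h2, FunLike.coe_smul, Pi.smul_apply, smul_assoc]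

/-- `testField j` as a linear map. -/
def testFieldL (j : Fin 3) : TF →ₗ[ℝ] L2Field where
  toFun := testField j
  map_add' := testField_add j
  map_smul' := testField_smul j

theorem testField_sub (j : Fin 3) (φ ψ : TF) :
    testField j (φ - ψ) = testField j φ - testField j ψ := map_sub (testFieldL j) φ ψ

theorem testField_neg (j : Fin 3) (φ : TF) : testField j (-φ) = -testField j φ :=
  map_neg (testFieldL j) φ

theorem norm_testField_sq (j : Fin 3) (φ : TF) : ‖testField j φ‖ ^ 2 = ∫ x, φ x ^ 2 := by
  rw [← real_inner_self_eq_norm_sq, inner_testField]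
  refine integral_congr_ae ?_
  filter_upwards [coeFn_testField j φ] with x hx
  rw [hx]
  simp [sq]

theorem norm_testField_le (j : Fin 3) (φ : TF) {K : Set E3} (hK : IsCompact K) {c : ℝ}
    (h0 : ∀ x ∉ K, φ x = 0) (hc : ∀ x ∈ K, |φ x| ≤ c) :
    ‖testField j φ‖ ≤ |c| * √(volume.real K) := by
  refine le_of_sq_le_sq ?_ (by positivity)
  rw [norm_testField_sq, mul_pow, Real.sq_sqrt (by positivity), sq_abs]
  calc ∫ x, φ x ^ 2 ≤ ∫ x, K.indicator (fun _ => c ^ 2) x := by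
        refine integral_mono_of_nonneg (Eventually.of_forall fun x => sq_nonneg _) ?_
          (Eventually.of_forall fun x => ?_)
        · exact (integrable_indicator_iff hK.measurableSet).2
            (integrableOn_const hK.measure_lt_top.ne)
        · by_cases hx : x ∈ K
          · simp only [indicator_of_mem hx]
            exact sq_le_sq.2 ((hc x hx).trans (le_abs_self c))
          · simp [indicator_of_notMem hx, h0 x hx]
    _ = c ^ 2 * volume.real K := by
        rw [integral_indicator hK.measurableSet]
        simp [mul_comm]

theorem eq_zero_of_inner_testField {v : L2Field}
    (h : ∀ i φ, inner ℝ (testField i φ) v = 0) : v = 0 := by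
  have key : ∀ i : Fin 3, ∀ᵐ x, v x i = 0 := by
    intro i
    refine ae_eq_zero_of_integral_contDiff_smul_eq_zero ?_ ?_
    · have : MemLp (fun x => v x i) 2 (volume : Measure E3) :=
        (Lp.memLp v).continuousLinearMap_comp (EuclideanSpace.proj (𝕜 := ℝ) i)
      exact this.locallyIntegrable (by norm_num)
    · intro g hg hgc
      have := h i ⟨g, hg, hgc, by simp⟩
      rw [inner_testField] at this
      exact this
  ext1
  filter_upwards [key 0, key 1, key 2, Lp.coeFn_zero E3 2 (volume : Measure E3)] with x h0 h1 h2 h3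
  rw [h3]
  ext i
  fin_cases i <;> assumption

/-- The span of the test fields. -/
def testSpan : Submodule ℝ L2Field :=
  Submodule.span ℝ (range fun p : Fin 3 × TF => testField p.1 p.2)

theorem testSpan_topologicalClosure : testSpan.topologicalClosure = ⊤ := by
  rw [Submodule.topologicalClosure_eq_top_iff, Submodule.eq_bot_iff]
  intro v hv
  refine eq_zero_of_inner_testField fun i φ => ?_
  exact (Submodule.mem_orthogonal _ _).1 hv _ (Submodule.subset_span ⟨(i, φ), rfl⟩)

theorem dense_testSpan : Dense (testSpan : Set L2Field) :=
  Submodule.dense_iff_topologicalClosure_eq_top.2 testSpan_topologicalClosure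

theorem clm_ext_testField {F : Type*} [NormedAddCommGroup F] [NormedSpace ℝ F]
    {A B : L2Field →L[ℝ] F} (h : ∀ i φ, A (testField i φ) = B (testField i φ)) : A = B := by
  refine ContinuousLinearMap.ext_on (s := range fun p : Fin 3 × TF => testField p.1 p.2)
    dense_testSpan ?_
  rintro _ ⟨p, rfl⟩
  exact h _ _

theorem ext_inner_testField {v w : L2Field}
    (h : ∀ i φ, inner ℝ (testField i φ) v = inner ℝ (testField i φ) w) : v = w := by
  rw [← sub_eq_zero]
  refine eq_zero_of_inner_testField fun i φ => ?_
  rw [inner_sub_right, h, sub_self]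

/-- A subset of `L²` that is closed under limits, sums and multiples and contains the test fields
is everything. -/
theorem testField_induction {p : L2Field → Prop} (hcl : IsClosed {v | p v})
    (hadd : ∀ v w, p v → p w → p (v + w)) (hsmul : ∀ (c : ℝ) v, p v → p (c • v))
    (htest : ∀ i φ, p (testField i φ)) (v : L2Field) : p v := by
  have hz : p 0 := by simpa using hsmul 0 _ (htest 0 0)
  have hspan : ∀ w ∈ testSpan, p w := by
    intro w hw
    refine Submodule.span_induction (p := fun w _ => p w) ?_ hz (fun x y _ _ => hadd x y)
      (fun c x _ => hsmul c x) hw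
    rintro _ ⟨q, rfl⟩
    exact htest _ _
  have : closure (testSpan : Set L2Field) ⊆ {v | p v} := closure_minimal hspan hcl
  rw [dense_testSpan.closure_eq] at this
  exact this (mem_univ v)

/-! ### Derivatives of test functions -/

theorem lineDeriv_apply {E : Type*} [NormedAddCommGroup E] [NormedSpace ℝ E] {Ω : Opens E}
    (φ : 𝓓(Ω, ℝ)) (v x : E) : (∂_{v} φ) x = fderiv ℝ φ x v := by
  rw [TestFunction.lineDerivOp_eq_lineDerivCLM ℝ, TestFunction.lineDerivCLM_eq_fderivCLM,
    TestFunction.fderivCLM_apply_of_le]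
  simp

theorem differentiable_testFunction {E : Type*} [NormedAddCommGroup E] [NormedSpace ℝ E]
    {Ω : Opens E} (φ : 𝓓(Ω, ℝ)) : Differentiable ℝ φ :=
  φ.contDiff.differentiable (by simp)

theorem hasLineDerivAt_testFunction {E : Type*} [NormedAddCommGroup E] [NormedSpace ℝ E]
    {Ω : Opens E} (φ : 𝓓(Ω, ℝ)) (v x : E) : HasLineDerivAt ℝ φ ((∂_{v} φ) x) x v := by
  rw [lineDeriv_apply]
  exact (differentiable_testFunction φ x).hasFDerivAt.hasLineDerivAt v

theorem lineDeriv_comm {E : Type*} [NormedAddCommGroup E] [NormedSpace ℝ E] {Ω : Opens E}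
    (φ : 𝓓(Ω, ℝ)) (v w : E) : ∂_{v} (∂_{w} φ) = ∂_{w} (∂_{v} φ) := by
  ext x
  have hd : DifferentiableAt ℝ (fderiv ℝ φ) x :=
    (φ.contDiff.fderiv_right (m := ∞) (by simp)).differentiable (by simp) x
  have key : ∀ a b : E, (∂_{a} (∂_{b} φ)) x = fderiv ℝ (fderiv ℝ φ) x a b := by
    intro a b
    rw [lineDeriv_apply]
    have : ⇑(∂_{b} φ : 𝓓(Ω, ℝ)) = fun y => fderiv ℝ φ y b := funext fun y => lineDeriv_apply φ b y
    rw [this, fderiv_clm_apply hd (differentiableAt_const b)]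
    simp
  rw [key, key]
  exact ((φ.contDiff.contDiffAt (n := ∞)).isSymmSndFDerivAt (by
    simp only [minSmoothness_of_isRCLikeNormedField]
    exact WithTop.coe_le_coe.2 le_top)).eq v w

/-! ### Translations -/

/-- The translation `v ↦ v(· - y)`. -/
def trans (y : E3) : L2Field →L[ℝ] L2Field :=
  (Lp.compMeasurePreservingₗᵢ ℝ (fun x => x - y)
    (measurePreserving_sub_right volume y)).toContinuousLinearMap

theorem coeFn_trans (y : E3) (v : L2Field) : trans y v =ᵐ[volume] fun x => v (x - y) :=
  Lp.coeFn_compMeasurePreserving v (measurePreserving_sub_right volume y)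

@[simp] theorem norm_trans (y : E3) (v : L2Field) : ‖trans y v‖ = ‖v‖ :=
  Lp.norm_compMeasurePreserving v (measurePreserving_sub_right volume y)

theorem trans_trans (y z : E3) (v : L2Field) : trans y (trans z v) = trans (y + z) v := by
  ext1
  filter_upwards [coeFn_trans y (trans z v), coeFn_trans (y + z) v,
    (measurePreserving_sub_right volume y).quasiMeasurePreserving.ae (coeFn_trans z v)]
    with x h1 h2 h3
  rw [h1, h2, h3, sub_sub]

@[simp] theorem trans_zero (v : L2Field) : trans 0 v = v := by
  ext1
  filter_upwards [coeFn_trans 0 v] with x h1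
  rw [h1, sub_zero]

theorem trans_comm (y z : E3) (v : L2Field) : trans y (trans z v) = trans z (trans y v) := by
  rw [trans_trans, trans_trans, add_comm]

theorem inner_trans_trans (y : E3) (v w : L2Field) :
    inner ℝ (trans y v) (trans y w) = inner ℝ v w :=
  LinearIsometry.inner_map_map _ v w

theorem inner_trans (y : E3) (v w : L2Field) :
    inner ℝ (trans y v) w = inner ℝ v (trans (-y) w) := by
  rw [← inner_trans_trans y v, trans_trans, add_neg_cancel, trans_zero]

theorem continuous_trans {X : Type*} [TopologicalSpace X] {f : X → E3} {g : X → L2Field}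
    (hf : Continuous f) (hg : Continuous g) : Continuous fun x => trans (f x) (g x) := by
  let k : C(X, C(E3, E3)) :=
    (ContinuousMap.mk (fun a : X × E3 => a.2 - f a.1) (by fun_prop)).curry
  exact hg.compMeasurePreservingLp k.continuous
    (fun p => measurePreserving_sub_right volume (f p)) (by norm_num)

/-- The translate of a test function. -/
def transTF (y : E3) (φ : TF) : TF where
  toFun x := φ (x - y)
  contDiff' := φ.contDiff.comp (contDiff_id.sub contDiff_const)
  hasCompactSupport' := φ.hasCompactSupport.comp_homeomorph (Homeomorph.subRight y)
  tsupport_subset' := by simp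

@[simp] theorem transTF_apply (y : E3) (φ : TF) (x : E3) : transTF y φ x = φ (x - y) := rfl

theorem lineDeriv_transTF (y v : E3) (φ : TF) : ∂_{v} (transTF y φ) = transTF y (∂_{v} φ) := by
  ext x
  rw [transTF_apply, lineDeriv_apply, lineDeriv_apply]
  have : (transTF y φ : E3 → ℝ) = fun x => φ (x - y) := rfl
  rw [this, fderiv_comp_sub y]

theorem trans_testField (y : E3) (i : Fin 3) (φ : TF) :
    trans y (testField i φ) = testField i (transTF y φ) := by
  ext1
  filter_upwards [coeFn_trans y (testField i φ), coeFn_testField i (transTF y φ),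
    (measurePreserving_sub_right volume y).quasiMeasurePreserving.ae (coeFn_testField i φ)]
    with x h1 h2 h3
  rw [h1, h2, h3, transTF_apply]

/-! ### Differentiability of curves of test fields -/

/-- The mean value inequality applied to `Φ t x - t Φ' t₀ x` gives a remainder that is small
uniformly on `K`, by compactness; the common support turns the sup bound into an `L²` bound. The
support is confined to `K` only near `t₀`, so that translates, whose supports move, are covered. -/
theorem hasDerivAt_testField (i : Fin 3) {Φ Φ' : ℝ → TF} {t₀ : ℝ} {K : Set E3} (hK : IsCompact K)
    (h0 : ∀ᶠ t in 𝓝 t₀, ∀ x ∉ K, Φ t x = 0)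
    (hd : ∀ t x, HasDerivAt (fun t => Φ t x) (Φ' t x) t)
    (hc : Continuous fun p : ℝ × E3 => Φ' p.1 p.2) :
    HasDerivAt (fun t => testField i (Φ t)) (testField i (Φ' t₀)) t₀ := by
  rw [hasDerivAt_iff_isLittleO, Asymptotics.isLittleO_iff]
  intro c hc0
  set m := √(volume.real K) with hm
  -- The summand `1` keeps the denominator positive when `K` is a null set.
  set η : ℝ := c / (m + 1) with hη
  have hη0 : 0 < η := by positivity
  have hu : ∀ᶠ t in 𝓝 t₀, ∀ x ∈ K, |Φ' t x - Φ' t₀ x| < η := by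
    refine hK.eventually_forall_of_forall_eventually fun x _ => ?_
    have h1 : Continuous fun p : ℝ × E3 => |Φ' p.1 p.2 - Φ' t₀ p.2| := by
      have : Continuous fun p : ℝ × E3 => Φ' t₀ p.2 := (Φ' t₀).continuous.comp continuous_snd
      fun_prop
    exact (h1.tendsto (t₀, x)).eventually_lt_const (by simpa using hη0)
  obtain ⟨r, hr, hball⟩ := Metric.eventually_nhds_iff_ball.1 (hu.and h0)
  have h00 := (hball t₀ (Metric.mem_ball_self hr)).2
  have h0' : ∀ x ∉ K, Φ' t₀ x = 0 := by
    intro x hx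
    have h1 : (fun t => Φ t x) =ᶠ[𝓝 t₀] fun _ => 0 := by
      filter_upwards [h0] with t ht using ht x hx
    exact (hd t₀ x).unique ((hasDerivAt_const t₀ (0 : ℝ)).congr_of_eventuallyEq h1)
  filter_upwards [Metric.ball_mem_nhds t₀ hr] with t ht
  rw [← testField_sub, ← testField_smul, ← testField_sub]
  refine (norm_testField_le i _ hK (c := η * |t - t₀|) ?_ ?_).trans ?_
  · intro x hx
    simp only [FunLike.coe_sub, FunLike.coe_smul, Pi.sub_apply, Pi.smul_apply]
    rw [(hball t ht).2 x hx, h00 x hx, h0' x hx]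
    simp
  · intro x hx
    have hder : ∀ s ∈ Metric.ball t₀ r, HasDerivWithinAt (fun s => Φ s x - s * Φ' t₀ x)
        (Φ' s x - Φ' t₀ x) (Metric.ball t₀ r) s := by
      intro s _
      have := (hd s x).fun_sub ((hasDerivAt_id s).mul_const (Φ' t₀ x))
      rw [one_mul] at this
      exact this.hasDerivWithinAt
    have := (convex_ball t₀ r).norm_image_sub_le_of_norm_hasDerivWithin_le hder
      (fun s hs => ((hball s hs).1 x hx).le) (Metric.mem_ball_self hr) ht
    simp only [FunLike.coe_sub, FunLike.coe_smul, Pi.sub_apply, Pi.smul_apply, smul_eq_mul]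
    simp only [Real.norm_eq_abs] at this
    convert this using 2
    ring
  · rw [abs_of_nonneg (by positivity), Real.norm_eq_abs, hη]
    have : c / (m + 1) * m ≤ c := by
      rw [div_mul_eq_mul_div, div_le_iff₀ (by positivity)]
      nlinarith [Real.sqrt_nonneg (volume.real K)]
    nlinarith [abs_nonneg (t - t₀)]

/-- The derivative of a translated test field with respect to the translation. -/
theorem hasDerivAt_trans_testField (i : Fin 3) (φ : TF) (v : E3) (h₀ : ℝ) :
    HasDerivAt (fun h : ℝ => trans (h • v) (testField i φ))
      (-trans (h₀ • v) (testField i (∂_{v} φ))) h₀ := by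
  -- The region swept by the support of `φ` under all translations with `|h - h₀| ≤ 1`.
  have hker : IsCompact ((fun p : ℝ × E3 => p.2 + p.1 • v) ''
      (Icc (h₀ - 1) (h₀ + 1) ×ˢ tsupport φ)) :=
    (isCompact_Icc.prod φ.hasCompactSupport).image (by fun_prop)
  have := hasDerivAt_testField i (Φ := fun h => transTF (h • v) φ)
    (Φ' := fun h => -transTF (h • v) (∂_{v} φ)) (t₀ := h₀) hker ?_ ?_ ?_
  · simpa only [trans_testField, testField_neg] using this
  · filter_upwards [Icc_mem_nhds (show h₀ - 1 < h₀ by linarith) (show h₀ < h₀ + 1 by linarith)]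
      with h hh x hx
    by_contra hne
    exact hx ⟨(h, x - h • v), ⟨hh, subset_tsupport _ hne⟩, by simp⟩
  · intro t x
    have h1 : HasDerivAt (fun h : ℝ => x - h • v) (-v) t := by
      simpa using ((hasDerivAt_id t).smul_const v).const_sub x
    have h2 := (differentiable_testFunction φ (x - t • v)).hasFDerivAt.comp_hasDerivAt t h1
    have h3 : (-transTF (t • v) (∂_{v} φ)) x = fderiv ℝ φ (x - t • v) (-v) := by
      rw [FunLike.coe_neg, Pi.neg_apply, transTF_apply, lineDeriv_apply, map_neg]
    rw [h3]
    exact h2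
  · have : Continuous fun p : ℝ × E3 => -(∂_{v} φ) (p.2 - p.1 • v) :=
      ((∂_{v} φ).continuous.comp (by fun_prop)).neg
    exact this

attribute [irreducible] trans

/-! ### Averages of translations -/

theorem continuous_trans_smul (y : E3) (v : L2Field) : Continuous fun s : ℝ => trans (s • y) v :=
  continuous_trans (by fun_prop) continuous_const

theorem integrable_smul_trans (k : TF) (δ : ℝ) (v : L2Field) :
    Integrable fun y => k y • trans (δ • y) v := by
  refine Continuous.integrable_of_hasCompactSupport ?_ k.hasCompactSupport.smul_right
  exact k.continuous.smul (continuous_trans (by fun_prop) continuous_const)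

theorem integrable_TF (k : TF) : Integrable (k : E3 → ℝ) :=
  k.continuous.integrable_of_hasCompactSupport k.hasCompactSupport

/-- The operator `v ↦ ∫ k(y) v(· - δ y) dy` on `L²`. -/
def cv (k : TF) (δ : ℝ) : L2Field →L[ℝ] L2Field :=
  LinearMap.mkContinuous
    { toFun := fun v => ∫ y, k y • trans (δ • y) v
      map_add' := fun v w => by
        simp only [map_add, smul_add]
        exact integral_add (integrable_smul_trans k δ v) (integrable_smul_trans k δ w)
      map_smul' := fun c v => by
        simp only [map_smul, RingHom.id_apply, smul_comm _ c]
        exact integral_smul c _ }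
    (∫ y, |k y|) (fun v => by
      refine (norm_integral_le_integral_norm _).trans (le_of_eq ?_)
      simp only [norm_smul, norm_trans, Real.norm_eq_abs]
      exact integral_mul_const _ _)

theorem cv_apply (k : TF) (δ : ℝ) (v : L2Field) : cv k δ v = ∫ y, k y • trans (δ • y) v := rfl

theorem norm_cv_le (k : TF) (δ : ℝ) (v : L2Field) : ‖cv k δ v‖ ≤ (∫ y, |k y|) * ‖v‖ :=
  (cv k δ).le_of_opNorm_le (LinearMap.mkContinuous_norm_le _
    (integral_nonneg fun _ => abs_nonneg _) _) v

theorem inner_cv_left (k : TF) (δ : ℝ) (v w : L2Field) :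
    inner ℝ (cv k δ v) w = ∫ y, k y * inner ℝ (trans (δ • y) v) w := by
  rw [real_inner_comm, cv_apply, ← integral_inner (integrable_smul_trans k δ v)]
  simp only [inner_smul_right, real_inner_comm]

theorem inner_cv (k : TF) (δ : ℝ) (v w : L2Field) :
    inner ℝ (cv k δ v) w = inner ℝ v (cv k (-δ) w) := by
  rw [inner_cv_left, real_inner_comm, inner_cv_left]
  congr 1 with y
  rw [inner_trans, real_inner_comm, neg_smul]

/-- A bounded operator passes under the Bochner integral. This is the source of all commutation
rules below: whatever commutes with translations commutes with mollification and with mollified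
derivatives. -/
theorem clm_cv (k : TF) (δ : ℝ) {A : L2Field →L[ℝ] L2Field}
    (hA : ∀ y v, A (trans y v) = trans y (A v)) (v : L2Field) : A (cv k δ v) = cv k δ (A v) := by
  rw [cv_apply, ← A.integral_comp_comm (integrable_smul_trans k δ v), cv_apply]
  simp only [map_smul, hA]

theorem trans_cv (k : TF) (δ : ℝ) (y : E3) (v : L2Field) :
    trans y (cv k δ v) = cv k δ (trans y v) :=
  clm_cv k δ (fun z w => trans_comm y z w) v

theorem cv_comm (k l : TF) (δ η : ℝ) (v : L2Field) :
    cv k δ (cv l η v) = cv l η (cv k δ v) :=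
  clm_cv l η (fun z w => (trans_cv k δ z w).symm) v

theorem cv_neg_of_even {k : TF} (hk : ∀ y, k (-y) = k y) (δ : ℝ) : cv k (-δ) = cv k δ := by
  ext1 v
  rw [cv_apply, cv_apply, ← integral_neg_eq_self]
  simp only [hk, smul_neg, neg_smul, neg_neg]

theorem cv_neg_of_odd {k : TF} (hk : ∀ y, k (-y) = -k y) (δ : ℝ) : cv k (-δ) = -cv k δ := by
  ext1 v
  rw [cv_apply, ← integral_neg_eq_self, neg_apply, cv_apply, ← integral_neg]
  simp only [hk, smul_neg, neg_smul, neg_neg]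

theorem continuous_cv (k : TF) (v : L2Field) : Continuous fun δ => cv k δ v := by
  simp only [cv_apply]
  refine continuous_of_dominated (bound := fun y => |k y| * ‖v‖) (fun δ =>
    (integrable_smul_trans k δ v).aestronglyMeasurable)
    (fun δ => Eventually.of_forall fun y => ?_) ((integrable_TF k).abs.mul_const _)
    (Eventually.of_forall fun y => ?_)
  · rw [norm_smul, norm_trans, Real.norm_eq_abs]
  · exact (continuous_trans_smul y v).const_smul (k y)

theorem cv_zero (k : TF) (v : L2Field) : cv k 0 v = (∫ y, k y) • v := by
  rw [cv_apply]
  simp only [zero_smul, trans_zero]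
  exact integral_smul_const _ _

theorem hasDerivAt_trans_smul (i : Fin 3) (φ : TF) (y v : E3) (h₀ : ℝ) :
    HasDerivAt (fun h : ℝ => trans (y + h • v) (testField i φ))
      (-trans (y + h₀ • v) (testField i (∂_{v} φ))) h₀ := by
  have := (trans y).hasFDerivAt.comp_hasDerivAt h₀ (hasDerivAt_trans_testField i φ v h₀)
  simpa only [Function.comp_def, map_neg, trans_trans] using this

theorem hasLineDerivAt_trans_smul (i : Fin 3) (φ : TF) (δ : ℝ) (y v : E3) :
    HasLineDerivAt ℝ (fun y : E3 => trans (δ • y) (testField i φ))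
      (-(δ • trans (δ • y) (testField i (∂_{v} φ)))) y v := by
  have h := hasDerivAt_trans_smul i φ (δ • y) v (δ * 0)
  have h2 := HasDerivAt.scomp (0 : ℝ) h ((hasDerivAt_id (0 : ℝ)).const_mul δ)
  unfold HasLineDerivAt
  convert h2 using 1
  · ext1 t
    simp [smul_add, smul_smul]
  · simp

/-- Integration by parts. -/
theorem cv_lineDeriv (k : TF) (δ : ℝ) (v : E3) (i : Fin 3) (φ : TF) :
    cv (∂_{v} k) δ (testField i φ) = δ • cv k δ (testField i (∂_{v} φ)) := by
  have h := integral_bilinear_hasLineDerivAt_right_eq_neg_left_of_integrable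
    (μ := (volume : Measure E3)) (f := fun y => trans (δ • y) (testField i φ))
    (f' := fun y => -(δ • trans (δ • y) (testField i (∂_{v} φ))))
    (g := k) (g' := (∂_{v} k : TF)) (v := v)
    (B := (ContinuousLinearMap.lsmul ℝ ℝ : ℝ →L[ℝ] L2Field →L[ℝ] L2Field).flip) ?_ ?_ ?_
    (fun x _ => hasLineDerivAt_trans_smul i φ δ x v) (fun x _ => hasLineDerivAt_testFunction k v x)
  · simp only [ContinuousLinearMap.flip_apply, ContinuousLinearMap.lsmul_apply, smul_neg,
      integral_neg, neg_neg, smul_comm _ δ] at h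
    rw [cv_apply, h, integral_smul, cv_apply]
  · simp only [ContinuousLinearMap.flip_apply, ContinuousLinearMap.lsmul_apply, smul_neg,
      smul_comm _ δ]
    exact ((integrable_smul_trans k δ _).smul δ).neg
  · exact integrable_smul_trans (∂_{v} k) δ _
  · exact integrable_smul_trans k δ _

/-- Integration by parts. These first moments of `∂_j k` identify the limit of the commutator: only
the diagonal survives, and it produces a divergence. -/
theorem integral_lineDeriv_mul_coord (k : TF) (j l : Fin 3) :
    ∫ y, (∂_{e j} k) y * y l = -((if j = l then 1 else 0) * ∫ y, k y) := by
  have hcont : ∀ φ : TF, Integrable fun y : E3 => φ y * y l := fun φ =>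
    (φ.continuous.mul (EuclideanSpace.proj (𝕜 := ℝ) l).continuous).integrable_of_hasCompactSupport
      φ.hasCompactSupport.mul_right
  have h := integral_bilinear_hasLineDerivAt_right_eq_neg_left_of_integrable
    (μ := (volume : Measure E3)) (f := fun y : E3 => y l)
    (f' := fun y => (e j) l)
    (g := k) (g' := (∂_{e j} k : TF)) (v := e j)
    (B := (ContinuousLinearMap.lsmul ℝ ℝ : ℝ →L[ℝ] ℝ →L[ℝ] ℝ).flip) ?_ ?_ ?_
    (fun x _ => (EuclideanSpace.proj (𝕜 := ℝ) l).hasFDerivAt.hasLineDerivAt _)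
    (fun x _ => hasLineDerivAt_testFunction k _ x)
  · simp only [ContinuousLinearMap.flip_apply, ContinuousLinearMap.lsmul_apply, smul_eq_mul] at h
    rw [h, integral_mul_const, mul_comm]
    simp [eq_comm]
  · exact (integrable_TF k).mul_const _
  · exact hcont _
  · exact hcont _

/-! ### Exchange of kernel and test field -/

/-- The rescaled kernel `s⁻³ k(·/s)`. -/
def scaleTF (k : TF) (s : ℝ) (hs : s ≠ 0) : TF where
  toFun x := (s ^ 3)⁻¹ * k (s⁻¹ • x)
  contDiff' := contDiff_const.mul (k.contDiff.comp (contDiff_const_smul _))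
  hasCompactSupport' :=
    (k.hasCompactSupport.comp_homeomorph (Homeomorph.smulOfNeZero s⁻¹ (inv_ne_zero hs))).mul_left
  tsupport_subset' := by simp

theorem scaleTF_apply (k : TF) (s : ℝ) (hs : s ≠ 0) (x : E3) :
    scaleTF k s hs x = (s ^ 3)⁻¹ * k (s⁻¹ • x) := rfl

theorem norm_testField_scaleTF (i : Fin 3) (k : TF) {s : ℝ} (hs : 0 < s) :
    ‖testField i (scaleTF k s hs.ne')‖ ^ 2 = (s ^ 3)⁻¹ * ‖testField i k‖ ^ 2 := by
  rw [norm_testField_sq, norm_testField_sq]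
  simp only [scaleTF_apply, mul_pow]
  rw [integral_const_mul, Measure.integral_comp_smul volume (fun x : E3 => k x ^ 2) s⁻¹]
  simp only [finrank_euclideanSpace, Fintype.card_fin, smul_eq_mul]
  rw [abs_of_nonneg (by positivity)]
  field_simp

/-- The hypothesis of Fubini's theorem. The integrand vanishes unless `x` lies in the compact set
`supp φ + s supp k`, on which an `L²` field is integrable. -/
theorem integrable_conv_integrand (k φ : TF) (s : ℝ) (i : Fin 3) (v : L2Field) :
    Integrable (fun p : E3 × E3 => k p.1 * (φ (p.2 - s • p.1) * v p.2 i)) := by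
  obtain ⟨C, hC⟩ := φ.continuous.bounded_above_of_compact_support φ.hasCompactSupport
  set K : Set E3 := (fun p : E3 × E3 => p.1 + s • p.2) '' (tsupport φ ×ˢ tsupport k) with hK
  have hKc : IsCompact K := (φ.hasCompactSupport.prod k.hasCompactSupport).image (by fun_prop)
  have hv : LocallyIntegrable (fun x => v x i) (volume : Measure E3) := by
    have : MemLp (fun x => v x i) 2 (volume : Measure E3) :=
      (Lp.memLp v).continuousLinearMap_comp (EuclideanSpace.proj (𝕜 := ℝ) i)
    exact this.locallyIntegrable (by norm_num)
  have h1 : Integrable (K.indicator fun x => v x i) :=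
    (integrable_indicator_iff hKc.measurableSet).2 (hv.integrableOn_isCompact hKc)
  have h2 := (integrable_TF k).mul_prod (h1.const_mul C)
  refine h2.mono ?_ (Eventually.of_forall fun p => ?_)
  · have hm : AEStronglyMeasurable (fun p : E3 × E3 => v p.2 i) (volume.prod volume) :=
      hv.aestronglyMeasurable.comp_snd
    refine (k.continuous.comp continuous_fst).aestronglyMeasurable.mul
      (AEStronglyMeasurable.mul ?_ hm)
    exact (φ.continuous.comp (by fun_prop : Continuous fun p : E3 × E3 =>
      p.2 - s • p.1)).aestronglyMeasurable
  · simp only [norm_mul]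
    by_cases hp : k p.1 = 0
    · simp [hp]
    by_cases hq : φ (p.2 - s • p.1) = 0
    · simp only [hq, norm_zero, zero_mul, mul_zero]
      positivity
    have hmem : p.2 ∈ K := ⟨(p.2 - s • p.1, p.1), ⟨subset_tsupport _ hq, subset_tsupport _ hp⟩,
      by simp⟩
    rw [indicator_of_mem hmem]
    gcongr
    exact (hC _).trans (le_abs_self C)

theorem inner_cv_testField (k φ : TF) (s : ℝ) (i : Fin 3) (v : L2Field) :
    inner ℝ (cv k s (testField i φ)) v = ∫ x, (∫ y, k y * φ (x - s • y)) * v x i := by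
  rw [inner_cv_left]
  simp only [trans_testField, inner_testField, transTF_apply, ← integral_const_mul]
  rw [integral_integral_swap (integrable_conv_integrand k φ s i v)]
  simp only [← mul_assoc, integral_mul_const]

/-- The convolution of a kernel with a test field is symmetric. -/
theorem cv_testField_swap (k φ : TF) {s : ℝ} (hs : 0 < s) (i : Fin 3) :
    cv k s (testField i φ) = cv φ 1 (testField i (scaleTF k s hs.ne')) := by
  refine ext_inner_right ℝ fun v => ?_
  rw [inner_cv_testField, inner_cv_testField]
  congr 1 with x
  congr 1
  simp only [one_smul, scaleTF_apply]
  have := Measure.integral_comp_smul (volume : Measure E3)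
    (fun y : E3 => k y * φ (x - s • y)) s⁻¹
  simp only [finrank_euclideanSpace, Fintype.card_fin, smul_eq_mul, smul_smul,
    mul_inv_cancel₀ hs.ne', one_smul] at this
  rw [abs_of_nonneg (by positivity)] at this
  have h2 : (∫ y, k y * φ (x - s • y)) = (s ^ 3)⁻¹ * ∫ y, k (s⁻¹ • y) * φ (x - y) := by
    rw [this]
    field_simp
  rw [h2, ← integral_sub_left_eq_self (fun y => k (s⁻¹ • y) * φ (x - y)) volume x,
    ← integral_const_mul]
  congr 1 with y
  rw [sub_sub_cancel]
  ring

/-- After exchanging kernel and test function this is Young's inequality `L¹ * L² ⊂ L²`. The test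
function enters only through its `L¹` norm, as a sup bound by duality requires; the price is the
factor `s^(-3/2)`. -/
theorem norm_cv_testField_le (k φ : TF) {s : ℝ} (hs : 0 < s) (i : Fin 3) :
    ‖cv k s (testField i φ)‖ ≤ (∫ y, |φ y|) * (√((s ^ 3)⁻¹) * ‖testField i k‖) := by
  rw [cv_testField_swap k φ hs]
  refine (norm_cv_le _ _ _).trans ?_
  refine mul_le_mul_of_nonneg_left ?_ (integral_nonneg fun x => abs_nonneg (φ x))
  refine le_of_sq_le_sq ?_ (by positivity)
  rw [norm_testField_scaleTF i k hs, mul_pow, Real.sq_sqrt (by positivity)]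

/-! ### The Leray projector commutes with translations -/

theorem divPairing_trans (y : E3) (v : L2Field) (φ : TF) :
    divPairing (trans y v) φ = divPairing v (transTF (-y) φ) := by
  rw [divPairing_eq, divPairing_eq]
  congr 2 with j
  rw [lineDeriv_transTF, ← trans_testField, inner_trans, neg_neg]

theorem trans_mem_L2sigma {v : L2Field} (hv : v ∈ L2sigma) (y : E3) : trans y v ∈ L2sigma := by
  intro φ
  rw [divPairing_trans]
  exact hv _

theorem leray_mem (v : L2Field) : leray v ∈ L2sigma := L2sigma.starProjection_apply_mem v

theorem leray_of_mem {v : L2Field} (hv : v ∈ L2sigma) : leray v = v :=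
  Submodule.starProjection_eq_self_iff.2 hv

theorem inner_leray (v w : L2Field) : inner ℝ (leray v) w = inner ℝ v (leray w) :=
  Submodule.inner_starProjection_left_eq_right L2sigma v w

theorem norm_leray_le (v : L2Field) : ‖leray v‖ ≤ ‖v‖ :=
  L2sigma.norm_starProjection_apply_le v

/-- Translations preserve `L²_σ`, and, being isometries with translations as inverses, also its
orthogonal complement. -/
theorem leray_trans (y : E3) (v : L2Field) : leray (trans y v) = trans y (leray v) := by
  refine Submodule.eq_starProjection_of_mem_orthogonal (K := L2sigma)
    (trans_mem_L2sigma (leray_mem v) y) ?_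
  rw [Submodule.mem_orthogonal']
  intro w hw
  rw [← map_sub, inner_trans]
  have h := L2sigma.sub_starProjection_mem_orthogonal v
  rw [Submodule.mem_orthogonal'] at h
  exact h _ (trans_mem_L2sigma hw (-y))

theorem leray_cv (k : TF) (δ : ℝ) (v : L2Field) : leray (cv k δ v) = cv k δ (leray v) :=
  clm_cv k δ leray_trans v

theorem cv_mem_L2sigma (k : TF) (δ : ℝ) {v : L2Field} (hv : v ∈ L2sigma) : cv k δ v ∈ L2sigma := by
  rw [← leray_of_mem hv, ← leray_cv]
  exact leray_mem _

/-! ### Mollified derivatives -/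

namespace MollifierKernel

variable (θ : MollifierKernel)

/-- The kernel as a test function. -/
def tf : TF := ⟨θ.toFun, θ.smooth, θ.compactSupport, by simp⟩

theorem tf_apply (x : E3) : θ.tf x = θ.toFun x := rfl

theorem tf_neg (x : E3) : θ.tf (-x) = θ.tf x := θ.even x

theorem _root_.Micropolar.lineDeriv_neg_arg {k : TF} {σ : ℝ} (hk : ∀ y, k (-y) = σ * k y)
    (v x : E3) : (∂_{v} k) (-x) = -(σ * (∂_{v} k) x) := by
  have h1 := hasLineDerivAt_testFunction k v (-x)
  have h2 := (hasLineDerivAt_testFunction k (-v) x).const_mul σ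
  have h3 : (fun t : ℝ => k (-x + t • v)) = fun t : ℝ => σ * k (x + t • -v) := by
    ext t
    rw [← hk]
    congr 1
    simp only [smul_neg, neg_add_rev, neg_neg]
    abel
  unfold HasLineDerivAt at h1
  rw [h3] at h1
  rw [h1.unique h2, lineDeriv_apply, lineDeriv_apply, map_neg]
  ring

theorem lineDeriv_tf_neg (v x : E3) : (∂_{v} θ.tf) (-x) = -(∂_{v} θ.tf) x := by
  have := lineDeriv_neg_arg (k := θ.tf) (σ := 1) (fun y => by rw [tf_neg, one_mul]) v x
  rwa [one_mul] at this

theorem lineDeriv_lineDeriv_tf_neg (v w x : E3) :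
    (∂_{v} (∂_{w} θ.tf)) (-x) = (∂_{v} (∂_{w} θ.tf)) x := by
  have := lineDeriv_neg_arg (k := ∂_{w} θ.tf) (σ := -1)
    (fun y => by rw [lineDeriv_tf_neg, neg_one_mul]) v x
  rwa [neg_one_mul, neg_neg] at this

/-- The mollification operator on `L²` at scale `δ`. -/
def S (δ : ℝ) : L2Field →L[ℝ] L2Field := cv θ.tf δ

/-- The mollified derivative `∂_j` at scale `δ`. -/
def D (j : Fin 3) (δ : ℝ) : L2Field →L[ℝ] L2Field := δ⁻¹ • cv (∂_{e j} θ.tf) δ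

/-- The mollified second derivative `∂_i ∂_j` at scale `δ`. -/
def DD (i j : Fin 3) (δ : ℝ) : L2Field →L[ℝ] L2Field :=
  (δ⁻¹ * δ⁻¹) • cv (∂_{e i} (∂_{e j} θ.tf)) δ

theorem D_apply (j : Fin 3) (δ : ℝ) (v : L2Field) :
    θ.D j δ v = δ⁻¹ • cv (∂_{e j} θ.tf) δ v := rfl

theorem DD_apply (i j : Fin 3) (δ : ℝ) (v : L2Field) :
    θ.DD i j δ v = (δ⁻¹ * δ⁻¹) • cv (∂_{e i} (∂_{e j} θ.tf)) δ v := rfl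

theorem inner_S (δ : ℝ) (v w : L2Field) : inner ℝ (θ.S δ v) w = inner ℝ v (θ.S δ w) := by
  rw [S, inner_cv, cv_neg_of_even θ.tf_neg]

theorem inner_D (j : Fin 3) (δ : ℝ) (v w : L2Field) :
    inner ℝ (θ.D j δ v) w = -inner ℝ v (θ.D j δ w) := by
  rw [D_apply, D_apply, inner_smul_left, inner_cv, cv_neg_of_odd (θ.lineDeriv_tf_neg _),
    inner_smul_right]
  simp

theorem inner_DD (i j : Fin 3) (δ : ℝ) (v w : L2Field) :
    inner ℝ (θ.DD i j δ v) w = inner ℝ v (θ.DD i j δ w) := by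
  rw [DD_apply, DD_apply, inner_smul_left, inner_cv,
    cv_neg_of_even (θ.lineDeriv_lineDeriv_tf_neg _ _), inner_smul_right]
  simp

theorem integral_tf : ∫ y, θ.tf y = 1 := θ.integral_eq_one

theorem integral_abs_tf : ∫ y, |θ.tf y| = 1 := by
  rw [← θ.integral_tf]
  congr 1 with y
  exact abs_of_nonneg (θ.nonneg y)

theorem norm_S_le (δ : ℝ) (v : L2Field) : ‖θ.S δ v‖ ≤ ‖v‖ := by
  have := norm_cv_le θ.tf δ v
  rwa [θ.integral_abs_tf, one_mul] at this

theorem tendsto_S (v : L2Field) : Tendsto (fun δ => θ.S δ v) (𝓝 0) (𝓝 v) := by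
  have := (continuous_cv θ.tf v).tendsto 0
  rwa [cv_zero, θ.integral_tf, one_smul] at this

theorem D_testField (j : Fin 3) {δ : ℝ} (hδ : δ ≠ 0) (i : Fin 3) (φ : TF) :
    θ.D j δ (testField i φ) = θ.S δ (testField i (∂_{e j} φ)) := by
  rw [D_apply, cv_lineDeriv, smul_smul, inv_mul_cancel₀ hδ, one_smul, S]

theorem DD_testField (k j : Fin 3) {δ : ℝ} (hδ : δ ≠ 0) (i : Fin 3) (φ : TF) :
    θ.DD k j δ (testField i φ) = θ.S δ (testField i (∂_{e k} (∂_{e j} φ))) := by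
  rw [DD_apply, cv_lineDeriv, cv_lineDeriv, smul_smul, smul_smul, S,
    lineDeriv_comm φ]
  have : δ⁻¹ * δ⁻¹ * δ * δ = 1 := by field_simp
  rw [this, one_smul]

/-- On test fields both sides mollify the second derivative twice. `DD` convolves with a single
kernel, a product of two `D` with two kernels; the extra `S` makes up the difference. -/
theorem S_DD (k j : Fin 3) {δ : ℝ} (hδ : δ ≠ 0) (v : L2Field) :
    θ.S δ (θ.DD k j δ v) = θ.D k δ (θ.D j δ v) := by
  have : (θ.S δ).comp (θ.DD k j δ) = (θ.D k δ).comp (θ.D j δ) := by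
    refine clm_ext_testField fun i φ => ?_
    simp only [ContinuousLinearMap.comp_apply]
    rw [DD_testField θ k j hδ, D_testField θ j hδ]
    have : θ.D k δ (θ.S δ (testField i (∂_{e j} φ))) =
        θ.S δ (θ.D k δ (testField i (∂_{e j} φ))) := by
      rw [D_apply, D_apply, S, cv_comm, map_smul]
    rw [this, D_testField θ k hδ]
  exact congr($this v)

theorem clm_S (δ : ℝ) {A : L2Field →L[ℝ] L2Field}
    (hA : ∀ y v, A (trans y v) = trans y (A v)) (v : L2Field) : A (θ.S δ v) = θ.S δ (A v) :=
  clm_cv _ _ hA v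

theorem clm_D (j : Fin 3) (δ : ℝ) {A : L2Field →L[ℝ] L2Field}
    (hA : ∀ y v, A (trans y v) = trans y (A v)) (v : L2Field) : A (θ.D j δ v) = θ.D j δ (A v) := by
  rw [D_apply, map_smul, clm_cv _ _ hA, D_apply]

theorem S_trans (δ : ℝ) (y : E3) (v : L2Field) : θ.S δ (trans y v) = trans y (θ.S δ v) :=
  (trans_cv _ _ _ _).symm

theorem D_trans (j : Fin 3) (δ : ℝ) (y : E3) (v : L2Field) :
    θ.D j δ (trans y v) = trans y (θ.D j δ v) := by
  rw [D_apply, D_apply, map_smul, trans_cv]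

theorem S_D (j : Fin 3) (δ : ℝ) (v : L2Field) : θ.S δ (θ.D j δ v) = θ.D j δ (θ.S δ v) :=
  θ.clm_D j δ (θ.S_trans δ) v

theorem D_comm (i j : Fin 3) (δ : ℝ) (v : L2Field) :
    θ.D i δ (θ.D j δ v) = θ.D j δ (θ.D i δ v) :=
  θ.clm_D j δ (θ.D_trans i δ) v

theorem leray_S (δ : ℝ) (v : L2Field) : leray (θ.S δ v) = θ.S δ (leray v) :=
  θ.clm_S δ leray_trans v

theorem leray_D (j : Fin 3) (δ : ℝ) (v : L2Field) : leray (θ.D j δ v) = θ.D j δ (leray v) :=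
  θ.clm_D j δ leray_trans v

end MollifierKernel

/-! ### Weak derivatives -/

/-- `g` is the weak derivative of `v` in the direction `e j`. -/
def HasWD (j : Fin 3) (v g : L2Field) : Prop :=
  ∀ i φ, inner ℝ (testField i φ) g = -inner ℝ (testField i (∂_{e j} φ)) v

theorem integral_smul_apply (φ : TF) (v : L2Field) (i : Fin 3) :
    (∫ x, φ x • v x) i = inner ℝ (testField i φ) v := by
  rw [inner_testField]
  obtain ⟨C, hC⟩ := φ.continuous.bounded_above_of_compact_support φ.hasCompactSupport
  have hint : Integrable fun x => φ x • v x := by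
    have : LocallyIntegrable v (volume : Measure E3) := (Lp.memLp v).locallyIntegrable (by norm_num)
    exact this.integrable_smul_left_of_hasCompactSupport φ.continuous φ.hasCompactSupport
  have := (EuclideanSpace.proj (𝕜 := ℝ) i : E3 →L[ℝ] ℝ).integral_comp_comm hint
  exact this.symm

theorem hasWeakGrad_iff {v : L2Field} {G : Fin 3 → L2Field} :
    HasWeakGrad v G ↔ ∀ j, HasWD j v (G j) := by
  refine forall_congr' fun j => ?_
  rw [HasWD, forall_comm]
  refine forall_congr' fun φ => ?_
  rw [PiLp.ext_iff]
  refine forall_congr' fun i => ?_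
  rw [integral_smul_apply, PiLp.neg_apply, integral_smul_apply]

/-- Along the segment from `0` to `y` the translate of `v` has derivative `-∑ y_j ∂_j v`. This is
seen by differentiating the translated test field instead, and then holds as an identity between
`L²` fields. -/
theorem HasWD.trans_sub {v : L2Field} {G : Fin 3 → L2Field} (h : ∀ j, HasWD j v (G j)) (y : E3) :
    ‖v - trans y v‖ ≤ ∑ j, ‖y‖ * ‖G j‖ := by
  have key : trans y v - v = ∫ s in (0 : ℝ)..1, -∑ j, y j • trans (s • y) (G j) := by
    refine ext_inner_testField fun i φ => ?_
    have hcont : Continuous fun s : ℝ => -∑ j, y j • trans (s • y) (G j) :=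
      (continuous_finsetSum Finset.univ fun j _ =>
        (continuous_trans_smul y (G j)).const_smul (y j)).neg
    have h1 : inner ℝ (testField i φ) (∫ s in (0 : ℝ)..1, -∑ j, y j • trans (s • y) (G j)) =
        ∫ s in (0 : ℝ)..1, inner ℝ (testField i φ) (-∑ j, y j • trans (s • y) (G j)) :=
      ((innerSL ℝ (testField i φ)).intervalIntegral_comp_comm
        (hcont.intervalIntegrable 0 1)).symm
    have h2 : ∀ s : ℝ, HasDerivAt (fun s : ℝ => inner ℝ (trans (s • (-y)) (testField i φ)) v)
        (inner ℝ (testField i φ) (-∑ j, y j • trans (s • y) (G j))) s := by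
      intro s
      have h3 := (hasDerivAt_trans_testField i φ (-y) s).inner ℝ (hasDerivAt_const s v)
      have hy : ∂_{-y} φ = -∑ j, y j • ∂_{e j} φ := by
        ext x
        have hsum : (∑ j, y j • ∂_{e j} φ : TF) x = ∑ j, y j * (∂_{e j} φ) x := by
          simp
        rw [FunLike.coe_neg, Pi.neg_apply, hsum, lineDeriv_apply, map_neg]
        simp only [lineDeriv_apply]
        congr 1
        conv_lhs => rw [← (EuclideanSpace.basisFun (Fin 3) ℝ).sum_repr y]
        simp
      refine h3.congr_deriv ?_
      have hin : ∀ j, inner ℝ (trans (s • -y) (testField i (∂_{e j} φ))) v =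
          -inner ℝ (testField i φ) (trans (s • y) (G j)) := by
        intro j
        rw [trans_testField, ← lineDeriv_transTF]
        have := h j i (transTF (s • -y) φ)
        rw [← trans_testField, inner_trans] at this
        simp only [smul_neg, neg_neg] at this ⊢
        linarith
      have hT : testField i (-∑ j, y j • ∂_{e j} φ) =
          -∑ j, y j • testField i (∂_{e j} φ) := by
        have := map_neg (testFieldL i) (∑ j, y j • ∂_{e j} φ)
        rw [map_sum] at this
        simp only [map_smul] at this
        exact this
      rw [inner_zero_right, zero_add, hy, hT]
      simp only [map_neg, map_sum, map_smul, neg_neg, inner_neg_right, inner_sum, inner_smul_right,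
        sum_inner, inner_smul_left, hin]
      simp
    rw [h1, intervalIntegral.integral_eq_sub_of_hasDerivAt (fun s _ => h2 s)
      ((continuous_const.inner hcont).intervalIntegrable 0 1), inner_sub_right]
    simp only [one_smul, zero_smul, trans_zero]
    rw [inner_trans, neg_neg]
  rw [norm_sub_rev, key]
  refine (intervalIntegral.norm_integral_le_of_norm_le_const
    (C := ∑ j, ‖y‖ * ‖G j‖) fun s _ => ?_).trans (by simp)
  rw [norm_neg]
  refine (norm_sum_le _ _).trans (Finset.sum_le_sum fun j _ => ?_)
  rw [norm_smul, norm_trans]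
  gcongr
  exact PiLp.norm_apply_le y j

/-- The first moment of the kernel. -/
def MollifierKernel.moment (θ : MollifierKernel) : ℝ := ∫ y, θ.tf y * ‖y‖

theorem MollifierKernel.moment_nonneg (θ : MollifierKernel) : 0 ≤ θ.moment :=
  integral_nonneg fun y => mul_nonneg (θ.nonneg y) (norm_nonneg y)

/-- The translation estimate averaged over the kernel. The rate depends on `v` only through its
gradient; this replaces strong compactness in the limit `ε → 0`. -/
theorem HasWD.norm_sub_S_le (θ : MollifierKernel) {v : L2Field} {G : Fin 3 → L2Field}
    (h : ∀ j, HasWD j v (G j)) {δ : ℝ} (hδ : 0 ≤ δ) :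
    ‖v - θ.S δ v‖ ≤ δ * θ.moment * ∑ j, ‖G j‖ := by
  have h1 : v - θ.S δ v = ∫ y, θ.tf y • (v - trans (δ • y) v) := by
    simp only [smul_sub]
    rw [integral_sub ((integrable_TF θ.tf).smul_const v) (integrable_smul_trans _ _ _),
      integral_smul_const, θ.integral_tf, one_smul]
    rfl
  have hint : Integrable fun y : E3 => θ.tf y * ‖y‖ :=
    (θ.tf.continuous.mul continuous_norm).integrable_of_hasCompactSupport
      θ.tf.hasCompactSupport.mul_right
  rw [h1, MollifierKernel.moment]
  calc _ ≤ ∫ y, (δ * ∑ j, ‖G j‖) * (θ.tf y * ‖y‖) := by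
        refine norm_integral_le_of_norm_le (hint.const_mul _) (Eventually.of_forall fun y => ?_)
        rw [norm_smul, Real.norm_eq_abs, abs_of_nonneg (show 0 ≤ θ.tf y from θ.nonneg y)]
        have := HasWD.trans_sub h (δ • y)
        rw [← Finset.mul_sum, norm_smul, Real.norm_eq_abs, abs_of_nonneg hδ] at this
        calc _ ≤ θ.tf y * (δ * ‖y‖ * ∑ j, ‖G j‖) :=
              mul_le_mul_of_nonneg_left this (θ.nonneg y)
          _ = _ := by ring
    _ = _ := by
        rw [integral_const_mul]
        ring

attribute [irreducible] cv MollifierKernel.S MollifierKernel.D MollifierKernel.DD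

/-! ### Multiplication by bounded continuous functions -/

/-- Bounded continuous functions on physical space. -/
abbrev BCF := BoundedContinuousFunction E3 ℝ

theorem memLp_mul (g : BCF) (v : L2Field) : MemLp (fun x => g x • v x) 2 (volume : Measure E3) :=
  MemLp.of_le_mul (c := ‖g‖) (Lp.memLp v)
    (g.continuous.aestronglyMeasurable.smul (Lp.aestronglyMeasurable v))
    (Eventually.of_forall fun x => by
      rw [norm_smul]
      exact mul_le_mul_of_nonneg_right (g.norm_coe_le_norm x) (norm_nonneg _))

/-- Multiplication of an `L²` field by a bounded continuous function, as a bilinear map. -/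
def mulL : BCF →L[ℝ] L2Field →L[ℝ] L2Field :=
  LinearMap.mkContinuous₂
    (LinearMap.mk₂ ℝ (fun g v => (memLp_mul g v).toLp _)
      (fun g h v => by
        rw [← MemLp.toLp_add]
        exact MemLp.toLp_congr _ _ (Eventually.of_forall fun x => by
          simp only [BoundedContinuousFunction.coe_add, Pi.add_apply, add_smul]))
      (fun c g v => by
        rw [← MemLp.toLp_const_smul]
        exact MemLp.toLp_congr _ _ (Eventually.of_forall fun x => by
          simp only [BoundedContinuousFunction.coe_smul, Pi.smul_apply, smul_assoc]))
      (fun g v w => by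
        rw [← MemLp.toLp_add]
        refine MemLp.toLp_congr _ _ ?_
        filter_upwards [Lp.coeFn_add v w] with x hx
        rw [hx, Pi.add_apply, Pi.add_apply, smul_add])
      (fun c g v => by
        rw [← MemLp.toLp_const_smul]
        refine MemLp.toLp_congr _ _ ?_
        filter_upwards [Lp.coeFn_smul c v] with x hx
        rw [hx, Pi.smul_apply, Pi.smul_apply, smul_comm]))
    1 (fun g v => by
      rw [one_mul]
      refine Lp.norm_le_mul_norm_of_ae_le_mul ?_
      filter_upwards [MemLp.coeFn_toLp (memLp_mul g v)] with x hx
      simp only [LinearMap.mk₂_apply]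
      rw [hx, norm_smul]
      exact mul_le_mul_of_nonneg_right (g.norm_coe_le_norm x) (norm_nonneg _))

theorem coeFn_mulL (g : BCF) (v : L2Field) : mulL g v =ᵐ[volume] fun x => g x • v x :=
  MemLp.coeFn_toLp (memLp_mul g v)

theorem norm_mulL_le (g : BCF) (v : L2Field) : ‖mulL g v‖ ≤ ‖g‖ * ‖v‖ := by
  refine Lp.norm_le_mul_norm_of_ae_le_mul ?_
  filter_upwards [coeFn_mulL g v] with x hx
  rw [hx, norm_smul]
  exact mul_le_mul_of_nonneg_right (g.norm_coe_le_norm x) (norm_nonneg _)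

theorem inner_mulL_eq (g : BCF) (v w : L2Field) :
    inner ℝ (mulL g v) w = ∫ x, g x * inner ℝ (v x) (w x) := by
  rw [L2.inner_def]
  refine integral_congr_ae ?_
  filter_upwards [coeFn_mulL g v] with x hx
  rw [hx, inner_smul_left]
  simp

theorem inner_mulL (g : BCF) (v w : L2Field) : inner ℝ (mulL g v) w = inner ℝ v (mulL g w) := by
  rw [inner_mulL_eq, real_inner_comm, inner_mulL_eq]
  simp only [real_inner_comm]

/-! ### Regularised fields -/

theorem abs_inner_trans_le (κ u : L2Field) (x : E3) :
    |inner ℝ (trans x κ) u| ≤ ‖κ‖ * ‖u‖ := by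
  simpa using abs_real_inner_le_norm (trans x κ) u

theorem continuous_inner_trans (κ u : L2Field) : Continuous fun x => inner ℝ (trans x κ) u :=
  (continuous_trans continuous_id continuous_const).inner continuous_const

/-- The bounded continuous function `x ↦ ∫ κ(y - x) · u(y) dy`. -/
def ptF (κ u : L2Field) : BCF :=
  BoundedContinuousFunction.ofNormedAddCommGroup (fun x => inner ℝ (trans x κ) u)
    (continuous_inner_trans κ u) (‖κ‖ * ‖u‖) (abs_inner_trans_le κ u)

theorem ptF_apply (κ u : L2Field) (x : E3) : ptF κ u x = inner ℝ (trans x κ) u := rfl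

theorem norm_ptF_le (κ u : L2Field) : ‖ptF κ u‖ ≤ ‖κ‖ * ‖u‖ :=
  BoundedContinuousFunction.norm_ofNormedAddCommGroup_le _ (by positivity) _

/-- `ptF` as a bilinear map. -/
def ptLin : L2Field →ₗ[ℝ] L2Field →ₗ[ℝ] BCF :=
  LinearMap.mk₂ ℝ ptF
    (fun κ κ' u => by
      ext x
      rw [BoundedContinuousFunction.add_apply]
      simp only [ptF_apply, map_add, inner_add_left])
    (fun c κ u => by
      ext x
      rw [BoundedContinuousFunction.smul_apply]
      simp only [ptF_apply, map_smul, inner_smul_left]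
      simp)
    (fun κ u u' => by
      ext x
      rw [BoundedContinuousFunction.add_apply]
      simp only [ptF_apply, inner_add_right])
    (fun c κ u => by
      ext x
      rw [BoundedContinuousFunction.smul_apply]
      simp only [ptF_apply, inner_smul_right, smul_eq_mul])

theorem ptLin_apply (κ u : L2Field) : ptLin κ u = ptF κ u := rfl

theorem norm_ptLin_le (κ u : L2Field) : ‖ptLin κ u‖ ≤ 1 * ‖κ‖ * ‖u‖ := by
  rw [ptLin_apply, one_mul]
  exact norm_ptF_le κ u

/-- `ptF` as a continuous bilinear map. -/
def ptB : L2Field →L[ℝ] L2Field →L[ℝ] BCF :=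
  LinearMap.mkContinuous₂ ptLin 1 norm_ptLin_le

theorem ptB_apply (κ u : L2Field) (x : E3) : ptB κ u x = inner ℝ (trans x κ) u := rfl

theorem norm_ptB_le (κ u : L2Field) : ‖ptB κ u‖ ≤ ‖κ‖ * ‖u‖ := norm_ptF_le κ u

attribute [irreducible] ptB mulL

theorem trans_mulL_ptB (y : E3) (κ u v : L2Field) :
    trans y (mulL (ptB κ u) v) = mulL (ptB (trans (-y) κ) u) (trans y v) := by
  ext1
  filter_upwards [coeFn_trans y (mulL (ptB κ u) v), coeFn_mulL (ptB (trans (-y) κ) u) (trans y v),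
    coeFn_trans y v,
    (measurePreserving_sub_right volume y).quasiMeasurePreserving.ae (coeFn_mulL (ptB κ u) v)]
    with x h1 h2 h3 h4
  rw [h1, h2, h3, h4, ptB_apply, ptB_apply, trans_trans, sub_eq_add_neg]

/-- The value at `x` is the divergence of `u` paired with the translate of `k` by `x`, up to sign.
-/
theorem sum_ptB_eq_zero (k : TF) {u : L2Field} (hu : u ∈ L2sigma) :
    ∑ j, ptB (testField j (∂_{e j} k)) u = 0 := by
  ext x
  have h := hu (transTF x k)
  rw [divPairing_eq, neg_eq_zero] at h
  simp only [lineDeriv_transTF, ← trans_testField] at h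
  simpa [BoundedContinuousFunction.coe_sum, ptB_apply] using h

/-- The pairing of a translated test field with another one can be differentiated on either side;
the two derivatives agree. -/
theorem hasWD_testField (j i : Fin 3) (k : TF) :
    HasWD j (testField i k) (testField i (∂_{e j} k)) := by
  intro l φ
  have h1 := (hasDerivAt_trans_testField l φ (e j) 0).inner ℝ
    (hasDerivAt_const (0 : ℝ) (testField i k))
  have h2 := (hasDerivAt_const (0 : ℝ) (testField l φ)).inner ℝ
    (hasDerivAt_trans_testField i k (-e j) 0)
  have h3 : (fun h : ℝ => inner ℝ (trans (h • e j) (testField l φ)) (testField i k)) =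
      fun h : ℝ => inner ℝ (testField l φ) (trans (h • -e j) (testField i k)) := by
    ext h
    rw [inner_trans, smul_neg]
  rw [h3] at h1
  have h4 := h1.unique h2
  have h5 : testField i (∂_{-e j} k) = -testField i (∂_{e j} k) := by
    rw [← testField_neg]
    congr 1
    ext x
    rw [lineDeriv_apply, FunLike.coe_neg, Pi.neg_apply, lineDeriv_apply, map_neg]
  simp only [zero_smul, trans_zero, inner_zero_right, inner_zero_left, inner_neg_left,
    h5, neg_neg, zero_add, add_zero] at h4
  exact h4.symm

theorem hasDerivAt_inner_mulL {f g : ℝ → L2Field} {b : ℝ → BCF} {f' g' : L2Field} {b' : BCF}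
    {t : ℝ} (hf : HasDerivAt f f' t) (hb : HasDerivAt b b' t) (hg : HasDerivAt g g' t) :
    HasDerivAt (fun h => inner ℝ (f h) (mulL (b h) (g h)))
      (inner ℝ (f t) (mulL b' (g t) + mulL (b t) g') + inner ℝ f' (mulL (b t) (g t))) t := by
  have h1 : HasDerivAt (fun h => mulL (b h)) (mulL b') t :=
    mulL.hasFDerivAt.comp_hasDerivAt t hb
  exact hf.inner ℝ (h1.clm_apply hg)

/-- The expression is bilinear and continuous in `v` and `w`, so it suffices to check test fields,
along whose translates one can differentiate. -/
theorem sum_inner_ext {A M : Fin 3 → L2Field →L[ℝ] L2Field} {S : L2Field →L[ℝ] L2Field}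
    (h : ∀ i φ i' φ', ∑ j, (inner ℝ (A j (testField i φ)) (M j (S (testField i' φ'))) +
      inner ℝ (S (testField i φ)) (M j (A j (testField i' φ')))) = 0) (v w : L2Field) :
    ∑ j, (inner ℝ (A j v) (M j (S w)) + inner ℝ (S v) (M j (A j w))) = 0 := by
  refine testField_induction (p := fun v => ∑ j,
    (inner ℝ (A j v) (M j (S w)) + inner ℝ (S v) (M j (A j w))) = 0) ?_ ?_ ?_ ?_ v
  · exact isClosed_eq (by fun_prop) continuous_const
  · intro a b ha hb
    simp only [map_add, inner_add_left]
    simp only [Finset.sum_add_distrib] at ha hb ⊢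
    linarith
  · intro c a ha
    simp only [map_smul, inner_smul_left, ← mul_add, ← Finset.mul_sum, ha, mul_zero]
  intro i φ
  refine testField_induction (p := fun w => ∑ j,
    (inner ℝ (A j (testField i φ)) (M j (S w)) + inner ℝ (S (testField i φ)) (M j (A j w))) = 0)
    ?_ ?_ (fun c a ha => ?_) (h i φ) w
  · exact isClosed_eq (by fun_prop) continuous_const
  · intro a b ha hb
    simp only [map_add, inner_add_right]
    simp only [Finset.sum_add_distrib] at ha hb ⊢
    linarith
  · simp only [map_smul, inner_smul_right, ← mul_add, ← Finset.mul_sum, ha, mul_zero]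

namespace MollifierKernel

variable (θ : MollifierKernel)

theorem hasDerivAt_trans_S_testField (δ : ℝ) (i : Fin 3) (φ : TF) (v : E3) :
    HasDerivAt (fun h : ℝ => trans (h • v) (θ.S δ (testField i φ)))
      (-θ.S δ (testField i (∂_{v} φ))) 0 := by
  have := (θ.S δ).hasFDerivAt.comp_hasDerivAt (0 : ℝ) (hasDerivAt_trans_testField i φ v 0)
  simpa only [Function.comp_def, map_neg, zero_smul, trans_zero, θ.S_trans] using this

theorem hasDerivAt_trans_neg_testField (k : TF) (j : Fin 3) (v : E3) :
    HasDerivAt (fun h : ℝ => trans (-(h • v)) (testField j k)) (testField j (∂_{v} k)) 0 := by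
  have h1 := hasDerivAt_trans_testField j k (-v) 0
  have h5 : -trans ((0 : ℝ) • -v) (testField j (∂_{-v} k)) = testField j (∂_{v} k) := by
    rw [zero_smul, trans_zero, ← testField_neg]
    congr 1
    ext x
    rw [lineDeriv_apply, FunLike.coe_neg, Pi.neg_apply, lineDeriv_apply, map_neg, neg_neg]
  rw [h5] at h1
  simpa only [smul_neg] using h1

theorem hasDerivAt_ptB (k : TF) (u : L2Field) (j : Fin 3) (v : E3) :
    HasDerivAt (fun h : ℝ => ptB (trans (-(h • v)) (testField j k)) u)
      (ptB (testField j (∂_{v} k)) u) 0 := by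
  have := ((ContinuousLinearMap.apply ℝ BCF u).comp ptB).hasFDerivAt.comp_hasDerivAt (0 : ℝ)
    (hasDerivAt_trans_neg_testField k j v)
  simpa only [Function.comp_def, ContinuousLinearMap.comp_apply,
    ContinuousLinearMap.apply_apply] using this

/-- Translating all three factors of `∫ b (S φ)·(S φ')` at once does not change the integral. The
derivative at zero of this constant function is the Leibniz rule, in which the derivative of `b` is
left over; it cancels after summation over `j`. -/
theorem inner_skew_testField (k : TF) (u : L2Field) (j : Fin 3)
    {δ : ℝ} (hδ : δ ≠ 0) (i i' : Fin 3) (φ φ' : TF) :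
    inner ℝ (θ.D j δ (testField i φ)) (mulL (ptB (testField j k) u) (θ.S δ (testField i' φ'))) +
      inner ℝ (θ.S δ (testField i φ)) (mulL (ptB (testField j k) u) (θ.D j δ (testField i' φ'))) =
    inner ℝ (θ.S δ (testField i φ))
      (mulL (ptB (testField j (∂_{e j} k)) u) (θ.S δ (testField i' φ'))) := by
  have h4 := hasDerivAt_inner_mulL (θ.hasDerivAt_trans_S_testField δ i φ (e j))
    (hasDerivAt_ptB k u j (e j)) (θ.hasDerivAt_trans_S_testField δ i' φ' (e j))
  simp only [← trans_mulL_ptB, inner_trans_trans] at h4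
  have h6 := h4.unique (hasDerivAt_const (0 : ℝ) _)
  simp only [zero_smul, trans_zero, neg_zero, map_neg, inner_neg_left,
    inner_add_right, inner_neg_right] at h6
  rw [θ.D_testField j hδ, θ.D_testField j hδ]
  linarith

theorem sum_inner_skew_add (k : TF) {u : L2Field} (hu : u ∈ L2sigma) {δ : ℝ} (hδ : δ ≠ 0)
    (v w : L2Field) :
    ∑ j, (inner ℝ (θ.D j δ v) (mulL (ptB (testField j k) u) (θ.S δ w)) +
      inner ℝ (θ.S δ v) (mulL (ptB (testField j k) u) (θ.D j δ w))) = 0 := by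
  refine sum_inner_ext (A := fun j => θ.D j δ) (M := fun j => mulL (ptB (testField j k) u))
    (S := θ.S δ) (fun i φ i' φ' => ?_) v w
  simp only [θ.inner_skew_testField k u _ hδ]
  rw [← inner_sum, ← sum_apply, ← map_sum, sum_ptB_eq_zero k hu]
  simp

/-- The transport by a divergence-free regularised field does not contribute to the energy. -/
theorem sum_inner_skew (k : TF) {u : L2Field} (hu : u ∈ L2sigma) {δ : ℝ} (hδ : δ ≠ 0)
    (v : L2Field) :
    ∑ j, inner ℝ (θ.S δ v) (mulL (ptB (testField j k) u) (θ.D j δ v)) = 0 := by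
  have h := θ.sum_inner_skew_add k hu hδ v v
  rw [Finset.sum_add_distrib] at h
  have h2 : ∑ j, inner ℝ (θ.D j δ v) (mulL (ptB (testField j k) u) (θ.S δ v)) =
      ∑ j, inner ℝ (θ.S δ v) (mulL (ptB (testField j k) u) (θ.D j δ v)) := by
    refine Finset.sum_congr rfl fun j _ => ?_
    rw [← inner_mulL, real_inner_comm]
  linarith

end MollifierKernel

namespace MollifierKernel

variable (θ : MollifierKernel)

/-! ### The commutator of mollification and transport -/

/-- The integrand of the commutator between mollified derivatives and multiplication. -/
def commIntegrand (k : TF) (u w : L2Field) (δ : ℝ) (y : E3) : L2Field :=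
  ∑ j, (∂_{e j} θ.tf) y • mulL (ptB (δ⁻¹ • (trans (-(δ • y)) (testField j k) - testField j k)) u)
    (trans (δ • y) w)

/-- A bound for the Lipschitz constant of the fields regularised with the kernel `k`. -/
def lipConst (k : TF) : ℝ := ∑ j, ∑ l, ‖testField j (∂_{e l} k)‖

theorem norm_diffQuot_le (k : TF) (j : Fin 3) {δ : ℝ} (hδ : 0 < δ) (y : E3) :
    ‖δ⁻¹ • (trans (-(δ • y)) (testField j k) - testField j k)‖ ≤ ‖y‖ * lipConst k := by
  have h := HasWD.trans_sub (fun l => hasWD_testField l j k) (-(δ • y))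
  rw [norm_smul, norm_sub_rev, norm_inv, Real.norm_eq_abs, abs_of_pos hδ,
    inv_mul_le_iff₀ hδ]
  refine h.trans ?_
  rw [norm_neg, norm_smul, Real.norm_eq_abs, abs_of_pos hδ, ← Finset.mul_sum, mul_assoc]
  gcongr
  exact Finset.single_le_sum (f := fun j => ∑ l, ‖testField j (∂_{e l} k)‖)
    (fun j _ => Finset.sum_nonneg fun l _ => norm_nonneg _) (Finset.mem_univ j)

/-- The function dominating the commutator. -/
def commBound (y : E3) : ℝ := ∑ j, |(∂_{e j} θ.tf) y| * ‖y‖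

theorem integrable_commBound : Integrable θ.commBound := by
  unfold commBound
  refine integrable_finsetSum _ fun j _ => ?_
  exact ((∂_{e j} θ.tf : TF).continuous.abs.mul continuous_norm).integrable_of_hasCompactSupport
    ((∂_{e j} θ.tf : TF).hasCompactSupport.norm.mul_right)

theorem norm_commIntegrand_le (k : TF) (u w : L2Field) {δ : ℝ} (hδ : 0 < δ) (y : E3) :
    ‖θ.commIntegrand k u w δ y‖ ≤ θ.commBound y * (lipConst k * ‖u‖ * ‖w‖) := by
  unfold commIntegrand commBound
  rw [Finset.sum_mul]
  refine (norm_sum_le _ _).trans (Finset.sum_le_sum fun j _ => ?_)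
  rw [norm_smul, Real.norm_eq_abs, mul_assoc]
  refine mul_le_mul_of_nonneg_left ?_ (abs_nonneg _)
  refine (norm_mulL_le _ _).trans ?_
  rw [norm_trans]
  calc _ ≤ (‖y‖ * lipConst k * ‖u‖) * ‖w‖ := by
        gcongr
        exact (norm_ptB_le _ _).trans (by gcongr; exact norm_diffQuot_le k j hδ y)
    _ = _ := by ring

theorem continuous_diffQuot (k : TF) (u : L2Field) (j : Fin 3) (δ : ℝ) :
    Continuous fun y : E3 => mulL (ptB (δ⁻¹ • (trans (-(δ • y)) (testField j k) -
      testField j k)) u) := by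
  have : Continuous fun y : E3 => trans (-(δ • y)) (testField j k) :=
    continuous_trans (by fun_prop) continuous_const
  fun_prop

theorem integrable_commIntegrand_term (k : TF) (u w : L2Field) (j : Fin 3) (δ : ℝ) :
    Integrable fun y => (∂_{e j} θ.tf) y •
      mulL (ptB (δ⁻¹ • (trans (-(δ • y)) (testField j k) - testField j k)) u)
        (trans (δ • y) w) := by
  refine Continuous.integrable_of_hasCompactSupport ?_
    (∂_{e j} θ.tf : TF).hasCompactSupport.smul_right
  have h2 : Continuous fun y : E3 => trans (δ • y) w :=
    continuous_trans (by fun_prop) continuous_const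
  exact (∂_{e j} θ.tf : TF).continuous.smul ((continuous_diffQuot k u j δ).clm_apply h2)

theorem continuous_commIntegrand (k : TF) (u w : L2Field) (δ : ℝ) :
    Continuous (θ.commIntegrand k u w δ) := by
  unfold commIntegrand
  refine continuous_finsetSum _ fun j _ => ?_
  have h2 : Continuous fun y : E3 => trans (δ • y) w :=
    continuous_trans (by fun_prop) continuous_const
  exact (∂_{e j} θ.tf : TF).continuous.smul ((continuous_diffQuot k u j δ).clm_apply h2)

theorem cv_commutator (k : TF) (δ : ℝ) (M : L2Field →L[ℝ] L2Field) (w : L2Field) :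
    cv k δ (M w) - M (cv k δ w) = ∫ y, k y • (trans (δ • y) (M w) - M (trans (δ • y) w)) := by
  have h1 := M.integral_comp_comm (integrable_smul_trans k δ w)
  have h2 := integral_sub (integrable_smul_trans k δ (M w))
    (M.integrable_comp (integrable_smul_trans k δ w))
  rw [cv_apply, cv_apply, ← h1, ← h2]
  simp only [map_smul, smul_sub]

theorem smul_cv_commutator (c : ℝ) (k : TF) (δ : ℝ) (M : L2Field →L[ℝ] L2Field) (w : L2Field) :
    c • cv k δ (M w) - M (c • cv k δ w) =
      ∫ y, k y • (c • (trans (δ • y) (M w) - M (trans (δ • y) w))) := by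
  rw [map_smul, ← smul_sub, cv_commutator, ← integral_smul]
  simp only [smul_comm c]

theorem mulL_ptB_sub (κ κ' u w : L2Field) :
    mulL (ptB (κ - κ') u) w = mulL (ptB κ u) w - mulL (ptB κ' u) w := by
  ext1
  filter_upwards [coeFn_mulL (ptB (κ - κ') u) w, coeFn_mulL (ptB κ u) w, coeFn_mulL (ptB κ' u) w,
    Lp.coeFn_sub (mulL (ptB κ u) w) (mulL (ptB κ' u) w)] with x h1 h2 h3 h4
  rw [h1, h4, Pi.sub_apply, h2, h3, ptB_apply, ptB_apply, ptB_apply, map_sub, inner_sub_left,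
    sub_smul]

theorem smul_mulL_ptB (c : ℝ) (κ u w : L2Field) :
    mulL (ptB (c • κ) u) w = c • mulL (ptB κ u) w := by
  ext1
  filter_upwards [coeFn_mulL (ptB (c • κ) u) w, coeFn_mulL (ptB κ u) w,
    Lp.coeFn_smul c (mulL (ptB κ u) w)] with x h1 h2 h4
  rw [h1, h4, Pi.smul_apply, h2, ptB_apply, ptB_apply, map_smul, real_inner_smul_left, mul_smul]

/-- Exchanging a translation with multiplication by `b` costs a difference of `b` alone; no
regularity of `w` is needed. Divided by `δ` it is a difference quotient of a Lipschitz function. -/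
theorem trans_commutator (κ u w : L2Field) (y : E3) :
    trans y (mulL (ptB κ u) w) - mulL (ptB κ u) (trans y w) =
      mulL (ptB (trans (-y) κ - κ) u) (trans y w) := by
  rw [trans_mulL_ptB, mulL_ptB_sub]

theorem D_commutator (k : TF) (u w : L2Field) (j : Fin 3) (δ : ℝ) :
    θ.D j δ (mulL (ptB (testField j k) u) w) - mulL (ptB (testField j k) u) (θ.D j δ w) =
      ∫ y, (∂_{e j} θ.tf) y •
      mulL (ptB (δ⁻¹ • (trans (-(δ • y)) (testField j k) - testField j k)) u)
        (trans (δ • y) w) := by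
  rw [D_apply, D_apply, smul_cv_commutator]
  refine integral_congr_ae (Eventually.of_forall fun y => ?_)
  exact congrArg _ ((congrArg _ (trans_commutator (testField j k) u w (δ • y))).trans
    (smul_mulL_ptB _ _ _ _).symm)

theorem sum_commutator (k : TF) (u w : L2Field) (δ : ℝ) :
    ∑ j, (θ.D j δ (mulL (ptB (testField j k) u) w) - mulL (ptB (testField j k) u) (θ.D j δ w)) =
      ∫ y, θ.commIntegrand k u w δ y := by
  refine (Finset.sum_congr rfl fun j _ => θ.D_commutator k u w j δ).trans ?_
  exact (integral_finsetSum _ fun j _ => θ.integrable_commIntegrand_term k u w j δ).symm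

/-- The bound is uniform in the scale `δ`; it provides the majorant for dominated convergence in
time in the energy equality. -/
theorem norm_sum_commutator_le (k : TF) (u w : L2Field) {δ : ℝ} (hδ : 0 < δ) :
    ‖∑ j, (θ.D j δ (mulL (ptB (testField j k) u) w) -
      mulL (ptB (testField j k) u) (θ.D j δ w))‖ ≤
      (∫ y, θ.commBound y) * (lipConst k * ‖u‖ * ‖w‖) := by
  rw [θ.sum_commutator k u w δ, ← integral_mul_const]
  exact norm_integral_le_of_norm_le (θ.integrable_commBound.mul_const _)
    (Eventually.of_forall fun y => θ.norm_commIntegrand_le k u w hδ y)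

theorem lineDeriv_eq_sum (k : TF) (y : E3) : ∂_{y} k = ∑ l, y l • ∂_{e l} k := by
  ext x
  have hsum : (∑ l, y l • ∂_{e l} k : TF) x = ∑ l, y l * (∂_{e l} k) x := by simp
  rw [hsum, lineDeriv_apply]
  simp only [lineDeriv_apply]
  conv_lhs => rw [← (EuclideanSpace.basisFun (Fin 3) ℝ).sum_repr y]
  simp

theorem continuous_mulL_ptB (u : L2Field) :
    Continuous fun p : L2Field × L2Field => mulL (ptB p.1 u) p.2 := by
  have h : Continuous fun p : L2Field × L2Field => ptB p.1 u := by fun_prop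
  exact (mulL.continuous.comp h).clm_apply continuous_snd

theorem tendsto_diffQuot_testField (k : TF) (j : Fin 3) (y : E3) :
    Tendsto (fun δ : ℝ => δ⁻¹ • (trans (-(δ • y)) (testField j k) - testField j k)) (𝓝[>] 0)
      (𝓝 (testField j (∂_{y} k))) := by
  have h1 := (hasDerivAt_trans_neg_testField k j y).tendsto_slope_zero_right
  simpa only [zero_add, zero_smul, neg_zero, trans_zero] using h1

theorem tendsto_mulL_ptB {ι : Type*} {l : Filter ι} {f g : ι → L2Field} {κ w : L2Field}
    (u : L2Field) (hf : Tendsto f l (𝓝 κ)) (hg : Tendsto g l (𝓝 w)) :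
    Tendsto (fun i => mulL (ptB (f i) u) (g i)) l (𝓝 (mulL (ptB κ u) w)) := by
  have h1 := hf.prodMk_nhds hg
  have h2 := (continuous_mulL_ptB u).tendsto (κ, w)
  have h3 := h2.comp h1
  exact h3

theorem tendsto_diffQuot (k : TF) (u w : L2Field) (j : Fin 3) (y : E3) :
    Tendsto (fun δ : ℝ => mulL (ptB (δ⁻¹ • (trans (-(δ • y)) (testField j k) - testField j k)) u)
      (trans (δ • y) w)) (𝓝[>] 0) (𝓝 (mulL (ptB (testField j (∂_{y} k)) u) w)) := by
  refine tendsto_mulL_ptB u (tendsto_diffQuot_testField k j y) ?_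
  have := (continuous_trans_smul y w).tendsto 0
  rw [zero_smul, trans_zero] at this
  exact this.mono_left nhdsWithin_le_nhds

theorem tendsto_commIntegrand (k : TF) (u w : L2Field) (y : E3) :
    Tendsto (fun δ => θ.commIntegrand k u w δ y) (𝓝[>] 0)
      (𝓝 (∑ j, (∂_{e j} θ.tf) y • mulL (ptB (testField j (∂_{y} k)) u) w)) :=
  tendsto_finsetSum _ fun j _ => (tendsto_diffQuot k u w j y).const_smul _

theorem lineDeriv_eq_sum_testField (j : Fin 3) (k : TF) (y : E3) :
    testField j (∂_{y} k) = ∑ l, y l • testField j (∂_{e l} k) := by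
  have := map_sum (testFieldL j) (fun l => y l • ∂_{e l} k) Finset.univ
  simp only [map_smul] at this
  rw [lineDeriv_eq_sum]
  exact this

theorem sum_mulL_ptB (a : Fin 3 → ℝ) (κ : Fin 3 → L2Field) (u w : L2Field) :
    mulL (ptB (∑ l, a l • κ l) u) w = ∑ l, a l • mulL (ptB (κ l) u) w := by
  simp only [map_sum, sum_apply, map_smul, smul_apply]

theorem integral_sum_lineDeriv (V : Fin 3 → Fin 3 → L2Field) :
    ∫ y : E3, (∑ j, ∑ l, ((∂_{e j} θ.tf) y * y l) • V j l) = -∑ j, V j j := by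
  have hint : ∀ j l : Fin 3, Integrable fun y : E3 => (∂_{e j} θ.tf) y * y l := fun j l =>
    ((∂_{e j} θ.tf : TF).continuous.mul
      (EuclideanSpace.proj (𝕜 := ℝ) l).continuous).integrable_of_hasCompactSupport
      (∂_{e j} θ.tf : TF).hasCompactSupport.mul_right
  rw [integral_finsetSum _ fun j _ => integrable_finsetSum _ fun l _ =>
    (hint j l).smul_const _, ← Finset.sum_neg_distrib]
  refine Finset.sum_congr rfl fun j _ => ?_
  rw [integral_finsetSum _ fun l _ => (hint j l).smul_const _]
  simp only [integral_smul_const, integral_lineDeriv_mul_coord, θ.integral_tf]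
  simp

/-- By the moments of `∂_j θ`, the integral equals `-∑_j (∂_j b_j) w`, which vanishes because `b` is
divergence-free. -/
theorem integral_commIntegrand_limit (k : TF) {u : L2Field} (hu : u ∈ L2sigma) (w : L2Field) :
    ∫ y, (∑ j, (∂_{e j} θ.tf) y • mulL (ptB (testField j (∂_{y} k)) u) w) = 0 := by
  have h1 : ∀ y, (∑ j, (∂_{e j} θ.tf) y • mulL (ptB (testField j (∂_{y} k)) u) w) =
      ∑ j, ∑ l, ((∂_{e j} θ.tf) y * y l) • mulL (ptB (testField j (∂_{e l} k)) u) w := by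
    intro y
    refine Finset.sum_congr rfl fun j _ => ?_
    rw [lineDeriv_eq_sum_testField, sum_mulL_ptB, Finset.smul_sum]
    simp only [smul_smul]
  rw [integral_congr_ae (Eventually.of_forall h1),
    θ.integral_sum_lineDeriv fun j l => mulL (ptB (testField j (∂_{e l} k)) u) w,
    ← sum_apply, ← map_sum, sum_ptB_eq_zero k hu, map_zero, zero_apply, neg_zero]

/-- Friedrichs' commutator lemma: the difference quotients of `b` converge to directional
derivatives, the moments of the kernel assemble them to a divergence, and the Lipschitz bound
dominates the integrand. -/
theorem tendsto_sum_commutator (k : TF) {u : L2Field} (hu : u ∈ L2sigma) (w : L2Field) :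
    Tendsto (fun δ => ∑ j, (θ.D j δ (mulL (ptB (testField j k) u) w) -
      mulL (ptB (testField j k) u) (θ.D j δ w))) (𝓝[>] 0) (𝓝 0) := by
  have h := tendsto_integral_filter_of_dominated_convergence (l := 𝓝[>] (0 : ℝ))
    (fun y => θ.commBound y * (lipConst k * ‖u‖ * ‖w‖))
    (Eventually.of_forall fun δ => (θ.continuous_commIntegrand k u w δ).aestronglyMeasurable)
    (eventually_mem_nhdsWithin.mono fun δ hδ =>
      Eventually.of_forall fun y => θ.norm_commIntegrand_le k u w hδ y)
    (θ.integrable_commBound.mul_const _)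
    (Eventually.of_forall fun y => θ.tendsto_commIntegrand k u w y)
  rw [θ.integral_commIntegrand_limit k hu w] at h
  exact h.congr fun δ => (θ.sum_commutator k u w δ).symm

/-- The remaining part `∑ ⟨S w, b_j D_j w⟩` vanishes by skew-symmetry, so only the commutator does
work. -/
theorem sum_inner_transport (k : TF) {u : L2Field} (hu : u ∈ L2sigma) (w : L2Field) {δ : ℝ}
    (hδ : 0 < δ) : ∑ j, inner ℝ (θ.S δ w) (θ.D j δ (mulL (ptB (testField j k) u) w)) =
      inner ℝ (θ.S δ w) (∑ j, (θ.D j δ (mulL (ptB (testField j k) u) w) -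
      mulL (ptB (testField j k) u) (θ.D j δ w))) := by
  simp only [inner_sum, inner_sub_right]
  rw [Finset.sum_sub_distrib, θ.sum_inner_skew k hu hδ.ne', sub_zero]

theorem tendsto_sum_inner_transport (k : TF) {u : L2Field} (hu : u ∈ L2sigma) (w : L2Field) :
    Tendsto (fun δ => ∑ j, inner ℝ (θ.S δ w) (θ.D j δ (mulL (ptB (testField j k) u) w)))
      (𝓝[>] 0) (𝓝 0) := by
  have h1 := ((θ.tendsto_S w).mono_left (nhdsWithin_le_nhds (s := Ioi 0))).inner
    (θ.tendsto_sum_commutator k hu w) (𝕜 := ℝ)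
  rw [inner_zero_right] at h1
  refine h1.congr' ?_
  filter_upwards [self_mem_nhdsWithin] with δ hδ
  exact (θ.sum_inner_transport k hu w hδ).symm

theorem abs_sum_inner_transport_le (k : TF) {u : L2Field} (hu : u ∈ L2sigma) (w : L2Field) {δ : ℝ}
    (hδ : 0 < δ) :
    |∑ j, inner ℝ (θ.S δ w) (θ.D j δ (mulL (ptB (testField j k) u) w))| ≤
      ‖w‖ * ((∫ y, θ.commBound y) * (lipConst k * ‖u‖ * ‖w‖)) := by
  rw [θ.sum_inner_transport k hu w hδ]
  refine (abs_real_inner_le_norm _ _).trans ?_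
  exact mul_le_mul (θ.norm_S_le δ w) (θ.norm_sum_commutator_le k u w hδ) (norm_nonneg _)
    (norm_nonneg _)

/-! ### The mollified velocity -/

/-- The kernel at scale `ε`. -/
def ktf (ε : ℝ) (hε : ε ≠ 0) : TF := scaleTF θ.tf ε hε

/-- The `j`-th component of the mollified velocity. -/
def mol (ε : ℝ) (hε : ε ≠ 0) (j : Fin 3) : L2Field →L[ℝ] BCF := ptB (testField j (θ.ktf ε hε))

/-- The evenness of `θ` turns convolution into pairing with a translate of the kernel. -/
theorem mollify_apply (ε : ℝ) (hε : ε ≠ 0) (v : L2Field) (x : E3) (j : Fin 3) :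
    mollify θ ε v x j = θ.mol ε hε j v x := by
  have h1 : mollify θ ε v x = ∫ t, transTF x (θ.ktf ε hε) t • v t := by
    unfold mollify convolution
    rw [← integral_sub_left_eq_self _ volume x]
    simp only [sub_sub_cancel, ContinuousLinearMap.lsmul_apply]
    refine integral_congr_ae (Eventually.of_forall fun t => ?_)
    beta_reduce
    congr 1
    change θ.scaled ε (x - t) = _
    rw [transTF_apply, ktf, scaleTF_apply, scaled, ← tf_apply, ← neg_sub, smul_neg, tf_neg]
  rw [h1, integral_smul_apply, mol, ptB_apply, trans_testField]

theorem toL2_mollify (ε : ℝ) (hε : ε ≠ 0) (v w : L2Field) (j : Fin 3) :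
    toL2 (fun y => mollify θ ε v y j • w y) = mulL (θ.mol ε hε j v) w := by
  simp only [θ.mollify_apply ε hε]
  rw [toL2, dif_pos (memLp_mul _ _)]
  unfold mulL
  rfl

/-- The pointwise convolution and the `L²`-valued average of translates agree almost everywhere:
tested against `φ`, they are related by the symmetry of convolution in kernel and test function. -/
theorem coeFn_mol (ε : ℝ) (hε : 0 < ε) (v : L2Field) (j : Fin 3) :
    ∀ᵐ x, θ.mol ε hε.ne' j v x = θ.S ε v x j := by
  have hS : LocallyIntegrable (fun x => θ.S ε v x j) (volume : Measure E3) := by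
    have : MemLp (fun x => θ.S ε v x j) 2 (volume : Measure E3) :=
      (Lp.memLp (θ.S ε v)).continuousLinearMap_comp (EuclideanSpace.proj (𝕜 := ℝ) j)
    exact this.locallyIntegrable (by norm_num)
  have hm : LocallyIntegrable (θ.mol ε hε.ne' j v : E3 → ℝ) :=
    (θ.mol ε hε.ne' j v).continuous.locallyIntegrable
  have := ae_eq_zero_of_integral_contDiff_smul_eq_zero (hm.sub hS) ?_
  · filter_upwards [this] with x hx
    exact sub_eq_zero.1 hx
  intro g hg hgc
  set φ : TF := ⟨g, hg, hgc, by simp⟩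
  have h1 : ∫ x, g x • θ.mol ε hε.ne' j v x = inner ℝ (testField j φ) (θ.S ε v) := by
    rw [← θ.inner_S, S, cv_testField_swap _ _ hε, inner_cv_left]
    simp only [one_smul]
    refine integral_congr_ae (Eventually.of_forall fun x => ?_)
    beta_reduce
    rw [mol, ptB_apply]
    rfl
  have h2 : ∫ x, g x • θ.S ε v x j = inner ℝ (testField j φ) (θ.S ε v) := by
    rw [inner_testField]
    rfl
  simp only [Pi.sub_apply, smul_sub]
  rw [integral_sub, h1, h2, sub_self]
  · exact hm.integrable_smul_left_of_hasCompactSupport hg.continuous hgc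
  · exact hS.integrable_smul_left_of_hasCompactSupport hg.continuous hgc

end MollifierKernel

/-! ### Matrix fields -/

/-- The matrix with entry `1` at `(a,b)`. -/
def pm (a b : Fin 3) : E3 →L[ℝ] E3 := (EuclideanSpace.proj (𝕜 := ℝ) b).smulRight (e a)

/-- The field `v_b e_a`. -/
def P (a b : Fin 3) : L2Field →L[ℝ] L2Field := (pm a b).compLpL 2 volume

theorem coeFn_P (a b : Fin 3) (v : L2Field) : P a b v =ᵐ[volume] fun x => v x b • e a :=
  (pm a b).coeFn_compLpL v

theorem inner_P (a b : Fin 3) (v w : L2Field) : inner ℝ (P a b v) w = inner ℝ v (P b a w) := by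
  rw [L2.inner_def, L2.inner_def]
  refine integral_congr_ae ?_
  filter_upwards [coeFn_P a b v, coeFn_P b a w] with x h1 h2
  rw [h1, h2, real_inner_smul_left, real_inner_smul_right, EuclideanSpace.inner_single_left,
    EuclideanSpace.inner_single_right]
  simp [mul_comm]

theorem trans_P (a b : Fin 3) (y : E3) (v : L2Field) : P a b (trans y v) = trans y (P a b v) := by
  ext1
  filter_upwards [coeFn_P a b (trans y v), coeFn_trans y (P a b v), coeFn_trans y v,
    (measurePreserving_sub_right volume y).quasiMeasurePreserving.ae (coeFn_P a b v)]
    with x h1 h2 h3 h4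
  rw [h1, h2, h3, h4]

theorem P_P (a b c d : Fin 3) (v : L2Field) :
    P a b (P c d v) = if b = c then P a d v else 0 := by
  ext1
  split_ifs with hbc
  · filter_upwards [coeFn_P a b (P c d v), coeFn_P c d v, coeFn_P a d v] with x h1 h2 h3
    rw [h1, h2, h3]
    simp [hbc]
  · filter_upwards [coeFn_P a b (P c d v), coeFn_P c d v, Lp.coeFn_zero E3 2 (volume : Measure E3)]
      with x h1 h2 h3
    rw [h1, h2, h3]
    simp [hbc]

theorem P_testField (a b i : Fin 3) (φ : TF) :
    P a b (testField i φ) = if b = i then testField a φ else 0 := by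
  ext1
  split_ifs with hbc
  · filter_upwards [coeFn_P a b (testField i φ), coeFn_testField i φ, coeFn_testField a φ]
      with x h1 h2 h3
    rw [h1, h2, h3]
    simp [hbc]
  · filter_upwards [coeFn_P a b (testField i φ), coeFn_testField i φ,
      Lp.coeFn_zero E3 2 (volume : Measure E3)] with x h1 h2 h3
    rw [h1, h2, h3]
    simp [hbc]

theorem sum_P (v : L2Field) : ∑ a, P a a v = v := by
  refine testField_induction (p := fun v => ∑ a, P a a v = v) ?_ ?_ ?_ ?_ v
  · exact isClosed_eq (by fun_prop) continuous_id
  · intro v w hv hw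
    simp only [map_add, Finset.sum_add_distrib, hv, hw]
  · intro c v hv
    simp only [map_smul, ← Finset.smul_sum, hv]
  · intro i φ
    simp [P_testField]

attribute [irreducible] P

/-- The field `e_j × v`, with indices modulo `3`. -/
def cross (j : Fin 3) : L2Field →L[ℝ] L2Field := P (j + 2) (j + 1) - P (j + 1) (j + 2)

theorem cross_apply (j : Fin 3) (v : L2Field) :
    cross j v = P (j + 2) (j + 1) v - P (j + 1) (j + 2) v := rfl

theorem inner_cross (j : Fin 3) (v w : L2Field) :
    inner ℝ (cross j v) w = -inner ℝ v (cross j w) := by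
  rw [cross_apply, cross_apply, inner_sub_left, inner_sub_right, inner_P, inner_P]
  ring

theorem trans_cross (j : Fin 3) (y : E3) (v : L2Field) :
    cross j (trans y v) = trans y (cross j v) := by
  rw [cross_apply, cross_apply, trans_P, trans_P, map_sub]

/-- The index form of `e_i × (e_j × v) = v_i e_j - δ_ij v`, checked over the nine pairs of indices.
-/
theorem cross_product_identity {V : Type*} [AddCommGroup V] (p : Fin 3 → Fin 3 → V) (i j : Fin 3) :
    (if i + 1 = j + 2 then p (i + 2) (j + 1) else 0) -
      (if i + 1 = j + 1 then p (i + 2) (j + 2) else 0) -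
      ((if i + 2 = j + 2 then p (i + 1) (j + 1) else 0) -
        (if i + 2 = j + 1 then p (i + 1) (j + 2) else 0)) =
      p j i - if i = j then ∑ a, p a a else 0 := by
  fin_cases i <;> fin_cases j <;> simp [Fin.sum_univ_three] <;> abel

theorem cross_cross (i j : Fin 3) (v : L2Field) :
    cross i (cross j v) = P j i v - if i = j then v else 0 := by
  rw [cross_apply, cross_apply, map_sub, map_sub, P_P, P_P, P_P, P_P,
    cross_product_identity fun a b => P a b v, sum_P]

attribute [irreducible] cross

namespace MollifierKernel

variable (θ : MollifierKernel)

/-- The curl at scale `δ`. -/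
def curlS (δ : ℝ) : L2Field →L[ℝ] L2Field := ∑ j, (cross j).comp (θ.D j δ)

/-- The divergence at scale `δ`, as the first component of a field. -/
def divS (δ : ℝ) : L2Field →L[ℝ] L2Field := ∑ j, (P 0 j).comp (θ.D j δ)

/-- The gradient of the divergence at scale `δ`. -/
def gradDivS (δ : ℝ) : L2Field →L[ℝ] L2Field :=
  ∑ i, ∑ j, (P i j).comp ((θ.D i δ).comp (θ.D j δ))

/-- The Laplacian at scale `δ`. -/
def lapS (δ : ℝ) : L2Field →L[ℝ] L2Field := ∑ j, (θ.D j δ).comp (θ.D j δ)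

theorem curlS_apply (δ : ℝ) (v : L2Field) : θ.curlS δ v = ∑ j, cross j (θ.D j δ v) := by
  simp [curlS, sum_apply]

theorem divS_apply (δ : ℝ) (v : L2Field) : θ.divS δ v = ∑ j, P 0 j (θ.D j δ v) := by
  simp [divS, sum_apply]

theorem gradDivS_apply (δ : ℝ) (v : L2Field) :
    θ.gradDivS δ v = ∑ i, ∑ j, P i j (θ.D i δ (θ.D j δ v)) := by
  simp [gradDivS, sum_apply]

theorem lapS_apply (δ : ℝ) (v : L2Field) : θ.lapS δ v = ∑ j, θ.D j δ (θ.D j δ v) := by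
  simp [lapS, sum_apply]

attribute [irreducible] curlS divS gradDivS lapS

theorem inner_curlS (δ : ℝ) (v w : L2Field) :
    inner ℝ (θ.curlS δ v) w = inner ℝ v (θ.curlS δ w) := by
  rw [curlS_apply, curlS_apply, sum_inner, inner_sum]
  refine Finset.sum_congr rfl fun j _ => ?_
  rw [inner_cross, inner_D, neg_neg, θ.clm_D j δ (trans_cross j)]

theorem inner_lapS (δ : ℝ) (v w : L2Field) :
    inner ℝ (θ.lapS δ v) w = -∑ j, inner ℝ (θ.D j δ v) (θ.D j δ w) := by
  rw [lapS_apply, sum_inner, ← Finset.sum_neg_distrib]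
  exact Finset.sum_congr rfl fun j _ => θ.inner_D j δ _ _

theorem inner_gradDivS (δ : ℝ) (v w : L2Field) :
    inner ℝ (θ.gradDivS δ v) w = -inner ℝ (θ.divS δ v) (θ.divS δ w) := by
  rw [gradDivS_apply, divS_apply, divS_apply, inner_sum, sum_inner, ← Finset.sum_neg_distrib]
  refine Finset.sum_congr rfl fun i _ => ?_
  rw [sum_inner, sum_inner, ← Finset.sum_neg_distrib]
  refine Finset.sum_congr rfl fun j _ => ?_
  rw [θ.clm_D i δ (trans_P i j), inner_D, inner_P i j, inner_P 0 j, P_P, if_pos rfl]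

theorem curlS_curlS (δ : ℝ) (v : L2Field) :
    θ.curlS δ (θ.curlS δ v) = θ.gradDivS δ v - θ.lapS δ v := by
  have h : ∀ i, cross i (θ.D i δ (θ.curlS δ v)) =
      (∑ j, P j i (θ.D i δ (θ.D j δ v))) - θ.D i δ (θ.D i δ v) := by
    intro i
    rw [curlS_apply, map_sum, map_sum]
    simp only [← θ.clm_D i δ (trans_cross _), cross_cross, Finset.sum_sub_distrib]
    simp
  rw [curlS_apply]
  simp only [h, Finset.sum_sub_distrib]
  rw [gradDivS_apply, lapS_apply, Finset.sum_comm]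
  simp only [θ.D_comm]

/-- Pairing `curl curl = ∇ div - Δ` with `v`; the identity is exact at every scale because the
mollified derivatives commute and are skew-adjoint. For divergence-free fields it trades `‖∇u‖²` for
`‖curl u‖²`, which completes the square in the energy law. -/
theorem sum_norm_D_sq (δ : ℝ) (v : L2Field) :
    ∑ j, ‖θ.D j δ v‖ ^ 2 = ‖θ.curlS δ v‖ ^ 2 + ‖θ.divS δ v‖ ^ 2 := by
  have h1 := θ.inner_lapS δ v v
  have h2 := θ.inner_gradDivS δ v v
  have h3 := congrArg (fun f => inner ℝ f v) (θ.curlS_curlS δ v)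
  simp only [inner_sub_left, inner_curlS] at h3
  rw [← θ.inner_curlS] at h3
  simp only [real_inner_self_eq_norm_sq] at h1 h2 h3
  linarith

theorem divS_of_mem (δ : ℝ) {v : L2Field} (hv : v ∈ L2sigma) : θ.divS δ v = 0 := by
  -- At scale zero the convention `0⁻¹ = 0` makes every `D j δ` vanish.
  by_cases hδ : δ = 0
  · subst hδ
    rw [divS_apply]
    simp [D_apply]
  refine eq_zero_of_inner_testField fun i φ => ?_
  have h := hv φ
  have hS := (show θ.S δ v ∈ L2sigma by unfold S; exact cv_mem_L2sigma _ _ hv) φ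
  rw [divPairing_eq, neg_eq_zero] at hS
  rw [divS_apply, inner_sum]
  have : ∀ j, inner ℝ (testField i φ) (P 0 j (θ.D j δ v)) =
      -if (0 : Fin 3) = i then inner ℝ (testField j (∂_{e j} φ)) (θ.S δ v) else 0 := by
    intro j
    rw [real_inner_comm, inner_P, real_inner_comm, P_testField]
    split_ifs
    · rw [real_inner_comm, inner_D, θ.D_testField j hδ, ← inner_S, real_inner_comm]
    · simp
  simp only [this, Finset.sum_neg_distrib]
  split_ifs
  · rw [hS, neg_zero]
  · simp

end MollifierKernel

/-! ### Weak convergence -/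

/-- Weak convergence in `L²`. -/
def WT {ι : Type*} (l : Filter ι) (f : ι → L2Field) (a : L2Field) : Prop :=
  ∀ v, Tendsto (fun i => inner ℝ v (f i)) l (𝓝 (inner ℝ v a))

section WT

variable {ι : Type*} {l : Filter ι} {f g : ι → L2Field} {a b : L2Field}

theorem WT.of_tendsto (h : Tendsto f l (𝓝 a)) : WT l f a := fun _ =>
  ((continuous_const.inner continuous_id).tendsto a).comp h

theorem WT.const (a : L2Field) : WT l (fun _ => a) a := fun _ => tendsto_const_nhds

theorem WT.comp {κ : Type*} {l' : Filter κ} {φ : κ → ι} (h : WT l f a) (hφ : Tendsto φ l' l) :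
    WT l' (f ∘ φ) a := fun v => (h v).comp hφ

theorem WT.sub (hf : WT l f a) (hg : WT l g b) : WT l (fun i => f i - g i) (a - b) := fun v => by
  simpa only [inner_sub_right] using (hf v).sub (hg v)

theorem WT.map (hf : WT l f a) (A : L2Field →L[ℝ] L2Field) : WT l (fun i => A (f i)) (A a) := by
  intro v
  have h := hf (ContinuousLinearMap.adjoint A v)
  simpa only [ContinuousLinearMap.adjoint_inner_left] using h

theorem WT.congr' (hf : WT l f a) (h : ∀ᶠ i in l, f i = g i) : WT l g a := fun v =>
  (hf v).congr' (h.mono fun i hi => by rw [hi])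

theorem WT.unique [l.NeBot] (h : WT l f a) (h' : WT l f b) : a = b :=
  ext_inner_left ℝ fun v => tendsto_nhds_unique (h v) (h' v)

/-- Weak times strong convergence. Boundedness is a hypothesis because weak convergence along a
general filter does not imply it. -/
theorem WT.inner_tendsto (hf : WT l f a) {M : ℝ} (hM : ∀ᶠ i in l, ‖f i‖ ≤ M) (hg : Tendsto g l (𝓝 b)) :
    Tendsto (fun i => inner ℝ (g i) (f i)) l (𝓝 (inner ℝ b a)) := by
  have h1 : Tendsto (fun i => inner ℝ (g i - b) (f i)) l (𝓝 0) := by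
    have h2 : Tendsto (fun i => ‖g i - b‖ * M) l (𝓝 0) := by
      have := (tendsto_iff_norm_sub_tendsto_zero.1 hg).mul_const M
      rwa [zero_mul] at this
    refine squeeze_zero_norm' ?_ h2
    filter_upwards [hM] with i hi
    exact (norm_inner_le_norm _ _).trans (by gcongr)
  have := h1.add (hf b)
  simpa only [← inner_add_left, sub_add_cancel, zero_add] using this

theorem WT.norm_le_of_tendsto [l.NeBot] (hf : WT l f a) {c : ι → ℝ} {c₀ : ℝ}
    (h : ∀ᶠ i in l, ‖f i‖ ≤ c i) (hc : Tendsto c l (𝓝 c₀)) : ‖a‖ ≤ c₀ := by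
  have hc0 : 0 ≤ c₀ := ge_of_tendsto hc (h.mono fun i hi => (norm_nonneg _).trans hi)
  rcases eq_or_ne a 0 with rfl | ha
  · simpa using hc0
  have h1 : ‖a‖ * ‖a‖ ≤ ‖a‖ * c₀ := by
    rw [← real_inner_self_eq_norm_mul_norm]
    refine le_of_tendsto_of_tendsto (hf a) (hc.const_mul ‖a‖) (h.mono fun i hi => ?_)
    exact (real_inner_le_norm _ _).trans (mul_le_mul_of_nonneg_left hi (norm_nonneg _))
  exact le_of_mul_le_mul_left h1 (norm_pos_iff.2 ha)

theorem WT.norm_le [l.NeBot] (hf : WT l f a) {c : ℝ} (h : ∀ᶠ i in l, ‖f i‖ ≤ c) : ‖a‖ ≤ c :=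
  hf.norm_le_of_tendsto h tendsto_const_nhds

theorem WT.eventually_lt_norm (hf : WT l f a) {c : ℝ} (hc : c < ‖a‖) : ∀ᶠ i in l, c < ‖f i‖ := by
  rcases lt_or_ge c 0 with h0 | h0
  · exact Eventually.of_forall fun i => h0.trans_le (norm_nonneg _)
  have ha : 0 < ‖a‖ := h0.trans_lt hc
  have h1 : ‖a‖ * c < inner ℝ a a := by
    rw [real_inner_self_eq_norm_mul_norm]
    gcongr
  filter_upwards [(hf a).eventually (lt_mem_nhds h1)] with i hi
  exact lt_of_mul_lt_mul_left (hi.trans_le (real_inner_le_norm _ _)) ha.le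

theorem WT.enorm_sq_le_liminf (hf : WT l f a) : ‖a‖ₑ ^ 2 ≤ liminf (fun i => ‖f i‖ₑ ^ 2) l := by
  refine le_of_forall_lt fun c hc => ?_
  obtain ⟨d, hcd, hd⟩ := exists_between hc
  refine hcd.trans_le (le_liminf_of_le (h := ?_))
  lift d to NNReal using hd.ne_top
  have hd1 : d < ‖a‖₊ ^ 2 := by
    change (d : ℝ≥0∞) < (‖a‖₊ : ℝ≥0∞) ^ 2 at hd
    exact_mod_cast hd
  have hd2 : (d : ℝ) < ‖a‖ ^ 2 := by exact_mod_cast hd1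
  have h1 : √(d : ℝ) < ‖a‖ := Real.sqrt_lt_sqrt d.coe_nonneg hd2 |>.trans_eq
    (Real.sqrt_sq (norm_nonneg _))
  filter_upwards [hf.eventually_lt_norm h1] with i hi
  have h2 : (d : ℝ) < ‖f i‖ ^ 2 := Real.lt_sq_of_sqrt_lt hi
  have h3 : d < ‖f i‖₊ ^ 2 := by exact_mod_cast h2
  change (d : ℝ≥0∞) ≤ (‖f i‖₊ : ℝ≥0∞) ^ 2
  exact_mod_cast h3.le

/-- For bounded families the test functions of weak convergence may be taken in a dense set. -/
theorem WT.of_dense {s : Set L2Field} (hs : Dense s) {M : ℝ} (hM : ∀ᶠ i in l, ‖f i‖ ≤ M)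
    (h : ∀ v ∈ s, Tendsto (fun i => inner ℝ v (f i)) l (𝓝 (inner ℝ v a))) : WT l f a := by
  intro v
  rcases l.eq_or_neBot with rfl | hl
  · exact tendsto_bot
  have hM0 : 0 ≤ M := by
    obtain ⟨i, hi⟩ := hM.exists
    exact (norm_nonneg _).trans hi
  rw [Metric.tendsto_nhds]
  intro r hr
  set C := M + ‖a‖ + 1
  have hC : 0 < C := by positivity
  obtain ⟨w, hw, hvw⟩ := Metric.mem_closure_iff.1 (hs v) (r / (2 * C)) (by positivity)
  filter_upwards [hM, (Metric.tendsto_nhds.1 (h w hw)) (r / 2) (by positivity)] with i hi h1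
  rw [Real.dist_eq] at h1 ⊢
  have h2 : inner ℝ v (f i) - inner ℝ v a = inner ℝ (v - w) (f i) - inner ℝ (v - w) a +
      (inner ℝ w (f i) - inner ℝ w a) := by
    simp only [inner_sub_left]; ring
  have h3 : |inner ℝ (v - w) (f i) - inner ℝ (v - w) a| ≤ r / (2 * C) * (M + ‖a‖) := by
    rw [← inner_sub_right]
    refine (abs_real_inner_le_norm _ _).trans ?_
    rw [dist_eq_norm] at hvw
    have := (norm_sub_le (f i) a).trans (add_le_add_left hi ‖a‖)
    gcongr
  have h4 : r / (2 * C) * (M + ‖a‖) ≤ r / 2 := by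
    have : M + ‖a‖ ≤ C := by simp [C]
    calc r / (2 * C) * (M + ‖a‖) ≤ r / (2 * C) * C := by gcongr
      _ = r / 2 := by field_simp
  rw [h2]
  have := abs_add_le (inner ℝ (v - w) (f i) - inner ℝ (v - w) a) (inner ℝ w (f i) - inner ℝ w a)
  linarith

theorem WT.of_testField {M : ℝ} (hM : ∀ᶠ i in l, ‖f i‖ ≤ M)
    (h : ∀ i φ, Tendsto (fun n => inner ℝ (testField i φ) (f n)) l
      (𝓝 (inner ℝ (testField i φ) a))) : WT l f a := by
  refine WT.of_dense dense_testSpan hM fun v hv => ?_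
  refine Submodule.span_induction (p := fun v _ => Tendsto (fun i => inner ℝ v (f i)) l
    (𝓝 (inner ℝ v a))) ?_ ?_ ?_ ?_ hv
  · rintro _ ⟨p, rfl⟩
    exact h p.1 p.2
  · simpa only [inner_zero_left] using tendsto_const_nhds
  · intro v w _ _ hv hw
    simpa only [inner_add_left] using hv.add hw
  · intro c v _ hv
    simpa only [real_inner_smul_left] using hv.const_mul c

end WT

theorem cauchySeq_inner_of_dense {f : ℕ → L2Field} {M : ℝ} (hM : ∀ n, ‖f n‖ ≤ M)
    {s : Set L2Field} (hs : Dense s) (h : ∀ v ∈ s, CauchySeq fun n => inner ℝ v (f n))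
    (v : L2Field) : CauchySeq fun n => inner ℝ v (f n) := by
  have hM0 : 0 ≤ M := (norm_nonneg _).trans (hM 0)
  rw [Metric.cauchySeq_iff]
  intro r hr
  obtain ⟨w, hw, hvw⟩ := Metric.mem_closure_iff.1 (hs v) (r / (4 * (M + 1))) (by positivity)
  obtain ⟨N, hN⟩ := Metric.cauchySeq_iff.1 (h w hw) (r / 2) (by positivity)
  refine ⟨N, fun m hm n hn => ?_⟩
  have h1 := hN m hm n hn
  rw [Real.dist_eq] at h1 ⊢
  have h2 : inner ℝ v (f m) - inner ℝ v (f n) = inner ℝ (v - w) (f m - f n) +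
      (inner ℝ w (f m) - inner ℝ w (f n)) := by
    simp only [inner_sub_left, inner_sub_right]; ring
  have h3 : |inner ℝ (v - w) (f m - f n)| ≤ r / (4 * (M + 1)) * (M + M) := by
    refine (abs_real_inner_le_norm _ _).trans ?_
    rw [dist_eq_norm] at hvw
    have := (norm_sub_le (f m) (f n)).trans (add_le_add (hM m) (hM n))
    gcongr
  have h4 : r / (4 * (M + 1)) * (M + M) ≤ r / 2 := by
    rw [div_mul_eq_mul_div, div_le_div_iff₀ (by positivity) (by positivity)]
    nlinarith
  rw [h2]
  have := abs_add_le (inner ℝ (v - w) (f m - f n)) (inner ℝ w (f m) - inner ℝ w (f n))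
  linarith

/-- A bounded sequence whose pairings with a dense set of fields converge has a weak limit. -/
theorem exists_WT_of_dense {f : ℕ → L2Field} {M : ℝ} (hM : ∀ n, ‖f n‖ ≤ M)
    {s : Set L2Field} (hs : Dense s) (h : ∀ v ∈ s, CauchySeq fun n => inner ℝ v (f n)) :
    ∃ a, WT atTop f a := by
  have hc := fun v => cauchySeq_tendsto_of_complete (cauchySeq_inner_of_dense hM hs h v)
  choose L hL using hc
  let Λ : L2Field →L[ℝ] ℝ := LinearMap.mkContinuous
    { toFun := L
      map_add' := fun v w => tendsto_nhds_unique (hL (v + w)) (by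
        simpa only [inner_add_left] using (hL v).add (hL w))
      map_smul' := fun c v => tendsto_nhds_unique (hL (c • v)) (by
        simpa only [real_inner_smul_left, RingHom.id_apply, smul_eq_mul] using
          (hL v).const_mul c) }
    M (fun v => le_of_tendsto (hL v).norm (Eventually.of_forall fun n =>
      (norm_inner_le_norm _ _).trans (by
        rw [mul_comm]
        exact mul_le_mul_of_nonneg_right (hM n) (norm_nonneg _))))
  refine ⟨(InnerProductSpace.toDual ℝ L2Field).symm Λ, fun v => ?_⟩
  rw [real_inner_comm, InnerProductSpace.toDual_symm_apply]
  exact hL v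

/-! ### Multiplication by regularised weakly convergent fields -/

/-- Dominated convergence with a multiple of `‖v‖²` as majorant. Countable generation of the filter
is what that theorem asks for. -/
theorem tendsto_mulL_of_pointwise {ι : Type*} {l : Filter ι} [l.IsCountablyGenerated]
    {b : ι → BCF} {b₀ : BCF} {C : ℝ} (hC : ∀ᶠ i in l, ‖b i‖ ≤ C)
    (h : ∀ x, Tendsto (fun i => b i x) l (𝓝 (b₀ x))) (v : L2Field) :
    Tendsto (fun i => mulL (b i) v) l (𝓝 (mulL b₀ v)) := by
  rw [tendsto_iff_norm_sub_tendsto_zero]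
  have hsq : ∀ i, ‖mulL (b i) v - mulL b₀ v‖ ^ 2 = ∫ x, (b i x - b₀ x) ^ 2 * ‖v x‖ ^ 2 := by
    intro i
    rw [← real_inner_self_eq_norm_sq, L2.inner_def]
    refine integral_congr_ae ?_
    filter_upwards [Lp.coeFn_sub (mulL (b i) v) (mulL b₀ v), coeFn_mulL (b i) v, coeFn_mulL b₀ v]
      with x h1 h2 h3
    rw [h1, Pi.sub_apply, h2, h3, ← sub_smul, real_inner_self_eq_norm_sq, norm_smul, mul_pow,
      Real.norm_eq_abs, sq_abs]
  have hv : Integrable fun x => ‖v x‖ ^ 2 := (Lp.memLp v).integrable_norm_pow (by norm_num)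
  have hlim : Tendsto (fun i => ∫ x, (b i x - b₀ x) ^ 2 * ‖v x‖ ^ 2) l (𝓝 (∫ _x : E3, (0 : ℝ))) := by
    refine tendsto_integral_filter_of_dominated_convergence
      (fun x => (C + ‖b₀‖) ^ 2 * ‖v x‖ ^ 2) ?_ ?_ (hv.const_mul _) ?_
    · refine Eventually.of_forall fun i => ?_
      exact (((b i).continuous.sub b₀.continuous).pow 2).aestronglyMeasurable.mul
        hv.aestronglyMeasurable
    · filter_upwards [hC] with i hi
      refine Eventually.of_forall fun x => ?_
      rw [Real.norm_eq_abs, abs_of_nonneg (by positivity)]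
      have h1 : |b i x - b₀ x| ≤ C + ‖b₀‖ := by
        refine (abs_sub _ _).trans (add_le_add (((b i).norm_coe_le_norm x).trans hi) ?_)
        exact b₀.norm_coe_le_norm x
      have := pow_le_pow_left₀ (abs_nonneg _) h1 2
      rw [sq_abs] at this
      gcongr
    · refine Eventually.of_forall fun x => ?_
      have := (((h x).sub_const (b₀ x)).pow 2).mul_const (‖v x‖ ^ 2)
      simpa using this
  rw [integral_zero] at hlim
  have := (Real.continuous_sqrt.tendsto 0).comp hlim
  rw [Real.sqrt_zero] at this
  refine this.congr fun i => ?_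
  rw [Function.comp_apply, ← hsq, Real.sqrt_sq (norm_nonneg _)]

theorem WT.tendsto_mulL_ptB {ι : Type*} {l : Filter ι} [l.IsCountablyGenerated] {f : ι → L2Field}
    {a : L2Field} (hf : WT l f a) {M : ℝ} (hM : ∀ᶠ i in l, ‖f i‖ ≤ M) (κ v : L2Field) :
    Tendsto (fun i => mulL (ptB κ (f i)) v) l (𝓝 (mulL (ptB κ a) v)) := by
  refine tendsto_mulL_of_pointwise (C := ‖κ‖ * M) ?_ (fun x => ?_) v
  · filter_upwards [hM] with i hi
    exact (norm_ptB_le _ _).trans (mul_le_mul_of_nonneg_left hi (norm_nonneg _))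
  · simpa only [ptB_apply] using hf (trans x κ)

/-- With a fixed kernel, weak convergence of the velocity gives bounded pointwise convergence of its
regularisation. Multiplication then converges strongly on each fixed field and, being symmetric, may
be moved onto the test field, so the product of two weakly convergent sequences converges weakly. -/
theorem WT.mulL_ptB {ι : Type*} {l : Filter ι} [l.IsCountablyGenerated] {f g : ι → L2Field}
    {a b : L2Field} (hf : WT l f a) {M : ℝ} (hM : ∀ᶠ i in l, ‖f i‖ ≤ M) (hg : WT l g b)
    {M' : ℝ} (hM' : ∀ᶠ i in l, ‖g i‖ ≤ M') (κ : L2Field) :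
    WT l (fun i => mulL (ptB κ (f i)) (g i)) (mulL (ptB κ a) b) := by
  intro v
  simp only [← inner_mulL]
  exact hg.inner_tendsto hM' (hf.tendsto_mulL_ptB hM κ v)

/-! ### Approximate weak derivatives -/

namespace MollifierKernel

variable (θ : MollifierKernel)

/-- `X δ` is the mollification at scale `δ` of a first order differential operator with formal
adjoint `T`. -/
structure FirstOrder (X : ℝ → L2Field →L[ℝ] L2Field) (T : Fin 3 → TF → L2Field) : Prop where
  adj : ∀ {δ : ℝ}, δ ≠ 0 → ∀ i φ v, inner ℝ (testField i φ) (X δ v) = inner ℝ (θ.S δ (T i φ)) v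
  equivariant : ∀ i φ y, T i (transTF y φ) = trans y (T i φ)

/-- `g` is the image of `v` under the differential operator with formal adjoint `T`. -/
def IsWeak (T : Fin 3 → TF → L2Field) (v g : L2Field) : Prop :=
  ∀ i φ, inner ℝ (testField i φ) g = inner ℝ (T i φ) v

theorem inner_cv_eq {a b v g : L2Field} (h : ∀ y, inner ℝ (trans y a) g = inner ℝ (trans y b) v)
    (k : TF) (δ : ℝ) : inner ℝ (cv k δ a) g = inner ℝ (cv k δ b) v := by
  simp only [inner_cv_left, h]

theorem inner_S_eq {a b v g : L2Field} (h : ∀ y, inner ℝ (trans y a) g = inner ℝ (trans y b) v)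
    (δ : ℝ) : inner ℝ (θ.S δ a) g = inner ℝ (θ.S δ b) v := by
  unfold S
  exact inner_cv_eq h θ.tf δ

variable {θ} {X : ℝ → L2Field →L[ℝ] L2Field} {T : Fin 3 → TF → L2Field}

theorem FirstOrder.X_eq (hX : θ.FirstOrder X T) {v g : L2Field} (h : IsWeak T v g) {δ : ℝ}
    (hδ : δ ≠ 0) : X δ v = θ.S δ g := by
  refine ext_inner_testField fun i φ => ?_
  rw [hX.adj hδ, ← inner_S]
  refine (θ.inner_S_eq (fun y => ?_) δ).symm
  rw [trans_testField, h, hX.equivariant]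

/-- `X η v` is the exact image under the operator of the mollified field `S η v`; hence scales may
be interchanged. -/
theorem FirstOrder.X_S (hX : θ.FirstOrder X T) {δ η : ℝ} (hδ : δ ≠ 0) (hη : η ≠ 0) (v : L2Field) :
    X δ (θ.S η v) = θ.S δ (X η v) := by
  refine hX.X_eq (fun i φ => ?_) hδ
  rw [hX.adj hη, ← inner_S]

theorem FirstOrder.tendsto_X (hX : θ.FirstOrder X T) {v g : L2Field} (h : IsWeak T v g) :
    Tendsto (fun δ => X δ v) (𝓝[≠] 0) (𝓝 g) := by
  refine ((θ.tendsto_S g).mono_left nhdsWithin_le_nhds).congr' ?_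
  filter_upwards [self_mem_nhdsWithin] with δ hδ
  exact (hX.X_eq h hδ).symm

theorem FirstOrder.isWeak_of_X_eq (hX : θ.FirstOrder X T) {v g : L2Field}
    (h : ∀ δ, δ ≠ 0 → X δ v = θ.S δ g) : IsWeak T v g := by
  intro i φ
  have h1 : Tendsto (fun δ => inner ℝ (testField i φ) (θ.S δ g)) (𝓝[≠] 0)
      (𝓝 (inner ℝ (testField i φ) g)) :=
    tendsto_const_nhds.inner ((θ.tendsto_S g).mono_left nhdsWithin_le_nhds)
  have h2 : Tendsto (fun δ => inner ℝ (θ.S δ (T i φ)) v) (𝓝[≠] 0) (𝓝 (inner ℝ (T i φ) v)) :=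
    ((θ.tendsto_S _).mono_left nhdsWithin_le_nhds).inner tendsto_const_nhds
  refine tendsto_nhds_unique h1 (h2.congr' ?_)
  filter_upwards [self_mem_nhdsWithin] with δ hδ
  rw [← h δ hδ, hX.adj hδ]

/-- A sequence of scales tending to zero. -/
def dn (n : ℕ) : ℝ := 1 / ((n : ℝ) + 1)

theorem dn_pos (n : ℕ) : 0 < dn n := Nat.one_div_pos_of_nat

theorem tendsto_dn : Tendsto dn atTop (𝓝 0) := tendsto_one_div_add_atTop_nhds_zero_nat

theorem tendsto_dn_ne : Tendsto dn atTop (𝓝[≠] 0) :=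
  tendsto_nhdsWithin_iff.2 ⟨tendsto_dn, Eventually.of_forall fun n => (dn_pos n).ne'⟩

variable (θ) in
theorem dense_range_S : Dense {v | ∃ w n, v = θ.S (dn n) w} := fun v =>
  mem_closure_of_tendsto ((θ.tendsto_S v).comp tendsto_dn)
    (Eventually.of_forall fun n => ⟨v, n, rfl⟩)

/-- Since `S η (X δ v) = X η (S δ v)` tends to `X η v`, the pairings of the bounded sequence `X (dn
n) v` with the dense range of the mollifiers converge. The resulting weak limit is the derivative.
-/
theorem FirstOrder.exists_isWeak (hX : θ.FirstOrder X T) {v : L2Field} {C : ℝ}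
    (hC : ∀ n, ‖X (dn n) v‖ ≤ C) : ∃ g, IsWeak T v g := by
  have key : ∀ η, η ≠ 0 → Tendsto (fun n => θ.S η (X (dn n) v)) atTop (𝓝 (X η v)) := by
    intro η hη
    have := ((X η).continuous.tendsto v).comp ((θ.tendsto_S v).comp tendsto_dn)
    refine this.congr fun n => ?_
    exact hX.X_S hη (dn_pos n).ne' v
  obtain ⟨g, hg⟩ := exists_WT_of_dense hC θ.dense_range_S (by
    rintro _ ⟨w, m, rfl⟩
    simp only [inner_S]
    exact (tendsto_const_nhds.inner (key _ (dn_pos m).ne')).cauchySeq)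
  refine ⟨g, hX.isWeak_of_X_eq fun η hη => ?_⟩
  exact (WT.of_tendsto (key η hη)).unique (hg.map (θ.S η))

variable (θ X) in
/-- The squared `L²` norm of `X v - c`, where `X` is understood as a differential operator. -/
def nSq (v c : L2Field) : ℝ≥0∞ := ⨆ n, ‖X (dn n) v - θ.S (dn n) c‖ₑ ^ 2

theorem enorm_S_le (δ : ℝ) (v : L2Field) : ‖θ.S δ v‖ₑ ≤ ‖v‖ₑ :=
  enorm_le_iff_norm_le.2 (θ.norm_S_le δ v)

/-- Here `X δ v - S δ c = S δ (g - c)`. Mollification is a contraction, which bounds the supremum,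
and tends to the identity, which attains it in the limit. -/
theorem FirstOrder.nSq_eq (hX : θ.FirstOrder X T) {v c g : L2Field} (h : IsWeak T v g) :
    θ.nSq X v c = ‖g - c‖ₑ ^ 2 := by
  have h1 : ∀ n, X (dn n) v - θ.S (dn n) c = θ.S (dn n) (g - c) := fun n => by
    rw [hX.X_eq h (dn_pos n).ne', map_sub]
  refine le_antisymm (iSup_le fun n => ?_) ?_
  · rw [h1]
    gcongr
    exact enorm_S_le _ _
  · have h2 : Tendsto (fun n => ‖θ.S (dn n) (g - c)‖ₑ ^ 2) atTop (𝓝 (‖g - c‖ₑ ^ 2)) :=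
      ENNReal.Tendsto.pow ((continuous_enorm.tendsto _).comp ((θ.tendsto_S _).comp tendsto_dn))
    refine le_of_tendsto h2 (Eventually.of_forall fun n => ?_)
    rw [← h1]
    exact le_iSup (fun n => ‖X (dn n) v - θ.S (dn n) c‖ₑ ^ 2) n

theorem FirstOrder.exists_isWeak_of_nSq (hX : θ.FirstOrder X T) {v c : L2Field}
    (h : θ.nSq X v c ≠ ⊤) : ∃ g, IsWeak T v g := by
  refine hX.exists_isWeak (C := √(θ.nSq X v c).toReal + ‖c‖) fun n => ?_
  have h1 : ‖X (dn n) v - θ.S (dn n) c‖ₑ ^ 2 ≤ θ.nSq X v c :=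
    le_iSup (fun n => ‖X (dn n) v - θ.S (dn n) c‖ₑ ^ 2) n
  have h2 : ‖X (dn n) v - θ.S (dn n) c‖ ^ 2 ≤ (θ.nSq X v c).toReal := by
    have := ENNReal.toReal_mono h h1
    simpa using this
  have h3 := norm_le_norm_add_norm_sub (θ.S (dn n) c) (X (dn n) v)
  rw [norm_sub_rev] at h3
  have h4 := Real.le_sqrt_of_sq_le h2
  have h5 := θ.norm_S_le (dn n) c
  linarith

theorem FirstOrder.enorm_le (hX : θ.FirstOrder X T) {v c : L2Field} {δ : ℝ} (hδ : δ ≠ 0) :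
    ‖X δ v - θ.S δ c‖ₑ ^ 2 ≤ θ.nSq X v c := by
  by_cases h : θ.nSq X v c = ⊤
  · rw [h]; exact le_top
  obtain ⟨g, hg⟩ := hX.exists_isWeak_of_nSq h
  rw [hX.nSq_eq hg, hX.X_eq hg hδ, ← map_sub]
  gcongr
  exact enorm_S_le _ _

theorem FirstOrder.tendsto_enorm (hX : θ.FirstOrder X T) {v c : L2Field} (h : θ.nSq X v c ≠ ⊤) :
    Tendsto (fun δ => ‖X δ v - θ.S δ c‖ₑ ^ 2) (𝓝[≠] 0) (𝓝 (θ.nSq X v c)) := by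
  obtain ⟨g, hg⟩ := hX.exists_isWeak_of_nSq h
  rw [hX.nSq_eq hg]
  exact ENNReal.Tendsto.pow ((continuous_enorm.tendsto _).comp
    ((hX.tendsto_X hg).sub ((θ.tendsto_S c).mono_left nhdsWithin_le_nhds)))

/-- Scale and field vary together here. A further mollification at a fixed scale moves `X` to that
scale, where weak limits pass through the bounded operator; it does not increase norms, so the fixed
scale can be removed again. -/
theorem FirstOrder.nSq_le_liminf (hX : θ.FirstOrder X T) {ι : Type*} {l : Filter ι}
    {f h : ι → L2Field} {a c : L2Field} {δ : ι → ℝ} (hf : WT l f a) (hh : WT l h c)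
    {M M' : ℝ} (hM : ∀ᶠ i in l, ‖f i‖ ≤ M) (hM' : ∀ᶠ i in l, ‖h i‖ ≤ M')
    (hδ : Tendsto δ l (𝓝[≠] 0)) :
    θ.nSq X a c ≤ liminf (fun i => ‖X (δ i) (f i) - θ.S (δ i) (h i)‖ₑ ^ 2) l := by
  refine iSup_le fun n => ?_
  have hδ0 := hδ.mono_right nhdsWithin_le_nhds
  have hS : ∀ {f : ι → L2Field} {a : L2Field} {M : ℝ}, WT l f a → (∀ᶠ i in l, ‖f i‖ ≤ M) →
      WT l (fun i => θ.S (δ i) (f i)) a := by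
    intro f a M hf hM v
    simp only [← inner_S]
    exact hf.inner_tendsto hM ((θ.tendsto_S v).comp hδ0)
  have h1 : WT l (fun i => θ.S (dn n) (X (δ i) (f i) - θ.S (δ i) (h i)))
      (X (dn n) a - θ.S (dn n) c) := by
    refine (((hS hf hM).map (X (dn n))).sub ((hS hh hM').map (θ.S (dn n)))).congr' ?_
    filter_upwards [(tendsto_nhdsWithin_iff.1 hδ).2] with i hi
    rw [map_sub, hX.X_S (dn_pos n).ne' hi]
  refine h1.enorm_sq_le_liminf.trans (liminf_le_liminf (Eventually.of_forall fun i => ?_))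
  gcongr
  exact enorm_S_le _ _

theorem FirstOrder.nSq_le_liminf_nSq (hX : θ.FirstOrder X T) {ι : Type*} {l : Filter ι}
    {f h : ι → L2Field} {a c : L2Field} (hf : WT l f a) (hh : WT l h c) :
    θ.nSq X a c ≤ liminf (fun i => θ.nSq X (f i) (h i)) l := by
  refine iSup_le fun n => ?_
  refine (((hf.map (X (dn n))).sub (hh.map (θ.S (dn n)))).enorm_sq_le_liminf).trans ?_
  exact liminf_le_liminf (Eventually.of_forall fun i => hX.enorm_le (dn_pos n).ne')

/-! ### Gradient, divergence and curl -/

theorem firstOrder_D (j : Fin 3) :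
    θ.FirstOrder (θ.D j) fun i φ => -testField i (∂_{e j} φ) where
  adj hδ i φ v := by
    rw [real_inner_comm, inner_D, θ.D_testField j hδ, map_neg, inner_neg_left, real_inner_comm]
  equivariant i φ y := by rw [lineDeriv_transTF, ← trans_testField, map_neg]

/-- The curl of the field `φ e_i`. -/
def curlT (i : Fin 3) (φ : TF) : L2Field :=
  testField (i + 1) (∂_{e (i + 2)} φ) - testField (i + 2) (∂_{e (i + 1)} φ)

theorem cross_testField (j i : Fin 3) (φ : TF) : cross j (testField i φ) =
    (if j + 1 = i then testField (j + 2) φ else 0) -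
      if j + 2 = i then testField (j + 1) φ else 0 := by
  rw [cross_apply, P_testField, P_testField]

theorem sum_cross_testField (i : Fin 3) (φ : TF) :
    ∑ j, cross j (testField i (∂_{e j} φ)) = curlT i φ := by
  simp only [cross_testField, curlT, Fin.sum_univ_three]
  fin_cases i <;> simp <;> abel

theorem firstOrder_curlS : θ.FirstOrder θ.curlS curlT where
  adj {δ} hδ i φ v := by
    rw [← inner_curlS, curlS_apply, ← sum_cross_testField, map_sum]
    congr 1
    refine Finset.sum_congr rfl fun j _ => ?_
    rw [θ.D_testField j hδ, θ.clm_S δ (trans_cross j)]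
  equivariant i φ y := by
    rw [curlT, curlT, lineDeriv_transTF, lineDeriv_transTF, ← trans_testField, ← trans_testField,
      map_sub]

/-- Minus the gradient of `φ` if `i = 0`. -/
def divT (i : Fin 3) (φ : TF) : L2Field :=
  -∑ j, P j 0 (testField i (∂_{e j} φ))

theorem firstOrder_divS : θ.FirstOrder θ.divS divT where
  adj {δ} hδ i φ v := by
    rw [divS_apply, divT, map_neg, map_sum, inner_neg_left, sum_inner, inner_sum,
      ← Finset.sum_neg_distrib]
    refine Finset.sum_congr rfl fun j _ => ?_
    rw [← inner_P j 0, ← neg_neg (inner ℝ (P j 0 (testField i φ)) _), ← inner_D,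
      ← θ.clm_D j δ (trans_P j 0), θ.D_testField j hδ, θ.clm_S δ (trans_P j 0)]
  equivariant i φ y := by
    simp only [divT, lineDeriv_transTF, ← trans_testField, trans_P, map_neg, map_sum]

theorem isWeak_D_iff {j : Fin 3} {v g : L2Field} :
    IsWeak (fun i φ => -testField i (∂_{e j} φ)) v g ↔ HasWD j v g := by
  simp only [IsWeak, HasWD, inner_neg_left]

theorem isWeak_curlT_iff {v c : L2Field} : IsWeak curlT v c ↔ HasWeakCurl v c := by
  refine forall_congr' fun i => forall_congr' fun φ => ?_
  rw [curlT, inner_sub_left, inner_testField, inner_testField, inner_testField]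
  have : ∀ a b : ℝ, a - b = -b - -a := fun a b => by ring
  rw [this]

end MollifierKernel

/-! ### Dissipation norms as suprema over mollification scales -/

namespace MollifierKernel

variable (θ : MollifierKernel)

theorem nSq_D_eq {j : Fin 3} {v g : L2Field} (h : HasWD j v g) : θ.nSq (θ.D j) v 0 = ‖g‖ₑ ^ 2 := by
  rw [(θ.firstOrder_D j).nSq_eq (isWeak_D_iff.2 h), sub_zero]

/-- The infimum over weak derivatives becomes a sum of suprema of continuous functions of `v`,
including the infinite case: if all suprema are finite, the weak derivatives exist. -/
theorem gradSq_eq (v : L2Field) : gradSq v = ∑ j, θ.nSq (θ.D j) v 0 := by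
  refine le_antisymm ?_ (le_iInf₂ fun G hG => ?_)
  · by_cases h : ∃ j, θ.nSq (θ.D j) v 0 = ⊤
    · obtain ⟨j, hj⟩ := h
      rw [ENNReal.sum_eq_top.2 ⟨j, Finset.mem_univ j, hj⟩]
      exact le_top
    push Not at h
    choose G hG using fun j => (θ.firstOrder_D j).exists_isWeak_of_nSq (h j)
    refine iInf₂_le_of_le G (hasWeakGrad_iff.2 fun j => isWeak_D_iff.1 (hG j)) ?_
    exact Finset.sum_le_sum fun j _ => (θ.nSq_D_eq (isWeak_D_iff.1 (hG j))).ge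
  · exact Finset.sum_le_sum fun j _ => (θ.nSq_D_eq (hasWeakGrad_iff.1 hG j)).le

theorem exists_hasWD (θ : MollifierKernel) {v : L2Field} (h : gradSq v ≠ ⊤) :
    ∃ G : Fin 3 → L2Field, (∀ j, HasWD j v (G j)) ∧ gradSq v = ∑ j, ‖G j‖ₑ ^ 2 := by
  have h' : ∀ j, θ.nSq (θ.D j) v 0 ≠ ⊤ := fun j hj => h <| by
    rw [θ.gradSq_eq, ENNReal.sum_eq_top.2 ⟨j, Finset.mem_univ j, hj⟩]
  choose G hG using fun j => (θ.firstOrder_D j).exists_isWeak_of_nSq (h' j)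
  refine ⟨G, fun j => isWeak_D_iff.1 (hG j), ?_⟩
  rw [θ.gradSq_eq]
  exact Finset.sum_congr rfl fun j _ => θ.nSq_D_eq (isWeak_D_iff.1 (hG j))

theorem curlSubSq_eq (v w : L2Field) : curlSubSq v w = θ.nSq θ.curlS v ((2 : ℝ) • w) := by
  refine le_antisymm ?_ (le_iInf₂ fun c hc => ?_)
  · by_cases h : θ.nSq θ.curlS v ((2 : ℝ) • w) = ⊤
    · rw [h]; exact le_top
    obtain ⟨c, hc⟩ := θ.firstOrder_curlS.exists_isWeak_of_nSq h
    exact iInf₂_le_of_le c (isWeak_curlT_iff.1 hc) (θ.firstOrder_curlS.nSq_eq hc).ge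
  · exact (θ.firstOrder_curlS.nSq_eq (isWeak_curlT_iff.2 hc)).le

theorem inner_divT_eq (i : Fin 3) (φ : TF) (v : L2Field) :
    inner ℝ (divT i φ) v = if i = 0 then divPairing v φ else 0 := by
  simp only [divT, P_testField, divPairing_eq, inner_neg_left, sum_inner]
  split_ifs with h1 h2 h2
  · rfl
  · exact absurd h1.symm h2
  · exact absurd h2.symm h1
  · simp

/-- Scalar functions as multiples of `e 0`. -/
def embed : Lp ℝ 2 (volume : Measure E3) →L[ℝ] L2Field :=
  ((ContinuousLinearMap.id ℝ ℝ).smulRight (e 0)).compLpL 2 volume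

theorem coeFn_embed (d : Lp ℝ 2 (volume : Measure E3)) : embed d =ᵐ[volume] fun x => d x • e 0 :=
  ContinuousLinearMap.coeFn_compLpL _ d

theorem norm_embed (d : Lp ℝ 2 (volume : Measure E3)) : ‖embed d‖ = ‖d‖ := by
  have h : ∀ᵐ x, ‖embed d x‖ = ‖d x‖ := by
    filter_upwards [coeFn_embed d] with x hx
    rw [hx, norm_smul]
    simp
  exact le_antisymm (Lp.norm_le_norm_of_ae_le (h.mono fun x hx => hx.le))
    (Lp.norm_le_norm_of_ae_le (h.mono fun x hx => hx.ge))

/-- The first component. -/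
def comp0 : L2Field →L[ℝ] Lp ℝ 2 (volume : Measure E3) :=
  (EuclideanSpace.proj (𝕜 := ℝ) (0 : Fin 3)).compLpL 2 volume

theorem coeFn_comp0 (v : L2Field) : comp0 v =ᵐ[volume] fun x => v x 0 :=
  ContinuousLinearMap.coeFn_compLpL _ v

theorem norm_comp0_le (v : L2Field) : ‖comp0 v‖ ≤ ‖v‖ := by
  refine Lp.norm_le_norm_of_ae_le ?_
  filter_upwards [coeFn_comp0 v] with x hx
  rw [hx]
  exact PiLp.norm_apply_le _ _

/-- The scalar divergence is carried as the first component of a vector field, so that it fits the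
framework of first order operators from fields to fields. -/
theorem isWeak_divT_embed {v : L2Field} {d : Lp ℝ 2 (volume : Measure E3)} (h : HasWeakDiv v d) :
    IsWeak divT v (embed d) := by
  intro i φ
  rw [inner_divT_eq, inner_testField]
  split_ifs with hi
  · rw [← h φ, hi]
    refine integral_congr_ae ?_
    filter_upwards [coeFn_embed d] with x hx
    rw [hx]
    simp
  · rw [← integral_zero E3 ℝ]
    refine integral_congr_ae ?_
    filter_upwards [coeFn_embed d] with x hx
    rw [hx]
    simp [hi]

theorem hasWeakDiv_comp0 {v g : L2Field} (h : IsWeak divT v g) : HasWeakDiv v (comp0 g) := by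
  intro φ
  have := h 0 φ
  rw [inner_divT_eq, if_pos rfl, inner_testField] at this
  rw [← this]
  refine integral_congr_ae ?_
  filter_upwards [coeFn_comp0 g] with x hx
  rw [hx]

theorem divSq_eq (v : L2Field) : divSq v = θ.nSq θ.divS v 0 := by
  refine le_antisymm ?_ (le_iInf₂ fun d hd => ?_)
  · by_cases h : θ.nSq θ.divS v 0 = ⊤
    · rw [h]; exact le_top
    obtain ⟨g, hg⟩ := θ.firstOrder_divS.exists_isWeak_of_nSq h
    refine iInf₂_le_of_le (comp0 g) (hasWeakDiv_comp0 hg) ?_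
    rw [θ.firstOrder_divS.nSq_eq hg, sub_zero]
    gcongr
    exact enorm_le_iff_norm_le.2 (norm_comp0_le g)
  · rw [θ.firstOrder_divS.nSq_eq (isWeak_divT_embed hd), sub_zero, ← ofReal_norm, norm_embed,
      ofReal_norm]

end MollifierKernel

/-! ### Weakly continuous curves -/

/-- Freezing the curve at negative times makes the weak continuity two-sided and global. -/
theorem WeaklyContinuous.WT_max {u : ℝ → L2Field} (hu : WeaklyContinuous u) (t : ℝ) :
    Micropolar.WT (𝓝 t) (fun s => u (max s 0)) (u (max t 0)) := by
  intro v
  have h1 : Tendsto (fun s : ℝ => max s 0) (𝓝 t) (𝓝[Ici 0] (max t 0)) :=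
    tendsto_nhdsWithin_iff.2 ⟨(continuous_id.max continuous_const).tendsto t,
      Eventually.of_forall fun s => le_max_right s 0⟩
  exact (hu v (max t 0) (le_max_right t 0)).tendsto.comp h1

theorem WeaklyContinuous.add {u w : ℝ → L2Field} (hu : WeaklyContinuous u)
    (hw : WeaklyContinuous w) : WeaklyContinuous (fun t => u t + w t) := by
  intro v
  simp only [inner_add_right]
  exact (hu v).add (hw v)

theorem WeaklyContinuous.map {u : ℝ → L2Field} (hu : WeaklyContinuous u)
    (A : L2Field →L[ℝ] L2Field) : WeaklyContinuous (fun t => A (u t)) := fun v => by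
  have := hu (ContinuousLinearMap.adjoint A v)
  simpa only [ContinuousLinearMap.adjoint_inner_left] using this

theorem weaklyContinuous_const (a : L2Field) : WeaklyContinuous fun _ => a :=
  fun _ => continuousOn_const

/-- Along weakly continuous curves the quantity is lower semicontinuous in time, once frozen at
negative times. -/
theorem MollifierKernel.FirstOrder.aemeasurable_nSq {θ : MollifierKernel}
    {X : ℝ → L2Field →L[ℝ] L2Field} {T : Fin 3 → TF → L2Field} (hX : θ.FirstOrder X T)
    {u c : ℝ → L2Field} (hu : WeaklyContinuous u) (hc : WeaklyContinuous c) :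
    AEMeasurable (fun t => θ.nSq X (u t) (c t)) (volume.restrict (Ioi 0)) := by
  have h1 : LowerSemicontinuous fun t => θ.nSq X (u (max t 0)) (c (max t 0)) := fun t =>
    lowerSemicontinuousAt_iff_le_liminf.2 (hX.nSq_le_liminf_nSq (hu.WT_max t) (hc.WT_max t))
  refine ⟨_, h1.measurable, ?_⟩
  filter_upwards [ae_restrict_mem measurableSet_Ioi] with t ht
  rw [max_eq_left (le_of_lt ht)]

theorem weaklyContinuous_of_lipschitz {u : ℝ → L2Field} {M : ℝ} (hM : ∀ t, 0 ≤ t → ‖u t‖ ≤ M)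
    (hL : ∀ i φ, ∃ C, ∀ s t, 0 ≤ s → 0 ≤ t →
      |inner ℝ (testField i φ) (u t) - inner ℝ (testField i φ) (u s)| ≤ C * |t - s|) :
    WeaklyContinuous u := by
  intro v t ht
  refine WT.of_testField (M := M) (l := 𝓝[Ici 0] t) (f := u) (a := u t) ?_ (fun i φ => ?_) v
  · filter_upwards [self_mem_nhdsWithin] with s hs using hM s hs
  · obtain ⟨C, hC⟩ := hL i φ
    rw [tendsto_iff_dist_tendsto_zero]
    have h0 : Tendsto (fun s => C * |s - t|) (𝓝[Ici 0] t) (𝓝 0) := by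
      have : Continuous fun s : ℝ => C * |s - t| := by fun_prop
      have := this.tendsto t
      simp only [sub_self, abs_zero, mul_zero] at this
      exact this.mono_left nhdsWithin_le_nhds
    refine squeeze_zero' (Eventually.of_forall fun _ => dist_nonneg) ?_ h0
    filter_upwards [self_mem_nhdsWithin] with s hs
    rw [Real.dist_eq]
    exact hC t s ht hs

theorem exists_WT_of_testField {f : ℕ → L2Field} {M : ℝ} (hM : ∀ n, ‖f n‖ ≤ M)
    (h : ∀ i φ, CauchySeq fun n => inner ℝ (testField i φ) (f n)) : ∃ a, WT atTop f a := by
  refine exists_WT_of_dense hM dense_testSpan fun v hv => ?_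
  refine Submodule.span_induction (p := fun v _ => CauchySeq fun n => inner ℝ v (f n))
    ?_ ?_ ?_ ?_ hv
  · rintro _ ⟨p, rfl⟩
    exact h p.1 p.2
  · simpa only [inner_zero_left] using cauchySeq_const (0 : ℝ)
  · intro v w _ _ hv hw
    simp only [inner_add_left]
    exact hv.add hw
  · intro c v _ hv
    obtain ⟨L, hL⟩ := cauchySeq_tendsto_of_complete hv
    simpa only [real_inner_smul_left] using (hL.const_mul c).cauchySeq

/-- Weak compactness of bounded families of curves that are equi-Lipschitz when tested. -/
theorem exists_weak_subseq {z : ℕ → ℝ → L2Field} {M : ℝ} (hM : ∀ n t, 0 ≤ t → ‖z n t‖ ≤ M)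
    (hL : ∀ i φ, ∃ C, ∀ n s t, 0 ≤ s → 0 ≤ t →
      |inner ℝ (testField i φ) (z n t) - inner ℝ (testField i φ) (z n s)| ≤ C * |t - s|) :
    ∃ (σ : ℕ → ℕ) (u : ℝ → L2Field), StrictMono σ ∧ WeaklyContinuous u ∧
      ∀ t, 0 ≤ t → WT atTop (fun n => z (σ n) t) (u t) := by
  -- Pairings with a countable dense family of fields at countably many times. The absolute value
  -- keeps the rational times nonnegative.
  set x : ℕ → ℕ × ℚ → ℝ := fun n p => inner ℝ (denseSeq L2Field p.1) (z n |(p.2 : ℝ)|)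
  have hx : ∀ n, x n ∈ Set.pi univ fun p : ℕ × ℚ =>
      Icc (-(‖denseSeq L2Field p.1‖ * M)) (‖denseSeq L2Field p.1‖ * M) := by
    intro n p _
    refine abs_le.1 ?_
    refine (abs_real_inner_le_norm _ _).trans ?_
    gcongr
    exact hM n _ (abs_nonneg _)
  -- Sequential compactness of a countable product of intervals replaces the diagonal argument.
  obtain ⟨y, -, σ, hσ, hy⟩ := (isCompact_univ_pi fun p : ℕ × ℚ =>
    (isCompact_Icc : IsCompact (Icc (-(‖denseSeq L2Field p.1‖ * M))
      (‖denseSeq L2Field p.1‖ * M)))).tendsto_subseq hx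
  rw [tendsto_pi_nhds] at hy
  have h1 : ∀ (q : ℚ) v, CauchySeq fun n => inner ℝ v (z (σ n) |(q : ℝ)|) := by
    intro q
    refine cauchySeq_inner_of_dense (fun n => hM (σ n) _ (abs_nonneg _))
      (denseRange_denseSeq L2Field) ?_
    rintro _ ⟨k, rfl⟩
    exact (hy (k, q)).cauchySeq
  have h2 : ∀ t, 0 ≤ t → ∃ a, WT atTop (fun n => z (σ n) t) a := by
    intro t ht
    refine exists_WT_of_testField (fun n => hM (σ n) t ht) fun i φ => ?_
    obtain ⟨C, hC⟩ := hL i φ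
    have hC0 : 0 ≤ C := by
      have := (abs_nonneg _).trans (hC 0 0 1 le_rfl zero_le_one)
      simpa using this
    rw [Metric.cauchySeq_iff]
    intro r hr
    -- The equi-Lipschitz bound transfers convergence from a nearby rational time: each of the two
    -- errors is at most `r / 4`. The `+ 1` avoids division by zero.
    obtain ⟨q, hq1, hq2⟩ := exists_rat_btwn (show t < t + r / (4 * (C + 1)) by
      have : 0 < r / (4 * (C + 1)) := by positivity
      linarith)
    obtain ⟨N, hN⟩ := Metric.cauchySeq_iff.1 (h1 q (testField i φ)) (r / 2) (by positivity)
    refine ⟨N, fun m hm n hn => ?_⟩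
    have e0 := hN m hm n hn
    rw [abs_of_nonneg (ht.trans hq1.le), Real.dist_eq] at e0
    have hd : C * |t - q| ≤ r / 4 := by
      have : |t - q| ≤ r / (4 * (C + 1)) := by
        rw [abs_le]; constructor <;> linarith
      calc C * |t - q| ≤ (C + 1) * (r / (4 * (C + 1))) := by gcongr; linarith
        _ = r / 4 := by field_simp
    have e1 := (hC (σ m) q t (ht.trans hq1.le) ht).trans hd
    have e2 := (hC (σ n) q t (ht.trans hq1.le) ht).trans hd
    rw [Real.dist_eq]
    rw [abs_le] at e1 e2
    rw [abs_lt] at e0 ⊢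
    constructor <;> linarith [e1.1, e1.2, e2.1, e2.2, e0.1, e0.2]
  have h3 : ∀ t, ∃ a, 0 ≤ t → WT atTop (fun n => z (σ n) t) a := by
    intro t
    by_cases ht : 0 ≤ t
    · obtain ⟨a, ha⟩ := h2 t ht
      exact ⟨a, fun _ => ha⟩
    · exact ⟨0, fun h => absurd h ht⟩
  choose u hu using h3
  refine ⟨σ, u, hσ, ?_, hu⟩
  refine weaklyContinuous_of_lipschitz (M := M) (fun t ht => (hu t ht).norm_le
    (Eventually.of_forall fun n => hM (σ n) t ht)) fun i φ => ?_
  obtain ⟨C, hC⟩ := hL i φ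
  refine ⟨C, fun s t hs ht => ?_⟩
  exact le_of_tendsto (((hu t ht) _).sub ((hu s hs) _)).abs
    (Eventually.of_forall fun n => hC (σ n) s t hs ht)

/-! ### Time slices of test functions -/

/-- Test functions on space-time. -/
abbrev STF := 𝓓(spaceTime, ℝ)

theorem isCompact_snd_tsupport (φ : STF) : IsCompact (Prod.snd '' tsupport φ) :=
  φ.hasCompactSupport.isCompact.image continuous_snd

theorem slice_eq_zero (φ : STF) (t : ℝ) {x : E3} (hx : x ∉ Prod.snd '' tsupport φ) :
    φ (t, x) = 0 := by
  by_contra h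
  exact hx ⟨(t, x), subset_tsupport _ h, rfl⟩

/-- The time slice `φ(t,·)`. -/
def slice (φ : STF) (t : ℝ) : TF where
  toFun x := φ (t, x)
  contDiff' := φ.contDiff.comp (contDiff_const.prodMk contDiff_id)
  hasCompactSupport' := HasCompactSupport.intro (isCompact_snd_tsupport φ)
    fun _ hx => slice_eq_zero φ t hx
  tsupport_subset' := by simp

theorem slice_apply (φ : STF) (t : ℝ) (x : E3) : slice φ t x = φ (t, x) := rfl

theorem lineDeriv_slice (φ : STF) (t : ℝ) (v : E3) :
    ∂_{v} (slice φ t) = slice (∂_{((0 : ℝ), v)} φ) t := by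
  ext x
  have h1 := hasLineDerivAt_testFunction (slice φ t) v x
  have h2 := hasLineDerivAt_testFunction φ ((0 : ℝ), v) (t, x)
  rw [slice_apply]
  refine HasDerivAt.unique h1 ?_
  have h3 : (fun s : ℝ => φ ((t, x) + s • ((0 : ℝ), v))) = fun s : ℝ => slice φ t (x + s • v) := by
    ext s
    rw [slice_apply]
    simp
  rw [HasLineDerivAt, h3] at h2
  exact h2

theorem hasDerivAt_slice_apply (φ : STF) (x : E3) (t : ℝ) :
    HasDerivAt (fun t => slice φ t x) (slice (∂_{((1 : ℝ), (0 : E3))} φ) t x) t := by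
  have h2 := hasLineDerivAt_testFunction φ ((1 : ℝ), (0 : E3)) (t, x)
  have h3 : (fun s : ℝ => φ ((t, x) + s • ((1 : ℝ), (0 : E3)))) = fun s : ℝ => slice φ (t + s) x := by
    ext s
    rw [slice_apply]
    simp
  rw [HasLineDerivAt, h3] at h2
  rw [← sub_self t] at h2
  have h4 := h2.comp_sub_const t t
  simpa only [add_sub_cancel, slice_apply] using h4

theorem hasDerivAt_testField_slice (i : Fin 3) (φ : STF) (t : ℝ) :
    HasDerivAt (fun t => testField i (slice φ t))
      (testField i (slice (∂_{((1 : ℝ), (0 : E3))} φ) t)) t := by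
  refine hasDerivAt_testField i (isCompact_snd_tsupport φ) ?_
    (fun t x => hasDerivAt_slice_apply φ x t) ?_
  · exact Eventually.of_forall fun t x hx => slice_eq_zero φ t hx
  · exact (∂_{((1 : ℝ), (0 : E3))} φ : STF).continuous

theorem continuous_testField_slice (i : Fin 3) (φ : STF) :
    Continuous fun t => testField i (slice φ t) :=
  continuous_iff_continuousAt.2 fun t => (hasDerivAt_testField_slice i φ t).continuousAt

theorem exists_slice_eq_zero (φ : STF) :
    ∃ a b : ℝ, 0 < a ∧ a < b ∧ ∀ t, t ∉ Icc a b → slice φ t = 0 := by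
  have hK : IsCompact (Prod.fst '' tsupport φ) :=
    φ.hasCompactSupport.isCompact.image continuous_fst
  have hpos : ∀ t ∈ Prod.fst '' tsupport φ, 0 < t := by
    rintro _ ⟨p, hp, rfl⟩
    exact (φ.tsupport_subset hp).1
  have hz : ∀ t, t ∉ Prod.fst '' tsupport φ → slice φ t = 0 := by
    intro t ht
    ext x
    by_contra h
    exact ht ⟨(t, x), subset_tsupport _ h, rfl⟩
  rcases (Prod.fst '' tsupport φ).eq_empty_or_nonempty with he | hne
  -- For the zero test function any interval of positive times will do.
  · exact ⟨1, 2, one_pos, one_lt_two, fun t _ => hz t (by rw [he]; exact notMem_empty t)⟩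
  · obtain ⟨a, ha, ha'⟩ := hK.exists_isLeast hne
    obtain ⟨b, hb, hb'⟩ := hK.exists_isGreatest hne
    -- The extra unit makes the interval nondegenerate even if the support meets a single time.
    refine ⟨a, b + 1, hpos a ha, by linarith [ha' hb], fun t ht => hz t fun h => ht ?_⟩
    exact ⟨ha' h, by linarith [hb' h]⟩

theorem comp_eq (u : ℝ → L2Field) (i : Fin 3) (φ : STF) :
    comp u i φ = ∫ t in Ioi (0 : ℝ), inner ℝ (testField i (slice φ t)) (u t) := by
  simp only [comp, regular, inner_testField, slice_apply, mul_comm]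

/-! ### Integrability of pairings -/

theorem WeaklyContinuous.continuousOn_inner {u F : ℝ → L2Field} (hu : WeaklyContinuous u) {M : ℝ}
    (hM : ∀ t, 0 ≤ t → ‖u t‖ ≤ M) (hF : Continuous F) :
    ContinuousOn (fun t => inner ℝ (F t) (u t)) (Ici 0) := fun t ht =>
  WT.inner_tendsto (fun v => hu v t ht) (eventually_mem_nhdsWithin.mono fun s hs => hM s hs)
    (hF.continuousWithinAt (s := Ici 0) (x := t))

theorem integrableOn_of_continuousOn {f : ℝ → ℝ} (hf : ContinuousOn f (Ici 0)) {b : ℝ}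
    (hb : ∀ t, b < t → f t = 0) : IntegrableOn f (Ioi 0) := by
  have h1 : IntegrableOn f (Icc 0 b) :=
    (hf.mono Icc_subset_Ici_self).integrableOn_compact isCompact_Icc
  refine (h1.of_forall_sdiff_eq_zero measurableSet_Ioi fun t ht => ?_)
  refine hb t (not_le.1 fun h => ht.2 ⟨(le_of_lt ht.1), h⟩)

theorem WeaklyContinuous.integrableOn_inner {u F : ℝ → L2Field} (hu : WeaklyContinuous u) {M : ℝ}
    (hM : ∀ t, 0 ≤ t → ‖u t‖ ≤ M) (hF : Continuous F) {b : ℝ} (hb : ∀ t, b < t → F t = 0) :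
    IntegrableOn (fun t => inner ℝ (F t) (u t)) (Ioi 0) :=
  integrableOn_of_continuousOn (hu.continuousOn_inner hM hF) fun t ht => by
    rw [hb t ht, inner_zero_left]

theorem integrableOn_inner_slice {u : ℝ → L2Field} (hu : BoundedWeaklyContinuous u) (i : Fin 3)
    (φ : STF) : IntegrableOn (fun t => inner ℝ (testField i (slice φ t)) (u t)) (Ioi 0) := by
  obtain ⟨M, hM⟩ := hu.bounded
  obtain ⟨a, b, -, -, hab⟩ := exists_slice_eq_zero φ
  refine hu.weaklyContinuous.integrableOn_inner hM (continuous_testField_slice i φ) (b := b)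
    fun t ht => ?_
  rw [hab t fun h => ht.not_ge h.2]
  exact map_zero (testFieldL i)

/-! ### The linear part of the equations -/

/-- The Laplacian of `φ e_i`. -/
def lapT (i : Fin 3) (φ : TF) : L2Field := ∑ j, testField i (∂_{e j} (∂_{e j} φ))

/-- The gradient of the divergence of `φ e_i`. -/
def gradDivT (i : Fin 3) (φ : TF) : L2Field := ∑ j, testField j (∂_{e j} (∂_{e i} φ))

/-- The linear part of the velocity equation, tested against `φ e_i`. -/
def linUT (μ χ : ℝ) (i : Fin 3) (φ : TF) (u w : L2Field) : ℝ :=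
  (μ + χ) * inner ℝ (lapT i φ) u + (2 * χ) * inner ℝ (MollifierKernel.curlT i φ) w

/-- The linear part of the microrotation equation, tested against `φ e_i`. -/
def linWT (χ γ κ : ℝ) (i : Fin 3) (φ : TF) (u w : L2Field) : ℝ :=
  γ * inner ℝ (lapT i φ) w + κ * inner ℝ (gradDivT i φ) w +
    (2 * χ) * inner ℝ (MollifierKernel.curlT i φ) u - (4 * χ) * inner ℝ (testField i φ) w

theorem lapD_eq {u : ℝ → L2Field} (hu : BoundedWeaklyContinuous u) (i : Fin 3) (φ : STF) :
    IntegrableOn (fun t => inner ℝ (lapT i (slice φ t)) (u t))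
    (Ioi 0) ∧
    lapD u i φ = ∫ t in Ioi (0 : ℝ), inner ℝ (lapT i (slice φ t)) (u t) := by
  have hi := fun j => integrableOn_inner_slice hu i (∂_{((0 : ℝ), e j)} (∂_{((0 : ℝ), e j)} φ))
  simp only [lapT, sum_inner, lineDeriv_slice]
  refine ⟨integrable_finsetSum _ fun j _ => hi j, ?_⟩
  rw [integral_finsetSum _ fun j _ => hi j]
  simp [lapD, Finset.sum_apply, Dx, comp_eq]

theorem gradDivD_eq {u : ℝ → L2Field} (hu : BoundedWeaklyContinuous u) (i : Fin 3)
    (φ : STF) :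
    IntegrableOn (fun t => inner ℝ (gradDivT i (slice φ t)) (u t)) (Ioi 0) ∧
      gradDivD u i φ = ∫ t in Ioi (0 : ℝ), inner ℝ (gradDivT i (slice φ t)) (u t) := by
  have hi := fun j => integrableOn_inner_slice hu j (∂_{((0 : ℝ), e j)} (∂_{((0 : ℝ), e i)} φ))
  simp only [gradDivT, sum_inner, lineDeriv_slice]
  refine ⟨integrable_finsetSum _ fun j _ => hi j, ?_⟩
  rw [integral_finsetSum _ fun j _ => hi j]
  simp [gradDivD, Finset.sum_apply, Dx, comp_eq]

theorem curlD_eq {u : ℝ → L2Field} (hu : BoundedWeaklyContinuous u) (i : Fin 3) (φ : STF) :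
    IntegrableOn (fun t => inner ℝ (MollifierKernel.curlT i (slice φ t)) (u t)) (Ioi 0) ∧
      curlD u i φ = ∫ t in Ioi (0 : ℝ), inner ℝ (MollifierKernel.curlT i (slice φ t)) (u t) := by
  have h1 := integrableOn_inner_slice hu (i + 1) (∂_{((0 : ℝ), e (i + 2))} φ)
  have h2 := integrableOn_inner_slice hu (i + 2) (∂_{((0 : ℝ), e (i + 1))} φ)
  simp only [MollifierKernel.curlT, inner_sub_left, lineDeriv_slice]
  refine ⟨h1.sub h2, ?_⟩
  rw [integral_sub h1 h2]
  simp only [curlD, Pi.sub_apply, Dx, comp_eq]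
  ring

theorem linU_eq {u w : ℝ → L2Field} (hu : BoundedWeaklyContinuous u)
    (hw : BoundedWeaklyContinuous w) (μ χ : ℝ) (i : Fin 3) (φ : STF) :
    IntegrableOn (fun t => linUT μ χ i (slice φ t) (u t) (w t)) (Ioi 0) ∧
      linU μ χ u w i φ = ∫ t in Ioi (0 : ℝ), linUT μ χ i (slice φ t) (u t) (w t) := by
  obtain ⟨h1, h1'⟩ := lapD_eq hu i φ
  obtain ⟨h2, h2'⟩ := curlD_eq hw i φ
  have h3 := h1.const_mul (μ + χ)
  have h4 := h2.const_mul (2 * χ)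
  refine ⟨h3.add h4, ?_⟩
  simp only [linU, Pi.add_apply, Pi.smul_apply, smul_eq_mul, h1', h2', linUT]
  rw [integral_add h3 h4, integral_const_mul, integral_const_mul]

theorem linW_eq {u w : ℝ → L2Field} (hu : BoundedWeaklyContinuous u)
    (hw : BoundedWeaklyContinuous w) (χ γ κ : ℝ) (i : Fin 3) (φ : STF) :
    IntegrableOn (fun t => linWT χ γ κ i (slice φ t) (u t) (w t)) (Ioi 0) ∧
      linW χ γ κ u w i φ = ∫ t in Ioi (0 : ℝ), linWT χ γ κ i (slice φ t) (u t) (w t) := by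
  obtain ⟨h1, h1'⟩ := lapD_eq hw i φ
  obtain ⟨h2, h2'⟩ := gradDivD_eq hw i φ
  obtain ⟨h3, h3'⟩ := curlD_eq hu i φ
  have h4 := integrableOn_inner_slice hw i φ
  have k1 := h1.const_mul γ
  have k2 := h2.const_mul κ
  have k3 := h3.const_mul (2 * χ)
  have k4 := h4.const_mul (4 * χ)
  have k12 : IntegrableOn (fun t => γ * inner ℝ (lapT i (slice φ t)) (w t) +
      κ * inner ℝ (gradDivT i (slice φ t)) (w t)) (Ioi 0) := k1.add k2
  have k123 : IntegrableOn (fun t => γ * inner ℝ (lapT i (slice φ t)) (w t) +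
      κ * inner ℝ (gradDivT i (slice φ t)) (w t) +
      2 * χ * inner ℝ (MollifierKernel.curlT i (slice φ t)) (u t)) (Ioi 0) := k12.add k3
  refine ⟨k123.sub k4, ?_⟩
  simp only [linW, Pi.add_apply, Pi.sub_apply, Pi.smul_apply, smul_eq_mul, h1', h2', h3', comp_eq,
    linWT]
  rw [integral_sub k123 k4, integral_add k12 k3, integral_add k1 k2]
  simp only [integral_const_mul]

/-! ### The mollified transport terms -/

namespace MollifierKernel

variable (θ : MollifierKernel) {ε : ℝ} (hε : ε ≠ 0)

/-- The nonlinear term `ℙ((J_ε u)·∇u)`, tested against `-φ e_i`. -/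
def trU (i : Fin 3) (φ : TF) (u : L2Field) : ℝ :=
  ∑ j, inner ℝ (leray (testField i (∂_{e j} φ))) (mulL (θ.mol ε hε j u) u)

/-- The nonlinear term `(J_ε u)·∇w`, tested against `-φ e_i`. -/
def trW (i : Fin 3) (φ : TF) (u w : L2Field) : ℝ :=
  ∑ j, inner ℝ (testField i (∂_{e j} φ)) (mulL (θ.mol ε hε j u) w)

/-- A bound for the mollified velocity. -/
def molConst : ℝ := ∑ j, ‖testField j (θ.ktf ε hε)‖

theorem molConst_nonneg : 0 ≤ θ.molConst hε := Finset.sum_nonneg fun _ _ => norm_nonneg _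

theorem norm_mol_le (j : Fin 3) (u : L2Field) : ‖θ.mol ε hε j u‖ ≤ θ.molConst hε * ‖u‖ := by
  refine (norm_ptB_le _ _).trans ?_
  gcongr
  exact Finset.single_le_sum (f := fun j => ‖testField j (θ.ktf ε hε)‖)
    (fun _ _ => norm_nonneg _) (Finset.mem_univ j)

theorem norm_mulL_mol_le (j : Fin 3) (u w : L2Field) :
    ‖mulL (θ.mol ε hε j u) w‖ ≤ θ.molConst hε * ‖u‖ * ‖w‖ :=
  (norm_mulL_le _ _).trans (by gcongr; exact θ.norm_mol_le hε j u)

theorem boundedWeaklyContinuous_mulL {u w : ℝ → L2Field} (hu : BoundedWeaklyContinuous u)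
    (hw : BoundedWeaklyContinuous w) (j : Fin 3) :
    BoundedWeaklyContinuous fun t => mulL (θ.mol ε hε j (u t)) (w t) := by
  obtain ⟨M, hM⟩ := hu.bounded
  obtain ⟨M', hM'⟩ := hw.bounded
  refine ⟨⟨θ.molConst hε * M * M', fun t ht => ?_⟩, fun v t ht => ?_⟩
  · have h0 := (norm_nonneg _).trans (hM t ht)
    have := θ.molConst_nonneg hε
    refine (θ.norm_mulL_mol_le hε j _ _).trans ?_
    gcongr
    exacts [hM t ht, hM' t ht]
  · exact WT.mulL_ptB (l := 𝓝[Ici 0] t) (fun v => hu.weaklyContinuous v t ht)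
      (eventually_mem_nhdsWithin.mono fun s hs => hM s hs)
      (fun v => hw.weaklyContinuous v t ht)
      (eventually_mem_nhdsWithin.mono fun s hs => hM' s hs) _ v

theorem _root_.Micropolar.BoundedWeaklyContinuous.leray {u : ℝ → L2Field}
    (hu : BoundedWeaklyContinuous u) : BoundedWeaklyContinuous fun t => leray (u t) := by
  obtain ⟨M, hM⟩ := hu.bounded
  exact ⟨⟨M, fun t ht => (norm_leray_le _).trans (hM t ht)⟩, hu.weaklyContinuous.map _⟩

theorem lerayTransportD_eq {u : ℝ → L2Field} (hu : BoundedWeaklyContinuous u) (i : Fin 3)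
    (φ : STF) :
    IntegrableOn (fun t => θ.trU hε i (slice φ t) (u t)) (Ioi 0) ∧
    lerayTransportD (fun t => mollify θ ε (u t)) u i φ =
      -∫ t in Ioi (0 : ℝ), θ.trU hε i (slice φ t) (u t) := by
  have hi := fun j => integrableOn_inner_slice (θ.boundedWeaklyContinuous_mulL hε hu hu j).leray i
    (∂_{((0 : ℝ), e j)} φ)
  simp only [trU, lineDeriv_slice, inner_leray]
  refine ⟨integrable_finsetSum _ fun j _ => hi j, ?_⟩
  rw [integral_finsetSum _ fun j _ => hi j]
  simp only [lerayTransportD, Finset.sum_apply, Dx, Finset.sum_neg_distrib, regular,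
    θ.toL2_mollify ε hε, inner_testField, slice_apply, mul_comm]

theorem transportD_eq {u w : ℝ → L2Field} (hu : BoundedWeaklyContinuous u)
    (hw : BoundedWeaklyContinuous w) (i : Fin 3) (φ : STF) :
    IntegrableOn (fun t => θ.trW hε i (slice φ t) (u t) (w t)) (Ioi 0) ∧
    transportD (fun t => mollify θ ε (u t)) w i φ =
      -∫ t in Ioi (0 : ℝ), θ.trW hε i (slice φ t) (u t) (w t) := by
  have hi := fun j => integrableOn_inner_slice (θ.boundedWeaklyContinuous_mulL hε hu hw j) i
    (∂_{((0 : ℝ), e j)} φ)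
  simp only [trW, lineDeriv_slice]
  refine ⟨integrable_finsetSum _ fun j _ => hi j, ?_⟩
  rw [integral_finsetSum _ fun j _ => hi j]
  simp only [transportD, Finset.sum_apply, Dx, Finset.sum_neg_distrib, regular]
  congr 1
  refine Finset.sum_congr rfl fun j _ => ?_
  refine integral_congr_ae (Eventually.of_forall fun t => ?_)
  simp only [inner_testField]
  refine integral_congr_ae ?_
  filter_upwards [coeFn_mulL (θ.mol ε hε j (u t)) (w t)] with x hx
  rw [hx, θ.mollify_apply ε hε, slice_apply]
  simp only [PiLp.smul_apply, smul_eq_mul]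
  ring

/-- The right-hand side of the mollified velocity equation, tested against `φ e_i`. -/
def rhsU (μ χ : ℝ) (i : Fin 3) (φ : TF) (u w : L2Field) : ℝ :=
  linUT μ χ i φ u w + θ.trU hε i φ u

/-- The right-hand side of the mollified microrotation equation, tested against `φ e_i`. -/
def rhsW (χ γ κ : ℝ) (i : Fin 3) (φ : TF) (u w : L2Field) : ℝ :=
  linWT χ γ κ i φ u w + θ.trW hε i φ u w

/-- The mollified velocity equation in terms of time slices. -/
theorem velocity_iff {u w : ℝ → L2Field} (hu : BoundedWeaklyContinuous u)
    (hw : BoundedWeaklyContinuous w) (μ χ : ℝ) (i : Fin 3) :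
    Dt (comp u i) + lerayTransportD (fun t => mollify θ ε (u t)) u i = linU μ χ u w i ↔
      ∀ φ : STF, -∫ t in Ioi (0 : ℝ), inner ℝ (testField i (slice (∂_{((1 : ℝ), (0 : E3))} φ) t))
        (u t) = ∫ t in Ioi (0 : ℝ), θ.rhsU hε μ χ i (slice φ t) (u t) (w t) := by
  rw [funext_iff]
  refine forall_congr' fun φ => ?_
  obtain ⟨h1, h1'⟩ := linU_eq hu hw μ χ i φ
  obtain ⟨h2, h2'⟩ := θ.lerayTransportD_eq hε hu i φ
  simp only [rhsU]
  rw [integral_add h1 h2, Pi.add_apply, h1', h2', Dt, comp_eq]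
  constructor <;> intro h <;> linarith

/-- The mollified microrotation equation in terms of time slices. -/
theorem microrotation_iff {u w : ℝ → L2Field} (hu : BoundedWeaklyContinuous u)
    (hw : BoundedWeaklyContinuous w) (χ γ κ : ℝ) (i : Fin 3) :
    Dt (comp w i) + transportD (fun t => mollify θ ε (u t)) w i = linW χ γ κ u w i ↔
      ∀ φ : STF, -∫ t in Ioi (0 : ℝ), inner ℝ (testField i (slice (∂_{((1 : ℝ), (0 : E3))} φ) t))
        (w t) = ∫ t in Ioi (0 : ℝ), θ.rhsW hε χ γ κ i (slice φ t) (u t) (w t) := by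
  rw [funext_iff]
  refine forall_congr' fun φ => ?_
  obtain ⟨h1, h1'⟩ := linW_eq hu hw χ γ κ i φ
  obtain ⟨h2, h2'⟩ := θ.transportD_eq hε hu hw i φ
  simp only [rhsW]
  rw [integral_add h1 h2, Pi.add_apply, h1', h2', Dt, comp_eq]
  constructor <;> intro h <;> linarith

end MollifierKernel

/-! ### Lipschitz bounds from equations in the sense of distributions -/

theorem deriv_smoothTransition_of_notMem {x : ℝ} (hx : x ∉ Icc (0 : ℝ) 1) :
    deriv Real.smoothTransition x = 0 := by
  rw [mem_Icc, not_and_or, not_le, not_le] at hx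
  rcases hx with hx | hx
  · have : Real.smoothTransition =ᶠ[𝓝 x] fun _ => 0 := by
      filter_upwards [gt_mem_nhds hx] with y hy using Real.smoothTransition.zero_of_nonpos hy.le
    rw [this.deriv_eq, deriv_const]
  · have : Real.smoothTransition =ᶠ[𝓝 x] fun _ => 1 := by
      filter_upwards [lt_mem_nhds hx] with y hy using Real.smoothTransition.one_of_one_le hy.le
    rw [this.deriv_eq, deriv_const]

theorem differentiable_smoothTransition : Differentiable ℝ Real.smoothTransition :=
  (Real.smoothTransition.contDiff (n := 1)).differentiable (by simp)

theorem continuous_deriv_smoothTransition : Continuous (deriv Real.smoothTransition) :=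
  (Real.smoothTransition.contDiff (n := 1)).continuous_deriv (by simp)

theorem integral_deriv_smoothTransition :
    ∫ x in Icc (0 : ℝ) 1, deriv Real.smoothTransition x = 1 := by
  rw [integral_Icc_eq_integral_Ioc, ← intervalIntegral.integral_of_le zero_le_one,
    intervalIntegral.integral_deriv_eq_sub (fun x _ => differentiable_smoothTransition x)
      (continuous_deriv_smoothTransition.intervalIntegrable _ _)]
  simp

/-- Substitution `τ = a + h x`. The approximate delta function sits to the right of `a`, so
integrating over positive times only loses nothing, even for `a = 0`. -/
theorem integral_deriv_smoothTransition_mul (G : ℝ → ℝ) {a h : ℝ} (ha : 0 ≤ a)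
    (hh : 0 < h) :
    ∫ τ in Ioi (0 : ℝ), h⁻¹ * deriv Real.smoothTransition (h⁻¹ * (τ - a)) * G τ =
      ∫ x in Icc (0 : ℝ) 1, deriv Real.smoothTransition x * G (a + h * x) := by
  rw [setIntegral_eq_integral_of_ae_compl_eq_zero,
    setIntegral_eq_integral_of_forall_compl_eq_zero]
  · have h1 := Measure.integral_comp_mul_left
      (fun x => h⁻¹ * (deriv Real.smoothTransition x * G (a + h * x))) h⁻¹
    have h2 := integral_sub_right_eq_self (μ := volume) (fun τ => h⁻¹ *
      (deriv Real.smoothTransition (h⁻¹ * τ) * G (a + h * (h⁻¹ * τ)))) a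
    rw [h1, integral_const_mul (L := ℝ) (μ := volume) h⁻¹ (fun x =>
      deriv Real.smoothTransition x * G (a + h * x)), inv_inv, abs_of_pos hh, smul_eq_mul,
      mul_inv_cancel_left₀ hh.ne'] at h2
    rw [← h2]
    refine integral_congr_ae (Eventually.of_forall fun τ => ?_)
    beta_reduce
    rw [mul_inv_cancel_left₀ hh.ne', add_sub_cancel, mul_assoc]
  · intro x hx
    rw [deriv_smoothTransition_of_notMem hx, zero_mul]
  · have h0 : ∀ᵐ τ : ℝ, τ ≠ 0 := by simp [ae_iff]
    filter_upwards [h0] with τ h0 hτ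
    rw [deriv_smoothTransition_of_notMem, mul_zero, zero_mul]
    intro hm
    have : τ < 0 := lt_of_le_of_ne (not_lt.1 hτ) h0
    have h3 : h⁻¹ * (τ - a) < 0 := mul_neg_of_pos_of_neg (by positivity) (by linarith)
    exact absurd hm.1 (not_le.2 h3)

theorem tendsto_integral_deriv_smoothTransition {G : ℝ → ℝ} (hG : Continuous G) (a : ℝ) :
    Tendsto (fun h => ∫ x in Icc (0 : ℝ) 1, deriv Real.smoothTransition x * G (a + h * x)) (𝓝[>] 0)
      (𝓝 (G a)) := by
  have hc : Continuous fun h : ℝ => ∫ x in Icc (0 : ℝ) 1,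
      deriv Real.smoothTransition x * G (a + h * x) := by
    refine continuous_parametric_integral_of_continuous ?_ isCompact_Icc
    have := continuous_deriv_smoothTransition
    fun_prop
  have := hc.tendsto 0
  simp only [zero_mul, add_zero, integral_mul_const, integral_deriv_smoothTransition, one_mul]
    at this
  exact this.mono_left nhdsWithin_le_nhds

/-- The test functions are smoothed indicators of the interval from `s` to `t`. Their derivatives
are differences of approximate delta functions at `s` and `t`, and they are bounded by one. -/
theorem abs_sub_le_of_distribution {G f : ℝ → ℝ} (hG : Continuous G) {C : ℝ}
    (hf : ∀ t, 0 < t → |f t| ≤ C)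
    (h : ∀ η : ℝ → ℝ, ContDiff ℝ ∞ η → HasCompactSupport η → tsupport η ⊆ Ioi 0 →
      -∫ t in Ioi (0 : ℝ), deriv η t * G t = ∫ t in Ioi (0 : ℝ), η t * f t)
    {s t : ℝ} (hs : 0 < s) (hst : s ≤ t) : |G t - G s| ≤ C * (t - s) := by
  have hC : 0 ≤ C := (abs_nonneg _).trans (hf 1 one_pos)
  -- Both transitions occupy a width `h` to the right of their base points, so the support stays in
  -- `[s, t + h]`, away from time zero.
  set η : ℝ → ℝ → ℝ := fun h τ =>
    Real.smoothTransition (h⁻¹ * (τ - s)) - Real.smoothTransition (h⁻¹ * (τ - t)) with hη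
  have hη0 : ∀ h, 0 < h → ∀ τ, τ ∉ Icc s (t + h) → η h τ = 0 := by
    intro h hh τ hτ
    rw [mem_Icc, not_and_or, not_le, not_le] at hτ
    rcases hτ with hτ | hτ
    · simp only [hη]
      rw [Real.smoothTransition.zero_of_nonpos, Real.smoothTransition.zero_of_nonpos, sub_zero]
      · exact mul_nonpos_of_nonneg_of_nonpos (by positivity) (by linarith)
      · exact mul_nonpos_of_nonneg_of_nonpos (by positivity) (by linarith)
    · simp only [hη]
      rw [Real.smoothTransition.one_of_one_le, Real.smoothTransition.one_of_one_le, sub_self]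
      · rw [inv_mul_eq_div, le_div_iff₀ hh]; linarith
      · rw [inv_mul_eq_div, le_div_iff₀ hh]; linarith
  have hη1 : ∀ h, 0 < h → ∀ τ, |η h τ| ≤ 1 := by
    intro h hh τ
    have h1 := Real.smoothTransition.nonneg (h⁻¹ * (τ - s))
    have h2 := Real.smoothTransition.le_one (h⁻¹ * (τ - s))
    have h3 := Real.smoothTransition.nonneg (h⁻¹ * (τ - t))
    have h4 := Real.smoothTransition.le_one (h⁻¹ * (τ - t))
    rw [abs_le]
    constructor <;> simp only [hη] <;> linarith
  have hηd : ∀ h, ContDiff ℝ ∞ (η h) := fun h =>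
    (Real.smoothTransition.contDiff.comp (by fun_prop)).sub
      (Real.smoothTransition.contDiff.comp (by fun_prop))
  have hder : ∀ h τ, deriv (η h) τ = h⁻¹ * deriv Real.smoothTransition (h⁻¹ * (τ - s)) -
      h⁻¹ * deriv Real.smoothTransition (h⁻¹ * (τ - t)) := by
    intro h τ
    have key : ∀ a : ℝ, HasDerivAt (fun τ => Real.smoothTransition (h⁻¹ * (τ - a)))
        (h⁻¹ * deriv Real.smoothTransition (h⁻¹ * (τ - a))) τ := by
      intro a
      have h1 : HasDerivAt (fun τ : ℝ => h⁻¹ * (τ - a)) h⁻¹ τ := by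
        simpa using ((hasDerivAt_id τ).sub_const a).const_mul h⁻¹
      have := (differentiable_smoothTransition (h⁻¹ * (τ - a))).hasDerivAt.comp τ h1
      rwa [mul_comm] at this
    exact ((key s).sub (key t)).deriv
  have hint : ∀ h a, 0 < h → 0 ≤ a → IntegrableOn
      (fun τ => h⁻¹ * deriv Real.smoothTransition (h⁻¹ * (τ - a)) * G τ) (Ioi 0) := by
    intro h a hh ha
    refine (Continuous.integrable_of_hasCompactSupport ?_ ?_).integrableOn
    · have := continuous_deriv_smoothTransition
      fun_prop
    · refine HasCompactSupport.intro (K := Icc a (a + h)) isCompact_Icc fun τ hτ => ?_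
      rw [deriv_smoothTransition_of_notMem, mul_zero, zero_mul]
      intro hmem
      refine hτ ⟨?_, ?_⟩
      · have := hmem.1
        rw [inv_mul_eq_div, le_div_iff₀ hh] at this
        linarith
      · have := hmem.2
        rw [inv_mul_eq_div, div_le_iff₀ hh] at this
        linarith
  have hbound : ∀ h, 0 < h →
      |(∫ x in Icc (0 : ℝ) 1, deriv Real.smoothTransition x * G (t + h * x)) -
        ∫ x in Icc (0 : ℝ) 1, deriv Real.smoothTransition x * G (s + h * x)| ≤
      C * (t + h - s) := by
    intro h' hh
    have hsupp : tsupport (η h') ⊆ Icc s (t + h') :=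
      closure_minimal (fun τ hτ => by
        by_contra hc
        exact hτ (hη0 h' hh τ hc)) isClosed_Icc
    have h1 := h (η h') (hηd h') (HasCompactSupport.intro isCompact_Icc (hη0 h' hh))
      (hsupp.trans fun τ hτ => hs.trans_le hτ.1)
    simp only [hder, sub_mul] at h1
    rw [integral_sub (hint h' s hh hs.le) (hint h' t hh (hs.le.trans hst)),
      integral_deriv_smoothTransition_mul G hs.le hh,
      integral_deriv_smoothTransition_mul G (hs.le.trans hst) hh, neg_sub] at h1
    rw [h1, ← Real.norm_eq_abs]
    have h2 : IntegrableOn (fun τ => (Icc s (t + h')).indicator (fun _ => C) τ) (Ioi 0) :=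
      ((integrable_indicator_iff measurableSet_Icc).2 (by simp)).integrableOn
    refine (norm_integral_le_of_norm_le h2 ?_).trans ?_
    · filter_upwards [ae_restrict_mem measurableSet_Ioi] with τ hτ
      rw [norm_mul, Real.norm_eq_abs, Real.norm_eq_abs]
      by_cases hm : τ ∈ Icc s (t + h')
      · rw [indicator_of_mem hm]
        calc _ ≤ 1 * C := by
              gcongr
              exacts [hη1 h' hh τ, hf τ hτ]
          _ = C := one_mul C
      · rw [indicator_of_notMem hm, hη0 h' hh τ hm, abs_zero, zero_mul]
    · rw [integral_indicator measurableSet_Icc, Measure.restrict_restrict measurableSet_Icc,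
        inter_eq_left.2 (fun τ hτ => mem_Ioi.2 (hs.trans_le hτ.1)), integral_const]
      simp only [measureReal_restrict_apply_univ, Real.volume_real_Icc, smul_eq_mul]
      rw [max_eq_left (by linarith), mul_comm]
  have hl := ((tendsto_integral_deriv_smoothTransition hG t).sub
    (tendsto_integral_deriv_smoothTransition hG s)).abs
  have hr : Tendsto (fun h => C * (t + h - s)) (𝓝[>] 0) (𝓝 (C * (t - s))) := by
    have : Continuous fun h => C * (t + h - s) := by fun_prop
    have := this.tendsto 0
    rw [add_zero] at this
    exact this.mono_left nhdsWithin_le_nhds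
  exact le_of_tendsto_of_tendsto hl hr (eventually_mem_nhdsWithin.mono fun h hh => hbound h hh)

/-- The product test function `η(t) ψ(x)`. -/
def prodTF (η : ℝ → ℝ) (hη : ContDiff ℝ ∞ η) (hc : HasCompactSupport η) (hs : tsupport η ⊆ Ioi 0)
    (ψ : TF) : STF where
  toFun p := η p.1 * ψ p.2
  contDiff' := (hη.comp contDiff_fst).mul (ψ.contDiff.comp contDiff_snd)
  hasCompactSupport' := by
    refine HasCompactSupport.intro (K := tsupport η ×ˢ tsupport ψ)
      (hc.isCompact.prod ψ.hasCompactSupport.isCompact) fun p hp => ?_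
    rw [mem_prod, not_and_or] at hp
    rcases hp with hp | hp
    · rw [image_eq_zero_of_notMem_tsupport hp, zero_mul]
    · rw [image_eq_zero_of_notMem_tsupport hp, mul_zero]
  tsupport_subset' := by
    have : tsupport (fun p : ℝ × E3 => η p.1 * ψ p.2) ⊆ tsupport η ×ˢ univ := by
      refine closure_minimal (fun p hp => ⟨?_, mem_univ _⟩)
        ((isClosed_tsupport η).prod isClosed_univ)
      by_contra hc
      exact hp (by simp only [image_eq_zero_of_notMem_tsupport hc, zero_mul])
    exact this.trans (prod_mono hs subset_rfl)

section

variable (η : ℝ → ℝ) (hη : ContDiff ℝ ∞ η) (hc : HasCompactSupport η) (hs : tsupport η ⊆ Ioi 0)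
  (ψ : TF)

theorem slice_prodTF (t : ℝ) : slice (prodTF η hη hc hs ψ) t = η t • ψ := rfl

theorem slice_dt_prodTF (t : ℝ) :
    slice (∂_{((1 : ℝ), (0 : E3))} (prodTF η hη hc hs ψ)) t = deriv η t • ψ := by
  ext x
  refine (hasDerivAt_slice_apply (prodTF η hη hc hs ψ) x t).unique ?_
  exact ((hη.differentiable (by simp) t).hasDerivAt).mul_const (ψ x)

end

/-- A bounded weakly continuous curve is Lipschitz when tested, if its distributional derivative is
bounded when tested. -/
theorem lipschitz_of_weak {v : ℝ → L2Field} (hv : WeaklyContinuous v) {i : Fin 3} {ψ : TF}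
    {R : TF → ℝ → ℝ} (hR : ∀ (c : ℝ) t, R (c • ψ) t = c * R ψ t) {C : ℝ}
    (hC : ∀ t, 0 < t → |R ψ t| ≤ C)
    (h : ∀ φ : STF, -∫ t in Ioi (0 : ℝ), inner ℝ (testField i
      (slice (∂_{((1 : ℝ), (0 : E3))} φ) t)) (v t) = ∫ t in Ioi (0 : ℝ), R (slice φ t) t)
    {s t : ℝ} (hs : 0 ≤ s) (ht : 0 ≤ t) :
    |inner ℝ (testField i ψ) (v t) - inner ℝ (testField i ψ) (v s)| ≤ C * |t - s| := by
  set G : ℝ → ℝ := fun t => inner ℝ (testField i ψ) (v (max t 0)) with hGdef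
  have hG : Continuous G := continuous_iff_continuousAt.2 fun t => hv.WT_max t (testField i ψ)
  have hGe : ∀ t, 0 ≤ t → G t = inner ℝ (testField i ψ) (v t) := fun t ht => by
    rw [hGdef]; simp only [max_eq_left ht]
  have key : ∀ η : ℝ → ℝ, ContDiff ℝ ∞ η → HasCompactSupport η → tsupport η ⊆ Ioi 0 →
      -∫ t in Ioi (0 : ℝ), deriv η t * G t = ∫ t in Ioi (0 : ℝ), η t * R ψ t := by
    intro η hη hc hs
    have := h (prodTF η hη hc hs ψ)
    simp only [slice_dt_prodTF, slice_prodTF, hR, testField_smul, real_inner_smul_left] at this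
    rw [← this]
    congr 1
    refine setIntegral_congr_fun measurableSet_Ioi fun t ht => ?_
    beta_reduce
    rw [hGe t (le_of_lt ht)]
  have main : ∀ s t, 0 < s → s ≤ t → |G t - G s| ≤ C * (t - s) := fun s t hs hst =>
    abs_sub_le_of_distribution hG hC key hs hst
  -- The initial time is reached by shifting both times by `h > 0` and using continuity.
  have main' : ∀ s t, 0 ≤ s → s ≤ t → |G t - G s| ≤ C * (t - s) := by
    intro s t hs hst
    have e1 : Tendsto (fun h => |G (t + h) - G (s + h)|) (𝓝[>] 0) (𝓝 |G t - G s|) := by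
      have : Continuous fun h => |G (t + h) - G (s + h)| := by fun_prop
      have := this.tendsto 0
      simp only [add_zero] at this
      exact this.mono_left nhdsWithin_le_nhds
    refine le_of_tendsto e1 (eventually_mem_nhdsWithin.mono fun h hh => ?_)
    have := main (s + h) (t + h) (by have : 0 < h := hh; linarith) (by linarith)
    rwa [add_sub_add_right_eq_sub] at this
  rw [← hGe t ht, ← hGe s hs]
  rcases le_total s t with hst | hst
  · rw [abs_of_nonneg (sub_nonneg.2 hst)]
    exact main' s t hs hst
  · rw [abs_sub_comm, abs_sub_comm t s, abs_of_nonneg (sub_nonneg.2 hst)]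
    exact main' t s ht hst

/-- A curve that satisfies an evolution equation when tested satisfies it in the sense of
distributions. -/
theorem weak_of_hasDerivAt {v : ℝ → L2Field} (hv : BoundedWeaklyContinuous v) {i : Fin 3}
    {R : TF → ℝ → ℝ} (hR : ∀ ψ t, 0 < t →
      HasDerivAt (fun t => inner ℝ (testField i ψ) (v t)) (R ψ t) t) (φ : STF)
    (hint : IntegrableOn (fun t => R (slice φ t) t) (Ioi 0)) :
    -∫ t in Ioi (0 : ℝ), inner ℝ (testField i
      (slice (∂_{((1 : ℝ), (0 : E3))} φ) t)) (v t) = ∫ t in Ioi (0 : ℝ), R (slice φ t) t := by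
  obtain ⟨M, hM⟩ := hv.bounded
  obtain ⟨a, b, ha, hab, h0⟩ := exists_slice_eq_zero φ
  have hder : ∀ t ∈ Ioi (0 : ℝ), HasDerivAt (fun t => inner ℝ (testField i (slice φ t)) (v t))
      (inner ℝ (testField i (slice (∂_{((1 : ℝ), (0 : E3))} φ) t)) (v t) + R (slice φ t) t) t := by
    intro t ht
    have h1 := hR (slice φ t) t ht
    -- The curve `v` need not be differentiable in norm, so the product rule is split by hand: the
    -- difference quotient of the test field converges strongly while `v` is bounded and weakly
    -- continuous.
    have h2 : HasDerivAt (fun τ => inner ℝ (testField i (slice φ τ) - testField i (slice φ t))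
        (v τ)) (inner ℝ (testField i (slice (∂_{((1 : ℝ), (0 : E3))} φ) t)) (v t)) t := by
      rw [hasDerivAt_iff_tendsto_slope]
      have h3 := hasDerivAt_iff_tendsto_slope.1 (hasDerivAt_testField_slice i φ t)
      have h4 : WT (𝓝[≠] t) v (v t) := fun w =>
        ((hv.weaklyContinuous w t (mem_Ici.2 (le_of_lt ht))).continuousAt (Ici_mem_nhds ht)).tendsto.mono_left
          nhdsWithin_le_nhds
      have h5 : ∀ᶠ τ in 𝓝[≠] t, ‖v τ‖ ≤ M :=
        nhdsWithin_le_nhds ((lt_mem_nhds ht).mono fun τ hτ => hM τ (le_of_lt hτ))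
      refine (h4.inner_tendsto h5 h3).congr fun τ => ?_
      simp only [slope_def_module, sub_self, inner_zero_left, sub_zero, real_inner_smul_left,
        smul_eq_mul]
    refine (h2.add h1).congr_of_eventuallyEq (Eventually.of_forall fun τ => ?_)
    simp only [Pi.add_apply, inner_sub_left, sub_add_cancel]
  have hi1 := integrableOn_inner_slice hv i (∂_{((1 : ℝ), (0 : E3))} φ)
  have hz : ∀ t, t ∉ Icc a b → inner ℝ (testField i (slice φ t)) (v t) = 0 := by
    intro t ht
    rw [h0 t ht, show testField i 0 = 0 from map_zero (testFieldL i), inner_zero_left]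
  have hlim : Tendsto (fun t => inner ℝ (testField i (slice φ t)) (v t)) atTop (𝓝 0) :=
    tendsto_const_nhds.congr' ((eventually_gt_atTop b).mono fun t ht =>
      (hz t fun h => ht.not_ge h.2).symm)
  have hc0 : ContinuousWithinAt (fun t => inner ℝ (testField i (slice φ t)) (v t)) (Ici 0) 0 := by
    refine ContinuousAt.continuousWithinAt ?_
    refine (continuousAt_const (y := (0 : ℝ))).congr ?_
    filter_upwards [gt_mem_nhds ha] with t ht
    exact (hz t fun h => ht.not_ge h.1).symm
  have := integral_Ioi_of_hasDerivAt_of_tendsto hc0 hder (hi1.add hint) hlim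
  rw [integral_add hi1 hint, hz 0 fun h => ha.not_ge h.1, sub_zero] at this
  linarith

/-! ### Dissipative ordinary differential equations -/

/-- Lipschitz continuity on bounded sets. -/
def LocLip {E E' : Type*} [SeminormedAddCommGroup E] [SeminormedAddCommGroup E'] (f : E → E') :
    Prop :=
  ∀ a : ℝ, ∃ K : ℝ, 0 ≤ K ∧ ∀ x y, ‖x‖ ≤ a → ‖y‖ ≤ a → ‖f x - f y‖ ≤ K * ‖x - y‖

set_option linter.unusedSectionVars false

section LocLip

variable {E E₁ E₂ E₃ : Type*} [NormedAddCommGroup E] [NormedSpace ℝ E] [NormedAddCommGroup E₁]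
  [NormedSpace ℝ E₁] [NormedAddCommGroup E₂] [NormedSpace ℝ E₂] [NormedAddCommGroup E₃]
  [NormedSpace ℝ E₃]

theorem LocLip.clm (A : E →L[ℝ] E₁) : LocLip A := fun _ =>
  ⟨‖A‖, norm_nonneg _, fun x y _ _ => by rw [← map_sub]; exact A.le_opNorm _⟩

theorem LocLip.add {f g : E → E₁} (hf : LocLip f) (hg : LocLip g) : LocLip fun x => f x + g x := by
  intro a
  obtain ⟨K, hK0, hK⟩ := hf a
  obtain ⟨L, hL0, hL⟩ := hg a
  refine ⟨K + L, by positivity, fun x y hx hy => ?_⟩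
  rw [add_sub_add_comm, add_mul]
  exact (norm_add_le _ _).trans (add_le_add (hK x y hx hy) (hL x y hx hy))

theorem LocLip.clm_comp {f : E → E₁} (hf : LocLip f) (A : E₁ →L[ℝ] E₂) :
    LocLip fun x => A (f x) := by
  intro a
  obtain ⟨K, hK0, hK⟩ := hf a
  refine ⟨‖A‖ * K, by positivity, fun x y hx hy => ?_⟩
  rw [← map_sub, mul_assoc]
  exact (A.le_opNorm _).trans (by gcongr; exact hK x y hx hy)

theorem LocLip.neg {f : E → E₁} (hf : LocLip f) : LocLip fun x => -f x := by
  simpa using hf.clm_comp (-ContinuousLinearMap.id ℝ E₁)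

theorem LocLip.sum {ι : Type*} (s : Finset ι) {f : ι → E → E₁} (hf : ∀ i, LocLip (f i)) :
    LocLip fun x => ∑ i ∈ s, f i x := by
  classical
  induction s using Finset.induction_on with
  | empty => exact fun _ => ⟨0, le_rfl, by simp⟩
  | insert i s hi ih => simpa only [Finset.sum_insert hi] using (hf i).add ih

theorem LocLip.prodMk {f : E → E₁} {g : E → E₂} (hf : LocLip f) (hg : LocLip g) :
    LocLip fun x => (f x, g x) := by
  intro a
  obtain ⟨K, hK0, hK⟩ := hf a
  obtain ⟨L, hL0, hL⟩ := hg a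
  refine ⟨max K L, le_max_of_le_left hK0, fun x y hx hy => ?_⟩
  rw [Prod.mk_sub_mk, Prod.norm_mk, max_le_iff]
  exact ⟨(hK x y hx hy).trans (by gcongr; exact le_max_left _ _),
    (hL x y hx hy).trans (by gcongr; exact le_max_right _ _)⟩

theorem LocLip.norm_le {f : E → E₁} (hf : LocLip f) (a : ℝ) :
    ∃ C, 0 ≤ C ∧ ∀ x, ‖x‖ ≤ a → ‖f x‖ ≤ C := by
  rcases lt_or_ge a 0 with ha | ha
  · exact ⟨0, le_rfl, fun x hx => absurd (norm_nonneg x) (by linarith)⟩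
  obtain ⟨K, hK0, hK⟩ := hf a
  refine ⟨‖f 0‖ + K * a, by positivity, fun x hx => ?_⟩
  have h1 := hK x 0 hx (by simpa using ha)
  rw [sub_zero] at h1
  have h2 := norm_le_norm_add_norm_sub (f 0) (f x)
  rw [norm_sub_rev] at h2
  have h3 : K * ‖x‖ ≤ K * a := by gcongr
  linarith

theorem LocLip.bilin {f : E → E₁} {g : E → E₂} (hf : LocLip f) (hg : LocLip g)
    (B : E₁ →L[ℝ] E₂ →L[ℝ] E₃) : LocLip fun x => B (f x) (g x) := by
  intro a
  obtain ⟨K, hK0, hK⟩ := hf a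
  obtain ⟨L, hL0, hL⟩ := hg a
  obtain ⟨C, hC0, hC⟩ := hf.norm_le a
  obtain ⟨D, hD0, hD⟩ := hg.norm_le a
  refine ⟨‖B‖ * K * D + ‖B‖ * C * L, by positivity, fun x y hx hy => ?_⟩
  have h : B (f x) (g x) - B (f y) (g y) = B (f x - f y) (g x) + B (f y) (g x - g y) := by
    simp only [map_sub, sub_apply]
    abel
  rw [h]
  refine (norm_add_le _ _).trans ?_
  have h1 : ‖B (f x - f y) (g x)‖ ≤ ‖B‖ * (K * ‖x - y‖) * D :=
    (B.le_opNorm₂ _ _).trans (by gcongr; exacts [hK x y hx hy, hD x hx])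
  have h2 : ‖B (f y) (g x - g y)‖ ≤ ‖B‖ * C * (L * ‖x - y‖) :=
    (B.le_opNorm₂ _ _).trans (by gcongr; exacts [hC y hy, hL x y hx hy])
  linarith

theorem LocLip.cutoff (R : ℝ) : LocLip fun x : E => max 0 (min 1 (R + 1 - ‖x‖)) := by
  intro a
  refine ⟨1, zero_le_one, fun x y _ _ => ?_⟩
  rw [one_mul, Real.norm_eq_abs]
  refine (abs_max_sub_max_le_max _ _ _ _).trans ?_
  rw [sub_self, abs_zero, max_eq_right (abs_nonneg _)]
  refine (abs_min_sub_min_le_max _ _ _ _).trans ?_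
  rw [sub_self, abs_zero, max_eq_right (abs_nonneg _), sub_sub_sub_cancel_left, abs_sub_comm]
  exact abs_norm_sub_norm_le x y

/-- Global existence for ordinary differential equations with a cut-off vector field. -/
theorem LocLip.exists_ode_cutoff [CompleteSpace E] {F : E → E} (hF : LocLip F) (R : ℝ) (z₀ : E)
    {T : ℝ} (hT : 0 < T) : ∃ z : ℝ → E, z 0 = z₀ ∧ ∀ t ∈ Icc 0 T,
      HasDerivWithinAt z (max 0 (min 1 (R + 1 - ‖z t‖)) • F (z t)) (Icc 0 T) t := by
  set G : E → E := fun x => max 0 (min 1 (R + 1 - ‖x‖)) • F x with hGdef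
  have hG : LocLip G := (LocLip.cutoff R).bilin hF (ContinuousLinearMap.lsmul ℝ ℝ)
  obtain ⟨C, hC0, hC⟩ := hF.norm_le (R + 1)
  have hb : ∀ x, ‖G x‖ ≤ C := by
    intro x
    -- The cut-off vanishes beyond radius `R + 1`, so the truncated field is globally bounded by its
    -- bound `C` on that ball.
    rcases le_or_gt ‖x‖ (R + 1) with hx | hx
    · rw [hGdef, norm_smul, Real.norm_eq_abs]
      have h1 : |max 0 (min 1 (R + 1 - ‖x‖))| ≤ 1 := by
        rw [abs_of_nonneg (le_max_left _ _)]
        exact max_le zero_le_one (min_le_left _ _)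
      calc _ ≤ 1 * C := by gcongr; exact hC x hx
        _ = C := one_mul C
    · have : max 0 (min 1 (R + 1 - ‖x‖)) = 0 := max_eq_left ((min_le_right _ _).trans (by linarith))
      rw [hGdef]
      simp only [this, zero_smul, norm_zero, hC0]
  -- With speed at most `C`, solutions cannot leave the ball of radius `C T` about `z₀` before time
  -- `T`; a Lipschitz constant there covers the whole interval at once.
  obtain ⟨K, hK0, hK⟩ := hG (‖z₀‖ + C * T)
  have hp : IsPicardLindelof (fun _ => G) (tmin := 0) (tmax := T) ⟨0, ⟨le_rfl, hT.le⟩⟩ z₀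
      (C * T).toNNReal 0 C.toNNReal K.toNNReal := by
    refine IsPicardLindelof.of_time_independent (fun x _ => ?_) ?_ ?_
    · rw [Real.coe_toNNReal _ hC0]
      exact hb x
    · refine LipschitzOnWith.of_dist_le_mul fun x hx y hy => ?_
      rw [Real.coe_toNNReal _ hK0, dist_eq_norm, dist_eq_norm]
      have hn : ∀ x ∈ Metric.closedBall z₀ ((C * T).toNNReal : ℝ), ‖x‖ ≤ ‖z₀‖ + C * T := by
        intro x hx
        rw [Metric.mem_closedBall, Real.coe_toNNReal _ (by positivity), dist_eq_norm] at hx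
        have := norm_le_norm_add_norm_sub z₀ x
        rw [norm_sub_rev] at this
        linarith
      exact hK x y (hn x hx) (hn y hy)
    · rw [Real.coe_toNNReal _ hC0, Real.coe_toNNReal _ (by positivity)]
      simp [hT.le]
  exact hp.exists_eq_forall_mem_Icc_hasDerivWithinAt₀

end LocLip

/-- A dissipative ordinary differential equation in a product of Hilbert spaces has global
solutions. -/
theorem exists_ode_of_dissipative {H H' : Type*} [NormedAddCommGroup H] [InnerProductSpace ℝ H]
    [CompleteSpace H] [NormedAddCommGroup H'] [InnerProductSpace ℝ H'] [CompleteSpace H']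
    {F : H × H' → H × H'} (hF : LocLip F)
    (hd : ∀ z, inner ℝ z.1 (F z).1 + inner ℝ z.2 (F z).2 ≤ 0) (z₀ : H × H') {T : ℝ} (hT : 0 < T) :
    ∃ z : ℝ → H × H', z 0 = z₀ ∧ ∀ t ∈ Icc 0 T, HasDerivWithinAt z (F (z t)) (Icc 0 T) t := by
  -- The Hilbert norm of the data. It dominates the sup norm of the product, in terms of which the
  -- cut-off is written.
  set R := √(‖z₀.1‖ ^ 2 + ‖z₀.2‖ ^ 2) with hR
  obtain ⟨z, hz0, hz⟩ := hF.exists_ode_cutoff R z₀ hT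
  refine ⟨z, hz0, fun t ht => ?_⟩
  have hder : ∀ t ∈ Icc 0 T, HasDerivWithinAt (fun t => ‖(z t).1‖ ^ 2 + ‖(z t).2‖ ^ 2)
      (2 * inner ℝ (z t).1 (max 0 (min 1 (R + 1 - ‖z t‖)) • (F (z t)).1) +
        2 * inner ℝ (z t).2 (max 0 (min 1 (R + 1 - ‖z t‖)) • (F (z t)).2)) (Icc 0 T) t := by
    intro t ht
    have h1 : HasDerivWithinAt (fun t => (z t).1) (max 0 (min 1 (R + 1 - ‖z t‖)) • (F (z t)).1)
        (Icc 0 T) t :=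
      (ContinuousLinearMap.fst ℝ H H').hasFDerivAt.comp_hasDerivWithinAt t (hz t ht)
    have h2 : HasDerivWithinAt (fun t => (z t).2) (max 0 (min 1 (R + 1 - ‖z t‖)) • (F (z t)).2)
        (Icc 0 T) t :=
      (ContinuousLinearMap.snd ℝ H H').hasFDerivAt.comp_hasDerivWithinAt t (hz t ht)
    exact h1.norm_sq.add h2.norm_sq
  -- Multiplying the field by the nonnegative cut-off preserves dissipativity. Thus the Hilbert norm
  -- never exceeds `R` and the cut-off is never active.
  have hanti : AntitoneOn (fun t => ‖(z t).1‖ ^ 2 + ‖(z t).2‖ ^ 2) (Icc 0 T) := by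
    refine antitoneOn_of_hasDerivWithinAt_nonpos (convex_Icc 0 T)
      (fun t ht => (hder t ht).continuousWithinAt)
      (fun t ht => (hder t (interior_subset ht)).mono interior_subset) fun t _ => ?_
    rw [real_inner_smul_right, real_inner_smul_right, ← mul_add, ← mul_add]
    exact mul_nonpos_of_nonneg_of_nonpos zero_le_two
      (mul_nonpos_of_nonneg_of_nonpos (le_max_left _ _) (hd _))
  have hle : ‖z t‖ ≤ R := by
    have h1 := hanti (left_mem_Icc.2 hT.le) ht ht.1
    simp only [hz0] at h1
    rw [Prod.norm_def, max_le_iff]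
    exact ⟨Real.le_sqrt_of_sq_le (by nlinarith [sq_nonneg ‖(z t).2‖]),
      Real.le_sqrt_of_sq_le (by nlinarith [sq_nonneg ‖(z t).1‖])⟩
  have h1 : max 0 (min 1 (R + 1 - ‖z t‖)) = 1 := by
    rw [min_eq_left (by linarith), max_eq_right zero_le_one]
  have := hz t ht
  rwa [h1, one_smul] at this

/-! ### The regularised system -/

namespace MollifierKernel

variable (θ : MollifierKernel) {ε : ℝ} (hε : ε ≠ 0) (μ χ γ κ δ : ℝ)

/-- The regularised transport term. -/
def transportS (u v : L2Field) : L2Field :=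
  ∑ j, θ.D j δ (mulL (θ.mol ε hε j (leray u)) (θ.S δ v))

/-- The linear part of the regularised velocity equation. -/
def linUS (u w : L2Field) : L2Field :=
  (μ + χ) • θ.lapS δ (leray u) + (2 * χ) • θ.S δ (θ.curlS δ w)

/-- The linear part of the regularised microrotation equation. -/
def linWS (u w : L2Field) : L2Field :=
  γ • θ.lapS δ w + κ • θ.gradDivS δ w + (2 * χ) • θ.S δ (θ.curlS δ (leray u)) -
    (4 * χ) • θ.S δ (θ.S δ w)

/-- The right-hand side of the regularised system. -/
def field (z : L2Field × L2Field) : L2Field × L2Field :=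
  (θ.linUS μ χ δ z.1 z.2 - leray (θ.transportS hε δ z.1 (leray z.1)),
    θ.linWS χ γ κ δ z.1 z.2 - θ.transportS hε δ z.1 z.2)

theorem locLip_transportS {f g : L2Field × L2Field → L2Field} (hf : LocLip f) (hg : LocLip g) :
    LocLip fun z => θ.transportS hε δ (f z) (g z) := by
  unfold transportS
  refine LocLip.sum _ fun j => LocLip.clm_comp ?_ (θ.D j δ)
  exact ((hf.clm_comp leray).clm_comp (θ.mol ε hε j)).bilin (hg.clm_comp (θ.S δ)) mulL

theorem locLip_fst : LocLip (Prod.fst : L2Field × L2Field → L2Field) :=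
  LocLip.clm (ContinuousLinearMap.fst ℝ L2Field L2Field)

theorem locLip_snd : LocLip (Prod.snd : L2Field × L2Field → L2Field) :=
  LocLip.clm (ContinuousLinearMap.snd ℝ L2Field L2Field)

theorem locLip_field : LocLip (θ.field hε μ χ γ κ δ) := by
  have smul : ∀ (c : ℝ) {f : L2Field × L2Field → L2Field}, LocLip f → LocLip fun z => c • f z :=
    fun c f hf => hf.clm_comp (c • ContinuousLinearMap.id ℝ L2Field)
  have h1 := locLip_fst
  have h2 := locLip_snd
  have hu := h1.clm_comp leray
  refine LocLip.prodMk ?_ ?_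
  · simp only [linUS, sub_eq_add_neg]
    exact ((smul _ (hu.clm_comp (θ.lapS δ))).add
      (smul _ ((h2.clm_comp (θ.curlS δ)).clm_comp (θ.S δ)))).add
      ((θ.locLip_transportS hε δ h1 hu).clm_comp leray).neg
  · simp only [linWS, sub_eq_add_neg]
    exact ((((smul _ (h2.clm_comp (θ.lapS δ))).add (smul _ (h2.clm_comp (θ.gradDivS δ)))).add
      (smul _ ((hu.clm_comp (θ.curlS δ)).clm_comp (θ.S δ)))).add
      (smul _ ((h2.clm_comp (θ.S δ)).clm_comp (θ.S δ))).neg).add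
      (θ.locLip_transportS hε δ h1 h2).neg

theorem S_curlS (v : L2Field) : θ.S δ (θ.curlS δ v) = θ.curlS δ (θ.S δ v) := by
  rw [curlS_apply, curlS_apply, map_sum]
  refine Finset.sum_congr rfl fun j _ => ?_
  rw [← θ.clm_S δ (trans_cross j), θ.S_D]

/-- The form `D_j (b_j S v)` of the regularised transport is chosen for this: moving `D_j` onto `v`
leaves the skew expression `∑ ⟨S v, b_j D_j v⟩`. Applying `ℙ` to the advecting field makes `b`
divergence-free for arbitrary `u`. -/
theorem inner_transportS {δ : ℝ} (hδ : δ ≠ 0) (u v : L2Field) :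
    inner ℝ v (θ.transportS hε δ u v) = 0 := by
  have h := θ.sum_inner_skew (θ.ktf ε hε) (leray_mem u) hδ v
  unfold transportS
  rw [inner_sum]
  have h2 : ∀ j, inner ℝ v (θ.D j δ (mulL (θ.mol ε hε j (leray u)) (θ.S δ v))) =
      -inner ℝ (θ.S δ v) (mulL (θ.mol ε hε j (leray u)) (θ.D j δ v)) := by
    intro j
    rw [real_inner_comm, inner_D, neg_inj, inner_mulL]
  rw [Finset.sum_congr rfl fun j _ => h2 j, Finset.sum_neg_distrib, neg_eq_zero]
  exact h

theorem D_mem (j : Fin 3) (δ : ℝ) {v : L2Field} (hv : v ∈ L2sigma) : θ.D j δ v ∈ L2sigma := by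
  rw [D_apply]
  exact L2sigma.smul_mem _ (cv_mem_L2sigma _ _ hv)

theorem S_mem (δ : ℝ) {v : L2Field} (hv : v ∈ L2sigma) : θ.S δ v ∈ L2sigma := by
  rw [← leray_of_mem hv, ← leray_S]
  exact leray_mem _

theorem lapS_mem (δ : ℝ) {v : L2Field} (hv : v ∈ L2sigma) : θ.lapS δ v ∈ L2sigma := by
  rw [lapS_apply]
  exact L2sigma.sum_mem fun j _ => θ.D_mem j δ (θ.D_mem j δ hv)

theorem curlS_mem {δ : ℝ} (hδ : δ ≠ 0) (v : L2Field) : θ.curlS δ v ∈ L2sigma := by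
  intro φ
  rw [divPairing_eq, neg_eq_zero, Finset.sum_congr rfl fun j _ =>
    θ.firstOrder_curlS.adj hδ j (∂_{e j} φ) v, ← sum_inner, ← map_sum]
  have h : ∑ j, curlT j (∂_{e j} φ) = 0 := by
    simp only [curlT, Fin.sum_univ_three]
    rw [show ((1 : Fin 3) + 2) = 0 from rfl, show ((2 : Fin 3) + 2) = 1 from rfl,
      show ((2 : Fin 3) + 1) = 0 from rfl, show ((1 : Fin 3) + 1) = 2 from rfl,
      show ((0 : Fin 3) + 1) = 1 from rfl, show ((0 : Fin 3) + 2) = 2 from rfl,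
      lineDeriv_comm φ (e 2) (e 0), lineDeriv_comm φ (e 1) (e 0), lineDeriv_comm φ (e 2) (e 1)]
    abel
  rw [h, map_zero, inner_zero_left]

theorem inner_leray_of_mem (v : L2Field) {w : L2Field} (hw : w ∈ L2sigma) :
    inner ℝ v w = inner ℝ (leray v) w := by
  rw [inner_leray, leray_of_mem hw]

/-- The dissipation of the regularised system. -/
def dissS (u w : L2Field) : ℝ :=
  μ * ∑ j, ‖θ.D j δ u‖ ^ 2 + γ * ∑ j, ‖θ.D j δ w‖ ^ 2 + κ * ‖θ.divS δ w‖ ^ 2 +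
    χ * ‖θ.curlS δ u - θ.S δ ((2 : ℝ) • w)‖ ^ 2

theorem dissS_nonneg {μ χ γ κ : ℝ} (hμ : 0 ≤ μ) (hχ : 0 ≤ χ) (hγ : 0 ≤ γ) (hκ : 0 ≤ κ)
    (u w : L2Field) : 0 ≤ θ.dissS μ χ γ κ δ u w := by
  unfold dissS
  positivity

theorem _root_.Micropolar.inner_smul_add_smul_add_smul_sub_smul {H : Type*}
    [NormedAddCommGroup H] [InnerProductSpace ℝ H] {u x₁ x₂ x₃ x₄ : H}
    {c₁ c₂ c₃ c₄ p₁ p₂ p₃ p₄ : ℝ} (h₁ : inner ℝ u x₁ = p₁) (h₂ : inner ℝ u x₂ = p₂)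
    (h₃ : inner ℝ u x₃ = p₃) (h₄ : inner ℝ u x₄ = p₄) :
    inner ℝ u (c₁ • x₁ + c₂ • x₂ + c₃ • x₃ - c₄ • x₄) =
      c₁ * p₁ + c₂ * p₂ + c₃ * p₃ - c₄ * p₄ := by
  rw [inner_sub_right, inner_add_right, inner_add_right, real_inner_smul_right,
    real_inner_smul_right, real_inner_smul_right, real_inner_smul_right, h₁, h₂, h₃, h₄]

theorem _root_.Micropolar.inner_smul_add_smul {H : Type*} [NormedAddCommGroup H]
    [InnerProductSpace ℝ H] {u a b : H} {c d p q : ℝ} (h1 : inner ℝ u a = p)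
    (h2 : inner ℝ u b = q) : inner ℝ u (c • a + d • b) = c * p + d * q := by
  rw [inner_add_right, real_inner_smul_right, real_inner_smul_right, h1, h2]

theorem inner_lapS_leray (δ : ℝ) (u : L2Field) :
    inner ℝ u (θ.lapS δ (leray u)) = -∑ j, ‖θ.D j δ (leray u)‖ ^ 2 := by
  have h1 := inner_leray_of_mem u (θ.lapS_mem δ (leray_mem u))
  have h2 := θ.inner_lapS δ (leray u) (leray u)
  rw [h1, real_inner_comm, h2]
  simp only [real_inner_self_eq_norm_sq]

theorem inner_S_curlS {δ : ℝ} (hδ : δ ≠ 0) (u w : L2Field) :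
    inner ℝ u (θ.S δ (θ.curlS δ w)) = inner ℝ (θ.curlS δ (leray u)) (θ.S δ w) := by
  have h1 := inner_leray_of_mem u (θ.S_mem δ (θ.curlS_mem hδ w))
  have h2 := θ.inner_curlS δ (leray u) (θ.S δ w)
  rw [h1, h2, S_curlS]

theorem inner_linUS {δ : ℝ} (hδ : δ ≠ 0) (u w : L2Field) :
    inner ℝ u (θ.linUS μ χ δ u w) = -((μ + χ) * ∑ j, ‖θ.D j δ (leray u)‖ ^ 2) +
      2 * χ * inner ℝ (θ.curlS δ (leray u)) (θ.S δ w) := by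
  have h1 := θ.inner_lapS_leray δ u
  have h2 := θ.inner_S_curlS hδ u w
  rw [linUS, inner_smul_add_smul h1 h2]
  ring

theorem inner_linWS (δ : ℝ) (u w : L2Field) :
    inner ℝ w (θ.linWS χ γ κ δ u w) = -(γ * ∑ j, ‖θ.D j δ w‖ ^ 2) - κ * ‖θ.divS δ w‖ ^ 2 +
      2 * χ * inner ℝ (θ.curlS δ (leray u)) (θ.S δ w) - 4 * χ * ‖θ.S δ w‖ ^ 2 := by
  have h1 : inner ℝ w (θ.lapS δ w) = -∑ j, ‖θ.D j δ w‖ ^ 2 := by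
    have := θ.inner_lapS δ w w
    rw [real_inner_comm, this]
    simp only [real_inner_self_eq_norm_sq]
  have h2 : inner ℝ w (θ.gradDivS δ w) = -‖θ.divS δ w‖ ^ 2 := by
    have := θ.inner_gradDivS δ w w
    rw [real_inner_comm, this, real_inner_self_eq_norm_sq]
  have h3 : inner ℝ w (θ.S δ (θ.curlS δ (leray u))) =
      inner ℝ (θ.curlS δ (leray u)) (θ.S δ w) := by
    rw [← inner_S, real_inner_comm]
  have h4 : inner ℝ w (θ.S δ (θ.S δ w)) = ‖θ.S δ w‖ ^ 2 := by
    rw [← inner_S, real_inner_self_eq_norm_sq]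
  exact (inner_smul_add_smul_add_smul_sub_smul h1 h2 h3 h4).trans (by ring)

/-- Transport contributes nothing. As `‖∇u‖ = ‖curl u‖` for divergence-free fields, the `χ` part of
the viscosity, the two coupling terms and the damping combine to `-χ ‖curl u - 2 w‖²`. -/
theorem inner_field {δ : ℝ} (hδ : δ ≠ 0) (z : L2Field × L2Field) :
    inner ℝ z.1 (θ.field hε μ χ γ κ δ z).1 + inner ℝ z.2 (θ.field hε μ χ γ κ δ z).2 =
      -θ.dissS μ χ γ κ δ (leray z.1) z.2 := by
  have h1 := θ.inner_linUS μ χ hδ z.1 z.2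
  have h2 := θ.inner_linWS χ γ κ δ z.1 z.2
  have h3 : inner ℝ z.1 (leray (θ.transportS hε δ z.1 (leray z.1))) = 0 := by
    rw [← inner_leray]
    exact θ.inner_transportS hε hδ _ _
  have h4 := θ.inner_transportS hε hδ z.1 z.2
  have h5 := θ.sum_norm_D_sq δ (leray z.1)
  rw [divS_of_mem _ _ (leray_mem _), norm_zero] at h5
  have h6 : ‖θ.curlS δ (leray z.1) - θ.S δ ((2 : ℝ) • z.2)‖ ^ 2 = ‖θ.curlS δ (leray z.1)‖ ^ 2 -
      4 * inner ℝ (θ.curlS δ (leray z.1)) (θ.S δ z.2) + 4 * ‖θ.S δ z.2‖ ^ 2 := by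
    rw [map_smul, norm_sub_sq_real, norm_smul, real_inner_smul_right]
    norm_num
    ring
  have h7 : inner ℝ z.1 (θ.field hε μ χ γ κ δ z).1 = _ - _ := (inner_sub_right _ _ _).trans
    (congrArg₂ (· - ·) h1 h3)
  have h8 : inner ℝ z.2 (θ.field hε μ χ γ κ δ z).2 = _ - _ := (inner_sub_right _ _ _).trans
    (congrArg₂ (· - ·) h2 h4)
  rw [h7, h8, dissS, h6]
  linear_combination (-χ) * h5

theorem field_fst_mem {δ : ℝ} (hδ : δ ≠ 0) (z : L2Field × L2Field) :
    (θ.field hε μ χ γ κ δ z).1 ∈ L2sigma := by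
  simp only [field, linUS]
  exact L2sigma.sub_mem (L2sigma.add_mem (L2sigma.smul_mem _ (θ.lapS_mem δ (leray_mem _)))
    (L2sigma.smul_mem _ (θ.S_mem δ (θ.curlS_mem hδ _)))) (leray_mem _)

theorem eq_of_hasDerivWithinAt_zero {E : Type*} [NormedAddCommGroup E] [NormedSpace ℝ E]
    {f : ℝ → E} {T : ℝ} (h : ∀ t ∈ Icc 0 T, HasDerivWithinAt f 0 (Icc 0 T) t) {t : ℝ}
    (ht : t ∈ Icc 0 T) : f t = f 0 := by
  refine constant_of_has_deriv_right_zero (fun s hs => (h s hs).continuousWithinAt)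
    (fun s hs => ?_) t ht
  exact (h s ⟨hs.1, hs.2.le⟩).mono_of_mem_nhdsWithin (Icc_mem_nhdsGE_of_mem hs)

/-- Solutions of the regularised system. -/
theorem exists_regularised {μ χ γ κ : ℝ} (hμ : 0 ≤ μ) (hχ : 0 ≤ χ) (hγ : 0 ≤ γ) (hκ : 0 ≤ κ)
    {δ : ℝ} (hδ : δ ≠ 0) {u₀ : L2Field} (hu₀ : u₀ ∈ L2sigma) (w₀ : L2Field) {T : ℝ}
    (hT : 0 < T) : ∃ u w : ℝ → L2Field, u 0 = u₀ ∧ w 0 = w₀ ∧ (∀ t ∈ Icc 0 T, u t ∈ L2sigma) ∧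
      (∀ t ∈ Icc 0 T, HasDerivWithinAt u (θ.field hε μ χ γ κ δ (u t, w t)).1 (Icc 0 T) t) ∧
      (∀ t ∈ Icc 0 T, HasDerivWithinAt w (θ.field hε μ χ γ κ δ (u t, w t)).2 (Icc 0 T) t) := by
  obtain ⟨z, hz0, hz⟩ := exists_ode_of_dissipative (θ.locLip_field hε μ χ γ κ δ)
    (fun z => by
      rw [θ.inner_field hε μ χ γ κ hδ z]
      exact neg_nonpos.2 (θ.dissS_nonneg δ hμ hχ hγ hκ _ _)) (u₀, w₀) hT
  have h1 : ∀ t ∈ Icc 0 T, HasDerivWithinAt (fun t => (z t).1)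
      (θ.field hε μ χ γ κ δ (z t)).1 (Icc 0 T) t := fun t ht =>
    (ContinuousLinearMap.fst ℝ L2Field L2Field).hasFDerivAt.comp_hasDerivWithinAt t (hz t ht)
  have h2 : ∀ t ∈ Icc 0 T, HasDerivWithinAt (fun t => (z t).2)
      (θ.field hε μ χ γ κ δ (z t)).2 (Icc 0 T) t := fun t ht =>
    (ContinuousLinearMap.snd ℝ L2Field L2Field).hasFDerivAt.comp_hasDerivWithinAt t (hz t ht)
  refine ⟨fun t => (z t).1, fun t => (z t).2, by simp only [hz0], by simp only [hz0],
    fun t ht => ?_, h1, h2⟩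
  -- The velocity component of the field lies in `L²_σ`, so `ℙ u - u` is constant, and it vanishes
  -- initially.
  have h3 : ∀ t ∈ Icc 0 T, HasDerivWithinAt (fun t => leray (z t).1 - (z t).1) 0 (Icc 0 T) t := by
    intro t ht
    have h4 := (leray.hasFDerivAt.comp_hasDerivWithinAt t (h1 t ht)).sub (h1 t ht)
    rw [leray_of_mem (θ.field_fst_mem hε μ χ γ κ hδ _), sub_self] at h4
    exact h4
  have h5 := eq_of_hasDerivWithinAt_zero h3 ht
  simp only [hz0, leray_of_mem hu₀, sub_self] at h5
  rw [sub_eq_zero] at h5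
  have h6 := leray_mem (z t).1
  rwa [h5] at h6

end MollifierKernel

/-! ### The regularised system tested against smooth fields -/

theorem WT.S (θ : MollifierKernel) {ι : Type*} {l : Filter ι} {f : ι → L2Field} {a : L2Field}
    (hf : WT l f a) {M : ℝ} (hM : ∀ᶠ i in l, ‖f i‖ ≤ M) {δ : ι → ℝ} (hδ : Tendsto δ l (𝓝 0)) :
    WT l (fun i => θ.S (δ i) (f i)) a := by
  intro v
  simp only [← θ.inner_S]
  exact hf.inner_tendsto hM ((θ.tendsto_S v).comp hδ)

theorem LocLip.continuous {E E' : Type*} [SeminormedAddCommGroup E] [SeminormedAddCommGroup E']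
    {f : E → E'} (hf : LocLip f) : Continuous f := by
  refine continuous_iff_continuousAt.2 fun x => ?_
  obtain ⟨K, hK0, hK⟩ := hf (‖x‖ + 1)
  refine ContinuousWithinAt.continuousAt (s := Metric.ball x 1) ?_
    (Metric.ball_mem_nhds x one_pos)
  have : LipschitzOnWith K.toNNReal f (Metric.ball x 1) := by
    refine LipschitzOnWith.of_dist_le_mul fun y hy z hz => ?_
    rw [Real.coe_toNNReal _ hK0, dist_eq_norm, dist_eq_norm]
    have hn : ∀ y ∈ Metric.ball x 1, ‖y‖ ≤ ‖x‖ + 1 := by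
      intro y hy
      rw [mem_ball_iff_norm'] at hy
      have := norm_le_norm_add_norm_sub x y
      linarith
    exact hK y z (hn y hy) (hn z hz)
  exact this.continuousOn.continuousWithinAt (Metric.mem_ball_self one_pos)

theorem abs_linUT_le (μ χ : ℝ) (i : Fin 3) (φ : TF) {u w : L2Field} {M : ℝ} (hu : ‖u‖ ≤ M)
    (hw : ‖w‖ ≤ M) : |linUT μ χ i φ u w| ≤
      (|μ + χ| * ‖lapT i φ‖ + |2 * χ| * ‖MollifierKernel.curlT i φ‖) * M := by
  unfold linUT
  have h1 := (abs_real_inner_le_norm (lapT i φ) u).trans (by gcongr : _ ≤ ‖lapT i φ‖ * M)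
  have h2 := (abs_real_inner_le_norm (MollifierKernel.curlT i φ) w).trans
    (by gcongr : _ ≤ ‖MollifierKernel.curlT i φ‖ * M)
  calc _ ≤ |μ + χ| * (‖lapT i φ‖ * M) + |2 * χ| * (‖MollifierKernel.curlT i φ‖ * M) := by
        refine (abs_add_le _ _).trans ?_
        rw [abs_mul (μ + χ), abs_mul (2 * χ)]
        gcongr
    _ = _ := by ring

theorem abs_linWT_le (χ γ κ : ℝ) (i : Fin 3) (φ : TF) {u w : L2Field} {M : ℝ} (hu : ‖u‖ ≤ M)
    (hw : ‖w‖ ≤ M) : |linWT χ γ κ i φ u w| ≤ (|γ| * ‖lapT i φ‖ + |κ| * ‖gradDivT i φ‖ +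
      |2 * χ| * ‖MollifierKernel.curlT i φ‖ + |4 * χ| * ‖testField i φ‖) * M := by
  unfold linWT
  have h1 := (abs_real_inner_le_norm (lapT i φ) w).trans (by gcongr : _ ≤ ‖lapT i φ‖ * M)
  have h2 := (abs_real_inner_le_norm (gradDivT i φ) w).trans
    (by gcongr : _ ≤ ‖gradDivT i φ‖ * M)
  have h3 := (abs_real_inner_le_norm (MollifierKernel.curlT i φ) u).trans
    (by gcongr : _ ≤ ‖MollifierKernel.curlT i φ‖ * M)
  have h4 := (abs_real_inner_le_norm (testField i φ) w).trans (by gcongr : _ ≤ ‖testField i φ‖ * M)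
  calc _ ≤ |γ| * (‖lapT i φ‖ * M) + |κ| * (‖gradDivT i φ‖ * M) +
        |2 * χ| * (‖MollifierKernel.curlT i φ‖ * M) + |4 * χ| * (‖testField i φ‖ * M) := by
        refine (abs_sub _ _).trans ?_
        refine add_le_add ((abs_add_three _ _ _).trans ?_) ?_ <;>
        · rw [abs_mul]
          try rw [abs_mul κ, abs_mul (2 * χ)]
          gcongr
    _ = _ := by ring

theorem WT.tendsto_linUT {ι : Type*} {l : Filter ι} {f g : ι → L2Field} {a b : L2Field}
    (hf : WT l f a) (hg : WT l g b) (μ χ : ℝ) (i : Fin 3) (φ : TF) :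
    Tendsto (fun n => linUT μ χ i φ (f n) (g n)) l (𝓝 (linUT μ χ i φ a b)) :=
  ((hf _).const_mul _).add ((hg _).const_mul _)

theorem WT.tendsto_linWT {ι : Type*} {l : Filter ι} {f g : ι → L2Field} {a b : L2Field}
    (hf : WT l f a) (hg : WT l g b) (χ γ κ : ℝ) (i : Fin 3) (φ : TF) :
    Tendsto (fun n => linWT χ γ κ i φ (f n) (g n)) l (𝓝 (linWT χ γ κ i φ a b)) :=
  ((((hg _).const_mul _).add ((hg _).const_mul _)).add ((hf _).const_mul _)).sub
    ((hg _).const_mul _)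

namespace MollifierKernel

variable (θ : MollifierKernel) {ε : ℝ} (hε : ε ≠ 0) (μ χ γ κ δ : ℝ)

/-- The regularised velocity equation, tested against `φ e_i`. -/
def regU (i : Fin 3) (φ : TF) (u w : L2Field) : ℝ :=
  linUT μ χ i φ (θ.S δ (θ.S δ u)) (θ.S δ (θ.S δ w)) +
    ∑ j, inner ℝ (leray (testField i (∂_{e j} φ))) (θ.S δ (mulL (θ.mol ε hε j u) (θ.S δ u)))

/-- The regularised microrotation equation, tested against `φ e_i`. -/
def regW (i : Fin 3) (φ : TF) (u w : L2Field) : ℝ :=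
  linWT χ γ κ i φ (θ.S δ (θ.S δ u)) (θ.S δ (θ.S δ w)) +
    ∑ j, inner ℝ (testField i (∂_{e j} φ)) (θ.S δ (mulL (θ.mol ε hε j u) (θ.S δ w)))

theorem inner_testField_D_D (a b : Fin 3) {δ : ℝ} (hδ : δ ≠ 0) (i : Fin 3) (φ : TF)
    (v : L2Field) : inner ℝ (testField i φ) (θ.D a δ (θ.D b δ v)) =
      inner ℝ (testField i (∂_{e b} (∂_{e a} φ))) (θ.S δ (θ.S δ v)) := by
  have h1 := θ.inner_D a δ (testField i φ) (θ.D b δ v)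
  have h2 := θ.inner_D b δ (θ.S δ (testField i (∂_{e a} φ))) v
  have h3 := θ.inner_S δ (testField i (∂_{e b} (∂_{e a} φ))) (θ.S δ v)
  have h4 := θ.inner_S δ (θ.S δ (testField i (∂_{e b} (∂_{e a} φ)))) v
  rw [D_testField _ _ hδ] at h1
  rw [← S_D, D_testField _ _ hδ] at h2
  linarith

theorem inner_testField_lapS {δ : ℝ} (hδ : δ ≠ 0) (i : Fin 3) (φ : TF) (v : L2Field) :
    inner ℝ (testField i φ) (θ.lapS δ v) = inner ℝ (lapT i φ) (θ.S δ (θ.S δ v)) := by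
  rw [lapS_apply, lapT, inner_sum, sum_inner]
  exact Finset.sum_congr rfl fun j _ => θ.inner_testField_D_D j j hδ i φ v

theorem inner_testField_gradDivS {δ : ℝ} (hδ : δ ≠ 0) (i : Fin 3) (φ : TF) (v : L2Field) :
    inner ℝ (testField i φ) (θ.gradDivS δ v) = inner ℝ (gradDivT i φ) (θ.S δ (θ.S δ v)) := by
  rw [gradDivS_apply, gradDivT, inner_sum, sum_inner, Finset.sum_eq_single i]
  · rw [inner_sum]
    refine Finset.sum_congr rfl fun j _ => ?_
    rw [← inner_P, P_testField, if_pos rfl]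
    exact θ.inner_testField_D_D i j hδ j φ v
  · intro a _ ha
    rw [inner_sum]
    refine Finset.sum_eq_zero fun j _ => ?_
    rw [← inner_P, P_testField, if_neg ha, inner_zero_left]
  · exact fun h => absurd (Finset.mem_univ i) h

theorem inner_testField_S_curlS {δ : ℝ} (hδ : δ ≠ 0) (i : Fin 3) (φ : TF) (v : L2Field) :
    inner ℝ (testField i φ) (θ.S δ (θ.curlS δ v)) = inner ℝ (curlT i φ) (θ.S δ (θ.S δ v)) := by
  rw [S_curlS, θ.firstOrder_curlS.adj hδ]
  exact θ.inner_S δ _ _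

theorem inner_transportS_eq {u : L2Field} (hu : u ∈ L2sigma) (v ψ : L2Field) :
    inner ℝ ψ (θ.transportS hε δ u v) =
      -∑ j, inner ℝ (θ.D j δ ψ) (mulL (θ.mol ε hε j u) (θ.S δ v)) := by
  unfold transportS
  rw [leray_of_mem hu, inner_sum, ← Finset.sum_neg_distrib]
  refine Finset.sum_congr rfl fun j _ => ?_
  have h1 := θ.inner_D j δ ψ (mulL (θ.mol ε hε j u) (θ.S δ v))
  linarith

theorem inner_leray_transportS {δ : ℝ} (hδ : δ ≠ 0) (i : Fin 3) (φ : TF) {u : L2Field}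
    (hu : u ∈ L2sigma) (v : L2Field) : inner ℝ (testField i φ) (leray (θ.transportS hε δ u v)) =
      -∑ j, inner ℝ (leray (testField i (∂_{e j} φ)))
        (θ.S δ (mulL (θ.mol ε hε j u) (θ.S δ v))) := by
  have h1 : ∀ j, θ.D j δ (leray (testField i φ)) = θ.S δ (leray (testField i (∂_{e j} φ))) :=
    fun j => by rw [← leray_D, D_testField _ _ hδ, leray_S]
  have h2 := inner_leray (testField i φ) (θ.transportS hε δ u v)
  have h3 := θ.inner_transportS_eq hε δ hu v (leray (testField i φ))
  rw [← h2, h3]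
  congr 1
  refine Finset.sum_congr rfl fun j _ => ?_
  rw [h1 j]
  exact θ.inner_S δ _ _

theorem inner_transportS_testField {δ : ℝ} (hδ : δ ≠ 0) (i : Fin 3) (φ : TF) {u : L2Field}
    (hu : u ∈ L2sigma) (v : L2Field) : inner ℝ (testField i φ) (θ.transportS hε δ u v) =
      -∑ j, inner ℝ (testField i (∂_{e j} φ)) (θ.S δ (mulL (θ.mol ε hε j u) (θ.S δ v))) := by
  rw [θ.inner_transportS_eq hε δ hu v (testField i φ)]
  congr 1
  refine Finset.sum_congr rfl fun j _ => ?_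
  rw [θ.D_testField j hδ]
  exact θ.inner_S δ _ _

/-- All mollified derivatives are moved onto the test field, where they become true derivatives; no
negative power of `δ` remains. -/
theorem inner_field_fst {δ : ℝ} (hδ : δ ≠ 0) (i : Fin 3) (φ : TF) {u : L2Field}
    (hu : u ∈ L2sigma) (w : L2Field) :
    inner ℝ (testField i φ) (θ.field hε μ χ γ κ δ (u, w)).1 = θ.regU hε μ χ δ i φ u w := by
  have h1 := θ.inner_testField_lapS hδ i φ u
  have h2 := θ.inner_testField_S_curlS hδ i φ w
  have h3 := θ.inner_leray_transportS hε hδ i φ hu u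
  have h4 : inner ℝ (testField i φ) (θ.field hε μ χ γ κ δ (u, w)).1 = _ - _ :=
    inner_sub_right _ _ _
  rw [h4]
  simp only [leray_of_mem hu, linUS, h3]
  rw [inner_smul_add_smul h1 h2, regU, linUT]
  ring

theorem inner_field_snd {δ : ℝ} (hδ : δ ≠ 0) (i : Fin 3) (φ : TF) {u : L2Field}
    (hu : u ∈ L2sigma) (w : L2Field) :
    inner ℝ (testField i φ) (θ.field hε μ χ γ κ δ (u, w)).2 = θ.regW hε χ γ κ δ i φ u w := by
  have h1 := θ.inner_testField_lapS hδ i φ w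
  have h2 := θ.inner_testField_gradDivS hδ i φ w
  have h3 := θ.inner_testField_S_curlS hδ i φ u
  have h4 := θ.inner_transportS_testField hε hδ i φ hu w
  have h5 : inner ℝ (testField i φ) (θ.field hε μ χ γ κ δ (u, w)).2 = _ - _ :=
    inner_sub_right _ _ _
  have h6 : inner ℝ (testField i φ) (θ.S δ (θ.S δ w)) = inner ℝ (testField i φ) (θ.S δ (θ.S δ w)) :=
    rfl
  rw [h5]
  simp only [leray_of_mem hu, linWS, h4]
  rw [inner_smul_add_smul_add_smul_sub_smul h1 h2 h3 h6, regW, linWT]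
  ring

/-- The bound is uniform in `δ`, but `molConst` depends on `ε`; this is harmless while `ε` is fixed.
-/
theorem exists_abs_regU_le (i : Fin 3) (φ : TF) (M : ℝ) : ∃ C, ∀ δ, ∀ u w : L2Field, ‖u‖ ≤ M →
    ‖w‖ ≤ M → |θ.regU hε μ χ δ i φ u w| ≤ C := by
  refine ⟨(|μ + χ| * ‖lapT i φ‖ + |2 * χ| * ‖curlT i φ‖) * M +
    ∑ j, ‖leray (testField i (∂_{e j} φ))‖ * (θ.molConst hε * M * M), fun δ u w hu hw => ?_⟩
  have hS := fun v => (θ.norm_S_le δ (θ.S δ v)).trans (θ.norm_S_le δ v)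
  refine (abs_add_le _ _).trans (add_le_add
    (abs_linUT_le μ χ i φ ((hS u).trans hu) ((hS w).trans hw)) ?_)
  refine (Finset.abs_sum_le_sum_abs _ _).trans (Finset.sum_le_sum fun j _ => ?_)
  refine (abs_real_inner_le_norm _ _).trans ?_
  have h0 := θ.molConst_nonneg hε
  have h1 := (θ.norm_S_le δ _).trans (θ.norm_mulL_mol_le hε j u (θ.S δ u))
  have h2 := (θ.norm_S_le δ u).trans hu
  have hM : 0 ≤ M := (norm_nonneg _).trans hu
  gcongr
  exact h1.trans (by gcongr)

theorem exists_abs_regW_le (i : Fin 3) (φ : TF) (M : ℝ) : ∃ C, ∀ δ, ∀ u w : L2Field, ‖u‖ ≤ M →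
    ‖w‖ ≤ M → |θ.regW hε χ γ κ δ i φ u w| ≤ C := by
  refine ⟨(|γ| * ‖lapT i φ‖ + |κ| * ‖gradDivT i φ‖ +
      |2 * χ| * ‖curlT i φ‖ + |4 * χ| * ‖testField i φ‖) * M +
    ∑ j, ‖testField i (∂_{e j} φ)‖ * (θ.molConst hε * M * M), fun δ u w hu hw => ?_⟩
  have hS := fun v => (θ.norm_S_le δ (θ.S δ v)).trans (θ.norm_S_le δ v)
  refine (abs_add_le _ _).trans (add_le_add
    (abs_linWT_le χ γ κ i φ ((hS u).trans hu) ((hS w).trans hw)) ?_)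
  refine (Finset.abs_sum_le_sum_abs _ _).trans (Finset.sum_le_sum fun j _ => ?_)
  refine (abs_real_inner_le_norm _ _).trans ?_
  have h0 := θ.molConst_nonneg hε
  have h1 := (θ.norm_S_le δ _).trans (θ.norm_mulL_mol_le hε j u (θ.S δ w))
  have h2 := (θ.norm_S_le δ w).trans hw
  have hM : 0 ≤ M := (norm_nonneg _).trans hu
  gcongr
  exact h1.trans (by gcongr)

section Limit

variable {ι : Type*} {l : Filter ι} [l.IsCountablyGenerated] {f g : ι → L2Field} {a b : L2Field}
  {M : ℝ} {d : ι → ℝ}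

/-- The outer mollifiers are symmetric and converge strongly on test fields; the product converges
weakly because the advecting velocity is regularised at the fixed scale `ε`. -/
theorem tendsto_regU (hf : WT l f a) (hg : WT l g b) (hfM : ∀ᶠ i in l, ‖f i‖ ≤ M)
    (hgM : ∀ᶠ i in l, ‖g i‖ ≤ M) (hd : Tendsto d l (𝓝 0)) (i : Fin 3) (φ : TF) :
    Tendsto (fun n => θ.regU hε μ χ (d n) i φ (f n) (g n)) l (𝓝 (θ.rhsU hε μ χ i φ a b)) := by
  have hS : ∀ {h : ι → L2Field}, (∀ᶠ n in l, ‖h n‖ ≤ M) → ∀ᶠ n in l, ‖θ.S (d n) (h n)‖ ≤ M :=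
    fun h => h.mono fun n hn => (θ.norm_S_le _ _).trans hn
  refine (((hf.S θ hfM hd).S θ (hS hfM) hd).tendsto_linUT
    ((hg.S θ hgM hd).S θ (hS hgM) hd) μ χ i φ).add (tendsto_finsetSum _ fun j _ => ?_)
  refine (((hf.mulL_ptB hfM (hf.S θ hfM hd) (hS hfM) _)).S θ
    (M := θ.molConst hε * M * M) ?_ hd) _
  have h0 := θ.molConst_nonneg hε
  filter_upwards [hfM, hS hfM] with n h1 h2
  refine (θ.norm_mulL_mol_le hε j _ _).trans ?_
  have hM : 0 ≤ M := (norm_nonneg _).trans h1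
  gcongr

theorem tendsto_regW (hf : WT l f a) (hg : WT l g b) (hfM : ∀ᶠ i in l, ‖f i‖ ≤ M)
    (hgM : ∀ᶠ i in l, ‖g i‖ ≤ M) (hd : Tendsto d l (𝓝 0)) (i : Fin 3) (φ : TF) :
    Tendsto (fun n => θ.regW hε χ γ κ (d n) i φ (f n) (g n)) l
      (𝓝 (θ.rhsW hε χ γ κ i φ a b)) := by
  have hS : ∀ {h : ι → L2Field}, (∀ᶠ n in l, ‖h n‖ ≤ M) → ∀ᶠ n in l, ‖θ.S (d n) (h n)‖ ≤ M :=
    fun h => h.mono fun n hn => (θ.norm_S_le _ _).trans hn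
  refine (((hf.S θ hfM hd).S θ (hS hfM) hd).tendsto_linWT
    ((hg.S θ hgM hd).S θ (hS hgM) hd) χ γ κ i φ).add (tendsto_finsetSum _ fun j _ => ?_)
  refine (((hf.mulL_ptB hfM (hg.S θ hgM hd) (hS hgM) _)).S θ
    (M := θ.molConst hε * M * M) ?_ hd) _
  have h0 := θ.molConst_nonneg hε
  filter_upwards [hfM, hS hgM] with n h1 h2
  refine (θ.norm_mulL_mol_le hε j _ _).trans ?_
  have hM : 0 ≤ M := (norm_nonneg _).trans h1
  gcongr

end Limit

theorem continuousOn_rhsU {u w : ℝ → L2Field} (hu : BoundedWeaklyContinuous u)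
    (hw : BoundedWeaklyContinuous w) (i : Fin 3) (φ : TF) :
    ContinuousOn (fun t => θ.rhsU hε μ χ i φ (u t) (w t)) (Ici 0) := by
  have h1 : ContinuousOn (fun t => linUT μ χ i φ (u t) (w t)) (Ici 0) := fun t ht =>
    WT.tendsto_linUT (l := 𝓝[Ici 0] t) (fun v => hu.weaklyContinuous v t ht)
      (fun v => hw.weaklyContinuous v t ht) μ χ i φ
  refine h1.add (continuousOn_finsetSum _ fun j _ => ?_)
  exact (θ.boundedWeaklyContinuous_mulL hε hu hu j).weaklyContinuous _

theorem continuousOn_rhsW {u w : ℝ → L2Field} (hu : BoundedWeaklyContinuous u)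
    (hw : BoundedWeaklyContinuous w) (i : Fin 3) (φ : TF) :
    ContinuousOn (fun t => θ.rhsW hε χ γ κ i φ (u t) (w t)) (Ici 0) := by
  have h1 : ContinuousOn (fun t => linWT χ γ κ i φ (u t) (w t)) (Ici 0) := fun t ht =>
    WT.tendsto_linWT (l := 𝓝[Ici 0] t) (fun v => hu.weaklyContinuous v t ht)
      (fun v => hw.weaklyContinuous v t ht) χ γ κ i φ
  refine h1.add (continuousOn_finsetSum _ fun j _ => ?_)
  exact (θ.boundedWeaklyContinuous_mulL hε hu hw j).weaklyContinuous _

theorem integrableOn_rhsU {u w : ℝ → L2Field} (hu : BoundedWeaklyContinuous u)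
    (hw : BoundedWeaklyContinuous w) (i : Fin 3) (φ : STF) :
    IntegrableOn (fun t => θ.rhsU hε μ χ i (slice φ t) (u t) (w t)) (Ioi 0) :=
  (linU_eq hu hw μ χ i φ).1.add (θ.lerayTransportD_eq hε hu i φ).1

theorem integrableOn_rhsW {u w : ℝ → L2Field} (hu : BoundedWeaklyContinuous u)
    (hw : BoundedWeaklyContinuous w) (i : Fin 3) (φ : STF) :
    IntegrableOn (fun t => θ.rhsW hε χ γ κ i (slice φ t) (u t) (w t)) (Ioi 0) :=
  (linW_eq hu hw χ γ κ i φ).1.add (θ.transportD_eq hε hu hw i φ).1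

end MollifierKernel

/-- Limits of solutions of ordinary differential equations on increasing intervals. -/
theorem hasDerivAt_of_tendsto {f r : ℕ → ℝ → ℝ} {g R : ℝ → ℝ} {T : ℕ → ℝ} {C : ℝ}
    (hT : Tendsto T atTop atTop)
    (hd : ∀ n, ∀ t ∈ Icc 0 (T n), HasDerivWithinAt (f n) (r n t) (Icc 0 (T n)) t)
    (hrc : ∀ n, ContinuousOn (r n) (Icc 0 (T n))) (hC : ∀ n, ∀ t ∈ Icc 0 (T n), |r n t| ≤ C)
    (hf : ∀ t, 0 ≤ t → Tendsto (fun n => f n t) atTop (𝓝 (g t)))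
    (hr : ∀ t, 0 ≤ t → Tendsto (fun n => r n t) atTop (𝓝 (R t))) (hR : ContinuousOn R (Ici 0))
    {t : ℝ} (ht : 0 < t) : HasDerivAt g (R t) t := by
  have h1 : ∀ t, 0 ≤ t → g t = g 0 + ∫ τ in (0 : ℝ)..t, R τ := by
    intro t ht
    have e1 : Tendsto (fun n => f n t - f n 0) atTop (𝓝 (∫ τ in (0 : ℝ)..t, R τ)) := by
      have e2 : Tendsto (fun n => ∫ τ in (0 : ℝ)..t, r n τ) atTop
          (𝓝 (∫ τ in (0 : ℝ)..t, R τ)) := by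
        refine intervalIntegral.tendsto_integral_filter_of_dominated_convergence (fun _ => C)
          ?_ ?_ intervalIntegrable_const ?_
        · filter_upwards [hT.eventually_ge_atTop t] with n hn
          rw [uIoc_of_le ht]
          exact ((hrc n).mono ((Ioc_subset_Icc_self).trans
            (Icc_subset_Icc_right hn))).aestronglyMeasurable measurableSet_Ioc
        · filter_upwards [hT.eventually_ge_atTop t] with n hn
          refine Eventually.of_forall fun τ hτ => ?_
          rw [uIoc_of_le ht] at hτ
          exact hC n τ ⟨hτ.1.le, hτ.2.trans hn⟩
        · refine Eventually.of_forall fun τ hτ => ?_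
          rw [uIoc_of_le ht] at hτ
          exact hr τ hτ.1.le
      refine e2.congr' ?_
      filter_upwards [hT.eventually_ge_atTop t] with n hn
      have hsub : Icc 0 t ⊆ Icc 0 (T n) := Icc_subset_Icc_right hn
      refine intervalIntegral.integral_eq_sub_of_hasDeriv_right_of_le ht
        (fun τ hτ => ((hd n τ (hsub hτ)).mono hsub).continuousWithinAt) (fun τ hτ => ?_) ?_
      · exact (hd n τ (hsub (Ioo_subset_Icc_self hτ))).mono_of_mem_nhdsWithin
          (mem_nhdsWithin_of_mem_nhds (Icc_mem_nhds hτ.1 (hτ.2.trans_le hn)))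
      · exact ((hrc n).mono hsub).intervalIntegrable_of_Icc ht
    have := tendsto_nhds_unique ((hf t ht).sub (hf 0 le_rfl)) e1
    linarith
  have h2 : HasDerivAt (fun s => ∫ τ in (0 : ℝ)..s, R τ) (R t) t := by
    refine intervalIntegral.integral_hasDerivAt_right ?_ ?_ ?_
    · exact (hR.mono Icc_subset_Ici_self).intervalIntegrable_of_Icc ht.le
    · exact (hR.mono Ioi_subset_Ici_self).stronglyMeasurableAtFilter isOpen_Ioi t ht
    · exact hR.continuousAt (Ici_mem_nhds ht)
  refine (h2.const_add (g 0)).congr_of_eventuallyEq ?_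
  filter_upwards [Ici_mem_nhds ht] with s hs using h1 s hs

/-! ### Passage to the limit in the regularised system -/

namespace MollifierKernel

variable (θ : MollifierKernel) {ε : ℝ} (hε : ε ≠ 0) {μ χ γ κ δ : ℝ}

theorem continuousOn_dissS {u w : ℝ → L2Field} {s : Set ℝ} (hu : ContinuousOn u s)
    (hw : ContinuousOn w s) : ContinuousOn (fun t => θ.dissS μ χ γ κ δ (u t) (w t)) s := by
  unfold dissS
  fun_prop

/-- Energy balance for the regularised system. -/
theorem energy_regularised (hμ : 0 ≤ μ) (hχ : 0 ≤ χ) (hγ : 0 ≤ γ) (hκ : 0 ≤ κ)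
    (hδ : δ ≠ 0) {u w : ℝ → L2Field} {T : ℝ} (hσ : ∀ t ∈ Icc 0 T, u t ∈ L2sigma)
    (hu : ∀ t ∈ Icc 0 T, HasDerivWithinAt u (θ.field hε μ χ γ κ δ (u t, w t)).1 (Icc 0 T) t)
    (hw : ∀ t ∈ Icc 0 T, HasDerivWithinAt w (θ.field hε μ χ γ κ δ (u t, w t)).2 (Icc 0 T) t)
    {t : ℝ} (ht : t ∈ Icc 0 T) : ‖u t‖ ^ 2 + ‖w t‖ ^ 2 ≤ ‖u 0‖ ^ 2 + ‖w 0‖ ^ 2 ∧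
      ∫⁻ τ in Ioc 0 t, ENNReal.ofReal (θ.dissS μ χ γ κ δ (u τ) (w τ)) ≤
        ENNReal.ofReal ((‖u 0‖ ^ 2 + ‖w 0‖ ^ 2) / 2) := by
  have hder : ∀ t ∈ Icc 0 T, HasDerivWithinAt (fun t => ‖u t‖ ^ 2 + ‖w t‖ ^ 2)
      (-2 * θ.dissS μ χ γ κ δ (u t) (w t)) (Icc 0 T) t := by
    intro t ht
    have h1 := θ.inner_field hε μ χ γ κ hδ (u t, w t)
    rw [leray_of_mem (hσ t ht)] at h1
    refine ((hu t ht).norm_sq.add (hw t ht).norm_sq).congr_deriv ?_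
    simp only at h1
    linarith
  have hsub : Icc 0 t ⊆ Icc 0 T := Icc_subset_Icc_right ht.2
  have hcont : ContinuousOn (fun t => θ.dissS μ χ γ κ δ (u t) (w t)) (Icc 0 T) :=
    θ.continuousOn_dissS (fun t ht => (hu t ht).continuousWithinAt)
      (fun t ht => (hw t ht).continuousWithinAt)
  have hint := (hcont.mono hsub).intervalIntegrable_of_Icc (μ := volume) ht.1
  have key : ∫ τ in (0 : ℝ)..t, -2 * θ.dissS μ χ γ κ δ (u τ) (w τ) =
      (‖u t‖ ^ 2 + ‖w t‖ ^ 2) - (‖u 0‖ ^ 2 + ‖w 0‖ ^ 2) := by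
    refine intervalIntegral.integral_eq_sub_of_hasDeriv_right_of_le ht.1
      (fun τ hτ => ((hder τ (hsub hτ)).mono hsub).continuousWithinAt) (fun τ hτ => ?_)
      (hint.const_mul _)
    exact (hder τ (hsub (Ioo_subset_Icc_self hτ))).mono_of_mem_nhdsWithin
      (mem_nhdsWithin_of_mem_nhds (Icc_mem_nhds hτ.1 (hτ.2.trans_le ht.2)))
  rw [intervalIntegral.integral_const_mul, intervalIntegral.integral_of_le ht.1] at key
  have hn : ∀ τ, 0 ≤ θ.dissS μ χ γ κ δ (u τ) (w τ) :=
    fun τ => θ.dissS_nonneg δ hμ hχ hγ hκ _ _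
  have hpos : 0 ≤ ∫ τ in Ioc 0 t, θ.dissS μ χ γ κ δ (u τ) (w τ) :=
    setIntegral_nonneg measurableSet_Ioc fun τ _ => hn τ
  refine ⟨by linarith, ?_⟩
  rw [← ofReal_integral_eq_lintegral_ofReal ((intervalIntegrable_iff_integrableOn_Ioc_of_le
    ht.1).1 hint) (Eventually.of_forall hn)]
  refine ENNReal.ofReal_le_ofReal ?_
  nlinarith [sq_nonneg ‖u t‖, sq_nonneg ‖w t‖]

/-- The regularised system has solutions on long time intervals, with uniform energy bounds. -/
theorem exists_regularised_seq (hμ : 0 ≤ μ) (hχ : 0 ≤ χ) (hγ : 0 ≤ γ) (hκ : 0 ≤ κ)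
    {u₀ : L2Field} (hu₀ : u₀ ∈ L2sigma) (w₀ : L2Field) (n : ℕ) :
    ∃ u w : ℝ → L2Field, u 0 = u₀ ∧ w 0 = w₀ ∧ (∀ t, 0 ≤ t → u t ∈ L2sigma) ∧
      (∀ t, 0 ≤ t → ‖u t‖ ≤ √(‖u₀‖ ^ 2 + ‖w₀‖ ^ 2)) ∧
      (∀ t, 0 ≤ t → ‖w t‖ ≤ √(‖u₀‖ ^ 2 + ‖w₀‖ ^ 2)) ∧
      (∀ t ∈ Icc (0 : ℝ) n,
        HasDerivWithinAt u (θ.field hε μ χ γ κ (dn n) (u t, w t)).1 (Icc (0 : ℝ) n) t) ∧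
      (∀ t ∈ Icc (0 : ℝ) n,
        HasDerivWithinAt w (θ.field hε μ χ γ κ (dn n) (u t, w t)).2 (Icc (0 : ℝ) n) t) ∧
      (∀ t, (n : ℝ) ≤ t → u t = u n ∧ w t = w n) ∧
      ∫⁻ τ in Ioc (0 : ℝ) n, ENNReal.ofReal (θ.dissS μ χ γ κ (dn n) (u τ) (w τ)) ≤
        ENNReal.ofReal ((‖u₀‖ ^ 2 + ‖w₀‖ ^ 2) / 2) := by
  -- The equation is solved slightly beyond time `n`, so that the interval is nondegenerate for `n =
  -- 0`; afterwards the solution is frozen at time `n`, which keeps it Lipschitz when tested.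
  have hT : (0 : ℝ) < n + 1 := by positivity
  obtain ⟨u, w, hu0, hw0, hσ, hu, hw⟩ := θ.exists_regularised hε hμ hχ hγ hκ (dn_pos n).ne' hu₀ w₀ hT
  have hmem : ∀ t : ℝ, 0 ≤ t → min t n ∈ Icc (0 : ℝ) (n + 1) := fun t ht =>
    ⟨le_min ht (Nat.cast_nonneg n), (min_le_right _ _).trans (by linarith)⟩
  have hE := fun t ht => (θ.energy_regularised hε hμ hχ hγ hκ (dn_pos n).ne' hσ hu hw (t := t) ht)
  rw [hu0, hw0] at hE
  have hsub : Icc (0 : ℝ) n ⊆ Icc (0 : ℝ) (n + 1) := Icc_subset_Icc_right (by linarith)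
  have hmin : ∀ t ∈ Icc (0 : ℝ) n, min t n = t := fun t ht => min_eq_left ht.2
  refine ⟨fun t => u (min t n), fun t => w (min t n), ?_, ?_, fun t ht => hσ _ (hmem t ht),
    fun t ht => ?_, fun t ht => ?_, fun t ht => ?_, fun t ht => ?_, fun t ht => ?_, ?_⟩
  · simp only [min_eq_left (Nat.cast_nonneg (α := ℝ) n), hu0]
  · simp only [min_eq_left (Nat.cast_nonneg (α := ℝ) n), hw0]
  · exact Real.le_sqrt_of_sq_le (by nlinarith [(hE _ (hmem t ht)).1, sq_nonneg ‖w (min t n)‖])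
  · exact Real.le_sqrt_of_sq_le (by nlinarith [(hE _ (hmem t ht)).1, sq_nonneg ‖u (min t n)‖])
  · simp only [hmin t ht]
    exact ((hu t (hsub ht)).mono hsub).congr (fun s hs => by rw [hmin s hs]) (by rw [hmin t ht])
  · simp only [hmin t ht]
    exact ((hw t (hsub ht)).mono hsub).congr (fun s hs => by rw [hmin s hs]) (by rw [hmin t ht])
  · simp only [min_eq_right ht, min_self, and_self]
  · refine le_trans (le_of_eq ?_) (hE n (hsub ⟨Nat.cast_nonneg n, le_rfl⟩)).2
    refine setLIntegral_congr_fun measurableSet_Ioc fun τ hτ => ?_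
    simp only [min_eq_left hτ.2]

/-- Fatou's lemma for approximate derivatives along weakly convergent curves. -/
theorem FirstOrder.lintegral_nSq_le {θ : MollifierKernel} {X : ℝ → L2Field →L[ℝ] L2Field}
    {Q : Fin 3 → TF → L2Field} (hX : θ.FirstOrder X Q) {f : ℕ → ℝ → L2Field} {a : ℝ → L2Field}
    (hf : ∀ t, 0 ≤ t → WT atTop (fun n => f n t) (a t)) {M : ℝ}
    (hM : ∀ n t, 0 ≤ t → ‖f n t‖ ≤ M) {d : ℕ → ℝ} (hd : Tendsto d atTop (𝓝[≠] 0)) {T : ℕ → ℝ}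
    (hT : Tendsto T atTop atTop) (hfc : ∀ n, ContinuousOn (f n) (Icc 0 (T n))) {K : ℝ≥0∞}
    (hK : ∀ n, ∫⁻ t in Ioc 0 (T n), ‖X (d n) (f n t)‖ₑ ^ 2 ≤ K) :
    ∫⁻ t in Ioi (0 : ℝ), θ.nSq X (a t) 0 ≤ K := by
  set g : ℕ → ℝ → ℝ≥0∞ := fun n => (Ioc 0 (T n)).indicator fun t => ‖X (d n) (f n t)‖ₑ ^ 2
  have hg : ∀ n, AEMeasurable (g n) (volume.restrict (Ioi 0)) := by
    intro n
    refine AEMeasurable.restrict ?_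
    refine (aemeasurable_indicator_iff measurableSet_Ioc).2 ?_
    have hc : ContinuousOn (fun t => ‖X (d n) (f n t)‖ₑ ^ 2) (Ioc 0 (T n)) :=
      (ENNReal.continuous_pow 2).comp_continuousOn (continuous_enorm.comp_continuousOn
        ((X (d n)).continuous.comp_continuousOn ((hfc n).mono Ioc_subset_Icc_self)))
    exact hc.aemeasurable measurableSet_Ioc
  calc ∫⁻ t in Ioi (0 : ℝ), θ.nSq X (a t) 0
      ≤ ∫⁻ t in Ioi (0 : ℝ), liminf (fun n => g n t) atTop := by
        refine setLIntegral_mono' measurableSet_Ioi fun t ht => ?_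
        have ht : (0 : ℝ) < t := ht
        refine (hX.nSq_le_liminf (hf t ht.le) (WT.const 0)
          (Eventually.of_forall fun n => hM n t ht.le)
          (Eventually.of_forall fun _ => (norm_zero (E := L2Field)).le) hd).trans
          (le_of_eq (liminf_congr ?_))
        filter_upwards [hT.eventually_ge_atTop t] with n hn
        simp only [g, map_zero, sub_zero]
        rw [indicator_of_mem (show t ∈ Ioc 0 (T n) from ⟨ht, hn⟩)]
    _ ≤ liminf (fun n => ∫⁻ t in Ioi (0 : ℝ), g n t) atTop := lintegral_liminf_le' hg
    _ ≤ K := by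
        refine (liminf_le_liminf (v := fun _ => K) (Eventually.of_forall fun n => ?_)).trans_eq
          (liminf_const K)
        refine (setLIntegral_le_lintegral _ _).trans ?_
        rw [lintegral_indicator measurableSet_Ioc]
        exact hK n

end MollifierKernel

/-- Lipschitz bounds for solutions of differential equations that become stationary. -/
theorem abs_sub_le_of_hasDerivWithinAt {f r : ℝ → ℝ} {T C : ℝ} (hT : 0 ≤ T)
    (hf : ∀ t ∈ Icc 0 T, HasDerivWithinAt f (r t) (Icc 0 T) t) (hr : ∀ t ∈ Icc 0 T, |r t| ≤ C)
    (hc : ∀ t, T ≤ t → f t = f T) {s t : ℝ} (hs : 0 ≤ s) (ht : 0 ≤ t) :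
    |f t - f s| ≤ C * |t - s| := by
  have h1 : ∀ t, f t = f (min t T) := by
    intro t
    rcases le_total t T with h | h
    · rw [min_eq_left h]
    · rw [min_eq_right h, hc t h]
  have hC : 0 ≤ C := (abs_nonneg _).trans (hr 0 ⟨le_rfl, hT⟩)
  rw [h1 t, h1 s]
  have h2 := (convex_Icc 0 T).norm_image_sub_le_of_norm_hasDerivWithin_le hf
    (fun x hx => hr x hx) (x := min s T) (y := min t T) ⟨le_min hs hT, min_le_right _ _⟩
    ⟨le_min ht hT, min_le_right _ _⟩
  refine h2.trans ?_
  gcongr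
  refine (abs_min_sub_min_le_max _ _ _ _).trans ?_
  rw [sub_self, abs_zero, max_eq_left (abs_nonneg _)]

theorem HasDerivWithinAt.inner_const {H : Type*} [NormedAddCommGroup H] [InnerProductSpace ℝ H]
    {f : ℝ → H} {f' : H} {s : Set ℝ} {t : ℝ} (h : HasDerivWithinAt f f' s t) (v : H) :
    HasDerivWithinAt (fun t => inner ℝ v (f t)) (inner ℝ v f') s t :=
  (innerSL ℝ v).hasFDerivAt.comp_hasDerivWithinAt t h

/-! ### Existence of finite energy solutions of the mollified system -/

namespace MollifierKernel

variable (θ : MollifierKernel) {ε μ χ γ κ : ℝ}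

theorem mul_D_sq_le_dissS (hμ : 0 ≤ μ) (hχ : 0 ≤ χ) (hγ : 0 ≤ γ) (hκ : 0 ≤ κ) (δ : ℝ)
    (u w : L2Field) (j : Fin 3) : μ * ‖θ.D j δ u‖ ^ 2 ≤ θ.dissS μ χ γ κ δ u w ∧
      γ * ‖θ.D j δ w‖ ^ 2 ≤ θ.dissS μ χ γ κ δ u w ∧
      κ * ‖θ.divS δ w‖ ^ 2 ≤ θ.dissS μ χ γ κ δ u w := by
  have h1 : ∀ v, ‖θ.D j δ v‖ ^ 2 ≤ ∑ j, ‖θ.D j δ v‖ ^ 2 := fun v =>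
    Finset.single_le_sum (f := fun j => ‖θ.D j δ v‖ ^ 2) (fun _ _ => sq_nonneg _)
      (Finset.mem_univ j)
  have h2 := mul_le_mul_of_nonneg_left (h1 u) hμ
  have h3 := mul_le_mul_of_nonneg_left (h1 w) hγ
  have h4 : 0 ≤ μ * ‖θ.D j δ u‖ ^ 2 := by positivity
  have h5 : 0 ≤ γ * ‖θ.D j δ w‖ ^ 2 := by positivity
  have h6 : 0 ≤ κ * ‖θ.divS δ w‖ ^ 2 := by positivity
  have h7 : 0 ≤ χ * ‖θ.curlS δ u - θ.S δ ((2 : ℝ) • w)‖ ^ 2 := by positivity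
  unfold dissS
  refine ⟨?_, ?_, ?_⟩ <;> linarith

theorem lintegral_enorm_sq_le {s : Set ℝ} (hs : MeasurableSet s) {f : ℝ → L2Field} {D : ℝ → ℝ}
    {c : ℝ} (hc : 0 < c) (h : ∀ t ∈ s, c * ‖f t‖ ^ 2 ≤ D t) {K : ℝ≥0∞}
    (hK : ∫⁻ t in s, ENNReal.ofReal (D t) ≤ K) :
    ∫⁻ t in s, ‖f t‖ₑ ^ 2 ≤ ENNReal.ofReal c⁻¹ * K := by
  calc ∫⁻ t in s, ‖f t‖ₑ ^ 2 ≤ ∫⁻ t in s, ENNReal.ofReal c⁻¹ * ENNReal.ofReal (D t) := by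
        refine setLIntegral_mono' hs fun t ht => ?_
        rw [← ENNReal.ofReal_mul (by positivity), ← ofReal_norm, ← ENNReal.ofReal_pow (norm_nonneg _)]
        refine ENNReal.ofReal_le_ofReal ?_
        rw [inv_mul_eq_div, le_div_iff₀' hc]
        exact h t ht
    _ = ENNReal.ofReal c⁻¹ * ∫⁻ t in s, ENNReal.ofReal (D t) :=
        lintegral_const_mul' _ _ ENNReal.ofReal_ne_top
    _ ≤ _ := by gcongr

theorem _root_.Micropolar.WT.mem_L2sigma {ι : Type*} {l : Filter ι} [l.NeBot] {f : ι → L2Field} {a : L2Field}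
    (h : WT l f a) (hf : ∀ᶠ i in l, f i ∈ L2sigma) : a ∈ L2sigma := by
  rw [((h.map leray).congr' (hf.mono fun i hi => leray_of_mem hi)).unique h |>.symm]
  exact leray_mem a

/-- Existence of finite energy solutions of the mollified system. -/
theorem exists_finiteEnergy (hε : ε ≠ 0) (hμ : 0 < μ) (hχ : 0 ≤ χ) (hγ : 0 ≤ γ) (hκ : 0 ≤ κ)
    {u₀ : L2Field} (hu₀ : u₀ ∈ L2sigma) (w₀ : L2Field) :
    ∃ u w : ℝ → L2Field, EnergyClass γ κ u w ∧
      (∀ i, Dt (comp u i) + lerayTransportD (fun t => mollify θ ε (u t)) u i = linU μ χ u w i) ∧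
      (∀ i, Dt (comp w i) + transportD (fun t => mollify θ ε (u t)) w i = linW χ γ κ u w i) ∧
      (∀ t, 0 ≤ t → u t ∈ L2sigma) ∧ u 0 = u₀ ∧ w 0 = w₀ := by
  choose U W hU0 hW0 hUσ hUM hWM hUd hWd hst hdiss using
    θ.exists_regularised_seq hε (μ := μ) (γ := γ) hμ.le hχ hγ hκ hu₀ w₀
  set M := √(‖u₀‖ ^ 2 + ‖w₀‖ ^ 2)
  have hUd' : ∀ (n : ℕ) i φ, ∀ t ∈ Icc (0 : ℝ) n, HasDerivWithinAt
      (fun t => inner ℝ (testField i φ) (U n t)) (θ.regU hε μ χ (dn n) i φ (U n t) (W n t))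
      (Icc (0 : ℝ) n) t := fun n i φ t ht => (HasDerivWithinAt.inner_const (hUd n t ht)
        (testField i φ)).congr_deriv
      (θ.inner_field_fst hε μ χ γ κ (dn_pos n).ne' i φ (hUσ n t ht.1) _)
  have hWd' : ∀ (n : ℕ) i φ, ∀ t ∈ Icc (0 : ℝ) n, HasDerivWithinAt
      (fun t => inner ℝ (testField i φ) (W n t)) (θ.regW hε χ γ κ (dn n) i φ (U n t) (W n t))
      (Icc (0 : ℝ) n) t := fun n i φ t ht => (HasDerivWithinAt.inner_const (hWd n t ht)
        (testField i φ)).congr_deriv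
      (θ.inner_field_snd hε μ χ γ κ (dn_pos n).ne' i φ (hUσ n t ht.1) _)
  obtain ⟨σ, u, hσ, hu, hUu⟩ := exists_weak_subseq hUM fun i φ => by
    obtain ⟨C, hC⟩ := θ.exists_abs_regU_le hε μ χ i φ M
    exact ⟨C, fun n s t hs ht => abs_sub_le_of_hasDerivWithinAt (Nat.cast_nonneg n) (hUd' n i φ)
      (fun t ht => hC _ _ _ (hUM n t ht.1) (hWM n t ht.1)) (fun t ht => by rw [(hst n t ht).1])
      hs ht⟩
  -- The second extraction runs along the first one.
  obtain ⟨τ, w, hτ, hw, hWw⟩ := exists_weak_subseq (fun n => hWM (σ n)) fun i φ => by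
    obtain ⟨C, hC⟩ := θ.exists_abs_regW_le hε χ γ κ i φ M
    exact ⟨C, fun n s t hs ht => abs_sub_le_of_hasDerivWithinAt (Nat.cast_nonneg _)
      (hWd' (σ n) i φ) (fun t ht => hC _ _ _ (hUM _ t ht.1) (hWM _ t ht.1))
      (fun t ht => by rw [(hst _ t ht).2]) hs ht⟩
  replace hUu : ∀ t, 0 ≤ t → WT atTop (fun n => U (σ (τ n)) t) (u t) := fun t ht =>
    (hUu t ht).comp hτ.tendsto_atTop
  set ρ : ℕ → ℕ := fun n => σ (τ n)
  have hρ : Tendsto ρ atTop atTop := hσ.tendsto_atTop.comp hτ.tendsto_atTop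
  have hT : Tendsto (fun n => (ρ n : ℝ)) atTop atTop := tendsto_natCast_atTop_atTop.comp hρ
  have hd : Tendsto (fun n => dn (ρ n)) atTop (𝓝[≠] 0) := tendsto_dn_ne.comp hρ
  have hd0 : Tendsto (fun n => dn (ρ n)) atTop (𝓝 0) := tendsto_dn.comp hρ
  have hub : BoundedWeaklyContinuous u := ⟨⟨M, fun t ht => (hUu t ht).norm_le
    (Eventually.of_forall fun n => hUM _ t ht)⟩, hu⟩
  have hwb : BoundedWeaklyContinuous w := ⟨⟨M, fun t ht => (hWw t ht).norm_le
    (Eventually.of_forall fun n => hWM _ t ht)⟩, hw⟩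
  have hUc : ∀ n : ℕ, ContinuousOn (U n) (Icc 0 n) := fun n t ht => (hUd n t ht).continuousWithinAt
  have hWc : ∀ n : ℕ, ContinuousOn (W n) (Icc 0 n) := fun n t ht => (hWd n t ht).continuousWithinAt
  have hFc : ∀ n : ℕ, ContinuousOn (fun t => θ.field hε μ χ γ κ (dn n) (U n t, W n t)) (Icc 0 n) :=
    fun n => (θ.locLip_field hε μ χ γ κ (dn n)).continuous.comp_continuousOn
      ((hUc n).prodMk (hWc n))
  have hrU : ∀ (n : ℕ) i φ, ContinuousOn (fun t => θ.regU hε μ χ (dn n) i φ (U n t) (W n t))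
      (Icc 0 n) := fun n i φ =>
    (ContinuousOn.inner continuousOn_const (continuous_fst.comp_continuousOn (hFc n))).congr
      fun t ht => (θ.inner_field_fst hε μ χ γ κ (dn_pos n).ne' i φ (hUσ n t ht.1) _).symm
  have hrW : ∀ (n : ℕ) i φ, ContinuousOn (fun t => θ.regW hε χ γ κ (dn n) i φ (U n t) (W n t))
      (Icc 0 n) := fun n i φ =>
    (ContinuousOn.inner continuousOn_const (continuous_snd.comp_continuousOn (hFc n))).congr
      fun t ht => (θ.inner_field_snd hε μ χ γ κ (dn_pos n).ne' i φ (hUσ n t ht.1) _).symm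
  have hUe : ∀ t, 0 ≤ t → ∀ᶠ n in atTop, ‖U (ρ n) t‖ ≤ M := fun t ht =>
    Eventually.of_forall fun n => hUM _ t ht
  have hWe : ∀ t, 0 ≤ t → ∀ᶠ n in atTop, ‖W (ρ n) t‖ ≤ M := fun t ht =>
    Eventually.of_forall fun n => hWM _ t ht
  have hfin : ∀ c : ℝ, ENNReal.ofReal c⁻¹ * ENNReal.ofReal ((‖u₀‖ ^ 2 + ‖w₀‖ ^ 2) / 2) < ⊤ :=
    fun c => ENNReal.mul_lt_top ENNReal.ofReal_lt_top ENNReal.ofReal_lt_top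
  have hgrad : ∀ v : ℝ → L2Field, WeaklyContinuous v →
      (∀ j, ∫⁻ t in Ioi (0 : ℝ), θ.nSq (θ.D j) (v t) 0 < ⊤) →
      ∫⁻ t in Ioi (0 : ℝ), gradSq (v t) < ⊤ := by
    intro v hv h
    simp only [θ.gradSq_eq]
    rw [lintegral_finsetSum' _ fun j _ =>
      (θ.firstOrder_D j).aemeasurable_nSq hv (weaklyContinuous_const 0)]
    exact ENNReal.sum_lt_top.2 fun j _ => h j
  refine ⟨u, w, ⟨hub, hgrad u hu fun j => ?_, hwb, fun hγ' => hgrad w hw fun j => ?_,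
    fun _ hκ' => ?_⟩, fun i => ?_, fun i => ?_, fun t ht => ?_, ?_, ?_⟩
  · refine ((θ.firstOrder_D j).lintegral_nSq_le hUu (fun n => hUM _) hd hT (fun n => hUc _)
      fun n => lintegral_enorm_sq_le measurableSet_Ioc hμ (fun t _ => ?_) (hdiss (ρ n))).trans_lt
      (hfin μ)
    exact (θ.mul_D_sq_le_dissS hμ.le hχ hγ hκ _ _ _ j).1
  · refine ((θ.firstOrder_D j).lintegral_nSq_le hWw (fun n => hWM _) hd hT (fun n => hWc _)
      fun n => lintegral_enorm_sq_le measurableSet_Ioc hγ' (fun t _ => ?_) (hdiss (ρ n))).trans_lt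
      (hfin γ)
    exact (θ.mul_D_sq_le_dissS hμ.le hχ hγ hκ _ _ _ j).2.1
  · simp only [θ.divSq_eq]
    refine (θ.firstOrder_divS.lintegral_nSq_le hWw (fun n => hWM _) hd hT (fun n => hWc _)
      fun n => lintegral_enorm_sq_le measurableSet_Ioc hκ' (fun t _ => ?_) (hdiss (ρ n))).trans_lt
      (hfin κ)
    exact (θ.mul_D_sq_le_dissS hμ.le hχ hγ hκ _ _ _ 0).2.2
  -- For a fixed spatial test field the tested equations converge at each time with bounded
  -- right-hand sides, so the limit solves the tested equation classically; time-dependent test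
  -- functions come afterwards.
  · refine (θ.velocity_iff hε hub hwb μ χ i).2 fun φ => ?_
    refine weak_of_hasDerivAt hub (R := fun ψ t => θ.rhsU hε μ χ i ψ (u t) (w t))
      (fun ψ t ht => ?_) φ (θ.integrableOn_rhsU hε μ χ hub hwb i φ)
    obtain ⟨C, hC⟩ := θ.exists_abs_regU_le hε μ χ i ψ M
    exact hasDerivAt_of_tendsto hT (fun n => hUd' (ρ n) i ψ) (fun n => hrU _ i ψ)
      (fun n t ht => hC _ _ _ (hUM _ t ht.1) (hWM _ t ht.1)) (fun t ht => hUu t ht _)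
      (fun t ht => θ.tendsto_regU hε μ χ (hUu t ht) (hWw t ht) (hUe t ht) (hWe t ht) hd0 i ψ)
      (θ.continuousOn_rhsU hε μ χ hub hwb i ψ) ht
  · refine (θ.microrotation_iff hε hub hwb χ γ κ i).2 fun φ => ?_
    refine weak_of_hasDerivAt hwb (R := fun ψ t => θ.rhsW hε χ γ κ i ψ (u t) (w t))
      (fun ψ t ht => ?_) φ (θ.integrableOn_rhsW hε χ γ κ hub hwb i φ)
    obtain ⟨C, hC⟩ := θ.exists_abs_regW_le hε χ γ κ i ψ M
    exact hasDerivAt_of_tendsto hT (fun n => hWd' (ρ n) i ψ) (fun n => hrW _ i ψ)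
      (fun n t ht => hC _ _ _ (hUM _ t ht.1) (hWM _ t ht.1)) (fun t ht => hWw t ht _)
      (fun t ht => θ.tendsto_regW hε χ γ κ (hUu t ht) (hWw t ht) (hUe t ht) (hWe t ht) hd0 i ψ)
      (θ.continuousOn_rhsW hε χ γ κ hub hwb i ψ) ht
  · exact WT.mem_L2sigma (hUu t ht) (Eventually.of_forall fun n => hUσ _ t ht)
  · exact (WT.const u₀).unique ((hUu 0 le_rfl).congr' (Eventually.of_forall fun n => hU0 _)) |>.symm
  · exact (WT.const w₀).unique ((hWw 0 le_rfl).congr' (Eventually.of_forall fun n => hW0 _)) |>.symm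

end MollifierKernel

/-! ### Integrated form of the evolution equations -/

/-- Subtracting a primitive of `f` leaves a function with zero distributional derivative, and the
Lipschitz estimate with constant zero shows that it is constant. -/
theorem sub_eq_integral_of_distribution {G f : ℝ → ℝ} (hG : Continuous G) (hf : Continuous f)
    (h : ∀ η : ℝ → ℝ, ContDiff ℝ ∞ η → HasCompactSupport η → tsupport η ⊆ Ioi 0 →
      -∫ t in Ioi (0 : ℝ), deriv η t * G t = ∫ t in Ioi (0 : ℝ), η t * f t) {s t : ℝ}
    (hs : 0 ≤ s) (hst : s ≤ t) : G t - G s = ∫ τ in s..t, f τ := by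
  set F : ℝ → ℝ := fun t => ∫ τ in (0 : ℝ)..t, f τ
  have hFd : ∀ t, HasDerivAt F (f t) t := fun t => hf.integral_hasStrictDerivAt 0 t |>.hasDerivAt
  have hF : Continuous F := continuous_iff_continuousAt.2 fun t => (hFd t).continuousAt
  have hGF : Continuous (G - F) := hG.sub hF
  have key : ∀ η : ℝ → ℝ, ContDiff ℝ ∞ η → HasCompactSupport η → tsupport η ⊆ Ioi 0 →
      -∫ t in Ioi (0 : ℝ), deriv η t * (G - F) t = ∫ t in Ioi (0 : ℝ), η t * (0 : ℝ) := by
    intro η hη hc hsupp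
    have hηd : Differentiable ℝ η := hη.differentiable (by simp)
    have hη' : Continuous (deriv η) := hη.continuous_deriv (by simp)
    have hi : ∀ {a b : ℝ → ℝ}, Continuous a → Continuous b → HasCompactSupport a →
        Integrable (a * b) volume := fun ha hb hca =>
      (ha.mul hb).integrable_of_hasCompactSupport hca.mul_right
    have h1 := integral_mul_deriv_eq_deriv_mul_of_integrable (u := η) (v := F) (u' := deriv η)
      (v' := f) (fun x _ => (hηd x).hasDerivAt) (fun x _ => hFd x) (hi hη.continuous hf hc)
      (hi hη' hF hc.deriv) (hi hη.continuous hF hc)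
    have h0 : ∀ x, x ∉ Ioi (0 : ℝ) → η x = 0 := fun x hx =>
      image_eq_zero_of_notMem_tsupport fun hx' => hx (hsupp hx')
    have h0' : ∀ x, x ∉ Ioi (0 : ℝ) → deriv η x = 0 := fun x hx =>
      image_eq_zero_of_notMem_tsupport fun hx' => hx (hsupp (tsupport_deriv_subset hx'))
    have h2 := h η hη hc hsupp
    rw [setIntegral_eq_integral_of_forall_compl_eq_zero (f := fun x => η x * f x)
      (fun x hx => by rw [h0 x hx, zero_mul])] at h2
    have i1 : IntegrableOn (fun x => deriv η x * G x) (Ioi 0) := (hi hη' hG hc.deriv).integrableOn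
    have i2 : IntegrableOn (fun x => deriv η x * F x) (Ioi 0) := (hi hη' hF hc.deriv).integrableOn
    simp only [mul_zero, integral_zero, Pi.sub_apply, mul_sub]
    rw [integral_sub i1 i2, setIntegral_eq_integral_of_forall_compl_eq_zero (f := fun x => deriv η x * F x)
        (fun x hx => by rw [h0' x hx, zero_mul])]
    linarith
  have main : ∀ s t, 0 < s → s ≤ t → (G - F) t = (G - F) s := by
    intro s t hs hst
    have := abs_sub_le_of_distribution hGF (C := 0) (fun t _ => by simp) key hs hst
    rw [zero_mul] at this
    exact sub_eq_zero.1 (abs_nonpos_iff.1 this)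
  have main' : (G - F) t = (G - F) s := by
    have e : ∀ x, Tendsto (fun h => (G - F) (x + h)) (𝓝[>] 0) (𝓝 ((G - F) x)) := by
      intro x
      have : Continuous fun h => (G - F) (x + h) := by fun_prop
      have := this.tendsto 0
      simp only [add_zero] at this
      exact this.mono_left nhdsWithin_le_nhds
    refine tendsto_nhds_unique (e t) ((e s).congr' (eventually_mem_nhdsWithin.mono fun h hh => ?_))
    have hh : 0 < h := hh
    exact (main (s + h) (t + h) (by linarith) (by linarith)).symm
  have h3 : F t - F s = ∫ τ in s..t, f τ :=
    intervalIntegral.integral_interval_sub_left (hf.intervalIntegrable _ _)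
      (hf.intervalIntegrable _ _)
  simp only [Pi.sub_apply] at main'
  linarith

/-- Integrated form of an evolution equation in the sense of distributions. -/
theorem sub_eq_integral_of_weak {v : ℝ → L2Field} (hv : WeaklyContinuous v) {i : Fin 3} {ψ : TF}
    {R : TF → ℝ → ℝ} (hR : ∀ (c : ℝ) t, R (c • ψ) t = c * R ψ t)
    (hRc : ContinuousOn (R ψ) (Ici 0))
    (h : ∀ φ : STF, -∫ t in Ioi (0 : ℝ), inner ℝ (testField i
      (slice (∂_{((1 : ℝ), (0 : E3))} φ) t)) (v t) = ∫ t in Ioi (0 : ℝ), R (slice φ t) t)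
    {s t : ℝ} (hs : 0 ≤ s) (hst : s ≤ t) :
    inner ℝ (testField i ψ) (v t) - inner ℝ (testField i ψ) (v s) = ∫ τ in s..t, R ψ τ := by
  have hmax : ContinuousOn (fun t : ℝ => max t 0) univ := by fun_prop
  have key := sub_eq_integral_of_distribution
    (G := fun t => inner ℝ (testField i ψ) (v (max t 0))) (f := fun t => R ψ (max t 0))
    (continuous_iff_continuousAt.2 fun t => hv.WT_max t (testField i ψ))
    (continuousOn_univ.1 (hRc.comp hmax fun t _ => mem_Ici.2 (le_max_right _ _))) (fun η hη hc hs => by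
      have := h (prodTF η hη hc hs ψ)
      simp only [slice_dt_prodTF, slice_prodTF, hR, testField_smul, real_inner_smul_left] at this
      refine Eq.trans ?_ (this.trans ?_)
      · congr 1
        refine setIntegral_congr_fun measurableSet_Ioi fun t ht => ?_
        beta_reduce
        rw [max_eq_left (le_of_lt ht)]
      · refine setIntegral_congr_fun measurableSet_Ioi fun t ht => ?_
        rw [max_eq_left (le_of_lt ht)]) hs hst
  rw [max_eq_left hs, max_eq_left (hs.trans hst)] at key
  rw [key]
  refine intervalIntegral.integral_congr fun τ hτ => ?_
  rw [uIcc_of_le hst] at hτ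
  rw [max_eq_left (hs.trans hτ.1)]

/-! ### Bounded weakly continuous curves and their integrals -/

theorem BoundedWeaklyContinuous.map {u : ℝ → L2Field} (hu : BoundedWeaklyContinuous u)
    (A : L2Field →L[ℝ] L2Field) : BoundedWeaklyContinuous fun t => A (u t) := by
  obtain ⟨M, hM⟩ := hu.bounded
  exact ⟨⟨‖A‖ * M, fun t ht => A.le_opNorm_of_le (hM t ht)⟩, hu.weaklyContinuous.map A⟩

theorem BoundedWeaklyContinuous.add {u w : ℝ → L2Field} (hu : BoundedWeaklyContinuous u)
    (hw : BoundedWeaklyContinuous w) : BoundedWeaklyContinuous fun t => u t + w t := by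
  obtain ⟨M, hM⟩ := hu.bounded
  obtain ⟨M', hM'⟩ := hw.bounded
  exact ⟨⟨M + M', fun t ht => norm_add_le_of_le (hM t ht) (hM' t ht)⟩,
    hu.weaklyContinuous.add hw.weaklyContinuous⟩

theorem boundedWeaklyContinuous_zero : BoundedWeaklyContinuous fun _ => 0 :=
  ⟨⟨0, fun _ _ => norm_zero.le⟩, weaklyContinuous_const 0⟩

theorem BoundedWeaklyContinuous.smul {u : ℝ → L2Field} (hu : BoundedWeaklyContinuous u) (c : ℝ) :
    BoundedWeaklyContinuous fun t => c • u t :=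
  hu.map (c • ContinuousLinearMap.id ℝ L2Field)

theorem BoundedWeaklyContinuous.sum {ι : Type*} (s : Finset ι) {u : ι → ℝ → L2Field}
    (hu : ∀ i, BoundedWeaklyContinuous (u i)) : BoundedWeaklyContinuous fun t => ∑ i ∈ s, u i t := by
  classical
  induction s using Finset.induction_on with
  | empty => simpa only [Finset.sum_empty] using boundedWeaklyContinuous_zero
  | insert i s hi ih => simpa only [Finset.sum_insert hi] using (hu i).add ih

/-- `F` is the weak integral of the curve `f` from `s` to `t`. -/
def WeakIntegral (f : ℝ → L2Field) (s t : ℝ) (F : L2Field) : Prop :=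
  ∀ v, IntervalIntegrable (fun τ => inner ℝ v (f τ)) volume s t ∧
    inner ℝ v F = ∫ τ in s..t, inner ℝ v (f τ)

theorem WeakIntegral.map {f : ℝ → L2Field} {s t : ℝ} {F : L2Field} (h : WeakIntegral f s t F)
    (A : L2Field →L[ℝ] L2Field) : WeakIntegral (fun τ => A (f τ)) s t (A F) := by
  intro v
  have := h (ContinuousLinearMap.adjoint A v)
  simpa only [ContinuousLinearMap.adjoint_inner_left] using this

theorem WeakIntegral.add {f g : ℝ → L2Field} {s t : ℝ} {F G : L2Field} (h : WeakIntegral f s t F)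
    (h' : WeakIntegral g s t G) : WeakIntegral (fun τ => f τ + g τ) s t (F + G) := by
  intro v
  simp only [inner_add_right]
  refine ⟨(h v).1.add (h' v).1, ?_⟩
  rw [intervalIntegral.integral_add (h v).1 (h' v).1, (h v).2, (h' v).2]

theorem WeakIntegral.smul {f : ℝ → L2Field} {s t : ℝ} {F : L2Field} (h : WeakIntegral f s t F)
    (c : ℝ) : WeakIntegral (fun τ => c • f τ) s t (c • F) :=
  h.map (c • ContinuousLinearMap.id ℝ L2Field)

theorem WeakIntegral.sum {ι : Type*} (σ : Finset ι) {f : ι → ℝ → L2Field} {s t : ℝ}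
    {F : ι → L2Field} (h : ∀ i, WeakIntegral (f i) s t (F i)) :
    WeakIntegral (fun τ => ∑ i ∈ σ, f i τ) s t (∑ i ∈ σ, F i) := by
  classical
  induction σ using Finset.induction_on with
  | empty =>
    intro v
    simp only [Finset.sum_empty, inner_zero_right, intervalIntegral.integral_zero, and_true]
    exact intervalIntegrable_const
  | insert i σ hi ih => simpa only [Finset.sum_insert hi] using (h i).add ih

theorem BoundedWeaklyContinuous.exists_weakIntegral {u : ℝ → L2Field}
    (hu : BoundedWeaklyContinuous u) {s t : ℝ} (hs : 0 ≤ s) (hst : s ≤ t) :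
    ∃ U, WeakIntegral u s t U := by
  obtain ⟨M, hM⟩ := hu.bounded
  have hint : ∀ v, IntervalIntegrable (fun τ => inner ℝ v (u τ)) volume s t := fun v =>
    ((hu.weaklyContinuous v).mono fun τ hτ => hs.trans hτ.1).intervalIntegrable_of_Icc hst
  let L : L2Field →ₗ[ℝ] ℝ :=
    { toFun := fun v => ∫ τ in s..t, inner ℝ v (u τ)
      map_add' := fun v w => by
        simp only [inner_add_left]
        exact intervalIntegral.integral_add (hint v) (hint w)
      map_smul' := fun c v => by
        simp only [real_inner_smul_left, intervalIntegral.integral_const_mul, RingHom.id_apply,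
          smul_eq_mul] }
  have hL : ∀ v, ‖L v‖ ≤ (M * |t - s|) * ‖v‖ := by
    intro v
    refine (intervalIntegral.norm_integral_le_of_norm_le_const (C := ‖v‖ * M)
      fun τ hτ => ?_).trans_eq (by ring)
    rw [uIoc_of_le hst] at hτ
    refine (norm_inner_le_norm _ _).trans ?_
    gcongr
    exact hM τ (hs.trans hτ.1.le)
  refine ⟨(InnerProductSpace.toDual ℝ L2Field).symm (L.mkContinuous _ hL), fun v => ⟨hint v, ?_⟩⟩
  rw [real_inner_comm, InnerProductSpace.toDual_symm_apply]
  rfl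

/-- The energy identity for a curve with a bounded weakly continuous weak derivative. -/
theorem norm_sq_sub_eq_integral {Y R : ℝ → L2Field} (hR : BoundedWeaklyContinuous R)
    (h : ∀ s t, 0 ≤ s → s ≤ t → WeakIntegral R s t (Y t - Y s)) {s t : ℝ} (hs : 0 ≤ s)
    (hst : s ≤ t) : ContinuousOn (fun τ => 2 * inner ℝ (Y τ) (R τ)) (Icc s t) ∧
      ‖Y t‖ ^ 2 - ‖Y s‖ ^ 2 = ∫ τ in s..t, 2 * inner ℝ (Y τ) (R τ) := by
  obtain ⟨M, hM⟩ := hR.bounded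
  -- Pairing the increment with itself turns the weak integral into a norm estimate; `Y` is thus
  -- Lipschitz in norm although `R` is only weakly continuous.
  have hlip' : ∀ s t, 0 ≤ s → s ≤ t → ‖Y t - Y s‖ ≤ M * |t - s| := by
    intro s t hs hst
    have h1 : inner ℝ (Y t - Y s) (Y t - Y s) ≤ (‖Y t - Y s‖ * M) * |t - s| := by
      rw [(h s t hs hst _).2]
      refine (Real.le_norm_self _).trans (intervalIntegral.norm_integral_le_of_norm_le_const
        (C := ‖Y t - Y s‖ * M) fun τ hτ => ?_)
      rw [uIoc_of_le hst] at hτ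
      refine (norm_inner_le_norm _ _).trans ?_
      gcongr
      exact hM τ (hs.trans hτ.1.le)
    rw [real_inner_self_eq_norm_sq] at h1
    rcases (norm_nonneg (Y t - Y s)).eq_or_lt with h0 | h0
    · rw [← h0]
      exact mul_nonneg ((norm_nonneg _).trans (hM s hs)) (abs_nonneg _)
    · refine le_of_mul_le_mul_left ?_ h0
      linarith
  have hlip : ∀ s t, 0 ≤ s → 0 ≤ t → ‖Y t - Y s‖ ≤ M * |t - s| := by
    intro s t hs ht
    rcases le_total s t with hst | hst
    · exact hlip' s t hs hst
    · rw [norm_sub_rev, abs_sub_comm]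
      exact hlip' t s ht hst
  have hM0 : 0 ≤ M := (norm_nonneg _).trans (hM 0 le_rfl)
  have hYc : ContinuousOn Y (Ici 0) := by
    have : LipschitzOnWith M.toNNReal Y (Ici 0) := LipschitzOnWith.of_dist_le_mul fun a ha b hb => by
      rw [dist_eq_norm, Real.dist_eq, Real.coe_toNNReal _ hM0]
      exact hlip b a hb ha
    exact this.continuousOn
  have hc : ContinuousOn (fun τ => 2 * inner ℝ (Y τ) (R τ)) (Ici 0) := by
    refine continuousOn_const.mul fun τ hτ => ?_
    exact WT.inner_tendsto (l := 𝓝[Ici 0] τ) (fun v => hR.weaklyContinuous v τ hτ)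
      (eventually_mem_nhdsWithin.mono fun a ha => hM a ha) (hYc τ hτ)
  have hsub : Icc s t ⊆ Ici 0 := fun τ hτ => hs.trans hτ.1
  refine ⟨hc.mono hsub, ?_⟩
  have hder : ∀ τ, 0 < τ → HasDerivAt (fun τ => ‖Y τ‖ ^ 2) (2 * inner ℝ (Y τ) (R τ)) τ := by
    intro τ hτ
    have hd : ∀ v, HasDerivAt (fun τ => inner ℝ v (Y τ)) (inner ℝ v (R τ)) τ := by
      intro v
      have h2 : HasDerivAt (fun a => ∫ x in (0 : ℝ)..a, inner ℝ v (R x)) (inner ℝ v (R τ)) τ := by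
        refine intervalIntegral.integral_hasDerivAt_right (h 0 τ le_rfl hτ.le v).1 ?_ ?_
        · exact ((hR.weaklyContinuous v).mono Ioi_subset_Ici_self).stronglyMeasurableAtFilter
            isOpen_Ioi τ hτ
        · exact (hR.weaklyContinuous v).continuousAt (Ici_mem_nhds hτ)
      refine (h2.const_add (inner ℝ v (Y 0))).congr_of_eventuallyEq ?_
      filter_upwards [Ici_mem_nhds hτ] with a ha
      rw [← (h 0 a le_rfl ha v).2, inner_sub_right]
      ring
    have hw : WT (𝓝[≠] τ) (fun a => slope Y τ a) (R τ) := by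
      intro v
      refine (hasDerivAt_iff_tendsto_slope.1 (hd v)).congr fun a => ?_
      simp only [slope_def_module, real_inner_smul_right, inner_sub_right, smul_eq_mul]
    have hb : ∀ᶠ a in 𝓝[≠] τ, ‖slope Y τ a‖ ≤ M := by
      filter_upwards [eventually_mem_nhdsWithin, nhdsWithin_le_nhds (lt_mem_nhds hτ)] with a ha ha'
      rw [slope_def_module, norm_smul, norm_inv, Real.norm_eq_abs]
      rw [inv_mul_le_iff₀ (abs_pos.2 (sub_ne_zero.2 ha)), mul_comm]
      exact hlip τ a hτ.le ha'.le
    have hYt : Tendsto (fun a => Y a + Y τ) (𝓝[≠] τ) (𝓝 (Y τ + Y τ)) :=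
      (((hYc.continuousAt (Ici_mem_nhds hτ)).tendsto.mono_left nhdsWithin_le_nhds)).add_const _
    -- The slope of `‖Y‖²` is the pairing of the slope of `Y`, weakly convergent and bounded, with
    -- `Y a + Y τ`, strongly convergent.
    rw [hasDerivAt_iff_tendsto_slope, two_mul, ← inner_add_left]
    refine (hw.inner_tendsto hb hYt).congr fun a => ?_
    simp only [slope_def_module, real_inner_smul_right, smul_eq_mul]
    congr 1
    rw [inner_add_left, inner_sub_right, inner_sub_right, real_inner_self_eq_norm_sq,
      real_inner_self_eq_norm_sq, real_inner_comm (Y a)]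
    ring
  refine (intervalIntegral.integral_eq_sub_of_hasDerivAt_of_le hst
    ((hYc.mono hsub).norm.pow 2) (fun τ hτ => hder τ (hs.trans_lt hτ.1))
    ((hc.mono hsub).intervalIntegrable_of_Icc hst)).symm

/-! ### Regularisation of the tested equations -/

namespace MollifierKernel

variable (θ : MollifierKernel)

/-- The regularisation of the functional `F`, seen as a distribution, is the field `r`. -/
def Represented (δ : ℝ) (F : Fin 3 → TF → ℝ) (r : L2Field) : Prop :=
  ∀ i φ, Integrable (fun y => θ.tf y * F i (transTF (δ • y) φ)) ∧
    ∫ y, θ.tf y * F i (transTF (δ • y) φ) = inner ℝ (testField i φ) r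

variable {θ} {δ : ℝ} {F F' : Fin 3 → TF → ℝ} {r r' : L2Field}

theorem Represented.add (h : θ.Represented δ F r) (h' : θ.Represented δ F' r') :
    θ.Represented δ (fun i φ => F i φ + F' i φ) (r + r') := by
  intro i φ
  simp only [mul_add, inner_add_right]
  exact ⟨(h i φ).1.add (h' i φ).1, by rw [integral_add (h i φ).1 (h' i φ).1, (h i φ).2, (h' i φ).2]⟩

theorem Represented.smul (h : θ.Represented δ F r) (c : ℝ) :
    θ.Represented δ (fun i φ => c * F i φ) (c • r) := by
  intro i φ
  simp only [mul_left_comm _ c, real_inner_smul_right]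
  exact ⟨(h i φ).1.const_mul c, by rw [integral_const_mul, (h i φ).2]⟩

theorem Represented.sum {ι : Type*} (s : Finset ι) {F : ι → Fin 3 → TF → ℝ} {r : ι → L2Field}
    (h : ∀ k, θ.Represented δ (F k) (r k)) :
    θ.Represented δ (fun i φ => ∑ k ∈ s, F k i φ) (∑ k ∈ s, r k) := by
  intro i φ
  simp only [Finset.mul_sum, inner_sum]
  exact ⟨integrable_finsetSum _ fun k _ => (h k i φ).1, by
    rw [integral_finsetSum _ fun k _ => (h k i φ).1]
    exact Finset.sum_congr rfl fun k _ => (h k i φ).2⟩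

theorem Represented.unique (h : θ.Represented δ F r) (h' : θ.Represented δ F r') : r = r' :=
  ext_inner_testField fun i φ => (h i φ).2.symm.trans (h' i φ).2

/-- By equivariance, averaging the functional over translated test functions amounts to mollifying
`T i φ`. -/
theorem represented_of_adj {T : Fin 3 → TF → L2Field}
    (hT : ∀ i φ y, T i (transTF y φ) = trans y (T i φ)) {g : L2Field}
    (h : ∀ i φ, inner ℝ (testField i φ) r = inner ℝ (θ.S δ (T i φ)) g) :
    θ.Represented δ (fun i φ => inner ℝ (T i φ) g) r := by
  intro i φ
  simp only [hT]
  refine ⟨?_, ?_⟩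
  · have := (integrable_smul_trans θ.tf δ (T i φ)).inner_const (𝕜 := ℝ) g
    simpa only [real_inner_smul_left] using this
  · rw [h]
    unfold S
    rw [inner_cv_left]

theorem represented_S (v : L2Field) :
    θ.Represented δ (fun i φ => inner ℝ (testField i φ) v) (θ.S δ v) :=
  represented_of_adj (fun i φ y => (trans_testField y i φ).symm) fun _ _ => (θ.inner_S δ _ _).symm

theorem represented_curlS (hδ : δ ≠ 0) (v : L2Field) :
    θ.Represented δ (fun i φ => inner ℝ (curlT i φ) v) (θ.curlS δ v) :=
  represented_of_adj θ.firstOrder_curlS.equivariant fun i φ => θ.firstOrder_curlS.adj hδ i φ v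

theorem represented_DD (hδ : δ ≠ 0) (a b : Fin 3) (v : L2Field) :
    θ.Represented δ (fun i φ => inner ℝ (testField i (∂_{e a} (∂_{e b} φ))) v) (θ.DD a b δ v) :=
  represented_of_adj (T := fun i φ => testField i (∂_{e a} (∂_{e b} φ)))
    (fun i φ y => by rw [lineDeriv_transTF, lineDeriv_transTF, trans_testField]) fun i φ => by
    rw [← inner_DD, DD_testField _ _ _ hδ]

theorem represented_D (hδ : δ ≠ 0) (a : Fin 3) (v : L2Field) :
    θ.Represented δ (fun i φ => inner ℝ (testField i (∂_{e a} φ)) v) (-θ.D a δ v) :=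
  represented_of_adj (T := fun i φ => testField i (∂_{e a} φ))
    (fun i φ y => by rw [lineDeriv_transTF, trans_testField]) fun i φ => by
    rw [← D_testField _ _ hδ, inner_D, inner_neg_right]

variable (θ δ)

/-- The regularised Laplacian. -/
def lapR : L2Field →L[ℝ] L2Field := ∑ j, θ.DD j j δ

/-- The regularised gradient of the divergence. -/
def gradDivR : L2Field →L[ℝ] L2Field := ∑ i, ∑ j, P i j ∘L θ.DD i j δ

theorem lapR_apply (v : L2Field) : θ.lapR δ v = ∑ j, θ.DD j j δ v := by
  simp [lapR]

theorem gradDivR_apply (v : L2Field) : θ.gradDivR δ v = ∑ i, ∑ j, P i j (θ.DD i j δ v) := by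
  simp [gradDivR]

attribute [irreducible] lapR gradDivR

variable {δ}

/-- The equation is mollified once and then paired with a once mollified field. The second
mollification completes the single kernel of `DD` to a product of two first derivatives, which can
be integrated by parts. -/
theorem S_lapR (hδ : δ ≠ 0) (v : L2Field) : θ.S δ (θ.lapR δ v) = θ.lapS δ v := by
  rw [lapR_apply, lapS_apply, map_sum]
  exact Finset.sum_congr rfl fun j _ => θ.S_DD j j hδ v

theorem S_gradDivR (hδ : δ ≠ 0) (v : L2Field) : θ.S δ (θ.gradDivR δ v) = θ.gradDivS δ v := by
  rw [gradDivR_apply, gradDivS_apply, map_sum]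
  refine Finset.sum_congr rfl fun i _ => ?_
  rw [map_sum]
  refine Finset.sum_congr rfl fun j _ => ?_
  rw [← θ.clm_S δ (trans_P i j), θ.S_DD i j hδ]

theorem represented_lapR (hδ : δ ≠ 0) (v : L2Field) :
    θ.Represented δ (fun i φ => inner ℝ (lapT i φ) v) (θ.lapR δ v) := by
  rw [lapR_apply]
  simp only [lapT, sum_inner]
  exact Represented.sum _ fun j => represented_DD hδ j j v

theorem represented_gradDivR (hδ : δ ≠ 0) (v : L2Field) :
    θ.Represented δ (fun i φ => inner ℝ (gradDivT i φ) v) (θ.gradDivR δ v) := by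
  refine represented_of_adj (T := gradDivT) (fun i φ y => ?_) fun i φ => ?_
  · simp only [gradDivT, map_sum, lineDeriv_transTF, trans_testField]
  · rw [gradDivR_apply, gradDivT, map_sum, inner_sum, sum_inner, Finset.sum_eq_single i]
    · rw [inner_sum]
      refine Finset.sum_congr rfl fun j _ => ?_
      rw [← inner_P, P_testField, if_pos rfl, ← inner_DD, DD_testField _ _ _ hδ, lineDeriv_comm]
    · intro a _ ha
      rw [inner_sum]
      refine Finset.sum_eq_zero fun j _ => ?_
      rw [← inner_P, P_testField, if_neg ha, inner_zero_left]
    · exact fun h => absurd (Finset.mem_univ i) h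

variable {ε : ℝ} (hε : ε ≠ 0) (μ χ γ κ : ℝ) (δ)

/-- The regularised right-hand side of the velocity equation. -/
def vecU (u w : L2Field) (m : Fin 3 → L2Field) : L2Field :=
  (μ + χ) • θ.lapR δ u + (2 * χ) • θ.curlS δ w + ∑ j, -θ.D j δ (leray (m j))

/-- The regularised right-hand side of the microrotation equation. -/
def vecW (u w : L2Field) (m : Fin 3 → L2Field) : L2Field :=
  γ • θ.lapR δ w + κ • θ.gradDivR δ w + (2 * χ) • θ.curlS δ u + (-(4 * χ)) • θ.S δ w +
    ∑ j, -θ.D j δ (m j)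

variable {δ}

theorem represented_vecU (hδ : δ ≠ 0) (u w : L2Field) (m : Fin 3 → L2Field) :
    θ.Represented δ (fun i φ => linUT μ χ i φ u w +
      ∑ j, inner ℝ (leray (testField i (∂_{e j} φ))) (m j)) (θ.vecU δ μ χ u w m) := by
  unfold linUT vecU
  refine (((represented_lapR θ hδ u).smul _).add ((represented_curlS hδ w).smul _)).add
    (Represented.sum _ fun j => ?_)
  simp only [inner_leray]
  exact represented_D hδ j (leray (m j))

theorem represented_vecW (hδ : δ ≠ 0) (u w : L2Field) (m : Fin 3 → L2Field) :
    θ.Represented δ (fun i φ => linWT χ γ κ i φ u w +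
      ∑ j, inner ℝ (testField i (∂_{e j} φ)) (m j)) (θ.vecW δ χ γ κ u w m) := by
  unfold linWT vecW
  simp only [sub_eq_add_neg, ← neg_mul]
  exact (((((represented_lapR θ hδ w).smul _).add ((represented_gradDivR θ hδ w).smul _)).add
    ((represented_curlS hδ u).smul _)).add ((represented_S w).smul _)).add
    (Represented.sum _ fun j => represented_D hδ j (m j))

variable (δ)

theorem boundedWeaklyContinuous_vecU {u w : ℝ → L2Field} {m : Fin 3 → ℝ → L2Field}
    (hu : BoundedWeaklyContinuous u) (hw : BoundedWeaklyContinuous w)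
    (hm : ∀ j, BoundedWeaklyContinuous (m j)) :
    BoundedWeaklyContinuous fun t => θ.vecU δ μ χ (u t) (w t) fun j => m j t :=
  (((hu.map _).smul _).add ((hw.map _).smul _)).add (BoundedWeaklyContinuous.sum _ fun j =>
    ((hm j).map leray).map (-θ.D j δ))

theorem boundedWeaklyContinuous_vecW {u w : ℝ → L2Field} {m : Fin 3 → ℝ → L2Field}
    (hu : BoundedWeaklyContinuous u) (hw : BoundedWeaklyContinuous w)
    (hm : ∀ j, BoundedWeaklyContinuous (m j)) :
    BoundedWeaklyContinuous fun t => θ.vecW δ χ γ κ (u t) (w t) fun j => m j t :=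
  (((((hw.map _).smul _).add ((hw.map _).smul _)).add ((hu.map _).smul _)).add
    ((hw.map _).smul _)).add (BoundedWeaklyContinuous.sum _ fun j => (hm j).map (-θ.D j δ))

theorem weakIntegral_vecU {u w : ℝ → L2Field} {m : Fin 3 → ℝ → L2Field} {s t : ℝ}
    {U W : L2Field} {V : Fin 3 → L2Field} (hu : WeakIntegral u s t U) (hw : WeakIntegral w s t W)
    (hm : ∀ j, WeakIntegral (m j) s t (V j)) :
    WeakIntegral (fun t => θ.vecU δ μ χ (u t) (w t) fun j => m j t) s t (θ.vecU δ μ χ U W V) :=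
  (((hu.map _).smul _).add ((hw.map _).smul _)).add (WeakIntegral.sum _ fun j =>
    ((hm j).map leray).map (-θ.D j δ))

theorem weakIntegral_vecW {u w : ℝ → L2Field} {m : Fin 3 → ℝ → L2Field} {s t : ℝ}
    {U W : L2Field} {V : Fin 3 → L2Field} (hu : WeakIntegral u s t U) (hw : WeakIntegral w s t W)
    (hm : ∀ j, WeakIntegral (m j) s t (V j)) :
    WeakIntegral (fun t => θ.vecW δ χ γ κ (u t) (w t) fun j => m j t) s t
      (θ.vecW δ χ γ κ U W V) :=
  (((((hw.map _).smul _).add ((hw.map _).smul _)).add ((hu.map _).smul _)).add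
    ((hw.map _).smul _)).add (WeakIntegral.sum _ fun j => (hm j).map (-θ.D j δ))

end MollifierKernel

/-- The function `f` is integrable from `s` to `t` and its integral is `I`. -/
def HasIntegral (f : ℝ → ℝ) (s t I : ℝ) : Prop :=
  IntervalIntegrable f volume s t ∧ I = ∫ τ in s..t, f τ

namespace HasIntegral

variable {f g : ℝ → ℝ} {s t I J : ℝ}

theorem add (h : HasIntegral f s t I) (h' : HasIntegral g s t J) :
    HasIntegral (fun τ => f τ + g τ) s t (I + J) :=
  ⟨h.1.add h'.1, by rw [intervalIntegral.integral_add h.1 h'.1, h.2, h'.2]⟩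

theorem sub (h : HasIntegral f s t I) (h' : HasIntegral g s t J) :
    HasIntegral (fun τ => f τ - g τ) s t (I - J) :=
  ⟨h.1.sub h'.1, by rw [intervalIntegral.integral_sub h.1 h'.1, h.2, h'.2]⟩

theorem const_mul (h : HasIntegral f s t I) (c : ℝ) :
    HasIntegral (fun τ => c * f τ) s t (c * I) :=
  ⟨h.1.const_mul c, by rw [intervalIntegral.integral_const_mul, h.2]⟩

theorem sum {ι : Type*} (σ : Finset ι) {f : ι → ℝ → ℝ} {I : ι → ℝ}
    (h : ∀ k, HasIntegral (f k) s t (I k)) :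
    HasIntegral (fun τ => ∑ k ∈ σ, f k τ) s t (∑ k ∈ σ, I k) := by
  refine ⟨?_, ?_⟩
  · have := IntervalIntegrable.sum σ fun k _ => (h k).1
    refine this.congr_ae (Eventually.of_forall fun τ => ?_)
    rw [Finset.sum_apply]
  · rw [intervalIntegral.integral_finsetSum fun k _ => (h k).1]
    exact Finset.sum_congr rfl fun k _ => (h k).2

end HasIntegral

theorem lineDeriv_smul_testFunction (v : E3) (c : ℝ) (φ : TF) : ∂_{v} (c • φ) = c • ∂_{v} φ :=
  LineDerivSMul.lineDerivOp_smul v c φ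

theorem linUT_smul (μ χ : ℝ) (i : Fin 3) (c : ℝ) (φ : TF) (u w : L2Field) :
    linUT μ χ i (c • φ) u w = c * linUT μ χ i φ u w := by
  simp only [linUT, lapT, MollifierKernel.curlT, lineDeriv_smul_testFunction, testField_smul,
    ← Finset.smul_sum, ← smul_sub, real_inner_smul_left]
  ring

theorem linWT_smul (χ γ κ : ℝ) (i : Fin 3) (c : ℝ) (φ : TF) (u w : L2Field) :
    linWT χ γ κ i (c • φ) u w = c * linWT χ γ κ i φ u w := by
  simp only [linWT, lapT, gradDivT, MollifierKernel.curlT, lineDeriv_smul_testFunction,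
    testField_smul, ← Finset.smul_sum, ← smul_sub, real_inner_smul_left]
  ring

namespace MollifierKernel

variable (θ : MollifierKernel) {ε : ℝ} (hε : ε ≠ 0) (μ χ γ κ : ℝ)

theorem rhsU_smul (i : Fin 3) (c : ℝ) (φ : TF) (u w : L2Field) :
    θ.rhsU hε μ χ i (c • φ) u w = c * θ.rhsU hε μ χ i φ u w := by
  simp only [rhsU, trU, linUT_smul, lineDeriv_smul_testFunction, testField_smul, map_smul,
    real_inner_smul_left, ← Finset.mul_sum, mul_add]

theorem rhsW_smul (i : Fin 3) (c : ℝ) (φ : TF) (u w : L2Field) :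
    θ.rhsW hε χ γ κ i (c • φ) u w = c * θ.rhsW hε χ γ κ i φ u w := by
  simp only [rhsW, trW, linWT_smul, lineDeriv_smul_testFunction, testField_smul,
    real_inner_smul_left, ← Finset.mul_sum, mul_add]

/-- The regularised velocity equation in integrated form. -/
theorem weakIntegral_S_velocity {δ : ℝ} (hδ : δ ≠ 0) {u w : ℝ → L2Field}
    (hu : BoundedWeaklyContinuous u) (hw : BoundedWeaklyContinuous w)
    (h : ∀ i, Dt (comp u i) + lerayTransportD (fun t => mollify θ ε (u t)) u i = linU μ χ u w i)
    {s t : ℝ} (hs : 0 ≤ s) (hst : s ≤ t) :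
    WeakIntegral (fun t => θ.vecU δ μ χ (u t) (w t) fun j => mulL (θ.mol ε hε j (u t)) (u t)) s t
      (θ.S δ (u t) - θ.S δ (u s)) := by
  have hm := fun j => θ.boundedWeaklyContinuous_mulL hε hu hu j
  obtain ⟨U, hU⟩ := hu.exists_weakIntegral hs hst
  obtain ⟨W, hW⟩ := hw.exists_weakIntegral hs hst
  choose V hV using fun j => (hm j).exists_weakIntegral hs hst
  have key : ∀ i φ, inner ℝ (testField i φ) (u t - u s) = linUT μ χ i φ U W +
      ∑ j, inner ℝ (leray (testField i (∂_{e j} φ))) (V j) := by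
    intro i φ
    rw [inner_sub_right, sub_eq_integral_of_weak hu.weaklyContinuous
      (R := fun φ t => θ.rhsU hε μ χ i φ (u t) (w t)) (fun c t => θ.rhsU_smul hε μ χ i c φ _ _)
      (θ.continuousOn_rhsU hε μ χ hu hw i φ) ((θ.velocity_iff hε hu hw μ χ i).1 (h i)) hs hst]
    simp only [rhsU, linUT, trU]
    exact ((HasIntegral.const_mul (hU _) _).add (HasIntegral.const_mul (hW _) _)).add
      (HasIntegral.sum _ fun j => hV j _) |>.2.symm
  have h1 := represented_S (θ := θ) (δ := δ) (u t - u s)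
  simp only [key] at h1
  -- The mollified increment and the regularised right-hand side of the time integrals represent the
  -- same functional of the test field, so they coincide in `L²`.
  rw [← map_sub, h1.unique (θ.represented_vecU μ χ hδ U W V)]
  exact θ.weakIntegral_vecU δ μ χ hU hW hV

/-- The regularised microrotation equation in integrated form. -/
theorem weakIntegral_S_microrotation {δ : ℝ} (hδ : δ ≠ 0) {u w : ℝ → L2Field}
    (hu : BoundedWeaklyContinuous u) (hw : BoundedWeaklyContinuous w)
    (h : ∀ i, Dt (comp w i) + transportD (fun t => mollify θ ε (u t)) w i = linW χ γ κ u w i)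
    {s t : ℝ} (hs : 0 ≤ s) (hst : s ≤ t) :
    WeakIntegral (fun t => θ.vecW δ χ γ κ (u t) (w t) fun j => mulL (θ.mol ε hε j (u t)) (w t)) s t
      (θ.S δ (w t) - θ.S δ (w s)) := by
  have hm := fun j => θ.boundedWeaklyContinuous_mulL hε hu hw j
  obtain ⟨U, hU⟩ := hu.exists_weakIntegral hs hst
  obtain ⟨W, hW⟩ := hw.exists_weakIntegral hs hst
  choose V hV using fun j => (hm j).exists_weakIntegral hs hst
  have key : ∀ i φ, inner ℝ (testField i φ) (w t - w s) = linWT χ γ κ i φ U W +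
      ∑ j, inner ℝ (testField i (∂_{e j} φ)) (V j) := by
    intro i φ
    rw [inner_sub_right, sub_eq_integral_of_weak hw.weaklyContinuous
      (R := fun φ t => θ.rhsW hε χ γ κ i φ (u t) (w t)) (fun c t => θ.rhsW_smul hε χ γ κ i c φ _ _)
      (θ.continuousOn_rhsW hε χ γ κ hu hw i φ) ((θ.microrotation_iff hε hu hw χ γ κ i).1 (h i)) hs
      hst]
    simp only [rhsW, linWT, trW]
    exact ((((HasIntegral.const_mul (hW _) _).add (HasIntegral.const_mul (hW _) _)).add
      (HasIntegral.const_mul (hU _) _)).sub (HasIntegral.const_mul (hW _) _)).add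
      (HasIntegral.sum _ fun j => hV j _) |>.2.symm
  have h1 := represented_S (θ := θ) (δ := δ) (w t - w s)
  simp only [key] at h1
  rw [← map_sub, h1.unique (θ.represented_vecW χ γ κ hδ U W V)]
  exact θ.weakIntegral_vecW δ χ γ κ hU hW hV

theorem _root_.Micropolar.inner_smul_add_smul_add_smul_add_smul_add {H : Type*}
    [NormedAddCommGroup H] [InnerProductSpace ℝ H] {u x₁ x₂ x₃ x₄ y : H}
    {c₁ c₂ c₃ c₄ p₁ p₂ p₃ p₄ q : ℝ} (h₁ : inner ℝ u x₁ = p₁) (h₂ : inner ℝ u x₂ = p₂)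
    (h₃ : inner ℝ u x₃ = p₃) (h₄ : inner ℝ u x₄ = p₄) (h : inner ℝ u y = q) :
    inner ℝ u (c₁ • x₁ + c₂ • x₂ + c₃ • x₃ + c₄ • x₄ + y) =
      c₁ * p₁ + c₂ * p₂ + c₃ * p₃ + c₄ * p₄ + q := by
  rw [inner_add_right, inner_add_right, inner_add_right, inner_add_right, real_inner_smul_right,
    real_inner_smul_right, real_inner_smul_right, real_inner_smul_right, h₁, h₂, h₃, h₄, h]

/-- The work of the transport term in the regularised energy balance. -/
def workS (δ : ℝ) (u v : L2Field) : ℝ :=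
  ∑ j, inner ℝ (θ.S δ v) (θ.D j δ (mulL (θ.mol ε hε j u) v))

theorem inner_S_lapR {δ : ℝ} (hδ : δ ≠ 0) (v : L2Field) :
    inner ℝ (θ.S δ v) (θ.lapR δ v) = -∑ j, ‖θ.D j δ v‖ ^ 2 := by
  have e1 := θ.inner_S δ v (θ.lapR δ v)
  have e2 := θ.inner_lapS δ v v
  rw [real_inner_comm] at e2
  rw [e1, S_lapR _ hδ, e2]
  simp only [real_inner_self_eq_norm_sq]

theorem inner_S_gradDivR {δ : ℝ} (hδ : δ ≠ 0) (v : L2Field) :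
    inner ℝ (θ.S δ v) (θ.gradDivR δ v) = -‖θ.divS δ v‖ ^ 2 := by
  have e1 := θ.inner_S δ v (θ.gradDivR δ v)
  have e2 := θ.inner_gradDivS δ v v
  rw [real_inner_comm] at e2
  rw [e1, S_gradDivR _ hδ, e2, real_inner_self_eq_norm_sq]

theorem inner_S_D_leray (δ : ℝ) {u : L2Field} (hu : u ∈ L2sigma) (j : Fin 3) (m : L2Field) :
    inner ℝ (θ.S δ u) (θ.D j δ (leray m)) = inner ℝ (θ.S δ u) (θ.D j δ m) := by
  have e1 := inner_leray (θ.S δ u) (θ.D j δ m)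
  have e2 := θ.leray_S δ u
  have e3 := θ.leray_D j δ m
  rw [e2, leray_of_mem hu, e3] at e1
  exact e1.symm

theorem inner_vecU {δ : ℝ} (hδ : δ ≠ 0) {u : L2Field} (hu : u ∈ L2sigma) (w : L2Field) :
    inner ℝ (θ.S δ u) (θ.vecU δ μ χ u w fun j => mulL (θ.mol ε hε j u) u) =
      -((μ + χ) * ∑ j, ‖θ.D j δ u‖ ^ 2) + 2 * χ * inner ℝ (θ.curlS δ u) (θ.S δ w) -
        θ.workS hε δ u u := by
  have h1 := θ.inner_S_lapR hδ u
  have h2 : inner ℝ (θ.S δ u) (θ.curlS δ w) = inner ℝ (θ.curlS δ u) (θ.S δ w) := by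
    have e1 := θ.inner_S δ u (θ.curlS δ w)
    have e2 := θ.inner_S_curlS hδ u w
    rw [leray_of_mem hu] at e2
    rw [e1, e2]
  have h3 : inner ℝ (θ.S δ u) (∑ j, -θ.D j δ (leray (mulL (θ.mol ε hε j u) u))) =
      -θ.workS hε δ u u := by
    rw [inner_sum, workS, ← Finset.sum_neg_distrib]
    refine Finset.sum_congr rfl fun j _ => ?_
    have e1 := θ.inner_S_D_leray δ hu j (mulL (θ.mol ε hε j u) u)
    exact (inner_neg_right _ _).trans (congrArg Neg.neg e1)
  unfold vecU
  rw [inner_add_right, inner_smul_add_smul h1 h2, h3]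
  ring

theorem inner_vecW {δ : ℝ} (hδ : δ ≠ 0) (u w : L2Field) :
    inner ℝ (θ.S δ w) (θ.vecW δ χ γ κ u w fun j => mulL (θ.mol ε hε j u) w) =
      -(γ * ∑ j, ‖θ.D j δ w‖ ^ 2) - κ * ‖θ.divS δ w‖ ^ 2 +
      2 * χ * inner ℝ (θ.curlS δ u) (θ.S δ w) - 4 * χ * ‖θ.S δ w‖ ^ 2 -
        θ.workS hε δ u w := by
  have h1 := θ.inner_S_lapR hδ w
  have h2 := θ.inner_S_gradDivR hδ w
  have h4 : inner ℝ (θ.S δ w) (θ.curlS δ u) = inner ℝ (θ.curlS δ u) (θ.S δ w) :=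
    real_inner_comm _ _
  have h5 := real_inner_self_eq_norm_sq (θ.S δ w)
  have h3 : inner ℝ (θ.S δ w) (∑ j, -θ.D j δ (mulL (θ.mol ε hε j u) w)) =
      -θ.workS hε δ u w := by
    rw [inner_sum, workS, ← Finset.sum_neg_distrib]
    exact Finset.sum_congr rfl fun j _ => inner_neg_right _ _
  exact (inner_smul_add_smul_add_smul_add_smul_add h1 h2 h4 h5 h3).trans (by ring)

end MollifierKernel

/-! ### The energy equality -/

theorem enorm_sq_eq_ofReal {H : Type*} [NormedAddCommGroup H] (x : H) :
    ‖x‖ₑ ^ 2 = ENNReal.ofReal (‖x‖ ^ 2) := by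
  rw [← ofReal_norm, ENNReal.ofReal_pow (norm_nonneg _)]

theorem two_mul_ofReal (x : ℝ) : 2 * ENNReal.ofReal x = ENNReal.ofReal (2 * x) := by
  rw [ENNReal.ofReal_mul zero_le_two, ENNReal.ofReal_ofNat]

theorem tendsto_ofReal_mul {ι : Type*} {l : Filter ι} {f : ι → ℝ≥0∞} {c : ℝ} {x : ℝ≥0∞}
    (hx : ENNReal.ofReal c * x ≠ ⊤) (h : x ≠ ⊤ → Tendsto f l (𝓝 x)) :
    Tendsto (fun i => ENNReal.ofReal c * f i) l (𝓝 (ENNReal.ofReal c * x)) := by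
  rcases eq_or_ne (ENNReal.ofReal c) 0 with hc | hc
  · simp only [hc, zero_mul]
    exact tendsto_const_nhds
  · refine ENNReal.Tendsto.const_mul (h fun hx' => hx ?_) (Or.inr ENNReal.ofReal_ne_top)
    rw [hx', ENNReal.mul_top hc]

/-- Half of the density of the dissipation. -/
def dissDensity (μ χ γ κ : ℝ) (u w : L2Field) : ℝ≥0∞ :=
  ENNReal.ofReal μ * gradSq u + ENNReal.ofReal γ * gradSq w + ENNReal.ofReal κ * divSq w +
    ENNReal.ofReal χ * curlSubSq u w

theorem aemeasurable_gradSq (θ : MollifierKernel) {u : ℝ → L2Field} (hu : WeaklyContinuous u) :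
    AEMeasurable (fun t => gradSq (u t)) (volume.restrict (Ioi 0)) := by
  simp only [θ.gradSq_eq]
  exact Finset.aemeasurable_fun_sum _ fun j _ =>
    (θ.firstOrder_D j).aemeasurable_nSq hu (weaklyContinuous_const 0)

theorem aemeasurable_divSq (θ : MollifierKernel) {u : ℝ → L2Field} (hu : WeaklyContinuous u) :
    AEMeasurable (fun t => divSq (u t)) (volume.restrict (Ioi 0)) := by
  simp only [θ.divSq_eq]
  exact θ.firstOrder_divS.aemeasurable_nSq hu (weaklyContinuous_const 0)

theorem aemeasurable_curlSubSq (θ : MollifierKernel) {u w : ℝ → L2Field}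
    (hu : WeaklyContinuous u) (hw : WeaklyContinuous w) :
    AEMeasurable (fun t => curlSubSq (u t) (w t)) (volume.restrict (Ioi 0)) := by
  simp only [θ.curlSubSq_eq]
  exact θ.firstOrder_curlS.aemeasurable_nSq hu
    (hw.map ((2 : ℝ) • ContinuousLinearMap.id ℝ L2Field))

theorem aemeasurable_dissDensity (θ : MollifierKernel) (μ χ γ κ : ℝ) {u w : ℝ → L2Field}
    (hu : WeaklyContinuous u) (hw : WeaklyContinuous w) :
    AEMeasurable (fun t => dissDensity μ χ γ κ (u t) (w t)) (volume.restrict (Ioi 0)) :=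
  ((((aemeasurable_gradSq θ hu).const_mul _).add ((aemeasurable_gradSq θ hw).const_mul _)).add
    ((aemeasurable_divSq θ hw).const_mul _)).add ((aemeasurable_curlSubSq θ hu hw).const_mul _)

/-- For `γ > 0` the energy class controls only the gradient of `w`; this supplies the divergence
term. -/
theorem divSq_le_gradSq (θ : MollifierKernel) (v : L2Field) : divSq v ≤ gradSq v := by
  rw [θ.divSq_eq, θ.gradSq_eq]
  refine iSup_le fun n => ?_
  calc ‖θ.divS (MollifierKernel.dn n) v - θ.S (MollifierKernel.dn n) 0‖ₑ ^ 2 ≤ ∑ j, ‖θ.D j (MollifierKernel.dn n) v‖ₑ ^ 2 := by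
        simp only [map_zero, sub_zero, enorm_sq_eq_ofReal]
        rw [← ENNReal.ofReal_sum_of_nonneg fun j _ => sq_nonneg _]
        refine ENNReal.ofReal_le_ofReal ?_
        rw [θ.sum_norm_D_sq]
        linarith [sq_nonneg ‖θ.curlS (MollifierKernel.dn n) v‖]
    _ ≤ ∑ j, θ.nSq (θ.D j) v 0 := Finset.sum_le_sum fun j _ => by
        have := (θ.firstOrder_D j).enorm_le (v := v) (c := 0) (MollifierKernel.dn_pos n).ne'
        rwa [map_zero, sub_zero] at this

/-- The constants come from `(a + 2b)² ≤ 2a² + 8b²` and `‖curl u‖ ≤ ‖∇u‖`, at each scale. -/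
theorem curlSubSq_le (θ : MollifierKernel) (u w : L2Field) :
    curlSubSq u w ≤ 2 * gradSq u + 8 * ‖w‖ₑ ^ 2 := by
  rw [θ.curlSubSq_eq, θ.gradSq_eq]
  refine iSup_le fun n => ?_
  calc ‖θ.curlS (MollifierKernel.dn n) u - θ.S (MollifierKernel.dn n) ((2 : ℝ) • w)‖ₑ ^ 2
      ≤ 2 * ∑ j, ‖θ.D j (MollifierKernel.dn n) u‖ₑ ^ 2 + 8 * ‖w‖ₑ ^ 2 := by
        have h8 : ∀ x : ℝ, 8 * ENNReal.ofReal x = ENNReal.ofReal (8 * x) := fun x => by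
          rw [ENNReal.ofReal_mul (by norm_num), ENNReal.ofReal_ofNat]
        simp only [enorm_sq_eq_ofReal]
        rw [← ENNReal.ofReal_sum_of_nonneg fun j _ => sq_nonneg _,
          two_mul_ofReal, h8,
          ← ENNReal.ofReal_add (by positivity) (by positivity)]
        refine ENNReal.ofReal_le_ofReal ?_
        have h1 := θ.sum_norm_D_sq (MollifierKernel.dn n) u
        have h2 := norm_sub_le (θ.curlS (MollifierKernel.dn n) u) (θ.S (MollifierKernel.dn n) ((2 : ℝ) • w))
        have h3 := θ.norm_S_le (MollifierKernel.dn n) ((2 : ℝ) • w)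
        rw [norm_smul, Real.norm_ofNat] at h3
        have h4 : ‖θ.curlS (MollifierKernel.dn n) u - θ.S (MollifierKernel.dn n) ((2 : ℝ) • w)‖ ≤ ‖θ.curlS (MollifierKernel.dn n) u‖ + 2 * ‖w‖ := by
          linarith
        have h5 := pow_le_pow_left₀ (norm_nonneg _) h4 2
        nlinarith [sq_nonneg (‖θ.curlS (MollifierKernel.dn n) u‖ - 2 * ‖w‖), sq_nonneg ‖θ.divS (MollifierKernel.dn n) u‖]
    _ ≤ 2 * ∑ j, θ.nSq (θ.D j) u 0 + 8 * ‖w‖ₑ ^ 2 := by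
        gcongr with j
        have := (θ.firstOrder_D j).enorm_le (v := u) (c := 0) (MollifierKernel.dn_pos n).ne'
        rwa [map_zero, sub_zero] at this

theorem lintegral_dissDensity {ν : Measure ℝ} {μ χ γ κ : ℝ} {u w : ℝ → L2Field}
    (h1 : AEMeasurable (fun t => gradSq (u t)) ν) (h2 : AEMeasurable (fun t => gradSq (w t)) ν)
    (h3 : AEMeasurable (fun t => divSq (w t)) ν) :
    ∫⁻ τ, dissDensity μ χ γ κ (u τ) (w τ) ∂ν = ENNReal.ofReal μ * ∫⁻ τ, gradSq (u τ) ∂ν +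
      ENNReal.ofReal γ * ∫⁻ τ, gradSq (w τ) ∂ν + ENNReal.ofReal κ * ∫⁻ τ, divSq (w τ) ∂ν +
      ENNReal.ofReal χ * ∫⁻ τ, curlSubSq (u τ) (w τ) ∂ν := by
  have a1 : AEMeasurable (fun τ => ENNReal.ofReal μ * gradSq (u τ)) ν := h1.const_mul _
  have a2 : AEMeasurable (fun τ => ENNReal.ofReal γ * gradSq (w τ)) ν := h2.const_mul _
  have a3 : AEMeasurable (fun τ => ENNReal.ofReal κ * divSq (w τ)) ν := h3.const_mul _
  have a12 : AEMeasurable (fun τ => ENNReal.ofReal μ * gradSq (u τ) +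
    ENNReal.ofReal γ * gradSq (w τ)) ν := a1.add a2
  have a123 : AEMeasurable (fun τ => ENNReal.ofReal μ * gradSq (u τ) +
    ENNReal.ofReal γ * gradSq (w τ) + ENNReal.ofReal κ * divSq (w τ)) ν := a12.add a3
  unfold dissDensity
  rw [lintegral_add_left' a123, lintegral_add_left' a12, lintegral_add_left' a1,
    lintegral_const_mul' _ _ ENNReal.ofReal_ne_top, lintegral_const_mul' _ _ ENNReal.ofReal_ne_top,
    lintegral_const_mul' _ _ ENNReal.ofReal_ne_top, lintegral_const_mul' _ _ ENNReal.ofReal_ne_top]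

theorem dissipation_eq (θ : MollifierKernel) {μ χ γ κ : ℝ} {u w : ℝ → L2Field}
    (hu : WeaklyContinuous u) (hw : WeaklyContinuous w) {s t : ℝ} (hs : 0 ≤ s) :
    dissipation μ χ γ κ u w s t = 2 * ∫⁻ τ in Ioc s t, dissDensity μ χ γ κ (u τ) (w τ) := by
  have hle : volume.restrict (Ioc s t) ≤ volume.restrict (Ioi (0 : ℝ)) :=
    Measure.restrict_mono (fun τ hτ => hs.trans_lt hτ.1) le_rfl
  have h1 := (aemeasurable_gradSq θ hu).mono_measure hle
  have h2 := (aemeasurable_gradSq θ hw).mono_measure hle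
  have h3 := (aemeasurable_divSq θ hw).mono_measure hle
  rw [lintegral_dissDensity h1 h2 h3, dissipation]
  simp only [← two_mul_ofReal, mul_add, mul_assoc]

theorem EnergyClass.lintegral_dissDensity_lt_top (θ : MollifierKernel) {μ χ γ κ : ℝ}
    (hγ : 0 ≤ γ) (hκ : 0 ≤ κ) {u w : ℝ → L2Field} (h : EnergyClass γ κ u w) {s t : ℝ}
    (hs : 0 ≤ s) : ∫⁻ τ in Ioc s t, dissDensity μ χ γ κ (u τ) (w τ) < ⊤ := by
  have hle : volume.restrict (Ioc s t) ≤ volume.restrict (Ioi (0 : ℝ)) :=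
    Measure.restrict_mono (fun τ hτ => hs.trans_lt hτ.1) le_rfl
  have hmono : ∀ f : ℝ → ℝ≥0∞, ∫⁻ τ in Ioi (0 : ℝ), f τ < ⊤ → ∫⁻ τ in Ioc s t, f τ < ⊤ :=
    fun f hf => (lintegral_mono' hle le_rfl).trans_lt hf
  have h1 := (aemeasurable_gradSq θ h.u_mem.weaklyContinuous).mono_measure hle
  have h2 := (aemeasurable_gradSq θ h.w_mem.weaklyContinuous).mono_measure hle
  have h3 := (aemeasurable_divSq θ h.w_mem.weaklyContinuous).mono_measure hle
  have hmul : ∀ {c : ℝ} {f : ℝ → ℝ≥0∞}, 0 ≤ c → (0 < c → ∫⁻ τ in Ioc s t, f τ < ⊤) →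
      ENNReal.ofReal c * ∫⁻ τ in Ioc s t, f τ < ⊤ := by
    intro c f hc hf
    rcases hc.eq_or_lt with hc | hc
    · rw [← hc, ENNReal.ofReal_zero, zero_mul]
      exact ENNReal.zero_lt_top
    · exact ENNReal.mul_lt_top ENNReal.ofReal_lt_top (hf hc)
  have h4 : ∫⁻ τ in Ioc s t, curlSubSq (u τ) (w τ) < ⊤ := by
    refine (lintegral_mono fun τ => curlSubSq_le θ (u τ) (w τ)).trans_lt ?_
    have a1 : AEMeasurable (fun τ => 2 * gradSq (u τ)) (volume.restrict (Ioc s t)) :=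
      h1.const_mul _
    rw [lintegral_add_left' a1, lintegral_const_mul' _ _ (by simp),
      lintegral_const_mul' _ _ (by simp)]
    refine ENNReal.add_lt_top.2 ⟨ENNReal.mul_lt_top (by simp) (hmono _ h.u_grad),
      ENNReal.mul_lt_top (by simp) ?_⟩
    obtain ⟨M, hM⟩ := h.w_mem.bounded
    refine (setLIntegral_mono' (g := fun _ => ENNReal.ofReal (M ^ 2)) measurableSet_Ioc
      fun τ hτ => ?_).trans_lt ?_
    · rw [enorm_sq_eq_ofReal]
      exact ENNReal.ofReal_le_ofReal (pow_le_pow_left₀ (norm_nonneg _) (hM τ (hs.trans hτ.1.le)) 2)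
    · simp [ENNReal.mul_lt_top]
  rw [lintegral_dissDensity h1 h2 h3]
  refine ENNReal.add_lt_top.2 ⟨ENNReal.add_lt_top.2 ⟨ENNReal.add_lt_top.2 ⟨?_, ?_⟩, ?_⟩, ?_⟩
  · exact ENNReal.mul_lt_top ENNReal.ofReal_lt_top (hmono _ h.u_grad)
  · exact hmul hγ fun hγ => hmono _ (h.w_grad hγ)
  · refine hmul hκ fun hκ => ?_
    rcases hγ.eq_or_lt with hγ | hγ
    · exact hmono _ (h.w_div hγ.symm hκ)
    · exact (lintegral_mono fun τ => divSq_le_gradSq θ (w τ)).trans_lt (hmono _ (h.w_grad hγ))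
  · exact ENNReal.mul_lt_top ENNReal.ofReal_lt_top h4

namespace MollifierKernel

variable (θ : MollifierKernel) {ε : ℝ} (hε : ε ≠ 0) {μ χ γ κ : ℝ}

theorem ofReal_dissS (hμ : 0 ≤ μ) (hχ : 0 ≤ χ) (hγ : 0 ≤ γ) (hκ : 0 ≤ κ) (δ : ℝ) (u w : L2Field) :
    ENNReal.ofReal (θ.dissS μ χ γ κ δ u w) =
      ENNReal.ofReal μ * (∑ j, ‖θ.D j δ u - θ.S δ 0‖ₑ ^ 2) +
      ENNReal.ofReal γ * (∑ j, ‖θ.D j δ w - θ.S δ 0‖ₑ ^ 2) +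
      ENNReal.ofReal κ * ‖θ.divS δ w - θ.S δ 0‖ₑ ^ 2 +
      ENNReal.ofReal χ * ‖θ.curlS δ u - θ.S δ ((2 : ℝ) • w)‖ₑ ^ 2 := by
  simp only [map_zero, sub_zero, enorm_sq_eq_ofReal]
  rw [← ENNReal.ofReal_sum_of_nonneg fun j _ => sq_nonneg _,
    ← ENNReal.ofReal_sum_of_nonneg fun j _ => sq_nonneg _, ← ENNReal.ofReal_mul hμ,
    ← ENNReal.ofReal_mul hγ, ← ENNReal.ofReal_mul hκ, ← ENNReal.ofReal_mul hχ,
    ← ENNReal.ofReal_add (by positivity) (by positivity),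
    ← ENNReal.ofReal_add (by positivity) (by positivity),
    ← ENNReal.ofReal_add (by positivity) (by positivity), dissS]

theorem ofReal_dissS_le (hμ : 0 ≤ μ) (hχ : 0 ≤ χ) (hγ : 0 ≤ γ) (hκ : 0 ≤ κ) {δ : ℝ} (hδ : δ ≠ 0)
    (u w : L2Field) :
    ENNReal.ofReal (θ.dissS μ χ γ κ δ u w) ≤ dissDensity μ χ γ κ u w := by
  rw [θ.ofReal_dissS hμ hχ hγ hκ, dissDensity, θ.gradSq_eq, θ.gradSq_eq, θ.divSq_eq,
    θ.curlSubSq_eq]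
  gcongr with j _ j _
  · exact (θ.firstOrder_D j).enorm_le hδ
  · exact (θ.firstOrder_D j).enorm_le hδ
  · exact θ.firstOrder_divS.enorm_le hδ
  · exact θ.firstOrder_curlS.enorm_le hδ

theorem tendsto_ofReal_dissS (hμ : 0 ≤ μ) (hχ : 0 ≤ χ) (hγ : 0 ≤ γ) (hκ : 0 ≤ κ)
    {u w : L2Field} (h : dissDensity μ χ γ κ u w ≠ ⊤) :
    Tendsto (fun δ => ENNReal.ofReal (θ.dissS μ χ γ κ δ u w)) (𝓝[≠] 0)
      (𝓝 (dissDensity μ χ γ κ u w)) := by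
  simp only [θ.ofReal_dissS hμ hχ hγ hκ]
  unfold dissDensity at h ⊢
  simp only [ENNReal.add_ne_top] at h
  have hg : ∀ v : L2Field, gradSq v ≠ ⊤ → Tendsto
      (fun δ => ∑ j, ‖θ.D j δ v - θ.S δ 0‖ₑ ^ 2) (𝓝[≠] 0) (𝓝 (gradSq v)) := by
    intro v hv
    rw [θ.gradSq_eq] at hv ⊢
    refine tendsto_finsetSum _ fun j _ => (θ.firstOrder_D j).tendsto_enorm fun hj => hv ?_
    exact ENNReal.sum_eq_top.2 ⟨j, Finset.mem_univ j, hj⟩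
  refine (((tendsto_ofReal_mul h.1.1.1 (hg u)).add (tendsto_ofReal_mul h.1.1.2 (hg w))).add
    (tendsto_ofReal_mul h.1.2 fun hd => ?_)).add (tendsto_ofReal_mul h.2 fun hd => ?_)
  · rw [θ.divSq_eq] at hd ⊢
    exact θ.firstOrder_divS.tendsto_enorm hd
  · rw [θ.curlSubSq_eq] at hd ⊢
    exact θ.firstOrder_curlS.tendsto_enorm hd

theorem dissS_eq (δ : ℝ) {u : L2Field} (hu : u ∈ L2sigma) (w : L2Field) :
    θ.dissS μ χ γ κ δ u w = (μ + χ) * ∑ j, ‖θ.D j δ u‖ ^ 2 + γ * ∑ j, ‖θ.D j δ w‖ ^ 2 +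
      κ * ‖θ.divS δ w‖ ^ 2 - 4 * χ * inner ℝ (θ.curlS δ u) (θ.S δ w) +
      4 * χ * ‖θ.S δ w‖ ^ 2 := by
  have h5 := θ.sum_norm_D_sq δ u
  rw [divS_of_mem _ _ hu, norm_zero] at h5
  have h6 : ‖θ.curlS δ u - θ.S δ ((2 : ℝ) • w)‖ ^ 2 = ‖θ.curlS δ u‖ ^ 2 -
      4 * inner ℝ (θ.curlS δ u) (θ.S δ w) + 4 * ‖θ.S δ w‖ ^ 2 := by
    rw [map_smul, norm_sub_sq_real, norm_smul, real_inner_smul_right]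
    norm_num
    ring
  rw [dissS, h6]
  linear_combination (-χ) * h5

/-- The regularised energy balance. -/
theorem energy_balance_S (hε : ε ≠ 0) {δ : ℝ} (hδ : δ ≠ 0) {u w : ℝ → L2Field}
    (hu : BoundedWeaklyContinuous u) (hw : BoundedWeaklyContinuous w)
    (hv : ∀ i, Dt (comp u i) + lerayTransportD (fun t => mollify θ ε (u t)) u i = linU μ χ u w i)
    (hm : ∀ i, Dt (comp w i) + transportD (fun t => mollify θ ε (u t)) w i = linW χ γ κ u w i)
    (hσ : ∀ t, 0 ≤ t → u t ∈ L2sigma) {s t : ℝ} (hs : 0 ≤ s) (hst : s ≤ t) :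
    ContinuousOn (fun τ => θ.dissS μ χ γ κ δ (u τ) (w τ) +
      (θ.workS hε δ (u τ) (u τ) + θ.workS hε δ (u τ) (w τ))) (Icc s t) ∧
    ∫ τ in Ioc s t, (θ.dissS μ χ γ κ δ (u τ) (w τ) +
      (θ.workS hε δ (u τ) (u τ) + θ.workS hε δ (u τ) (w τ))) =
      ((‖θ.S δ (u s)‖ ^ 2 + ‖θ.S δ (w s)‖ ^ 2) - (‖θ.S δ (u t)‖ ^ 2 + ‖θ.S δ (w t)‖ ^ 2)) / 2 := by
  obtain ⟨c1, i1⟩ := norm_sq_sub_eq_integral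
    (θ.boundedWeaklyContinuous_vecU δ μ χ hu hw fun j => θ.boundedWeaklyContinuous_mulL hε hu hu j)
    (fun s t hs hst => θ.weakIntegral_S_velocity hε μ χ hδ hu hw hv hs hst) hs hst
  obtain ⟨c2, i2⟩ := norm_sq_sub_eq_integral
    (θ.boundedWeaklyContinuous_vecW δ χ γ κ hu hw fun j =>
      θ.boundedWeaklyContinuous_mulL hε hu hw j)
    (fun s t hs hst => θ.weakIntegral_S_microrotation hε χ γ κ hδ hu hw hm hs hst) hs hst
  have key : ∀ τ, 0 ≤ τ → θ.dissS μ χ γ κ δ (u τ) (w τ) +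
      (θ.workS hε δ (u τ) (u τ) + θ.workS hε δ (u τ) (w τ)) =
      (-1 / 2) * (2 * inner ℝ (θ.S δ (u τ)) (θ.vecU δ μ χ (u τ) (w τ)
        fun j => mulL (θ.mol ε hε j (u τ)) (u τ)) +
      2 * inner ℝ (θ.S δ (w τ)) (θ.vecW δ χ γ κ (u τ) (w τ)
        fun j => mulL (θ.mol ε hε j (u τ)) (w τ))) := by
    intro τ hτ
    rw [θ.inner_vecU hε μ χ hδ (hσ τ hτ), θ.inner_vecW hε χ γ κ hδ, θ.dissS_eq δ (hσ τ hτ)]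
    ring
  refine ⟨((c1.add c2).const_mul (-1 / 2)).congr fun τ hτ => key τ (hs.trans hτ.1), ?_⟩
  rw [setIntegral_congr_fun measurableSet_Ioc fun τ hτ => key τ (hs.trans hτ.1.le),
    ← intervalIntegral.integral_of_le hst, intervalIntegral.integral_const_mul,
    intervalIntegral.integral_add (c1.intervalIntegrable_of_Icc hst)
      (c2.intervalIntegrable_of_Icc hst), ← i1, ← i2]
  ring

/-- Finite energy solutions of the mollified system satisfy the energy equality. -/
theorem energy_equality (hε : ε ≠ 0) (hμ : 0 ≤ μ) (hχ : 0 ≤ χ) (hγ : 0 ≤ γ) (hκ : 0 ≤ κ)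
    {u w : ℝ → L2Field} (hE : EnergyClass γ κ u w)
    (hv : ∀ i, Dt (comp u i) + lerayTransportD (fun t => mollify θ ε (u t)) u i = linU μ χ u w i)
    (hm : ∀ i, Dt (comp w i) + transportD (fun t => mollify θ ε (u t)) w i = linW χ γ κ u w i)
    (hσ : ∀ t, 0 ≤ t → u t ∈ L2sigma) {s t : ℝ} (hs : 0 ≤ s) (hst : s ≤ t) :
    energy u w t + dissipation μ χ γ κ u w s t = energy u w s := by
  have hu := hE.u_mem
  have hw := hE.w_mem
  obtain ⟨M, hM⟩ := hu.bounded
  obtain ⟨M', hM'⟩ := hw.bounded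
  have hle : volume.restrict (Ioc s t) ≤ volume.restrict (Ioi (0 : ℝ)) :=
    Measure.restrict_mono (fun τ hτ => hs.trans_lt hτ.1) le_rfl
  have hfin := hE.lintegral_dissDensity_lt_top θ (μ := μ) (χ := χ) hγ hκ hs (t := t)
  have hmeas := (aemeasurable_dissDensity θ μ χ γ κ hu.weaklyContinuous
    hw.weaklyContinuous).mono_measure hle
  set d : ℝ → ℝ := fun τ => (dissDensity μ χ γ κ (u τ) (w τ)).toReal
  have hdint : IntegrableOn d (Ioc s t) := integrable_toReal_of_lintegral_ne_top hmeas hfin.ne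
  have hae := ae_lt_top' hmeas hfin.ne
  set q : ℕ → ℝ → ℝ := fun n τ => θ.dissS μ χ γ κ (dn n) (u τ) (w τ) +
      (θ.workS hε (dn n) (u τ) (u τ) + θ.workS hε (dn n) (u τ) (w τ))
  have hbal := fun n => θ.energy_balance_S (γ := γ) hε (dn_pos n).ne' hu hw hv hm hσ hs hst
  have hgt : Tendsto dn atTop (𝓝[>] 0) :=
    tendsto_nhdsWithin_iff.2 ⟨tendsto_dn, Eventually.of_forall fun n => dn_pos n⟩
  set B : ℝ := (∫ y, θ.commBound y) * lipConst (θ.ktf ε hε)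
  have hw1 : ∀ n τ, 0 ≤ τ → ∀ v : L2Field, ∀ N, ‖v‖ ≤ N → |θ.workS hε (dn n) (u τ) v| ≤
      |B| * M * N ^ 2 := by
    intro n τ hτ v N hv
    refine (θ.abs_sum_inner_transport_le (θ.ktf ε hε) (hσ τ hτ) v (dn_pos n)).trans ?_
    have h0 : 0 ≤ ‖u τ‖ := norm_nonneg _
    have h1 := hM τ hτ
    calc ‖v‖ * ((∫ y, θ.commBound y) * (lipConst (θ.ktf ε hε) * ‖u τ‖ * ‖v‖))
        = B * ‖u τ‖ * ‖v‖ ^ 2 := by ring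
      _ ≤ |B| * M * N ^ 2 := by
        gcongr
        · exact mul_nonneg (abs_nonneg _) (h0.trans h1)
        · exact le_abs_self _
  -- The regularised dissipation is below the true density at every scale, and the commutator bounds
  -- the transport work by constants.
  have hdom : Integrable (fun τ => d τ + (|B| * M * M ^ 2 + |B| * M * M' ^ 2))
      (volume.restrict (Ioc s t)) := Integrable.add hdint (integrable_const _)
  -- At almost every time the regularised dissipation tends to the true one and the work of the
  -- transport tends to zero.
  have hlim : Tendsto (fun n => ∫ τ in Ioc s t, q n τ) atTop (𝓝 (∫ τ in Ioc s t, d τ)) := by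
    refine tendsto_integral_of_dominated_convergence
      (fun τ => d τ + (|B| * M * M ^ 2 + |B| * M * M' ^ 2)) (fun n => ?_)
      hdom (fun n => ?_) ?_
    · exact ((hbal n).1.mono Ioc_subset_Icc_self).aestronglyMeasurable measurableSet_Ioc
    · filter_upwards [hae, ae_restrict_mem measurableSet_Ioc] with τ hτ hτ'
      have hτ0 : 0 ≤ τ := hs.trans hτ'.1.le
      have h1 : θ.dissS μ χ γ κ (dn n) (u τ) (w τ) ≤ d τ :=
        (ENNReal.ofReal_le_iff_le_toReal hτ.ne).1
          (θ.ofReal_dissS_le hμ hχ hγ hκ (dn_pos n).ne' _ _)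
      have h2 := θ.dissS_nonneg (dn n) hμ hχ hγ hκ (u τ) (w τ)
      refine (abs_add_le _ _).trans (add_le_add ?_ ((abs_add_le _ _).trans
        (add_le_add (hw1 n τ hτ0 _ _ (hM τ hτ0)) (hw1 n τ hτ0 _ _ (hM' τ hτ0)))))
      rwa [abs_of_nonneg h2]
    · filter_upwards [hae, ae_restrict_mem measurableSet_Ioc] with τ hτ hτ'
      have hτ0 : 0 ≤ τ := hs.trans hτ'.1.le
      have h1 := (ENNReal.tendsto_toReal hτ.ne).comp
        ((θ.tendsto_ofReal_dissS hμ hχ hγ hκ hτ.ne).comp tendsto_dn_ne)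
      have h1' : Tendsto (fun n => θ.dissS μ χ γ κ (dn n) (u τ) (w τ)) atTop (𝓝 (d τ)) :=
        h1.congr fun n => ENNReal.toReal_ofReal (θ.dissS_nonneg (dn n) hμ hχ hγ hκ _ _)
      have h2 := fun v => (θ.tendsto_sum_inner_transport (θ.ktf ε hε) (hσ τ hτ0) v).comp hgt
      have h3 := h1'.add ((h2 (u τ)).add (h2 (w τ)))
      rw [add_zero, add_zero] at h3
      exact h3
  have hS : ∀ v : L2Field, Tendsto (fun n => ‖θ.S (dn n) v‖ ^ 2) atTop (𝓝 (‖v‖ ^ 2)) := fun v =>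
    (((θ.tendsto_S v).comp tendsto_dn).norm).pow 2
  have hlim' : Tendsto (fun n => ∫ τ in Ioc s t, q n τ) atTop
      (𝓝 (((‖u s‖ ^ 2 + ‖w s‖ ^ 2) - (‖u t‖ ^ 2 + ‖w t‖ ^ 2)) / 2)) := by
    refine ((((hS (u s)).add (hS (w s))).sub ((hS (u t)).add (hS (w t)))).div_const 2).congr
      fun n => (hbal n).2.symm
  have heq := tendsto_nhds_unique hlim hlim'
  have hd0 : 0 ≤ ∫ τ in Ioc s t, d τ := integral_nonneg fun τ => ENNReal.toReal_nonneg
  have hL : ∫⁻ τ in Ioc s t, dissDensity μ χ γ κ (u τ) (w τ) =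
      ENNReal.ofReal (∫ τ in Ioc s t, d τ) := by
    rw [ofReal_integral_eq_lintegral_ofReal hdint
      (Eventually.of_forall fun τ => ENNReal.toReal_nonneg)]
    refine lintegral_congr_ae ?_
    filter_upwards [hae] with τ hτ
    rw [ENNReal.ofReal_toReal hτ.ne]
  rw [dissipation_eq θ hu.weaklyContinuous hw.weaklyContinuous hs, hL]
  simp only [energy, enorm_sq_eq_ofReal]
  rw [two_mul_ofReal,
    ← ENNReal.ofReal_add (by positivity) (by positivity),
    ← ENNReal.ofReal_add (by positivity) (by positivity),
    ← ENNReal.ofReal_add (by positivity) (by positivity), heq]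
  congr 1
  ring

end MollifierKernel

/-- Existence of mollified solutions. -/
theorem exists_isMollifiedSolution (θ : MollifierKernel) {ε μ χ γ κ : ℝ} (hε : ε ≠ 0) (hμ : 0 < μ)
    (hχ : 0 ≤ χ) (hγ : 0 ≤ γ) (hκ : 0 ≤ κ) {u₀ : L2Field} (hu₀ : u₀ ∈ L2sigma) (w₀ : L2Field) :
    ∃ u w, IsMollifiedSolution θ μ χ γ κ u₀ w₀ ε u w := by
  obtain ⟨u, w, hE, hv, hm, hσ, hu0, hw0⟩ := θ.exists_finiteEnergy (γ := γ) hε hμ hχ hγ hκ hu₀ w₀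
  exact ⟨u, w, hE, hv, hm, hσ, ⟨hu0, hw0⟩, fun s t hs hst =>
    θ.energy_equality hε hμ.le hχ hγ hκ hE hv hm hσ hs hst⟩

/-! ### Sup bounds for translation invariant operators -/

theorem one_sub_norm_sq_nonpos {x : E3} (h : x ∉ Metric.closedBall (0 : E3) 1) :
    1 - ‖x‖ ^ 2 ≤ 0 := by
  have h : 1 < ‖x‖ := by simpa using h
  nlinarith [norm_nonneg x]

/-- A smooth radial bump. -/
def bump : TF where
  toFun x := Real.smoothTransition (1 - ‖x‖ ^ 2)
  contDiff' := Real.smoothTransition.contDiff.comp (contDiff_const.sub (contDiff_norm_sq ℝ))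
  hasCompactSupport' := HasCompactSupport.intro (isCompact_closedBall (0 : E3) 1) fun _ hx =>
    Real.smoothTransition.zero_of_nonpos (one_sub_norm_sq_nonpos hx)
  tsupport_subset' := by simp

/-- The function `ρ` for which `∂_l bump = y_l ρ`. -/
def bumpDeriv : TF where
  toFun x := -2 * deriv Real.smoothTransition (1 - ‖x‖ ^ 2)
  contDiff' := contDiff_const.mul (((contDiff_infty_iff_deriv.1
    Real.smoothTransition.contDiff).2).comp (contDiff_const.sub (contDiff_norm_sq ℝ)))
  hasCompactSupport' := HasCompactSupport.intro (isCompact_closedBall (0 : E3) 1) fun x hx => by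
    have h : 1 < ‖x‖ := by simpa using hx
    rw [deriv_smoothTransition_of_notMem (fun h' => by nlinarith [h'.1, norm_nonneg x]), mul_zero]
  tsupport_subset' := by simp

theorem bumpDeriv_apply (x : E3) :
    bumpDeriv x = -2 * deriv Real.smoothTransition (1 - ‖x‖ ^ 2) := rfl

theorem lineDeriv_bump (l : Fin 3) (y : E3) : (∂_{e l} bump) y = y l * bumpDeriv y := by
  have h1 : HasFDerivAt (fun x : E3 => 1 - ‖x‖ ^ 2) (-(2 • innerSL ℝ y)) y := by
    simpa using (hasStrictFDerivAt_norm_sq y).hasFDerivAt.const_sub 1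
  have h2 := ((differentiable_smoothTransition _).hasDerivAt).comp_hasFDerivAt y h1
  rw [lineDeriv_apply, show fderiv ℝ bump y = _ from h2.fderiv, bumpDeriv_apply]
  simp [EuclideanSpace.inner_single_right]
  ring

theorem bump_neg (y : E3) : bump (-y) = bump y := by
  change Real.smoothTransition _ = Real.smoothTransition _
  rw [norm_neg]

theorem bumpDeriv_neg (y : E3) : bumpDeriv (-y) = bumpDeriv y := by
  rw [bumpDeriv_apply, bumpDeriv_apply, norm_neg]

theorem integral_bumpDeriv_ne_zero : ∫ y, bumpDeriv y ≠ 0 := by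
  have hd : ∀ x, 0 ≤ deriv Real.smoothTransition x := fun x => Real.smoothTransition.monotone.deriv_nonneg
  obtain ⟨s, hs, hs0⟩ : ∃ s ∈ Icc (0 : ℝ) 1, deriv Real.smoothTransition s ≠ 0 := by
    by_contra! h
    have := integral_deriv_smoothTransition
    rw [setIntegral_congr_fun measurableSet_Icc h] at this
    simp at this
  have hpos : 0 < ∫ y, -bumpDeriv y := by
    refine (bumpDeriv.continuous.neg).integral_pos_of_hasCompactSupport_nonneg_nonzero
      (x := √(1 - s) • e 0) bumpDeriv.hasCompactSupport.neg ?_ ?_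
    · intro y
      change 0 ≤ -bumpDeriv y
      rw [bumpDeriv_apply]
      linarith [hd (1 - ‖y‖ ^ 2)]
    · have : 1 - ‖√(1 - s) • e 0‖ ^ 2 = s := by
        rw [norm_smul, mul_pow, Real.norm_eq_abs, sq_abs, Real.sq_sqrt (by linarith [hs.2])]
        simp
      rw [bumpDeriv_apply, this]
      simpa using hs0
  rw [integral_neg] at hpos
  linarith

/-- Differentiating in the scale brings down `-∑ y_l ∂_l φ`. Since `y_l bumpDeriv = ∂_l bump`, an
integration by parts converts this into the Laplacian, with a factor `δ` gained. -/
theorem hasDerivAt_cv_bumpDeriv (i : Fin 3) (φ : TF) (δ : ℝ) :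
    HasDerivAt (fun δ => cv bumpDeriv δ (testField i φ)) (-(δ • cv bump δ (lapT i φ))) δ := by
  have key := hasDerivAt_integral_of_dominated_loc_of_deriv_le (μ := (volume : Measure E3)) (𝕜 := ℝ)
    (F := fun δ y => bumpDeriv y • trans (δ • y) (testField i φ))
    (F' := fun δ y => bumpDeriv y • -trans (δ • y) (testField i (∂_{y} φ))) (x₀ := δ)
    (s := univ) (bound := fun y => |bumpDeriv y| * ∑ l, |y l| * ‖testField i (∂_{e l} φ)‖)
    univ_mem
    (Eventually.of_forall fun δ => (integrable_smul_trans bumpDeriv δ _).aestronglyMeasurable)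
    (integrable_smul_trans bumpDeriv δ _) ?_ ?_ ?_ ?_
  · refine (key.2.congr_deriv ?_).congr_of_eventuallyEq (Eventually.of_forall fun δ => cv_apply _ _ _)
    have h : ∀ y : E3, bumpDeriv y • -trans (δ • y) (testField i (∂_{y} φ)) =
        -∑ l, (∂_{e l} bump) y • trans (δ • y) (testField i (∂_{e l} φ)) := by
      intro y
      rw [MollifierKernel.lineDeriv_eq_sum_testField, map_sum, smul_neg, Finset.smul_sum]
      congr 1
      refine Finset.sum_congr rfl fun l _ => ?_
      rw [map_smul, smul_smul, lineDeriv_bump, mul_comm]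
    simp only [h]
    rw [integral_neg, integral_finsetSum _ fun l _ => integrable_smul_trans _ _ _]
    simp only [← cv_apply, cv_lineDeriv, lapT, map_sum, Finset.smul_sum]
  · have h : (fun y : E3 => bumpDeriv y • -trans (δ • y) (testField i (∂_{y} φ))) =
        fun y => -∑ l, (∂_{e l} bump) y • trans (δ • y) (testField i (∂_{e l} φ)) := by
      ext1 y
      rw [MollifierKernel.lineDeriv_eq_sum_testField, map_sum, smul_neg, Finset.smul_sum]
      congr 1
      refine Finset.sum_congr rfl fun l _ => ?_
      rw [map_smul, smul_smul, lineDeriv_bump, mul_comm]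
    rw [h]
    exact (integrable_finsetSum _ fun l _ => integrable_smul_trans _ _ _).neg.aestronglyMeasurable
  · refine Eventually.of_forall fun y η _ => ?_
    rw [norm_smul, norm_neg, Real.norm_eq_abs]
    gcongr
    rw [norm_trans, MollifierKernel.lineDeriv_eq_sum_testField]
    refine (norm_sum_le _ _).trans (Finset.sum_le_sum fun l _ => ?_)
    rw [norm_smul, Real.norm_eq_abs]
  · refine Continuous.integrable_of_hasCompactSupport (by fun_prop) ?_
    exact bumpDeriv.hasCompactSupport.abs.mul_right
  · exact Eventually.of_forall fun y η _ =>
      (hasDerivAt_trans_testField i φ y η).const_smul (bumpDeriv y)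

/-- The `L²` norms of the bumps that enter the sup bound below. -/
def bumpConst : ℝ :=
  |∫ y, bumpDeriv y|⁻¹ * (2 * ∑ j, ‖testField j bumpDeriv‖ + 4 * ∑ j, ‖testField j bump‖)

theorem bumpConst_nonneg : 0 ≤ bumpConst := by unfold bumpConst; positivity

theorem abs_inner_cv_testField_le {A : L2Field →L[ℝ] L2Field}
    (hA : ∀ y v, A (trans y v) = trans y (A v)) (hA2 : ∀ v, ‖A v‖ ≤ 2 * ‖v‖)
    (j : Fin 3) (φ' : TF) {k : TF} (hk : ∀ y, k (-y) = k y) (v : L2Field) {s : ℝ} (hs : 0 < s) :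
    |inner ℝ (A (cv k s v)) (testField j φ')| ≤
      2 * ‖v‖ * ((∫ y, |φ' y|) * (√((s ^ 3)⁻¹) * ‖testField j k‖)) := by
  rw [clm_cv k s hA, inner_cv, cv_neg_of_even hk]
  refine (abs_real_inner_le_norm _ _).trans ?_
  exact mul_le_mul (hA2 v) (norm_cv_testField_le k φ' hs j) (norm_nonneg _) (by positivity)

theorem add_le_mul_add {x y N a b : ℝ} (hx : 0 ≤ x) (hy : 0 ≤ y) (hN : 0 ≤ N) (ha : 0 ≤ a)
    (hb : 0 ≤ b) : 2 * x * (N * a) + 4 * y * (N * b) ≤ (2 * a + 4 * b) * ((x + y) * N) := by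
  have h1 : 0 ≤ N * x * b := by positivity
  have h2 : 0 ≤ N * y * a := by positivity
  linarith

theorem hasDerivAt_inner_cv_bumpDeriv (A : L2Field →L[ℝ] L2Field) (i : Fin 3) (φ : TF)
    (v : L2Field) (s : ℝ) :
    HasDerivAt (fun s : ℝ => inner ℝ (A (cv bumpDeriv (s ^ 2) (testField i φ))) v)
      (-(2 * s * (s ^ 2 * inner ℝ (A (cv bump (s ^ 2) (lapT i φ))) v))) s := by
  have h1 := (hasDerivAt_cv_bumpDeriv i φ (s ^ 2)).scomp s (hasDerivAt_pow 2 s)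
  have h2 := (A.hasFDerivAt.comp_hasDerivAt s h1).inner ℝ (hasDerivAt_const s v)
  refine h2.congr_deriv ?_
  rw [inner_zero_right, zero_add, map_smul, map_neg, map_smul, real_inner_smul_left, inner_neg_left,
    real_inner_smul_left]
  norm_num

/-- In `δ` the derivative is of size `δ · δ^(-3/2)`, integrable but unbounded. In the variable `s`
with `δ = s²` it is bounded, so the mean value inequality applies. One factor two comes from the
chain rule, the other from the norm of `A`. -/
theorem abs_inner_cv_bumpDeriv_sub_le {A : L2Field →L[ℝ] L2Field}
    (hA : ∀ y v, A (trans y v) = trans y (A v)) (hA2 : ∀ v, ‖A v‖ ≤ 2 * ‖v‖)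
    (i j : Fin 3) (φ φ' : TF) :
    |inner ℝ (A (cv bumpDeriv 1 (testField i φ))) (testField j φ') -
        inner ℝ (A (cv bumpDeriv 0 (testField i φ))) (testField j φ')| ≤
      4 * ‖lapT i φ‖ * ((∫ y, |φ' y|) * ‖testField j bump‖) := by
  have hN : 0 ≤ ∫ y, |φ' y| := integral_nonneg fun _ => abs_nonneg _
  have hle := (convex_Icc (0 : ℝ) 1).norm_image_sub_le_of_norm_hasDerivWithin_le (x := 0) (y := 1)
      (C := 4 * ‖lapT i φ‖ * ((∫ y, |φ' y|) * ‖testField j bump‖))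
      (fun s _ => (hasDerivAt_inner_cv_bumpDeriv A i φ (testField j φ') s).hasDerivWithinAt)
      (fun s hs => ?_) (by simp) (by simp)
  · simpa only [one_pow, ne_eq, OfNat.ofNat_ne_zero, not_false_eq_true, zero_pow, sub_zero, norm_one,
      mul_one, Real.norm_eq_abs] using hle
  rcases hs.1.eq_or_lt with rfl | hs0
  · rw [mul_zero, zero_mul, neg_zero, norm_zero]
    positivity
  · have h := abs_inner_cv_testField_le hA hA2 j φ' bump_neg (lapT i φ) (pow_pos hs0 2)
    have hr : √(((s ^ 2) ^ 3)⁻¹) = (s ^ 3)⁻¹ := by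
      rw [Real.sqrt_inv, ← pow_mul, mul_comm 2 3, pow_mul, Real.sqrt_sq (by positivity)]
    rw [hr] at h
    generalize (inner ℝ (A (cv bump (s ^ 2) (lapT i φ))) (testField j φ') : ℝ) = z at h ⊢
    rw [norm_neg, Real.norm_eq_abs, abs_mul, abs_mul (s ^ 2), abs_of_pos (a := 2 * s) (by positivity),
      abs_of_pos (a := s ^ 2) (by positivity)]
    refine (mul_le_mul_of_nonneg_left (mul_le_mul_of_nonneg_left h (by positivity))
      (by positivity)).trans (le_of_eq ?_)
    field_simp
    ring

/-- The embedding of `H²` into `L^∞` in three dimensions, in dual form: the average at scale zero is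
a nonzero multiple of the field, the average at scale one is controlled by Young's inequality, and
their difference by the Laplacian. Only commutation with translations is used, so `A` may be a
nonlocal projector. -/
theorem abs_inner_testField_le {A : L2Field →L[ℝ] L2Field}
    (hA : ∀ y v, A (trans y v) = trans y (A v)) (hA2 : ∀ v, ‖A v‖ ≤ 2 * ‖v‖)
    (i j : Fin 3) (φ φ' : TF) :
    |inner ℝ (A (testField i φ)) (testField j φ')| ≤
      bumpConst * (‖testField i φ‖ + ‖lapT i φ‖) * ∫ y, |φ' y| := by
  have hN : 0 ≤ ∫ y, |φ' y| := integral_nonneg fun _ => abs_nonneg _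
  have hle := abs_inner_cv_bumpDeriv_sub_le hA hA2 i j φ φ'
  have h1 := abs_inner_cv_testField_le hA hA2 j φ' bumpDeriv_neg (testField i φ) one_pos
  rw [one_pow, inv_one, Real.sqrt_one, one_mul] at h1
  have h0 : inner ℝ (A (cv bumpDeriv 0 (testField i φ))) (testField j φ') =
      (∫ y, bumpDeriv y) * inner ℝ (A (testField i φ)) (testField j φ') := by
    rw [cv_zero, map_smul, real_inner_smul_left]
  rw [h0] at hle
  generalize (inner ℝ (A (cv bumpDeriv 1 (testField i φ))) (testField j φ') : ℝ) = z at h1 hle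
  generalize (inner ℝ (A (testField i φ)) (testField j φ') : ℝ) = y at hle ⊢
  have h2 := abs_sub_abs_le_abs_sub ((∫ y, bumpDeriv y) * y) z
  rw [abs_sub_comm, abs_mul] at h2
  have hI := abs_pos.2 integral_bumpDeriv_ne_zero
  unfold bumpConst
  rw [mul_assoc, mul_assoc, ← div_eq_inv_mul, le_div_iff₀ hI, mul_comm |y|]
  have s1 := Finset.single_le_sum (f := fun j => ‖testField j bumpDeriv‖)
    (fun j _ => norm_nonneg _) (Finset.mem_univ j)
  have s2 := Finset.single_le_sum (f := fun j => ‖testField j bump‖)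
    (fun j _ => norm_nonneg _) (Finset.mem_univ j)
  refine le_trans ?_ (add_le_mul_add (norm_nonneg _) (norm_nonneg _) hN ((norm_nonneg _).trans s1)
    ((norm_nonneg _).trans s2))
  refine le_trans (by linarith) (add_le_add (mul_le_mul_of_nonneg_left
    (mul_le_mul_of_nonneg_left s1 hN) (by positivity)) (mul_le_mul_of_nonneg_left
    (mul_le_mul_of_nonneg_left s2 hN) (by positivity)))

namespace MollifierKernel

theorem integral_abs_ktf (θ : MollifierKernel) {ε : ℝ} (hε : 0 < ε) :
    ∫ y, |θ.ktf ε hε.ne' y| = 1 := by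
  have h : ∀ y, |θ.ktf ε hε.ne' y| = (ε ^ 3)⁻¹ * |θ.tf (ε⁻¹ • y)| := by
    intro y
    rw [ktf, scaleTF_apply, abs_mul, abs_of_pos (by positivity : 0 < (ε ^ 3)⁻¹)]
  simp only [h]
  rw [integral_const_mul, Measure.integral_comp_smul volume (fun y : E3 => |θ.tf y|) ε⁻¹,
    integral_abs_tf]
  simp [abs_of_pos hε, hε.ne']

/-- Testing with translated kernels, of `L¹` norm one, bounds each component of the mollified field
by `C`; a subsequence of mollifications converges almost everywhere. The factor `3` is a crude `√3`.
-/
theorem ae_norm_le_of_inner_le (θ : MollifierKernel) {Ψ : L2Field} {C : ℝ}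
    (h : ∀ j (φ' : TF), |inner ℝ Ψ (testField j φ')| ≤ C * ∫ y, |φ' y|) :
    ∀ᵐ x, ‖Ψ x‖ ≤ 3 * C := by
  have hmol : ∀ n j, ∀ᵐ x, |θ.S (dn n) Ψ x j| ≤ C := by
    intro n j
    filter_upwards [θ.coeFn_mol (dn n) (dn_pos n) Ψ j] with x hx
    rw [← hx, mol, ptB_apply, trans_testField, real_inner_comm]
    refine (h j _).trans (le_of_eq ?_)
    have : ∫ y, |transTF x (θ.ktf (dn n) (dn_pos n).ne') y| = 1 :=
      (integral_sub_right_eq_self (fun y => |θ.ktf (dn n) (dn_pos n).ne' y|) x).trans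
        (θ.integral_abs_ktf (dn_pos n))
    rw [this, mul_one]
  have hS : Tendsto (fun n => θ.S (dn n) Ψ) atTop (𝓝 Ψ) := (θ.tendsto_S Ψ).comp tendsto_dn
  obtain ⟨ns, -, hns⟩ := (tendstoInMeasure_of_tendsto_Lp hS).exists_seq_tendsto_ae
  filter_upwards [hns, ae_all_iff.2 fun n => ae_all_iff.2 (hmol n)] with x hx hb
  have hj : ∀ j, |Ψ x j| ≤ C := fun j => by
    have hc : Continuous fun z : E3 => |z j| := by fun_prop
    exact le_of_tendsto ((hc.tendsto _).comp hx) (Eventually.of_forall fun n => hb _ j)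
  have h0 : 0 ≤ C := (abs_nonneg _).trans (hj 0)
  rw [EuclideanSpace.norm_eq]
  refine Real.sqrt_le_iff.2 ⟨by positivity, ?_⟩
  simp only [Real.norm_eq_abs, Fin.sum_univ_three]
  nlinarith [pow_le_pow_left₀ (abs_nonneg _) (hj 0) 2, pow_le_pow_left₀ (abs_nonneg _) (hj 1) 2,
    pow_le_pow_left₀ (abs_nonneg _) (hj 2) 2]

/-- A translation invariant operator maps test fields to bounded fields. -/
theorem ae_norm_apply_testField_le (θ : MollifierKernel) {A : L2Field →L[ℝ] L2Field}
    (hA : ∀ y v, A (trans y v) = trans y (A v)) (hA2 : ∀ v, ‖A v‖ ≤ 2 * ‖v‖)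
    (i : Fin 3) (φ : TF) :
    ∀ᵐ x, ‖A (testField i φ) x‖ ≤ 3 * (bumpConst * (‖testField i φ‖ + ‖lapT i φ‖)) :=
  θ.ae_norm_le_of_inner_le fun j φ' => abs_inner_testField_le hA hA2 i j φ φ'

end MollifierKernel

/-! ### Products of three fields -/

/-- The bounded operators on `L²` that commute with translations, with norm at most two. -/
structure Equivariant (A : L2Field →L[ℝ] L2Field) : Prop where
  comm : ∀ y v, A (trans y v) = trans y (A v)
  norm_le : ∀ v, ‖A v‖ ≤ 2 * ‖v‖

theorem equivariant_id : Equivariant (ContinuousLinearMap.id ℝ L2Field) where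
  comm _ _ := rfl
  norm_le v := by
    rw [ContinuousLinearMap.id_apply]
    linarith [norm_nonneg v]

theorem equivariant_leray : Equivariant leray where
  comm := leray_trans
  norm_le v := (norm_leray_le v).trans (by linarith [norm_nonneg v])

/-- The triangle inequality used here is the reason for the constant two in `Equivariant`. -/
theorem equivariant_id_sub_leray : Equivariant (ContinuousLinearMap.id ℝ L2Field - leray) where
  comm y v := by
    simp only [sub_apply, ContinuousLinearMap.id_apply, leray_trans, map_sub]
  norm_le v := (norm_sub_le v (leray v)).trans (by linarith [norm_leray_le v])

/-- A bound for the translates of the field `φ e_i` under equivariant operators. -/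
def supBound (i : Fin 3) (φ : TF) : ℝ := 3 * (bumpConst * (‖testField i φ‖ + ‖lapT i φ‖))

theorem supBound_nonneg (i : Fin 3) (φ : TF) : 0 ≤ supBound i φ := by
  have := bumpConst_nonneg
  unfold supBound
  positivity

theorem Equivariant.ae_norm_le (θ : MollifierKernel) {A : L2Field →L[ℝ] L2Field}
    (hA : Equivariant A) (i : Fin 3) (φ : TF) : ∀ᵐ x, ‖A (testField i φ) x‖ ≤ supBound i φ :=
  θ.ae_norm_apply_testField_le hA.comm hA.norm_le i φ

/-- `∫ u_j (v·Ψ)`. -/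
def tri (j : Fin 3) (u v Ψ : L2Field) : ℝ := ∫ x, u x j * inner ℝ (v x) (Ψ x)

theorem integrable_norm_mul_norm (u v : L2Field) : Integrable fun x => ‖u x‖ * ‖v x‖ :=
  (Lp.memLp u).norm.integrable_mul (Lp.memLp v).norm

theorem integral_norm_mul_norm_le (u v : L2Field) : ∫ x, ‖u x‖ * ‖v x‖ ≤ ‖u‖ * ‖v‖ := by
  have h (w : L2Field) : ‖(Lp.memLp w).norm.toLp‖ = ‖w‖ := by
    rw [Lp.norm_toLp, eLpNorm_norm, Lp.norm_def]
  have := real_inner_le_norm (Lp.memLp u).norm.toLp (Lp.memLp v).norm.toLp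
  rw [h, h, L2.inner_def] at this
  refine (le_of_eq (integral_congr_ae ?_)).trans this
  filter_upwards [(Lp.memLp u).norm.coeFn_toLp, (Lp.memLp v).norm.coeFn_toLp] with x hx hx'
  rw [hx, hx']
  simp [mul_comm]

section Tri

variable {j : Fin 3} {u u' v v' Ψ Ψ' : L2Field} {C C' : ℝ}

theorem ae_abs_tri_integrand_le (h : ∀ᵐ x, ‖Ψ x‖ ≤ C) :
    ∀ᵐ x, ‖u x j * inner ℝ (v x) (Ψ x)‖ ≤ C * (‖u x‖ * ‖v x‖) := by
  filter_upwards [h] with x hx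
  rw [norm_mul]
  calc ‖u x j‖ * ‖inner ℝ (v x) (Ψ x)‖ ≤ ‖u x‖ * (‖v x‖ * C) :=
        mul_le_mul (PiLp.norm_apply_le _ _) ((norm_inner_le_norm _ _).trans
          (mul_le_mul_of_nonneg_left hx (norm_nonneg _))) (norm_nonneg _) (norm_nonneg _)
    _ = _ := by ring

theorem integrable_tri (u v : L2Field) (h : ∀ᵐ x, ‖Ψ x‖ ≤ C) :
    Integrable fun x => u x j * inner ℝ (v x) (Ψ x) := by
  refine ((integrable_norm_mul_norm u v).const_mul C).mono' ?_ (ae_abs_tri_integrand_le h)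
  have hu : AEStronglyMeasurable (fun x => u x j) volume :=
    (show Continuous fun z : E3 => z j by fun_prop).comp_aestronglyMeasurable
      (Lp.aestronglyMeasurable u)
  exact hu.mul ((Lp.aestronglyMeasurable v).inner (Lp.aestronglyMeasurable Ψ))

theorem abs_tri_le (u v : L2Field) (h : ∀ᵐ x, ‖Ψ x‖ ≤ C) : |tri j u v Ψ| ≤ C * (‖u‖ * ‖v‖) := by
  have hC : 0 ≤ C := let ⟨x, hx⟩ := h.exists; (norm_nonneg _).trans hx
  refine (norm_integral_le_of_norm_le ((integrable_norm_mul_norm u v).const_mul C)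
    (ae_abs_tri_integrand_le h)).trans ?_
  rw [integral_const_mul]
  exact mul_le_mul_of_nonneg_left (integral_norm_mul_norm_le u v) hC

theorem tri_sub_left (h : ∀ᵐ x, ‖Ψ x‖ ≤ C) : tri j (u - u') v Ψ = tri j u v Ψ - tri j u' v Ψ := by
  unfold tri
  rw [← integral_sub (integrable_tri u v h) (integrable_tri u' v h)]
  refine integral_congr_ae ?_
  filter_upwards [Lp.coeFn_sub u u'] with x hx
  rw [hx, Pi.sub_apply, PiLp.sub_apply, sub_mul]

theorem tri_add_right (h : ∀ᵐ x, ‖Ψ x‖ ≤ C) (h' : ∀ᵐ x, ‖Ψ' x‖ ≤ C') :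
    tri j u v (Ψ + Ψ') = tri j u v Ψ + tri j u v Ψ' := by
  unfold tri
  rw [← integral_add (integrable_tri u v h) (integrable_tri u v h')]
  refine integral_congr_ae ?_
  filter_upwards [Lp.coeFn_add Ψ Ψ'] with x hx
  rw [hx, Pi.add_apply, inner_add_right, mul_add]

theorem tri_smul_right (c : ℝ) : tri j u v (c • Ψ) = c * tri j u v Ψ := by
  unfold tri
  rw [← integral_const_mul]
  refine integral_congr_ae ?_
  filter_upwards [Lp.coeFn_smul c Ψ] with x hx
  rw [hx, Pi.smul_apply, inner_smul_right]
  ring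

theorem tri_testField (i : Fin 3) (φ : TF) :
    tri j u v (testField i φ) = ∫ x, u x j * v x i * φ x := by
  refine integral_congr_ae ?_
  filter_upwards [coeFn_testField i φ] with x hx
  rw [hx, inner_smul_right, EuclideanSpace.inner_single_right]
  simp only [one_mul, conj_trivial]
  ring

theorem inner_mulL_mol (θ : MollifierKernel) {ε : ℝ} (hε : 0 < ε) :
    inner ℝ Ψ (mulL (θ.mol ε hε.ne' j u) v) = tri j (θ.S ε u) v Ψ := by
  rw [real_inner_comm, inner_mulL_eq]
  refine integral_congr_ae ?_
  filter_upwards [θ.coeFn_mol ε hε u j] with x hx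
  rw [hx]

theorem tendsto_tri_S (θ : MollifierKernel) (h : ∀ᵐ x, ‖Ψ x‖ ≤ C) :
    Tendsto (fun n => tri j (θ.S (MollifierKernel.dn n) u) v Ψ) atTop (𝓝 (tri j u v Ψ)) := by
  have h0 : Tendsto (fun n => C * (‖θ.S (MollifierKernel.dn n) u - u‖ * ‖v‖)) atTop (𝓝 0) := by
    have := ((tendsto_iff_norm_sub_tendsto_zero.1
      ((θ.tendsto_S u).comp MollifierKernel.tendsto_dn)).mul_const ‖v‖).const_mul C
    simpa using this
  refine tendsto_iff_norm_sub_tendsto_zero.2 (squeeze_zero (fun _ => norm_nonneg _)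
    (fun n => ?_) h0)
  rw [← tri_sub_left h, Real.norm_eq_abs]
  exact abs_tri_le _ _ h

end Tri

theorem transportD_apply (b v : ℝ → L2Field) (i : Fin 3) (φ : STF) :
    transportD (fun t => b t) v i φ =
      -∑ j, ∫ t in Ioi (0 : ℝ), tri j (b t) (v t) (testField i (slice (∂_{((0 : ℝ), e j)} φ) t)) := by
  simp only [transportD, Finset.sum_apply, Dx, regular, tri_testField, slice_apply,
    Finset.sum_neg_distrib]

/-- Both mollifications are compared with `v`. The bound linear in the gradient is relaxed by `a ≤ 1
+ a²`, because only the square of the gradient norm is integrable over all times. The moment is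
increased by one so that the right-hand side is infinite whenever the gradient is. -/
theorem MollifierKernel.enorm_S_sub_S_le (θ : MollifierKernel) (v : L2Field) {ε δ : ℝ} (hε : 0 < ε)
    (hδ : 0 < δ) :
    ‖θ.S ε v - θ.S δ v‖ₑ ≤ ENNReal.ofReal ((ε + δ) * (θ.moment + 1)) * (3 + gradSq v) := by
  have hm := θ.moment_nonneg
  by_cases h : gradSq v = ⊤
  · rw [h, add_top, ENNReal.mul_top (by simpa using by positivity)]
    exact le_top
  obtain ⟨G, hG, hs⟩ := exists_hasWD θ h
  have h1 := HasWD.norm_sub_S_le θ hG hε.le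
  have h2 := HasWD.norm_sub_S_le θ hG hδ.le
  have h3 : ∑ j, ‖G j‖ ≤ 3 + ∑ j, ‖G j‖ ^ 2 := by
    have : ∀ j, ‖G j‖ ≤ 1 + ‖G j‖ ^ 2 := fun j => by nlinarith [sq_nonneg (‖G j‖ - 1)]
    refine (Finset.sum_le_sum fun j _ => this j).trans (le_of_eq ?_)
    rw [Finset.sum_add_distrib]
    simp
  have h4 : (3 : ℝ≥0∞) + gradSq v = ENNReal.ofReal (3 + ∑ j, ‖G j‖ ^ 2) := by
    rw [hs, ENNReal.ofReal_add (by norm_num) (by positivity),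
      ENNReal.ofReal_sum_of_nonneg fun _ _ => by positivity]
    simp only [enorm_sq_eq_ofReal]
    norm_num
  rw [h4, ← ENNReal.ofReal_mul (by positivity), ← ofReal_norm]
  refine ENNReal.ofReal_le_ofReal ?_
  have h5 : ‖θ.S ε v - θ.S δ v‖ ≤ ‖v - θ.S δ v‖ + ‖v - θ.S ε v‖ := by
    rw [← norm_neg (v - θ.S ε v)]
    refine le_trans (le_of_eq ?_) (norm_add_le _ _)
    congr 1
    abel
  refine h5.trans ((add_le_add h2 h1).trans ?_)
  have h6 : (0 : ℝ) ≤ ∑ j, ‖G j‖ := by positivity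
  calc δ * θ.moment * ∑ j, ‖G j‖ + ε * θ.moment * ∑ j, ‖G j‖
      = (ε + δ) * θ.moment * ∑ j, ‖G j‖ := by ring
    _ ≤ (ε + δ) * (θ.moment + 1) * (3 + ∑ j, ‖G j‖ ^ 2) := by gcongr; linarith

/-- Extended norms allow `g` to be infinite at exceptional times; the cut-off at `b` makes the
constant part of the bound integrable. -/
theorem abs_setIntegral_le_of_enorm_le {f : ℝ → ℝ} {g : ℝ → ℝ≥0∞} {b c : ℝ} {K : ℝ≥0∞}
    (hc : 0 ≤ c) (hb : 0 ≤ b) (hK : K ≠ ⊤) (hf : ∀ t, 0 < t → ‖f t‖ₑ ≤ ENNReal.ofReal c * (3 + g t))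
    (h0 : ∀ t, b < t → f t = 0) (hg : ∫⁻ t in Ioi (0 : ℝ), g t ≤ K) :
    |∫ t in Ioi (0 : ℝ), f t| ≤ c * (3 * b + K.toReal) := by
  have h : ‖∫ t in Ioi (0 : ℝ), f t‖ₑ ≤ ENNReal.ofReal (c * (3 * b + K.toReal)) := by
    calc ‖∫ t in Ioi (0 : ℝ), f t‖ₑ ≤ ∫⁻ t in Ioi (0 : ℝ), ‖f t‖ₑ := enorm_integral_le_lintegral_enorm _
      _ ≤ ∫⁻ t in Ioi (0 : ℝ), ENNReal.ofReal c * ((Iic b).indicator (fun _ => 3) t + g t) := by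
          refine setLIntegral_mono' measurableSet_Ioi fun t ht => ?_
          by_cases htb : t ≤ b
          · rw [indicator_of_mem (by exact htb)]
            exact hf t ht
          · rw [h0 t (not_le.1 htb)]
            simp
      _ = ENNReal.ofReal c * (3 * ENNReal.ofReal b + ∫⁻ t in Ioi (0 : ℝ), g t) := by
          rw [lintegral_const_mul' _ _ ENNReal.ofReal_ne_top, lintegral_add_left
            (measurable_const.indicator measurableSet_Iic), lintegral_indicator measurableSet_Iic,
            Measure.restrict_restrict measurableSet_Iic, setLIntegral_const, Iic_inter_Ioi,
            Real.volume_Ioc, sub_zero]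
      _ ≤ ENNReal.ofReal c * (3 * ENNReal.ofReal b + K) := by gcongr
      _ = _ := by
          rw [ENNReal.ofReal_mul hc, ENNReal.ofReal_add (by positivity) ENNReal.toReal_nonneg,
            ENNReal.ofReal_mul (by norm_num), ENNReal.ofReal_toReal hK]
          norm_num
  rwa [← ofReal_norm, Real.norm_eq_abs, ENNReal.ofReal_le_ofReal_iff (by positivity)] at h

theorem tendsto_of_double_limit {a : ℕ → ℝ} {H : ℕ → ℕ → ℝ} {G ε d : ℕ → ℝ} {L K : ℝ}
    (h : ∀ n m, |a n - H n m| ≤ (ε n + d m) * K) (hε : Tendsto ε atTop (𝓝 0))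
    (hd : Tendsto d atTop (𝓝 0)) (hH : ∀ m, Tendsto (fun n => H n m) atTop (𝓝 (G m)))
    (hG : Tendsto G atTop (𝓝 L)) : Tendsto a atTop (𝓝 L) := by
  rw [Metric.tendsto_atTop']
  intro η hη
  have e1 : Tendsto (fun n => ε n * K) atTop (𝓝 0) := by simpa using hε.mul_const K
  have e2 : Tendsto (fun n => d n * K) atTop (𝓝 0) := by simpa using hd.mul_const K
  obtain ⟨m, hm1, hm2⟩ := ((e2.eventually (gt_mem_nhds (by positivity : 0 < η / 4))).and
    (hG.eventually (Metric.ball_mem_nhds L (by positivity : 0 < η / 4)))).exists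
  obtain ⟨N, hN⟩ := eventually_atTop.1 ((e1.eventually (gt_mem_nhds (by positivity : 0 < η / 4))).and
    ((hH m).eventually (Metric.ball_mem_nhds (G m) (by positivity : 0 < η / 4))))
  refine ⟨N, fun n hn => ?_⟩
  obtain ⟨h1, h2⟩ := hN n hn.le
  have h3 := h n m
  rw [Real.dist_eq] at hm2 h2
  rw [Real.dist_eq]
  have : a n - L = (a n - H n m) + (H n m - G m) + (G m - L) := by ring
  rw [this]
  refine (abs_add_three _ _ _).trans_lt ?_
  linarith

/-! ### Passage to the limit in the quadratic terms -/

theorem supBound_zero (i : Fin 3) : supBound i 0 = 0 := by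
  have h (ψ : TF) (h : ∀ x, ψ x = 0) : testField i ψ = 0 := by
    rw [show ψ = (0 : ℝ) • ψ from DFunLike.ext _ _ fun x => by simp [h x], testField_smul, zero_smul]
  have h2 (j : Fin 3) : ∂_{e j} (∂_{e j} (0 : TF)) = 0 := by simp
  unfold supBound lapT
  simp only [h2]
  rw [h 0 fun _ => rfl]
  simp

theorem continuous_lapT_slice (i : Fin 3) (φ : STF) : Continuous fun t => lapT i (slice φ t) := by
  unfold lapT
  simp only [lineDeriv_slice]
  exact continuous_finsetSum _ fun _ _ => continuous_testField_slice i _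

theorem exists_supBound_slice_le (i : Fin 3) (φ : STF) :
    ∃ a b C : ℝ, 0 < a ∧ a < b ∧ 0 ≤ C ∧ (∀ t, t ∉ Icc a b → slice φ t = 0) ∧
      ∀ t, supBound i (slice φ t) ≤ (Icc a b).indicator (fun _ => C) t := by
  obtain ⟨a, b, ha, hab, h0⟩ := exists_slice_eq_zero φ
  have hc : Continuous fun t => supBound i (slice φ t) := by
    unfold supBound
    exact continuous_const.mul (continuous_const.mul
      ((continuous_testField_slice i φ).norm.add (continuous_lapT_slice i φ).norm))
  obtain ⟨C, hC⟩ := isCompact_Icc.exists_bound_of_continuousOn (hc.continuousOn (s := Icc a b))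
  refine ⟨a, b, C, ha, hab, (norm_nonneg _).trans (hC a ⟨le_rfl, hab.le⟩), h0, fun t => ?_⟩
  by_cases ht : t ∈ Icc a b
  · rw [indicator_of_mem ht]
    exact (le_abs_self _).trans (hC t ht)
  · rw [indicator_of_notMem ht, h0 t ht, supBound_zero]

theorem Equivariant.abs_tri_le (θ : MollifierKernel) {A : L2Field →L[ℝ] L2Field}
    (hA : Equivariant A) (i j : Fin 3) (φ : TF) {u v : L2Field} {M : ℝ} (hu : ‖u‖ ≤ M)
    (hv : ‖v‖ ≤ M) : |tri j u v (A (testField i φ))| ≤ supBound i φ * (M * M) :=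
  (Micropolar.abs_tri_le u v (hA.ae_norm_le θ i φ)).trans (mul_le_mul_of_nonneg_left
    (mul_le_mul hu hv (norm_nonneg _) ((norm_nonneg _).trans hu)) (supBound_nonneg i φ))

section

variable (θ : MollifierKernel) {A : L2Field →L[ℝ] L2Field}

theorem continuousOn_inner_mulL_mol {ε : ℝ} (hε : ε ≠ 0) {u v : ℝ → L2Field}
    (hu : BoundedWeaklyContinuous u) (hv : BoundedWeaklyContinuous v) (i j : Fin 3) (φ : STF) :
    ContinuousOn (fun t => inner ℝ (A (testField i (slice φ t))) (mulL (θ.mol ε hε j (u t)) (v t)))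
      (Ici 0) := by
  have h := θ.boundedWeaklyContinuous_mulL hε hu hv j
  obtain ⟨M, hM⟩ := h.bounded
  exact h.weaklyContinuous.continuousOn_inner hM (A.continuous.comp (continuous_testField_slice i φ))

theorem aestronglyMeasurable_inner_mulL_mol {ε : ℝ} (hε : ε ≠ 0) {u v : ℝ → L2Field}
    (hu : BoundedWeaklyContinuous u) (hv : BoundedWeaklyContinuous v) (i j : Fin 3) (φ : STF) :
    AEStronglyMeasurable (fun t => inner ℝ (A (testField i (slice φ t)))
      (mulL (θ.mol ε hε j (u t)) (v t))) (volume.restrict (Ioi 0)) :=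
  ((continuousOn_inner_mulL_mol θ hε hu hv i j φ).mono Ioi_subset_Ici_self).aestronglyMeasurable
    measurableSet_Ioi

theorem Equivariant.exists_bound_slice (θ : MollifierKernel) (hA : Equivariant A) (i j : Fin 3) (φ : STF) (M : ℝ) :
    ∃ B : ℝ → ℝ, IntegrableOn B (Ioi 0) ∧ ∀ t u v, ‖u‖ ≤ M → ‖v‖ ≤ M →
      |tri j u v (A (testField i (slice φ t)))| ≤ B t := by
  obtain ⟨a, b, C, -, -, -, -, hC⟩ := exists_supBound_slice_le i φ
  refine ⟨fun t => (Icc a b).indicator (fun _ => C) t * (M * M), ?_, fun t u v hu hv => ?_⟩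
  · have : Integrable ((Icc a b).indicator fun _ : ℝ => C) :=
      (integrable_indicator_iff measurableSet_Icc).2
        (integrableOn_const (measure_Icc_lt_top.ne) (by simp))
    exact (this.mul_const _).integrableOn
  · exact (hA.abs_tri_le θ i j (slice φ t) hu hv).trans
      (mul_le_mul_of_nonneg_right (hC t) (mul_self_nonneg M))

/-- A quadratic expression in weakly continuous curves need not be continuous in time, but it is the
limit of its regularised versions, which are. -/
theorem Equivariant.aestronglyMeasurable_tri (θ : MollifierKernel) (hA : Equivariant A) {u v : ℝ → L2Field}
    (hu : BoundedWeaklyContinuous u) (hv : BoundedWeaklyContinuous v) (i j : Fin 3) (φ : STF) :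
    AEStronglyMeasurable (fun t => tri j (u t) (v t) (A (testField i (slice φ t))))
      (volume.restrict (Ioi 0)) := by
  refine aestronglyMeasurable_of_tendsto_ae atTop (fun n => aestronglyMeasurable_inner_mulL_mol θ
    (A := A) (MollifierKernel.dn_pos n).ne' hu hv i j φ) (Eventually.of_forall fun t => ?_)
  simp only [inner_mulL_mol θ (MollifierKernel.dn_pos _)]
  exact tendsto_tri_S θ (hA.ae_norm_le θ i _)

theorem Equivariant.integrableOn_tri (θ : MollifierKernel) (hA : Equivariant A) {u v : ℝ → L2Field}
    (hu : BoundedWeaklyContinuous u) (hv : BoundedWeaklyContinuous v) (i j : Fin 3) (φ : STF) :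
    IntegrableOn (fun t => tri j (u t) (v t) (A (testField i (slice φ t)))) (Ioi 0) := by
  obtain ⟨M, hM⟩ := hu.bounded
  obtain ⟨M', hM'⟩ := hv.bounded
  obtain ⟨B, hB, h⟩ := hA.exists_bound_slice θ i j φ (max M M')
  refine hB.mono' (hA.aestronglyMeasurable_tri θ hu hv i j φ) ?_
  filter_upwards [ae_restrict_mem measurableSet_Ioi] with t ht
  exact h t _ _ ((hM t (le_of_lt ht)).trans (le_max_left _ _))
    ((hM' t (le_of_lt ht)).trans (le_max_right _ _))

/-- Replacing the scale `ε n` by a fixed `dn m` costs at most a constant times `ε n + dn m`,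
uniformly in the solutions, by the gradient bound on `un`. At the fixed scale the weak limits pass
through the product at each time; then `m → ∞`. No gradient of `vn` enters, which covers the
microrotation with `γ = 0`. -/
theorem Equivariant.tendsto_integral_tri (hA : Equivariant A) {u v : ℝ → L2Field}
    {un vn : ℕ → ℝ → L2Field} {ε : ℕ → ℝ} {M : ℝ} {K : ℝ≥0∞} (hε : ∀ n, 0 < ε n)
    (hε0 : Tendsto ε atTop (𝓝 0)) (hu : BoundedWeaklyContinuous u) (hv : BoundedWeaklyContinuous v)
    (hun : ∀ n, BoundedWeaklyContinuous (un n)) (hvn : ∀ n, BoundedWeaklyContinuous (vn n))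
    (huM : ∀ n t, 0 ≤ t → ‖un n t‖ ≤ M) (hvM : ∀ n t, 0 ≤ t → ‖vn n t‖ ≤ M)
    (hut : ∀ t, 0 ≤ t → WT atTop (fun n => un n t) (u t))
    (hvt : ∀ t, 0 ≤ t → WT atTop (fun n => vn n t) (v t)) (hK : K ≠ ⊤)
    (hg : ∀ n, ∫⁻ t in Ioi (0 : ℝ), gradSq (un n t) ≤ K) (i j : Fin 3) (φ : STF) :
    Tendsto (fun n => ∫ t in Ioi (0 : ℝ), inner ℝ (A (testField i (slice φ t)))
        (mulL (θ.mol (ε n) (hε n).ne' j (un n t)) (vn n t))) atTop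
      (𝓝 (∫ t in Ioi (0 : ℝ), tri j (u t) (v t) (A (testField i (slice φ t))))) := by
  obtain ⟨B, hB, hBle⟩ := hA.exists_bound_slice θ i j φ M
  obtain ⟨a, b, C, ha, hab, hC0, h0, hC⟩ := exists_supBound_slice_le i φ
  have hM0 : 0 ≤ M := (norm_nonneg _).trans (huM 0 0 le_rfl)
  have huM' : ∀ t, 0 ≤ t → ‖u t‖ ≤ M := fun t ht => (hut t ht).norm_le (Eventually.of_forall fun n => huM n t ht)
  have hvM' : ∀ t, 0 ≤ t → ‖v t‖ ≤ M := fun t ht => (hvt t ht).norm_le (Eventually.of_forall fun n => hvM n t ht)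
  have bound : ∀ {ε : ℝ} (hε : 0 < ε) {x y : ℝ → L2Field}, (∀ t, 0 ≤ t → ‖x t‖ ≤ M) →
      (∀ t, 0 ≤ t → ‖y t‖ ≤ M) → ∀ᵐ t ∂(volume.restrict (Ioi (0 : ℝ))),
        ‖inner ℝ (A (testField i (slice φ t))) (mulL (θ.mol ε hε.ne' j (x t)) (y t))‖ ≤ B t := by
    intro ε hε x y hx hy
    filter_upwards [ae_restrict_mem measurableSet_Ioi] with t ht
    rw [inner_mulL_mol θ hε]
    exact hBle t _ _ ((θ.norm_S_le ε _).trans (hx t (le_of_lt ht))) (hy t (le_of_lt ht))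
  refine tendsto_of_double_limit (d := MollifierKernel.dn)
    (H := fun n m => ∫ t in Ioi (0 : ℝ), inner ℝ (A (testField i (slice φ t)))
      (mulL (θ.mol (MollifierKernel.dn m) (MollifierKernel.dn_pos m).ne' j (un n t)) (vn n t)))
    (G := fun m => ∫ t in Ioi (0 : ℝ), inner ℝ (A (testField i (slice φ t)))
      (mulL (θ.mol (MollifierKernel.dn m) (MollifierKernel.dn_pos m).ne' j (u t)) (v t)))
    (K := C * M * (θ.moment + 1) * (3 * b + K.toReal)) (fun n m => ?_) hε0
    MollifierKernel.tendsto_dn (fun m => ?_) ?_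
  · have hd := MollifierKernel.dn_pos m
    have e1 : IntegrableOn (fun t => inner ℝ (A (testField i (slice φ t)))
        (mulL (θ.mol (ε n) (hε n).ne' j (un n t)) (vn n t))) (Ioi 0) :=
      hB.mono' (aestronglyMeasurable_inner_mulL_mol θ _ (hun n) (hvn n) i j φ)
        (bound (hε n) (huM n) (hvM n))
    have e2 : IntegrableOn (fun t => inner ℝ (A (testField i (slice φ t)))
        (mulL (θ.mol (MollifierKernel.dn m) hd.ne' j (un n t)) (vn n t))) (Ioi 0) :=
      hB.mono' (aestronglyMeasurable_inner_mulL_mol θ _ (hun n) (hvn n) i j φ)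
        (bound hd (huM n) (hvM n))
    rw [← integral_sub e1 e2]
    have hm := θ.moment_nonneg
    refine (abs_setIntegral_le_of_enorm_le (c := C * M * ((ε n + MollifierKernel.dn m) *
      (θ.moment + 1))) (b := b) (g := fun t => gradSq (un n t)) (mul_nonneg (mul_nonneg hC0 hM0)
        (mul_nonneg (add_pos (hε n) hd).le (by positivity))) (ha.trans hab).le hK
      (fun t ht => ?_) (fun t ht => ?_) (hg n)).trans (le_of_eq (by ring))
    · have hF := hA.ae_norm_le θ i (slice φ t)
      rw [inner_mulL_mol θ (hε n), inner_mulL_mol θ hd, ← tri_sub_left hF,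
        ENNReal.ofReal_mul (mul_nonneg hC0 hM0), mul_assoc]
      refine le_trans ?_ (mul_le_mul_right (θ.enorm_S_sub_S_le (un n t) (hε n) hd) _)
      rw [← ofReal_norm, ← ofReal_norm, ← ENNReal.ofReal_mul (mul_nonneg hC0 hM0)]
      refine ENNReal.ofReal_le_ofReal ((Micropolar.abs_tri_le _ _ hF).trans ?_)
      have hle : supBound i (slice φ t) ≤ C :=
        (hC t).trans (indicator_le_self' (fun _ _ => hC0) t)
      calc supBound i (slice φ t) * (‖θ.S (ε n) (un n t) - θ.S (MollifierKernel.dn m) (un n t)‖ *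
            ‖vn n t‖) ≤ C * (‖θ.S (ε n) (un n t) - θ.S (MollifierKernel.dn m) (un n t)‖ * M) :=
            mul_le_mul hle (mul_le_mul_of_nonneg_left (hvM n t ht.le) (norm_nonneg _))
              (by positivity) hC0
        _ = _ := by ring
    · have ht' : t ∉ Icc a b := fun h => (not_le.2 ht) h.2
      have hz : testField i (slice φ t) = 0 := by
        rw [h0 t ht', show (0 : TF) = (0 : ℝ) • 0 by simp, testField_smul, zero_smul]
      simp [hz]
  · refine tendsto_integral_of_dominated_convergence B (fun n => aestronglyMeasurable_inner_mulL_mol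
      θ _ (hun n) (hvn n) i j φ) hB (fun n => bound (MollifierKernel.dn_pos m) (huM n) (hvM n)) ?_
    filter_upwards [ae_restrict_mem measurableSet_Ioi] with t ht
    have ht : 0 ≤ t := le_of_lt ht
    exact (hut t ht).mulL_ptB (Eventually.of_forall fun n => huM n t ht) (hvt t ht)
      (Eventually.of_forall fun n => hvM n t ht) _ _
  · refine tendsto_integral_of_dominated_convergence B (fun n => aestronglyMeasurable_inner_mulL_mol
      θ _ hu hv i j φ) hB (fun n => bound (MollifierKernel.dn_pos n) huM' hvM') (Eventually.of_forall fun t => ?_)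
    simp only [inner_mulL_mol θ (MollifierKernel.dn_pos _)]
    exact tendsto_tri_S θ (hA.ae_norm_le θ i _)

end

/-! ### Sequences of mollified solutions -/

theorem lintegral_Ioi_le {f : ℝ → ℝ≥0∞} {K : ℝ≥0∞} (h : ∀ t, 0 ≤ t → ∫⁻ τ in Ioc 0 t, f τ ≤ K) :
    ∫⁻ τ in Ioi 0, f τ ≤ K := by
  have hU : Ioi (0 : ℝ) = ⋃ n : ℕ, Ioc (0 : ℝ) n := by
    ext t
    simp only [mem_iUnion, mem_Ioc, mem_Ioi, exists_and_left]
    exact ⟨fun h => ⟨h, exists_nat_ge t⟩, fun h => h.1⟩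
  rw [hU, setLIntegral_iUnion_of_directed _ (Monotone.directed_le fun m n hmn =>
    Ioc_subset_Ioc_right (Nat.cast_le.2 hmn))]
  exact iSup_le fun n => h n n.cast_nonneg

theorem lintegral_Ioi_le_div {f : ℝ → ℝ≥0∞} {c : ℝ} {K : ℝ≥0∞} (hc : 0 < c)
    (h : ∀ t, 0 ≤ t → ENNReal.ofReal (2 * c) * ∫⁻ τ in Ioc 0 t, f τ ≤ K) :
    ∫⁻ τ in Ioi 0, f τ ≤ K / ENNReal.ofReal (2 * c) := by
  refine lintegral_Ioi_le fun t ht => ?_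
  rw [ENNReal.le_div_iff_mul_le (Or.inl (by simpa using hc)) (Or.inl ENNReal.ofReal_ne_top), mul_comm]
  exact h t ht

section Dissipation

variable {μ χ γ κ : ℝ} {u w : ℝ → L2Field} {s t : ℝ}

theorem gradSq_u_le_dissipation :
    ENNReal.ofReal (2 * μ) * (∫⁻ τ in Ioc s t, gradSq (u τ)) ≤ dissipation μ χ γ κ u w s t :=
  le_add_right (le_add_right le_self_add)

theorem gradSq_w_le_dissipation :
    ENNReal.ofReal (2 * γ) * (∫⁻ τ in Ioc s t, gradSq (w τ)) ≤ dissipation μ χ γ κ u w s t :=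
  le_add_right (le_add_right le_add_self)

theorem divSq_w_le_dissipation :
    ENNReal.ofReal (2 * κ) * (∫⁻ τ in Ioc s t, divSq (w τ)) ≤ dissipation μ χ γ κ u w s t :=
  le_add_right le_add_self

theorem energyClass_of_dissipation_le (hμ : 0 < μ) (hu : BoundedWeaklyContinuous u)
    (hw : BoundedWeaklyContinuous w) {K : ℝ≥0∞} (hK : K ≠ ⊤)
    (h : ∀ t, 0 ≤ t → dissipation μ χ γ κ u w 0 t ≤ K) : EnergyClass γ κ u w where
  u_mem := hu
  u_grad := (lintegral_Ioi_le_div hμ fun t ht => gradSq_u_le_dissipation.trans (h t ht)).trans_lt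
    (ENNReal.div_lt_top hK (by simpa using hμ))
  w_mem := hw
  w_grad hγ := (lintegral_Ioi_le_div hγ fun t ht => gradSq_w_le_dissipation.trans
    (h t ht)).trans_lt (ENNReal.div_lt_top hK (by simpa using hγ))
  w_div _ hκ := (lintegral_Ioi_le_div hκ fun t ht => divSq_w_le_dissipation.trans
    (h t ht)).trans_lt (ENNReal.div_lt_top hK (by simpa using hκ))

end Dissipation

/-! ### Lower semicontinuity of the dissipation under weak convergence -/

section Lsc

variable {ι : Type*} {l : Filter ι} [l.NeBot] [l.IsCountablyGenerated] {f g : ι → L2Field} {a b : L2Field}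

/-- Fatou's lemma for the counting measure on a finite set. -/
theorem sum_liminf_le_liminf_sum {κ : Type*} [Fintype κ] (x : κ → ι → ℝ≥0∞) :
    ∑ k, liminf (x k) l ≤ liminf (fun i => ∑ k, x k i) l := by
  let _ : MeasurableSpace κ := ⊤
  simpa only [lintegral_count, tsum_fintype] using lintegral_liminf_le' (μ := Measure.count) (u := l)
    (f := fun i k => x k i) fun i => (measurable_from_top (f := fun k => x k i)).aemeasurable

theorem liminf_add_liminf_le (x y : ι → ℝ≥0∞) :
    liminf x l + liminf y l ≤ liminf (fun i => x i + y i) l := by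
  simpa using sum_liminf_le_liminf_sum (l := l) (fun b : Bool => if b then x else y)

theorem WT.gradSq_le_liminf (θ : MollifierKernel) (h : WT l f a) :
    gradSq a ≤ liminf (fun i => gradSq (f i)) l := by
  simp only [θ.gradSq_eq]
  exact (Finset.sum_le_sum fun j _ => (θ.firstOrder_D j).nSq_le_liminf_nSq h
    (WT.const 0)).trans (sum_liminf_le_liminf_sum _)

theorem WT.dissDensity_le_liminf (θ : MollifierKernel) (μ χ γ κ : ℝ) (hf : WT l f a)
    (hg : WT l g b) : dissDensity μ χ γ κ a b ≤ liminf (fun i => dissDensity μ χ γ κ (f i) (g i)) l := by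
  have hm {c : ℝ} {y : ℝ≥0∞} {x : ι → ℝ≥0∞} (h : y ≤ liminf x l) :
      ENNReal.ofReal c * y ≤ liminf (fun i => ENNReal.ofReal c * x i) l := by
    rw [ENNReal.liminf_const_mul_of_ne_top ENNReal.ofReal_ne_top]
    gcongr
  unfold dissDensity
  have h1 := hm (c := μ) (hf.gradSq_le_liminf θ)
  have h2 := hm (c := γ) (hg.gradSq_le_liminf θ)
  have h3 : divSq b ≤ liminf (fun i => divSq (g i)) l := by
    simp only [θ.divSq_eq]
    exact θ.firstOrder_divS.nSq_le_liminf_nSq hg (WT.const 0)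
  have h4 : curlSubSq a b ≤ liminf (fun i => curlSubSq (f i) (g i)) l := by
    simp only [θ.curlSubSq_eq]
    exact θ.firstOrder_curlS.nSq_le_liminf_nSq hf
      (hg.map ((2 : ℝ) • ContinuousLinearMap.id ℝ L2Field))
  exact (add_le_add ((add_le_add ((add_le_add h1 h2).trans (liminf_add_liminf_le _ _))
    (hm (c := κ) h3)).trans (liminf_add_liminf_le _ _)) (hm (c := χ) h4)).trans (liminf_add_liminf_le _ _)

end Lsc

/-! ### Bounds for mollified solutions that are uniform in the mollification parameter -/

namespace IsMollifiedSolution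

variable {θ : MollifierKernel} {μ χ γ κ ε : ℝ} {u₀ w₀ : L2Field} {u w : ℝ → L2Field}

theorem energy_add_dissipation (h : IsMollifiedSolution θ μ χ γ κ u₀ w₀ ε u w) {t : ℝ}
    (ht : 0 ≤ t) : energy u w t + dissipation μ χ γ κ u w 0 t = ‖u₀‖ₑ ^ 2 + ‖w₀‖ₑ ^ 2 := by
  rw [h.energy_eq 0 t le_rfl ht, energy, h.initial.1, h.initial.2]

theorem dissipation_le (h : IsMollifiedSolution θ μ χ γ κ u₀ w₀ ε u w) {t : ℝ} (ht : 0 ≤ t) :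
    dissipation μ χ γ κ u w 0 t ≤ ‖u₀‖ₑ ^ 2 + ‖w₀‖ₑ ^ 2 :=
  le_add_self.trans (h.energy_add_dissipation ht).le

theorem norm_le (h : IsMollifiedSolution θ μ χ γ κ u₀ w₀ ε u w) {t : ℝ} (ht : 0 ≤ t) :
    ‖u t‖ ≤ √(‖u₀‖ ^ 2 + ‖w₀‖ ^ 2) ∧ ‖w t‖ ≤ √(‖u₀‖ ^ 2 + ‖w₀‖ ^ 2) := by
  have h1 : energy u w t ≤ ‖u₀‖ₑ ^ 2 + ‖w₀‖ₑ ^ 2 :=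
    le_self_add.trans (h.energy_add_dissipation ht).le
  simp only [energy, enorm_sq_eq_ofReal] at h1
  rw [← ENNReal.ofReal_add (by positivity) (by positivity),
    ← ENNReal.ofReal_add (by positivity) (by positivity),
    ENNReal.ofReal_le_ofReal_iff (by positivity)] at h1
  exact ⟨Real.le_sqrt_of_sq_le (by nlinarith [sq_nonneg ‖w t‖]),
    Real.le_sqrt_of_sq_le (by nlinarith [sq_nonneg ‖u t‖])⟩

theorem lintegral_gradSq_le (h : IsMollifiedSolution θ μ χ γ κ u₀ w₀ ε u w) (hμ : 0 < μ) :
    ∫⁻ t in Ioi (0 : ℝ), gradSq (u t) ≤ (‖u₀‖ₑ ^ 2 + ‖w₀‖ₑ ^ 2) / ENNReal.ofReal (2 * μ) :=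
  lintegral_Ioi_le_div hμ fun _ ht => gradSq_u_le_dissipation.trans (h.dissipation_le ht)

end IsMollifiedSolution

namespace MollifierKernel

variable (θ : MollifierKernel) {ε : ℝ} (hε : 0 < ε)

/-- Unlike the bound through `molConst`, this one does not depend on `ε`: the test field is
estimated in `L^∞` and both velocities in `L²`. It yields the uniform Lipschitz constants. -/
theorem abs_trU_le (i : Fin 3) (φ : TF) {u : L2Field} {M : ℝ} (hu : ‖u‖ ≤ M) :
    |θ.trU hε.ne' i φ u| ≤ ∑ j, supBound i (∂_{e j} φ) * (M * M) := by
  refine (Finset.abs_sum_le_sum_abs _ _).trans (Finset.sum_le_sum fun j _ => ?_)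
  rw [inner_mulL_mol θ hε]
  exact equivariant_leray.abs_tri_le θ i j _ ((θ.norm_S_le ε u).trans hu) hu

theorem abs_trW_le (i : Fin 3) (φ : TF) {u w : L2Field} {M : ℝ} (hu : ‖u‖ ≤ M) (hw : ‖w‖ ≤ M) :
    |θ.trW hε.ne' i φ u w| ≤ ∑ j, supBound i (∂_{e j} φ) * (M * M) := by
  refine (Finset.abs_sum_le_sum_abs _ _).trans (Finset.sum_le_sum fun j _ => ?_)
  rw [inner_mulL_mol θ hε]
  exact equivariant_id.abs_tri_le θ i j _ ((θ.norm_S_le ε u).trans hu) hw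

theorem lerayTransportD_eq_sum (i : Fin 3) (φ : STF) (u : ℝ → L2Field) :
    lerayTransportD (fun t => mollify θ ε (u t)) u i φ =
      -∑ j, ∫ t in Ioi (0 : ℝ), inner ℝ (leray (testField i (slice (∂_{((0 : ℝ), e j)} φ) t)))
        (mulL (θ.mol ε hε.ne' j (u t)) (u t)) := by
  simp only [lerayTransportD, Finset.sum_apply, Dx, Finset.sum_neg_distrib, regular, inner_leray,
    θ.toL2_mollify ε hε.ne', inner_testField, slice_apply, mul_comm]

theorem transportD_eq_sum (i : Fin 3) (φ : STF) {u w : ℝ → L2Field}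
    (hu : BoundedWeaklyContinuous u) (hw : BoundedWeaklyContinuous w) :
    transportD (fun t => mollify θ ε (u t)) w i φ =
      -∑ j, ∫ t in Ioi (0 : ℝ), inner ℝ (testField i (slice (∂_{((0 : ℝ), e j)} φ) t))
        (mulL (θ.mol ε hε.ne' j (u t)) (w t)) := by
  rw [(θ.transportD_eq hε.ne' hu hw i φ).2]
  simp only [trW, lineDeriv_slice]
  rw [integral_finsetSum _ fun j _ => integrableOn_inner_slice
    (θ.boundedWeaklyContinuous_mulL hε.ne' hu hw j) i (∂_{((0 : ℝ), e j)} φ)]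

end MollifierKernel

namespace IsMollifiedSolution

variable {θ : MollifierKernel} {μ χ γ κ ε : ℝ} {u₀ w₀ : L2Field} {u w : ℝ → L2Field}

theorem lipschitz_u (h : IsMollifiedSolution θ μ χ γ κ u₀ w₀ ε u w) (hε : 0 < ε) (i : Fin 3)
    (φ : TF) {M : ℝ} (hM : √(‖u₀‖ ^ 2 + ‖w₀‖ ^ 2) = M) {s t : ℝ} (hs : 0 ≤ s) (ht : 0 ≤ t) :
    |inner ℝ (testField i φ) (u t) - inner ℝ (testField i φ) (u s)| ≤
      ((|μ + χ| * ‖lapT i φ‖ + |2 * χ| * ‖MollifierKernel.curlT i φ‖) * M +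
        ∑ j, supBound i (∂_{e j} φ) * (M * M)) * |t - s| := by
  subst hM
  have hr := h.regularity
  refine lipschitz_of_weak (R := fun φ t => θ.rhsU hε.ne' μ χ i φ (u t) (w t))
    hr.u_mem.weaklyContinuous (fun c t => θ.rhsU_smul hε.ne' μ χ i c φ _ _) (fun t ht => ?_)
    ((θ.velocity_iff hε.ne' hr.u_mem hr.w_mem μ χ i).1 (h.velocity i)) hs ht
  obtain ⟨h1, h2⟩ := h.norm_le ht.le
  exact (abs_add_le _ _).trans (add_le_add (abs_linUT_le μ χ i φ h1 h2) (θ.abs_trU_le hε i φ h1))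

theorem lipschitz_w (h : IsMollifiedSolution θ μ χ γ κ u₀ w₀ ε u w) (hε : 0 < ε) (i : Fin 3)
    (φ : TF) {M : ℝ} (hM : √(‖u₀‖ ^ 2 + ‖w₀‖ ^ 2) = M) {s t : ℝ} (hs : 0 ≤ s) (ht : 0 ≤ t) :
    |inner ℝ (testField i φ) (w t) - inner ℝ (testField i φ) (w s)| ≤
      ((|γ| * ‖lapT i φ‖ + |κ| * ‖gradDivT i φ‖ + |2 * χ| * ‖MollifierKernel.curlT i φ‖ +
        |4 * χ| * ‖testField i φ‖) * M + ∑ j, supBound i (∂_{e j} φ) * (M * M)) * |t - s| := by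
  subst hM
  have hr := h.regularity
  refine lipschitz_of_weak (R := fun φ t => θ.rhsW hε.ne' χ γ κ i φ (u t) (w t))
    hr.w_mem.weaklyContinuous (fun c t => θ.rhsW_smul hε.ne' χ γ κ i c φ _ _) (fun t ht => ?_)
    ((θ.microrotation_iff hε.ne' hr.u_mem hr.w_mem χ γ κ i).1 (h.microrotation i)) hs ht
  obtain ⟨h1, h2⟩ := h.norm_le ht.le
  exact (abs_add_le _ _).trans (add_le_add (abs_linWT_le χ γ κ i φ h1 h2)
    (θ.abs_trW_le hε i φ h1 h2))

end IsMollifiedSolution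

theorem exists_subseq_of_mollified {θ : MollifierKernel} {μ χ γ κ : ℝ} {u₀ w₀ : L2Field}
    {ε : ℕ → ℝ} (hε : ∀ n, 0 < ε n) {un wn : ℕ → ℝ → L2Field}
    (h : ∀ n, IsMollifiedSolution θ μ χ γ κ u₀ w₀ (ε n) (un n) (wn n)) :
    ∃ (σ : ℕ → ℕ) (u w : ℝ → L2Field), StrictMono σ ∧ WeaklyContinuous u ∧ WeaklyContinuous w ∧
      (∀ t, 0 ≤ t → WT atTop (fun n => un (σ n) t) (u t)) ∧
      ∀ t, 0 ≤ t → WT atTop (fun n => wn (σ n) t) (w t) := by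
  obtain ⟨σ, u, hσ, hu, hut⟩ := exists_weak_subseq (z := un) (M := √(‖u₀‖ ^ 2 + ‖w₀‖ ^ 2))
    (fun n t ht => ((h n).norm_le ht).1) fun i φ => ⟨_, fun n s t hs ht =>
      (h n).lipschitz_u (hε n) i φ rfl hs ht⟩
  obtain ⟨τ, w, hτ, hw, hwt⟩ := exists_weak_subseq (z := fun n => wn (σ n))
    (M := √(‖u₀‖ ^ 2 + ‖w₀‖ ^ 2)) (fun n t ht => ((h _).norm_le ht).2) fun i φ => ⟨_,
      fun n s t hs ht => (h _).lipschitz_w (hε _) i φ rfl hs ht⟩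
  exact ⟨σ ∘ τ, u, w, hσ.comp hτ, hu, hw, fun t ht => (hut t ht).comp hτ.tendsto_atTop, hwt⟩

/-! ### Distributions given by time integrals -/

/-- The sup norm of `φ` and of its second space derivatives. -/
def supNorm (φ : STF) : ℝ :=
  ‖TestFunction.toBoundedContinuousFunctionCLM ℝ φ‖ +
    ∑ j, ‖TestFunction.toBoundedContinuousFunctionCLM ℝ
      (∂_{((0 : ℝ), e j)} (∂_{((0 : ℝ), e j)} φ))‖

theorem continuous_supNorm : Continuous supNorm := by
  unfold supNorm
  refine ((ContinuousLinearMap.continuous _).norm).add (continuous_finsetSum _ fun j _ =>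
    ((ContinuousLinearMap.continuous _).comp ?_).norm)
  exact (ContinuousLineDeriv.continuous_lineDerivOp _).comp (ContinuousLineDeriv.continuous_lineDerivOp _)

theorem abs_apply_le_norm (φ : STF) (z : ℝ × E3) :
    |φ z| ≤ ‖TestFunction.toBoundedContinuousFunctionCLM ℝ φ‖ :=
  (TestFunction.toBoundedContinuousFunctionCLM ℝ φ).norm_coe_le_norm z

theorem lineDeriv_eq_zero_of_notMem {φ : STF} {K : Set (ℝ × E3)} (hK : IsClosed K)
    (h : ∀ z ∉ K, φ z = 0) (v : ℝ × E3) : ∀ z ∉ K, (∂_{v} φ) z = 0 := by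
  intro z hz
  have : φ =ᶠ[𝓝 z] fun _ => 0 := by
    filter_upwards [hK.isOpen_compl.mem_nhds hz] with y hy using h y hy
  rw [lineDeriv_apply, this.fderiv_eq]
  simp

theorem norm_testField_slice_le {K : Set (ℝ × E3)} (hK : IsCompact K) (i : Fin 3) {φ : STF}
    (h : ∀ z ∉ K, φ z = 0) (t : ℝ) :
    ‖testField i (slice φ t)‖ ≤ ‖TestFunction.toBoundedContinuousFunctionCLM ℝ φ‖ *
      √(volume.real (Prod.snd '' K)) := by
  have := norm_testField_le i (slice φ t) (hK.image continuous_snd)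
    (c := ‖TestFunction.toBoundedContinuousFunctionCLM ℝ φ‖)
    (fun x hx => h (t, x) fun hz => hx ⟨_, hz, rfl⟩) fun x _ => abs_apply_le_norm φ (t, x)
  rwa [abs_norm] at this

theorem norm_testField_add_norm_lapT_slice_le {K : Set (ℝ × E3)} (hK : IsCompact K) (i : Fin 3)
    {φ : STF} (h : ∀ z ∉ K, φ z = 0) (t : ℝ) :
    ‖testField i (slice φ t)‖ + ‖lapT i (slice φ t)‖ ≤
      supNorm φ * √(volume.real (Prod.snd '' K)) := by
  unfold supNorm lapT
  simp only [lineDeriv_slice]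
  rw [add_mul, Finset.sum_mul]
  refine add_le_add (norm_testField_slice_le hK i h t) ((norm_sum_le _ _).trans
    (Finset.sum_le_sum fun j _ => norm_testField_slice_le hK i ?_ t))
  exact lineDeriv_eq_zero_of_notMem hK.isClosed (lineDeriv_eq_zero_of_notMem hK.isClosed h _) _

theorem abs_setIntegral_Ioi_le {f : ℝ → ℝ} {b B : ℝ} (hb : 0 ≤ b) (hB : ∀ t, 0 < t → |f t| ≤ B)
    (h0 : ∀ t, b < t → f t = 0) : |∫ t in Ioi (0 : ℝ), f t| ≤ B * b := by
  rw [setIntegral_eq_of_subset_of_forall_sdiff_eq_zero measurableSet_Ioi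
    (Ioc_subset_Ioi_self : Ioc 0 b ⊆ Ioi 0) fun t ht => h0 t (not_le.1 fun h => ht.2 ⟨ht.1, h⟩)]
  refine (norm_setIntegral_le_of_norm_le_const (f := f) (C := B) (μ := volume) (s := Ioc 0 b) (by simp)
    fun t ht => hB t ht.1).trans ?_
  simp [hb]

/-- Continuity on test functions need only be checked on those supported in a fixed compact set,
where it follows from a seminorm bound. -/
theorem continuous_of_abs_le {T : STF →ₗ[ℝ] ℝ} (h : ∀ K : Compacts (ℝ × E3),
    ∃ C, ∀ φ : STF, (∀ z ∉ K, φ z = 0) → |T φ| ≤ C * supNorm φ) : Continuous T := by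
  rw [TestFunction.continuous_iff_continuous_comp]
  intro K hK
  obtain ⟨C, hC⟩ := h K
  let T' : 𝓓_{K}(ℝ × E3, ℝ) →ₗ[ℝ] ℝ := T ∘ₗ (TestFunction.ofSupportedInCLM ℝ hK).toLinearMap
  refine continuous_of_continuousAt_zero T' ?_
  have hq : Continuous fun f => C * supNorm (TestFunction.ofSupportedIn hK f) :=
    continuous_const.mul (continuous_supNorm.comp (TestFunction.continuous_ofSupportedIn hK))
  have h0 : supNorm (TestFunction.ofSupportedIn hK 0) = 0 := by
    have : TestFunction.ofSupportedIn hK 0 = (0 : STF) := rfl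
    have h2 : ∀ v : ℝ × E3, ∂_{v} (0 : STF) = 0 := fun v => by simp
    simp only [this, supNorm, h2, map_zero, norm_zero, Finset.sum_const_zero, add_zero]
  have hlim := hq.tendsto 0
  rw [h0, mul_zero] at hlim
  rw [ContinuousAt, map_zero]
  exact squeeze_zero_norm (fun f => hC _ fun z hz => f.zero_on_compl hz) hlim

theorem slice_add (φ ψ : STF) (t : ℝ) : slice (φ + ψ) t = slice φ t + slice ψ t := rfl

theorem slice_smul (c : ℝ) (φ : STF) (t : ℝ) : slice (c • φ) t = c • slice φ t := rfl

/-- The Laplacian is allowed in the bound because the sup estimate behind the pressure costs two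
derivatives. -/
theorem exists_distribution {L : ℝ → TF → ℝ} (i : Fin 3) {B : ℝ} (hB : 0 ≤ B)
    (hadd : ∀ t ψ ψ', L t (ψ + ψ') = L t ψ + L t ψ') (hsmul : ∀ t (c : ℝ) ψ, L t (c • ψ) = c * L t ψ)
    (hle : ∀ t, 0 < t → ∀ ψ, |L t ψ| ≤ B * (‖testField i ψ‖ + ‖lapT i ψ‖))
    (hint : ∀ φ : STF, IntegrableOn (fun t => L t (slice φ t)) (Ioi 0)) :
    ∃ T : 𝓓'(spaceTime, ℝ), ∀ φ, T φ = ∫ t in Ioi (0 : ℝ), L t (slice φ t) := by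
  let T : STF →ₗ[ℝ] ℝ :=
    { toFun φ := ∫ t in Ioi (0 : ℝ), L t (slice φ t)
      map_add' φ ψ := by
        rw [← integral_add (hint φ) (hint ψ)]
        simp only [slice_add, hadd]
      map_smul' c φ := by
        rw [RingHom.id_apply, smul_eq_mul, ← integral_const_mul]
        simp only [slice_smul, hsmul] }
  have hT : Continuous T := by
    refine continuous_of_abs_le fun K => ?_
    obtain ⟨b, hb⟩ := (K.isCompact.image continuous_fst).bddAbove
    refine ⟨B * √(volume.real (Prod.snd '' (K : Set (ℝ × E3)))) * max b 0, fun φ hφ => ?_⟩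
    refine (abs_setIntegral_Ioi_le (le_max_right b 0) (B := B * (supNorm φ *
      √(volume.real (Prod.snd '' (K : Set (ℝ × E3)))))) (fun t ht => (hle t ht _).trans
        (mul_le_mul_of_nonneg_left (norm_testField_add_norm_lapT_slice_le K.isCompact i hφ t) hB))
      fun t ht => ?_).trans (le_of_eq (by ring))
    -- Beyond the support the slice vanishes, and homogeneity of `L` gives the value zero.
    have : slice φ t = (0 : ℝ) • slice φ t := by
      ext x
      have h0 : φ (t, x) = 0 := hφ _ fun hz =>
        (not_le.2 ((le_max_left b 0).trans_lt ht)) (hb ⟨_, hz, rfl⟩)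
      simp [slice_apply, h0]
    rw [this, hsmul, zero_mul]
  exact ⟨{ toLinearMap := T, cont := hT }, fun _ => rfl⟩

theorem exists_distribution_comp {u : ℝ → L2Field} (hu : BoundedWeaklyContinuous u) (i : Fin 3) :
    ∃ T : 𝓓'(spaceTime, ℝ), ∀ φ, T φ = comp u i φ := by
  obtain ⟨M, hM⟩ := hu.bounded
  obtain ⟨T, hT⟩ := exists_distribution (L := fun t ψ => inner ℝ (testField i ψ) (u t)) i
    ((norm_nonneg _).trans (hM 0 le_rfl))
    (fun t ψ ψ' => by rw [testField_add, inner_add_left])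
    (fun t c ψ => by rw [testField_smul, real_inner_smul_left])
    (fun t ht ψ => (abs_real_inner_le_norm _ _).trans (by
      rw [mul_comm]
      exact mul_le_mul (hM t ht.le) (le_add_of_nonneg_right (norm_nonneg _)) (norm_nonneg _)
        ((norm_nonneg _).trans (hM t ht.le))))
    (fun φ => integrableOn_inner_slice hu i φ)
  exact ⟨T, fun φ => (hT φ).trans (comp_eq u i φ).symm⟩

theorem exists_represents {u : ℝ → L2Field} (hu : BoundedWeaklyContinuous u) :
    ∃ U : 𝓓'(spaceTime, E3), Represents u U := by
  choose T hT using exists_distribution_comp hu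
  refine ⟨∑ j, Distribution.mapCLM (ContinuousLinearMap.toSpanSingleton ℝ (e j)) (T j), fun φ i => ?_⟩
  have : (∑ j, Distribution.mapCLM (ContinuousLinearMap.toSpanSingleton ℝ (e j)) (T j)) φ =
      ∑ j, comp u j φ • e j := by
    simp only [← hT]
    exact map_sum (AddMonoidHom.mk' (fun S : 𝓓'(spaceTime, E3) => S φ) fun _ _ => rfl) _ _
  rw [this]
  fin_cases i <;> simp [Fin.sum_univ_three]

theorem Equivariant.exists_distribution_tri (θ : MollifierKernel) {A : L2Field →L[ℝ] L2Field}
    (hA : Equivariant A) {u v : ℝ → L2Field} (hu : BoundedWeaklyContinuous u)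
    (hv : BoundedWeaklyContinuous v) (i j : Fin 3) : ∃ T : 𝓓'(spaceTime, ℝ), ∀ φ,
      T φ = ∫ t in Ioi (0 : ℝ), tri j (u t) (v t) (A (testField i (slice φ t))) := by
  obtain ⟨M, hM⟩ := hu.bounded
  obtain ⟨M', hM'⟩ := hv.bounded
  have hb := bumpConst_nonneg
  refine exists_distribution (L := fun t ψ => tri j (u t) (v t) (A (testField i ψ))) i
    (B := 3 * bumpConst * (max M M' * max M M'))
    (mul_nonneg (by positivity) (mul_self_nonneg _)) (fun t ψ ψ' => ?_) (fun t c ψ => ?_)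
    (fun t ht ψ => ?_) (hA.integrableOn_tri θ hu hv i j)
  · rw [testField_add, map_add, tri_add_right (hA.ae_norm_le θ i ψ) (hA.ae_norm_le θ i ψ')]
  · rw [testField_smul, map_smul, tri_smul_right]
  · refine (hA.abs_tri_le θ i j ψ ((hM t ht.le).trans (le_max_left _ _))
      ((hM' t ht.le).trans (le_max_right _ _))).trans (le_of_eq ?_)
    unfold supBound
    ring

/-! ### The limit of mollified solutions -/

theorem inner_testField_testField_lineDeriv (i j k : Fin 3) (φ ψ : TF) :
    inner ℝ (testField k (∂_{e k} φ)) (testField i (∂_{e j} ψ)) =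
      if k = i then -∫ x, φ x * (∂_{e i} (∂_{e j} ψ)) x else 0 := by
  have h := hasWD_testField k i (∂_{e j} ψ) k φ
  rw [eq_neg_iff_add_eq_zero, add_comm, ← eq_neg_iff_add_eq_zero] at h
  rw [h, inner_testField]
  split_ifs with hk
  · subst hk
    congr 1
    refine integral_congr_ae ?_
    filter_upwards [coeFn_testField k (∂_{e k} (∂_{e j} ψ))] with x hx
    rw [hx]
    simp
  · rw [neg_eq_zero]
    refine integral_eq_zero_of_ae ?_
    filter_upwards [coeFn_testField i (∂_{e k} (∂_{e j} ψ))] with x hx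
    rw [hx]
    simp [hk]

/-- The divergence of `∂_jψ e_i - ∂_iψ e_j` is `∂_i∂_jψ - ∂_j∂_iψ = 0`. -/
theorem testField_sub_testField_mem (i j : Fin 3) (ψ : TF) :
    testField i (∂_{e j} ψ) - testField j (∂_{e i} ψ) ∈ L2sigma := by
  intro φ
  rw [divPairing_eq]
  simp only [inner_sub_right, inner_testField_testField_lineDeriv, Finset.sum_sub_distrib,
    Finset.sum_ite_eq', Finset.mem_univ, if_true]
  rw [lineDeriv_comm ψ (e i) (e j), sub_self, neg_zero]

theorem id_sub_leray_testField_comm (i j : Fin 3) (ψ : TF) :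
    (ContinuousLinearMap.id ℝ L2Field - leray) (testField i (∂_{e j} ψ)) =
      (ContinuousLinearMap.id ℝ L2Field - leray) (testField j (∂_{e i} ψ)) := by
  have h := leray_of_mem (testField_sub_testField_mem i j ψ)
  rw [map_sub] at h
  simp only [sub_apply, ContinuousLinearMap.id_apply]
  rw [sub_eq_sub_iff_sub_eq_sub, ← h]

/-- Mollified solutions that converge weakly at every time, as the parameter tends to zero. -/
structure WeakLimit (θ : MollifierKernel) (μ χ γ κ : ℝ) (u₀ w₀ : L2Field) (ε : ℕ → ℝ)
    (un wn : ℕ → ℝ → L2Field) (u w : ℝ → L2Field) : Prop where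
  pos : ∀ n, 0 < ε n
  tendsto_zero : Tendsto ε atTop (𝓝 0)
  mollified : ∀ n, IsMollifiedSolution θ μ χ γ κ u₀ w₀ (ε n) (un n) (wn n)
  weaklyContinuous_u : WeaklyContinuous u
  weaklyContinuous_w : WeaklyContinuous w
  tendsto_u : ∀ t, 0 ≤ t → WT atTop (fun n => un n t) (u t)
  tendsto_w : ∀ t, 0 ≤ t → WT atTop (fun n => wn n t) (w t)

theorem tendsto_comp {un : ℕ → ℝ → L2Field} {u : ℝ → L2Field} {M : ℝ}
    (hun : ∀ n, BoundedWeaklyContinuous (un n)) (hM : ∀ n t, 0 ≤ t → ‖un n t‖ ≤ M)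
    (h : ∀ t, 0 ≤ t → WT atTop (fun n => un n t) (u t)) (i : Fin 3) (φ : STF) :
    Tendsto (fun n => comp (un n) i φ) atTop (𝓝 (comp u i φ)) := by
  simp only [comp_eq]
  obtain ⟨a, b, -, -, h0⟩ := exists_slice_eq_zero φ
  have hz : ∀ t, t ∉ Icc a b → testField i (slice φ t) = 0 := fun t ht => by
    rw [h0 t ht, show (0 : TF) = (0 : ℝ) • 0 by simp, testField_smul, zero_smul]
  refine tendsto_integral_of_dominated_convergence (fun t => ‖testField i (slice φ t)‖ * M)
    (fun n => (integrableOn_inner_slice (hun n) i φ).aestronglyMeasurable) ?_ (fun n => ?_) ?_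
  · refine integrableOn_of_continuousOn (b := b) ?_ fun t ht => ?_
    · exact ((continuous_testField_slice i φ).norm.mul continuous_const).continuousOn
    · rw [hz t fun h => (not_le.2 ht) h.2, norm_zero, zero_mul]
  · filter_upwards [ae_restrict_mem measurableSet_Ioi] with t ht
    exact (norm_inner_le_norm _ _).trans
      (mul_le_mul_of_nonneg_left (hM n t (le_of_lt ht)) (norm_nonneg _))
  · filter_upwards [ae_restrict_mem measurableSet_Ioi] with t ht
    exact h t (le_of_lt ht) _

theorem tendsto_linU {un wn : ℕ → ℝ → L2Field} {u w : ℝ → L2Field}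
    (hu : ∀ i φ, Tendsto (fun n => comp (un n) i φ) atTop (𝓝 (comp u i φ)))
    (hw : ∀ i φ, Tendsto (fun n => comp (wn n) i φ) atTop (𝓝 (comp w i φ)))
    (μ χ : ℝ) (i : Fin 3) (φ : STF) :
    Tendsto (fun n => linU μ χ (un n) (wn n) i φ) atTop (𝓝 (linU μ χ u w i φ)) := by
  simp only [linU, lapD, curlD, Dx, Pi.add_apply, Pi.smul_apply, Pi.sub_apply, Finset.sum_apply,
    smul_eq_mul]
  exact ((tendsto_finsetSum _ fun j _ => (hu _ _).neg.neg).const_mul _).add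
    (((hw _ _).neg.sub (hw _ _).neg).const_mul _)

theorem tendsto_linW {un wn : ℕ → ℝ → L2Field} {u w : ℝ → L2Field}
    (hu : ∀ i φ, Tendsto (fun n => comp (un n) i φ) atTop (𝓝 (comp u i φ)))
    (hw : ∀ i φ, Tendsto (fun n => comp (wn n) i φ) atTop (𝓝 (comp w i φ)))
    (χ γ κ : ℝ) (i : Fin 3) (φ : STF) :
    Tendsto (fun n => linW χ γ κ (un n) (wn n) i φ) atTop (𝓝 (linW χ γ κ u w i φ)) := by
  simp only [linW, lapD, gradDivD, curlD, Dx, Pi.add_apply, Pi.smul_apply, Pi.sub_apply,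
    Finset.sum_apply, smul_eq_mul]
  exact ((((tendsto_finsetSum _ fun j _ => (hw _ _).neg.neg).const_mul _).add
    ((tendsto_finsetSum _ fun j _ => (hw _ _).neg).neg.const_mul _)).add
    (((hu _ _).neg.sub (hu _ _).neg).const_mul _)).sub ((hw _ _).const_mul _)

namespace WeakLimit

variable {θ : MollifierKernel} {μ χ γ κ : ℝ} {u₀ w₀ : L2Field} {ε : ℕ → ℝ}
  {un wn : ℕ → ℝ → L2Field} {u w : ℝ → L2Field}

theorem boundedWeaklyContinuous (h : WeakLimit θ μ χ γ κ u₀ w₀ ε un wn u w) :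
    BoundedWeaklyContinuous u ∧ BoundedWeaklyContinuous w :=
  ⟨⟨⟨_, fun t ht => (h.tendsto_u t ht).norm_le
    (Eventually.of_forall fun n => ((h.mollified n).norm_le ht).1)⟩, h.weaklyContinuous_u⟩,
  ⟨⟨_, fun t ht => (h.tendsto_w t ht).norm_le
    (Eventually.of_forall fun n => ((h.mollified n).norm_le ht).2)⟩, h.weaklyContinuous_w⟩⟩

theorem initial (h : WeakLimit θ μ χ γ κ u₀ w₀ ε un wn u w) : u 0 = u₀ ∧ w 0 = w₀ := by
  have hu := h.tendsto_u 0 le_rfl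
  have hw := h.tendsto_w 0 le_rfl
  simp only [(h.mollified _).initial] at hu hw
  exact ⟨hu.unique (WT.const _), hw.unique (WT.const _)⟩

theorem tendsto_comp_u (h : WeakLimit θ μ χ γ κ u₀ w₀ ε un wn u w) (i : Fin 3) (φ : STF) :
    Tendsto (fun n => comp (un n) i φ) atTop (𝓝 (comp u i φ)) :=
  tendsto_comp (fun n => (h.mollified n).regularity.u_mem)
    (fun n _ ht => ((h.mollified n).norm_le ht).1) h.tendsto_u i φ

theorem tendsto_comp_w (h : WeakLimit θ μ χ γ κ u₀ w₀ ε un wn u w) (i : Fin 3) (φ : STF) :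
    Tendsto (fun n => comp (wn n) i φ) atTop (𝓝 (comp w i φ)) :=
  tendsto_comp (fun n => (h.mollified n).regularity.w_mem)
    (fun n _ ht => ((h.mollified n).norm_le ht).2) h.tendsto_w i φ

theorem enorm_sq_add_ne_top (a b : L2Field) : ‖a‖ₑ ^ 2 + ‖b‖ₑ ^ 2 ≠ ⊤ :=
  ENNReal.add_ne_top.2 ⟨ENNReal.pow_ne_top enorm_ne_top, ENNReal.pow_ne_top enorm_ne_top⟩

theorem bound_ne_top (hμ : 0 < μ) (a b : L2Field) :
    (‖a‖ₑ ^ 2 + ‖b‖ₑ ^ 2) / ENNReal.ofReal (2 * μ) ≠ ⊤ := by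
  exact (ENNReal.div_lt_top (enorm_sq_add_ne_top a b) (by simpa using hμ)).ne

/-- The limit equation before the pressure is introduced: the projector acts on the test field,
where the sup bound makes sense of the product. -/
theorem velocity_leray (h : WeakLimit θ μ χ γ κ u₀ w₀ ε un wn u w) (hμ : 0 < μ) (i : Fin 3)
    (φ : STF) :
    Dt (comp u i) φ - ∑ j, ∫ t in Ioi (0 : ℝ), tri j (u t) (u t)
      (leray (testField i (slice (∂_{((0 : ℝ), e j)} φ) t))) = linU μ χ u w i φ := by
  refine tendsto_nhds_unique ?_ (tendsto_linU h.tendsto_comp_u h.tendsto_comp_w μ χ i φ)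
  have h1 : ∀ n, linU μ χ (un n) (wn n) i φ = Dt (comp (un n) i) φ - ∑ j, ∫ t in Ioi (0 : ℝ),
      inner ℝ (leray (testField i (slice (∂_{((0 : ℝ), e j)} φ) t)))
        (mulL (θ.mol (ε n) (h.pos n).ne' j (un n t)) (un n t)) := by
    intro n
    rw [← (h.mollified n).velocity i, Pi.add_apply, θ.lerayTransportD_eq_sum (h.pos n), sub_eq_add_neg]
  simp only [h1]
  obtain ⟨hu, -⟩ := h.boundedWeaklyContinuous
  refine Tendsto.sub (h.tendsto_comp_u i _).neg (tendsto_finsetSum _ fun j _ => ?_)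
  exact equivariant_leray.tendsto_integral_tri θ h.pos h.tendsto_zero hu hu
    (fun n => (h.mollified n).regularity.u_mem) (fun n => (h.mollified n).regularity.u_mem)
    (fun n t ht => ((h.mollified n).norm_le ht).1) (fun n t ht => ((h.mollified n).norm_le ht).1)
    h.tendsto_u h.tendsto_u (bound_ne_top hμ u₀ w₀) (fun n => (h.mollified n).lintegral_gradSq_le hμ)
    i j _

theorem microrotation (h : WeakLimit θ μ χ γ κ u₀ w₀ ε un wn u w) (hμ : 0 < μ) (i : Fin 3) :
    Dt (comp w i) + transportD (fun t => u t) w i = linW χ γ κ u w i := by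
  ext φ
  refine tendsto_nhds_unique ?_ (tendsto_linW h.tendsto_comp_u h.tendsto_comp_w χ γ κ i φ)
  obtain ⟨hu, hw⟩ := h.boundedWeaklyContinuous
  have h1 : ∀ n, linW χ γ κ (un n) (wn n) i φ = Dt (comp (wn n) i) φ + -∑ j, ∫ t in Ioi (0 : ℝ),
      inner ℝ (testField i (slice (∂_{((0 : ℝ), e j)} φ) t))
        (mulL (θ.mol (ε n) (h.pos n).ne' j (un n t)) (wn n t)) := by
    intro n
    rw [← (h.mollified n).microrotation i, Pi.add_apply, θ.transportD_eq_sum (h.pos n) i φ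
      (h.mollified n).regularity.u_mem (h.mollified n).regularity.w_mem]
  simp only [h1]
  rw [Pi.add_apply, transportD_apply]
  refine Tendsto.add (h.tendsto_comp_w i _).neg (tendsto_finsetSum _ fun j _ => ?_).neg
  exact equivariant_id.tendsto_integral_tri θ h.pos h.tendsto_zero hu hw
    (fun n => (h.mollified n).regularity.u_mem) (fun n => (h.mollified n).regularity.w_mem)
    (fun n t ht => ((h.mollified n).norm_le ht).1) (fun n t ht => ((h.mollified n).norm_le ht).2)
    h.tendsto_u h.tendsto_w (bound_ne_top hμ u₀ w₀) (fun n => (h.mollified n).lintegral_gradSq_le hμ)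
    i j _

/-- The projected and unprojected quadratic terms differ by `∑_j ∫ u_j u·(1-ℙ)(∂_jφ e_i)`. By the
symmetry in `i` and `j`, the derivative in each summand may be taken to be `∂_iφ`, with `e_j` in
place of `e_i`; the difference is thus a gradient, with potential `p(φ) = -∑_j ∫ u_j u·(1-ℙ)(φ
e_j)`. -/
theorem exists_pressure (h : WeakLimit θ μ χ γ κ u₀ w₀ ε un wn u w) (hμ : 0 < μ) :
    ∃ p : 𝓓'(spaceTime, ℝ), ∀ i,
      Dt (comp u i) + transportD (fun t => u t) u i + Dx i p = linU μ χ u w i := by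
  obtain ⟨hu, -⟩ := h.boundedWeaklyContinuous
  choose T hT using fun j => equivariant_id_sub_leray.exists_distribution_tri θ hu hu j j
  refine ⟨-∑ j, T j, fun i => ?_⟩
  ext φ
  have hp : Dx i (-∑ j, T j : 𝓓'(spaceTime, ℝ)) φ = ∑ j, T j (∂_{((0 : ℝ), e i)} φ) := by
    have h1 := map_sum (AddMonoidHom.mk' (fun S : 𝓓'(spaceTime, ℝ) => S (∂_{((0 : ℝ), e i)} φ))
      fun _ _ => rfl) T Finset.univ
    exact (neg_neg _).trans h1
  rw [Pi.add_apply, Pi.add_apply, hp, ← h.velocity_leray hμ i φ, transportD_apply, add_assoc,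
    sub_eq_add_neg]
  congr 1
  rw [← Finset.sum_neg_distrib, ← Finset.sum_neg_distrib, ← Finset.sum_add_distrib]
  refine Finset.sum_congr rfl fun j _ => ?_
  rw [hT, neg_add_eq_iff_eq_add, ← sub_eq_add_neg, eq_sub_iff_add_eq,
    ← integral_add (equivariant_id_sub_leray.integrableOn_tri θ hu hu j j _)
      (equivariant_leray.integrableOn_tri θ hu hu i j _)]
  refine integral_congr_ae (Eventually.of_forall fun t => ?_)
  simp only [← lineDeriv_slice]
  rw [← id_sub_leray_testField_comm i j, ← tri_add_right (equivariant_id_sub_leray.ae_norm_le θ i _)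
    (equivariant_leray.ae_norm_le θ i _)]
  congr 1
  exact sub_add_cancel _ _

/-- Each term is lower semicontinuous under weak convergence at fixed times, Fatou's lemma handles
the time integral, and the sum for the approximations is the constant initial energy. -/
theorem energy_le (h : WeakLimit θ μ χ γ κ u₀ w₀ ε un wn u w) {t : ℝ} (ht : 0 ≤ t) :
    energy u w t + dissipation μ χ γ κ u w 0 t ≤ ‖u₀‖ₑ ^ 2 + ‖w₀‖ₑ ^ 2 := by
  have hle : volume.restrict (Ioc 0 t) ≤ volume.restrict (Ioi (0 : ℝ)) :=
    Measure.restrict_mono (fun τ hτ => hτ.1) le_rfl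
  have hr := fun n => (h.mollified n).regularity
  have hD : ∫⁻ τ in Ioc 0 t, dissDensity μ χ γ κ (u τ) (w τ) ≤
      liminf (fun n => ∫⁻ τ in Ioc 0 t, dissDensity μ χ γ κ (un n τ) (wn n τ)) atTop := by
    refine le_trans (setLIntegral_mono' measurableSet_Ioc fun τ hτ => ?_)
      (lintegral_liminf_le' fun n => (aemeasurable_dissDensity θ μ χ γ κ
        (hr n).u_mem.weaklyContinuous (hr n).w_mem.weaklyContinuous).mono_measure hle)
    exact (h.tendsto_u τ hτ.1.le).dissDensity_le_liminf θ μ χ γ κ (h.tendsto_w τ hτ.1.le)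
  have hD2 : 2 * ∫⁻ τ in Ioc 0 t, dissDensity μ χ γ κ (u τ) (w τ) ≤
      liminf (fun n => 2 * ∫⁻ τ in Ioc 0 t, dissDensity μ χ γ κ (un n τ) (wn n τ)) atTop := by
    rw [ENNReal.liminf_const_mul_of_ne_top ENNReal.ofNat_ne_top]
    gcongr
  have hE : energy u w t ≤ liminf (fun n => energy (un n) (wn n) t) atTop :=
    (add_le_add (h.tendsto_u t ht).enorm_sq_le_liminf
      (h.tendsto_w t ht).enorm_sq_le_liminf).trans (liminf_add_liminf_le _ _)
  rw [dissipation_eq θ h.weaklyContinuous_u h.weaklyContinuous_w le_rfl]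
  refine (add_le_add hE hD2).trans ((liminf_add_liminf_le _ _).trans (le_of_eq ?_))
  have : ∀ n, energy (un n) (wn n) t + 2 * ∫⁻ τ in Ioc 0 t, dissDensity μ χ γ κ (un n τ) (wn n τ) =
      ‖u₀‖ₑ ^ 2 + ‖w₀‖ₑ ^ 2 := fun n => by
    rw [← dissipation_eq θ (hr n).u_mem.weaklyContinuous (hr n).w_mem.weaklyContinuous le_rfl]
    exact (h.mollified n).energy_add_dissipation ht
  simp only [this, liminf_const]

theorem energyClass (h : WeakLimit θ μ χ γ κ u₀ w₀ ε un wn u w) (hμ : 0 < μ) :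
    EnergyClass γ κ u w :=
  energyClass_of_dissipation_le (χ := χ) hμ h.boundedWeaklyContinuous.1 h.boundedWeaklyContinuous.2
    (enorm_sq_add_ne_top u₀ w₀)
    fun _ ht => le_add_self.trans (h.energy_le ht)

theorem solves (h : WeakLimit θ μ χ γ κ u₀ w₀ ε un wn u w) (hμ : 0 < μ) :
    SolvesMicropolar μ χ γ κ u w where
  velocity := h.exists_pressure hμ
  microrotation := h.microrotation hμ
  divFree t ht := (h.tendsto_u t ht).mem_L2sigma
    (Eventually.of_forall fun n => (h.mollified n).divFree t ht)

end WeakLimit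

/-! ### Restricted Leray solutions -/

/-- Product test functions show that the tested curves agree at almost every time; continuity gives
every time, including the initial one. -/
theorem eq_of_comp_eq {u u' : ℝ → L2Field} (hu : WeaklyContinuous u) (hu' : WeaklyContinuous u')
    (h : ∀ i φ, comp u i φ = comp u' i φ) {t : ℝ} (ht : 0 ≤ t) : u t = u' t := by
  refine ext_inner_testField fun i ψ => ?_
  have hc := hu (testField i ψ)
  have hc' := hu' (testField i ψ)
  suffices EqOn (fun t => inner ℝ (testField i ψ) (u t)) (fun t => inner ℝ (testField i ψ) (u' t))
    (Ici 0) from this ht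
  refine Measure.eqOn_of_ae_eq (μ := volume) ?_ hc hc' (by simp)
  rw [← restrict_Ioi_eq_restrict_Ici]
  have hz : ∀ᵐ t : ℝ, t ∈ Ioi (0 : ℝ) →
      inner ℝ (testField i ψ) (u t) - inner ℝ (testField i ψ) (u' t) = 0 := by
    have hd := (hc.sub hc').mono (Ioi_subset_Ici_self (a := (0 : ℝ)))
    refine isOpen_Ioi.ae_eq_zero_of_integral_contDiff_smul_eq_zero
      (hd.locallyIntegrableOn measurableSet_Ioi) fun η hη hcs hs => ?_
    have hint {v : ℝ → L2Field} (hv : WeaklyContinuous v) :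
        IntegrableOn (fun t => η t * inner ℝ (testField i ψ) (v t)) (Ioi 0) := by
      obtain ⟨b, hb⟩ := hcs.isCompact.bddAbove
      refine integrableOn_of_continuousOn (hη.continuous.continuousOn.mul (hv _)) (b := b)
        fun t ht => ?_
      rw [image_eq_zero_of_notMem_tsupport fun h' => (not_le.2 ht) (hb h'), zero_mul]
    have h1 := h i (prodTF η hη hcs hs ψ)
    simp only [comp_eq, slice_prodTF, testField_smul, real_inner_smul_left] at h1
    rw [← setIntegral_eq_integral_of_forall_compl_eq_zero (s := Ioi 0)]
    · simp only [smul_eq_mul, mul_sub]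
      rw [integral_sub (hint hu) (hint hu'), h1, sub_self]
    · intro t ht
      rw [image_eq_zero_of_notMem_tsupport fun h' => ht (hs h'), zero_smul]
  rw [EventuallyEq, ae_restrict_iff' measurableSet_Ioi]
  filter_upwards [hz] with t ht hm using sub_eq_zero.1 (ht hm)

section

variable {θ : MollifierKernel} {μ χ γ κ : ℝ} {u₀ w₀ : L2Field} {ε : ℕ → ℝ}
  {un wn : ℕ → ℝ → L2Field} {u w : ℝ → L2Field} {U W : 𝓓'(spaceTime, E3)}

theorem MollifiedApproximation.exists_weakLimit
    (h : MollifiedApproximation θ μ χ γ κ u₀ w₀ ε un wn U W) :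
    ∃ (σ : ℕ → ℕ) (u w : ℝ → L2Field), WeakLimit θ μ χ γ κ u₀ w₀ (fun n => ε (σ n))
      (fun n => un (σ n)) (fun n => wn (σ n)) u w ∧ Represents u U ∧ Represents w W := by
  obtain ⟨σ, u, w, hσ, hu, hw, hut, hwt⟩ := exists_subseq_of_mollified h.pos h.mollified
  have hl : WeakLimit θ μ χ γ κ u₀ w₀ (fun n => ε (σ n)) (fun n => un (σ n)) (fun n => wn (σ n))
      u w := ⟨fun n => h.pos _, h.tendsto_zero.comp hσ.tendsto_atTop, fun n => h.mollified _, hu, hw,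
    hut, hwt⟩
  exact ⟨σ, u, w, hl, fun φ i => tendsto_nhds_unique ((h.tendsto_u φ i).comp hσ.tendsto_atTop)
    (hl.tendsto_comp_u i φ), fun φ i => tendsto_nhds_unique
      ((h.tendsto_w φ i).comp hσ.tendsto_atTop) (hl.tendsto_comp_w i φ)⟩

/-- Any subsequential weak limit represents the same distributions and therefore equals the chosen
representative at every `t ≥ 0`. This makes the bounds e) and f) available for an arbitrary
approximating sequence. -/
theorem MollifiedApproximation.exists_tendsto
    (h : MollifiedApproximation θ μ χ γ κ u₀ w₀ ε un wn U W) (hu : WeaklyContinuous u)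
    (hw : WeaklyContinuous w) (hU : Represents u U) (hW : Represents w W) :
    ∃ σ : ℕ → ℕ, ∀ t, 0 ≤ t → WT atTop (fun n => un (σ n) t) (u t) ∧
      WT atTop (fun n => wn (σ n) t) (w t) := by
  obtain ⟨σ, u', w', hl, hU', hW'⟩ := h.exists_weakLimit
  refine ⟨σ, fun t ht => ?_⟩
  rw [eq_of_comp_eq hu hl.weaklyContinuous_u (fun i φ => (hU φ i).symm.trans (hU' φ i)) ht,
    eq_of_comp_eq hw hl.weaklyContinuous_w (fun i φ => (hW φ i).symm.trans (hW' φ i)) ht]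
  exact ⟨hl.tendsto_u t ht, hl.tendsto_w t ht⟩

theorem exists_isRestrictedLeray (θ : MollifierKernel) (hμ : 0 < μ) (hχ : 0 < χ) (hγ : 0 ≤ γ)
    (hκ : 0 ≤ κ) (hu₀ : u₀ ∈ L2sigma) (w₀ : L2Field) :
    ∃ U W : 𝓓'(spaceTime, E3), IsRestrictedLeray θ μ χ γ κ u₀ w₀ U W := by
  choose un wn h using fun n => exists_isMollifiedSolution θ
    (MollifierKernel.dn_pos n).ne' hμ hχ.le hγ hκ hu₀ w₀
  obtain ⟨σ, u, w, hσ, hu, hw, hut, hwt⟩ := exists_subseq_of_mollified MollifierKernel.dn_pos h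
  have hl : WeakLimit θ μ χ γ κ u₀ w₀ (fun n => MollifierKernel.dn (σ n)) (fun n => un (σ n))
      (fun n => wn (σ n)) u w := ⟨fun n => MollifierKernel.dn_pos _,
    MollifierKernel.tendsto_dn.comp hσ.tendsto_atTop, fun n => h _, hu, hw, hut, hwt⟩
  obtain ⟨U, hU⟩ := exists_represents hl.boundedWeaklyContinuous.1
  obtain ⟨W, hW⟩ := exists_represents hl.boundedWeaklyContinuous.2
  refine ⟨U, W, _, _, _, hl.pos, hl.tendsto_zero, hl.mollified, fun φ i => ?_, fun φ i => ?_⟩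
  · rw [hU φ i]
    exact hl.tendsto_comp_u i φ
  · rw [hW φ i]
    exact hl.tendsto_comp_w i φ

end

/-- Lower semicontinuity of the norm of a pair, obtained from that of its components because the
lower limit is superadditive. -/
theorem WT.sqrt_add_le {f g : ℕ → L2Field} {a b : L2Field} (hf : WT atTop f a) (hg : WT atTop g b)
    {c : ℝ} (h : ∀ n, √(‖f n‖ ^ 2 + ‖g n‖ ^ 2) ≤ c) : √(‖a‖ ^ 2 + ‖b‖ ^ 2) ≤ c := by
  have hc : 0 ≤ c := (Real.sqrt_nonneg _).trans (h 0)
  have key : ‖a‖ₑ ^ 2 + ‖b‖ₑ ^ 2 ≤ ENNReal.ofReal (c ^ 2) := by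
    refine (add_le_add hf.enorm_sq_le_liminf hg.enorm_sq_le_liminf).trans
      ((liminf_add_liminf_le _ _).trans ?_)
    refine (liminf_le_liminf (Eventually.of_forall fun n => ?_)).trans
      (liminf_const (f := (atTop : Filter ℕ)) (ENNReal.ofReal (c ^ 2))).le
    rw [enorm_sq_eq_ofReal, enorm_sq_eq_ofReal, ← ENNReal.ofReal_add (by positivity) (by positivity)]
    exact ENNReal.ofReal_le_ofReal ((Real.sqrt_le_left hc).1 (h n))
  rw [enorm_sq_eq_ofReal, enorm_sq_eq_ofReal, ← ENNReal.ofReal_add (by positivity) (by positivity),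
    ENNReal.ofReal_le_ofReal_iff (by positivity)] at key
  exact (Real.sqrt_le_left hc).2 key

end Micropolar

end

/-! ### The proposition -/

theorem proposition2p3 (θ : MollifierKernel) (μ χ γ κ : ℝ)
    (hμ : 0 < μ) (hχ : 0 < χ) (hγ : 0 ≤ γ) (hκ : 0 ≤ κ)
    (u₀ w₀ : L2Field) (hu₀ : u₀ ∈ L2sigma) :
    (∃ U W : 𝓓'(spaceTime, E3), IsRestrictedLeray θ μ χ γ κ u₀ w₀ U W) ∧
    ∀ U W : 𝓓'(spaceTime, E3), IsRestrictedLeray θ μ χ γ κ u₀ w₀ U W →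
      ∃ u w : ℝ → L2Field, Represents u U ∧ Represents w W ∧
        (SolvesMicropolar μ χ γ κ u w ∧ u 0 = u₀ ∧ w 0 = w₀) ∧
        EnergyClass γ κ u w ∧
        (∀ t, 0 ≤ t → energy u w t + dissipation μ χ γ κ u w 0 t ≤ ‖u₀‖ₑ ^ 2 + ‖w₀‖ₑ ^ 2) ∧
        ∀ (ε : ℕ → ℝ) (un wn : ℕ → ℝ → L2Field),
          MollifiedApproximation θ μ χ γ κ u₀ w₀ ε un wn U W →
            (∀ f : ℝ → ℝ, (∀ n t, 0 ≤ t → ‖un n t‖ ≤ f t) → ∀ t, 0 ≤ t → ‖u t‖ ≤ f t) ∧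
            (∀ g : ℝ → ℝ, (∀ n t, 0 ≤ t → ‖wn n t‖ ≤ g t) → ∀ t, 0 ≤ t → ‖w t‖ ≤ g t) ∧
            (∀ uL wL : ℝ → L2Field, IsLinearSolution μ χ γ κ u₀ w₀ uL wL →
              ∀ h : ℝ → ℝ,
                (∀ n t, 0 ≤ t → √(‖un n t - uL t‖ ^ 2 + ‖wn n t - wL t‖ ^ 2) ≤ h t) →
                ∀ t, 0 ≤ t → √(‖u t - uL t‖ ^ 2 + ‖w t - wL t‖ ^ 2) ≤ h t) := by
  refine ⟨exists_isRestrictedLeray θ hμ hχ hγ hκ hu₀ w₀, fun U W hUW => ?_⟩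
  obtain ⟨ε, un, wn, h⟩ := hUW
  obtain ⟨σ, u, w, hl, hU, hW⟩ := h.exists_weakLimit
  refine ⟨u, w, hU, hW, ⟨hl.solves hμ, hl.initial⟩, hl.energyClass hμ, fun t ht => hl.energy_le ht,
    fun ε un wn h => ?_⟩
  -- The new sequence is unrelated to the one that produced `u` and `w`; both have the same
  -- distributional limit.
  obtain ⟨σ, hσ⟩ := h.exists_tendsto hl.weaklyContinuous_u hl.weaklyContinuous_w hU hW
  refine ⟨fun f hf t ht => ?_, fun g hg t ht => ?_, fun uL wL _ k hk t ht => ?_⟩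
  · exact (hσ t ht).1.norm_le (Eventually.of_forall fun n => hf _ t ht)
  · exact (hσ t ht).2.norm_le (Eventually.of_forall fun n => hg _ t ht)
  · exact ((hσ t ht).1.sub (WT.const _)).sqrt_add_le ((hσ t ht).2.sub (WT.const _))
      fun n => hk _ t ht
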